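/- **Setting.** All algorithms are probabilistic programs with a cost measure (total work, parallel time, number of processors); $\lambda$ is the security parameter, "PPT" means total work polynomial in $\lambda$, and negligible means $o(\lambda^{-c})$ for all $c$. Fix $z\ge 1$, polynomial-time schemes and functions as follows, and a bound on the solver: functions $S(\lambda)$ (squarings per second; computable in time polynomial in $\lambda$ and, in unary, in its value, so polynomially bounded), $\mathrm{speed}(\lambda)$ (elementary steps per second), $\delta$ with $\delta(D)<D$ for $D>0$ and $\delta(0)\le 0$, and a polynomial $\xi$. * $\mathsf{SKE}$: a (perfectly correct) symmetric-key encryption scheme; $\mathsf{Sig}$: a (perfectly correct) signature scheme; $\mathsf{CEDG}(ToC,S,\bar\Delta_j,aux)\in\mathbb N$: an extra-delay function. * **GC-TLP** (chained time-lock puzzles) built from $\mathsf{SKE}$, a generator of pairs of distinct primes, a keyed hash family $H_{hk}$ and lengths $\omega_1,\omega_2$. *Setup*$(1^\lambda,\vec\Delta,S)$: primes $q_1,q_2$, $N=q_1q_2$, $T_j=S\bar\Delta_j$, $a_j=2^{T_j}\bmod (q_1-1)(q_2-1)$, uniform $r_1,\dots,r_{z+1}\in\mathbb Z_N^*$, keys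 $k_j\leftarrow\mathsf{SKE.keyGen}(1^\lambda)$, uniform $d_j\in\{0,1\}^{\omega_2}$, hash key $hk$; $pk=(hk,N,\vec T,r_1,\omega_1,\omega_2)$, $sk=(q_1,q_2,\vec a,\vec k,\vec r,\vec d)$. *GenPuzzle*$(\vec m,pk,sk)$: $p_j=(\mathsf{SKE.Enc}(k_j,m_j\|d_j\|r_{j+1}),\ k_j+r_j^{a_j}\bmod N)$ with $r_{j+1}$ encoded by $\omega_1$ bits, and commitment $g_j=H_{hk}(m_j\|d_j)$; $\hat p=(\vec p,\vec g)$. *Solve*: for $j=1,\dots,z$ compute $r_j^{2^{T_j}}\bmod N$ by $T_j$ squarings, recover $k_j$, decrypt, and parse $s_j=m_j\|d_j$ and $r_{j+1}$. *Prove*: $\pi_j=d_j$. *Verify*$(pk,j,m,\pi,g)$ accepts iff $|\pi|=\omega_2$ and $H_{hk}(m\|\pi)=g$. * A **blockchain** protocol with honest parties $1,\dots,n_0$, a depth $k(\lambda)$ and a network delay $\Upsilon(\lambda)$: a polynomial-time reactive system that proceeds in rounds and interacts with an environment that ends rounds, broadcasts transactions and acts for the corrupted parties and the network. Each honest party has a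 chain of blocks; its ledger is the chain without the last $k$ blocks. A transaction is (account, (contract address, nonce, call), signature). A contract's address determines its content (the four accounts, $\vec\Delta$, $\vec\Psi$, $t_0$, $\Upsilon$, $\overrightarrow{coins}$). The registration time of a transaction, for an honest party, is the first round at whose end that party's ledger contained the position of its block. **ED-TLP.** Client setup: $csk\leftarrow\mathsf{SKE.keyGen}(1^\lambda)$, $cpk=\vec\Delta$. Client delegation: $m_i^*\leftarrow\mathsf{SKE.Enc}(csk,m_i)$, starting time $t_0$. Server delegation: $\Psi_j=\mathsf{CEDG}(ToC,S,\bar\Delta_j,aux)$; deploy the contract $\mathcal{SC}$ with deposit $\sum_j coins_j$ and deadlines $T_j=t_0+\sum_{i\le j}(\bar\Delta_i+\Psi_i+\Upsilon)$. The client's helper runs GC-TLP setup, generates $\hat p=(\vec p,\vec g)$ for $\vec m^*$ and publishes $(pk,\vec g)$ in $\mathcal{SC}$. The server's helper solves, unless some $coins_j$ or $\Psi_j$ is smaller than it demands ($coins'_j$, $\Psi'_j$), and registers $(m_j^*,\pi_j)$ in $\mathcal{SC}$; for each $j$ the first registration counts, and its time is $t_j$. Verification: $v_j=1$ iff $t_j\le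 T_j$ and GC-TLP verification accepts $(pk,j,m_j^*,\pi_j,g_j)$. Payment (called by client or server once $\mathcal{SC}$ is deployed, $(pk,\vec g)$ published and the $j$-th solution registered; it first computes $v_j$): if $v_j=1$, send $coins_j$ to the server's helper unless already paid, and set $u_j=1$; if $v_j=0$, send $coins_j$ back to the server (once) and set $u_j=0$. Retrieval: $m_j=\mathsf{SKE.Dec}(csk,m_j^*)$. **Hypotheses.** All of the above algorithms and $\Upsilon$ are polynomial-time computable, and the states of the blockchain system stay polynomially bounded. * $\mathsf{SKE}$ is IND-CPA (equal-length challenge messages); $\mathsf{Sig}$ is EUF-CMA. * GC-TLP is secure, for all polynomial-time computable $\vec\Delta(\lambda)\in\mathbb N^z$: *Privacy*: for every $j\in[z]$ and $(A_1,A_2)$, where $A_1$ is PPT and $A_2$ takes at most $\mathrm{speed}(\lambda)\cdot\delta(\sum_{i\le j}\bar\Delta_i)$ steps on at most $\xi(\max_{i\le j}\bar\Delta_i)$ processors: $A_1(1^\lambda,z)$ outputs $\vec m_0,\vec m_1$, state; uniform bits $b_i$, $i\in[z]$, are drawn; $A_2(pk,\hat p,\text{state})$ is given the puzzles for $(m_{b_i,i})_i$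 and outputs $b',k$. The probability that $|m_{0,i}|=|m_{1,i}|$ for all $i$, $k\ge j$ and $b'=b_k$ is at most $\frac12+\mathrm{negl}(\lambda)$. *Validity*: for every PPT $(A_1,A_2)$, where $A_1(1^\lambda,pk,\vec\Delta)$ outputs $\vec m$ and a state, and $A_2(pk,\vec s,\hat p,\text{state})$, given the solutions and puzzles for $\vec m$, outputs $(j,\pi',m)$, the probability that $m\ne m_j$ and *Verify*$(pk,j,m,\pi',g_j)=1$ is negligible. * The blockchain is secure: against every PPT environment, except with negligible probability, (*persistence*) the ledger of an honest party at the end of a round is a prefix of the chain of every honest party at the end of that and every later round, and (*liveness*) every transaction signed and issued by an honest account holder in round $r$ is in the ledger of every honest party at the end of every round $\ge r+\Upsilon$. * *$\mathcal{SC}$'s correctness*: against every PPT environment, except with negligible probability, the state of every contract that an honest party reports at the end of a round is the result of executing, in order, the properly signed calls in its ledger with their registration times. **Conclusion.** ED-TLP is a secure delegated time-lock puzzle. That is, for all $ToC,\vec\Delta,aux,t_0,\overrightarrow{coins},\overrightarrow{coins}',\vec\Psi'$ that are computable from $\lambda$ in polynomial time (and with $\vec\Delta$ polynomially bounded): 1.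 **Privacy.** (a) *Helpers*: for every PPT $A$ that, from $(1^\lambda,cpk,z)$, chooses $\vec m_0,\vec m_1$ (equal lengths entrywise) and then, for uniform bits $b_i$, $i\in[z]$, and $\vec m=(m_{b_i,i})_i$, sees $pk$, $cpk$, $\vec m_0,\vec m_1$, the encoded messages $\vec m^*$, $t_0$, $ToC$, $aux$, $\vec\Psi$, $\vec\Delta$, all solutions $\vec s$, $\hat p$, $\overrightarrow{coins}$, the address of the server's helper and the address of $\mathcal{SC}$, the probability that $A$ outputs $k\in[z]$ and $b_k$ is at most $\frac12+\mathrm{negl}(\lambda)$. (b) *Server and its helper*: for every $j\in[z]$ and $(A_2,A_3)$, where $A_2(1^\lambda,cpk,csk,z)$ is PPT and chooses encoded message vectors $\vec m^*_0,\vec m^*_1$ (equal lengths entrywise), and $A_3$, limited to $\mathrm{speed}(\lambda)\cdot\delta(\sum_{i\le j}\bar\Delta_i)$ steps on $\xi(\max_{i\le j}\bar\Delta_i)$ processors, is given $pk$, $cpk$, the puzzles $\hat p$ for $(m^*_{b_i,i})_i$, the state, $\vec\Psi$, $\vec\Delta$, both addresses, $aux$, $ToC$, $t_0$, the probability that $A_3$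 outputs $k\ge j$ and $b_k$ is at most $\frac12+\mathrm{negl}(\lambda)$. 2. **Solution validity.** Let a PPT adversary choose the encoded messages $\vec m^*$ from $(1^\lambda,cpk,\vec\Delta,z)$. After $\mathcal{SC}$ is deployed and $(pk,\vec g)$ is published, it acts as environment of the blockchain, knowing $pk$, $cpk$, $csk$, $\vec s$, $\hat p$, all public parameters, and the keys of the server's helper, and has honest calls of the payment function (by client or server) issued at will; finally it outputs $(j,\pi,m)$. Let $t_j$ be the true delivery time of $(m,\pi)$: the first round at whose end the ledger of some honest party contains the registration of $(m,\pi)$ as $j$-th solution by the server's helper. Delivery is on time if $t_j$ exists and $t_j\le T_j$. Except with negligible probability, neither of the following happens: (i) delivery is on time, $m\ne m^*_j$, and verification with time $t_j$ accepts; (ii) delivery is not on time, $m=m_j^*$, and some honest party reports $(m,\pi)$ as registered $j$-th solution with a time $t'_j$ with which verification accepts. 3. **Fair payment.** Let a PPT adversary choose plaintext messages $\vec m$ from $(1^\lambda,cpk,z)$, which are delegated honestly, and then interact as in 2 (without being given $csk$ and $\vec s$, but given $\vec m$). For each $j\in[z]$, except with negligible probability, payment is made exactly when verification accepts: in all reports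 of honest parties, (i) if $u_j$ is set, then a $j$-th solution is registered and $u_j$ equals its verification result $v_j$ (for the true $pk$ and $g_j$); and (ii) whenever the client or server issued the payment call for $j$ in a round $r$ such that, in the report at the end of that round of the same honest party, the contract was deployed and published and a $j$-th solution was registered, then $u_j$ equals the verification result of that solution in all reports at the end of rounds $\ge r+\Upsilon$. -/

import Mathlib

open scoped BigOperators

noncomputable section

namespace DelegatedTLP

/-! ## Data, programs and their cost -/

/-- Binary trees: the data on which algorithms work. -/
inductive Data : Type
  | nil : Data
  | cons : Data → Data → Data
  deriving DecidableEq

/-- Bit strings, `{0,1}^*`. -/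
abbrev Bits : Type := List Bool

namespace Data

def size : Data → ℕ
  | nil => 1
  | cons a b => a.size + b.size + 1

def fst : Data → Data
  | nil => nil
  | cons a _ => a

def snd : Data → Data
  | nil => nil
  | cons _ b => b

/-- The entries along the right spine. -/
def toList : Data → List Data
  | nil => []
  | cons a b => a :: b.toList

def ofList : List Data → Data
  | [] => nil
  | a :: l => cons a (ofList l)

/-- The length of the right spine; the value of a unary numeral. -/
def len (d : Data) : ℕ := d.toList.length

/-- The `i`-th entry along the right spine (`nil` if there is none). -/
def nth (d : Data) (i : ℕ) : Data := d.toList.getD i nil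

def toBool : Data → Bool
  | nil => false
  | cons _ _ => true

def toBits (d : Data) : Bits := d.toList.map toBool

end Data

/-- The value of a bit string, least significant bit first. -/
def bitsToNat (l : Bits) : ℕ := l.foldr (fun b a => b.toNat + 2 * a) 0

/-- The fixed-length encoding of a number by `w` bits, least significant bit first. -/
def natToBits (w k : ℕ) : Bits := List.ofFn fun i : Fin w => k.testBit i

def Data.toNat (d : Data) : ℕ := bitsToNat d.toBits

/-- Numbers that are written in unary. -/
structure Unary : Type where
  val : ℕ

/-- Types whose elements are presented to algorithms as data. -/
class Coded (α : Type) where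
  code : α → Data

open Coded (code)

instance : Coded Data := ⟨id⟩
instance : Coded Bool := ⟨fun b => if b then .cons .nil .nil else .nil⟩
instance {α : Type} [Coded α] : Coded (List α) := ⟨fun l => Data.ofList (l.map Coded.code)⟩
instance {α β : Type} [Coded α] [Coded β] : Coded (α × β) :=
  ⟨fun x => .cons (Coded.code x.1) (Coded.code x.2)⟩
instance {α : Type} [Coded α] : Coded (Option α) :=
  ⟨fun x => x.elim .nil fun a => .cons .nil (Coded.code a)⟩
instance {α : Type} [Coded α] {k : ℕ} : Coded (Fin k → α) :=
  ⟨fun v => Coded.code (List.ofFn v)⟩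
/-- Numbers are written in binary. -/
instance : Coded ℕ := ⟨fun k => Coded.code (Nat.bits k)⟩
instance {k : ℕ} : Coded (Fin k) := ⟨fun i => Coded.code (i : ℕ)⟩
instance : Coded Unary := ⟨fun k => Data.ofList (List.replicate k.val .nil)⟩


/-- Resources of a run: total work, parallel time, and number of processors. -/
structure Cost : Type where
  work : ℕ
  time : ℕ
  procs : ℕ

namespace Cost

def zero : Cost := ⟨0, 0, 0⟩

/-- One elementary step, of the given work. -/
def step (w : ℕ) : Cost := ⟨w, 1, 1⟩

/-- One computation after the other. -/
def seq (c d : Cost) : Cost := ⟨c.work + d.work, c.time + d.time, max c.procs d.procs⟩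

/-- Two computations at the same time, on separate processors. -/
def par (c d : Cost) : Cost := ⟨c.work + d.work, max c.time d.time, c.procs + d.procs⟩

end Cost

/-- The uniform distribution on `{0, …, k - 1}` (on `{0}` if `k = 0`). -/
def unifBelow (k : ℕ) : PMF ℕ :=
  PMF.uniformOfFinset (Finset.range (k - 1 + 1)) ⟨0, by simp⟩

/-- Independent draws from the distributions `f 0, f 1, …`. -/
def drawVec {α : Type} : (k : ℕ) → (Fin k → PMF α) → PMF (Fin k → α)
  | 0, _ => pure Fin.elim0
  | k + 1, f => do
      let a ← f 0
      let v ← drawVec k fun i => f i.succ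
      pure (Fin.cons a v)

/-- Uniformly random bits. -/
def unifBits (k : ℕ) : PMF (Fin k → Bool) := drawVec k fun _ => PMF.uniformOfFintype Bool

/-- Probabilistic parallel programs over binary trees. Loops are bounded by the length of a list
that the program has built itself, so that every program halts; every polynomial-time machine can be
run under such a clock. -/
inductive Prog : Type
  | skip : Prog
  | const : Data → Prog
  | fst : Prog
  | snd : Prog
  /-- both results, computed one after the other -/
  | pair : Prog → Prog → Prog
  /-- both results, computed in parallel -/
  | par : Prog → Prog → Prog
  /-- the first program, then the second -/
  | seq : Prog → Prog → Prog
  /-- branch on whether the result of the first program is not `nil` -/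
  | ite : Prog → Prog → Prog → Prog
  /-- a fair coin -/
  | coin : Prog
  /-- a uniformly random number below the (binary) input -/
  | rand : Prog
  /-- on `(l, x)`: apply the program to `x` once for each cell of the list `l` -/
  | iter : Prog → Prog
  /-- on `(e, [a₁, …, aₙ])`: apply the program to all `(e, aᵢ)` in parallel -/
  | pmap : Prog → Prog

def iterRun (f : Data → PMF (Data × Cost)) : Data → Data → PMF (Data × Cost)
  | .nil, x => pure (x, .step 1)
  | .cons _ l, x => do
      let y ← f x
      let w ← iterRun f l y.1
      pure (w.1, (Cost.step 1).seq (y.2.seq w.2))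

def pmapRun (f : Data → PMF (Data × Cost)) (e : Data) : Data → PMF (Data × Cost)
  | .nil => pure (.nil, ⟨1, 1, 0⟩)
  | .cons a l => do
      let y ← f (.cons e a)
      let w ← pmapRun f e l
      pure (.cons y.1 w.1, Cost.par ⟨y.2.work + e.size + 1, y.2.time, y.2.procs⟩ w.2)

/-- The distribution of the result of a program together with the resources used. Reading and
sharing data takes unit time; the work also counts the size of all data that are duplicated, so the
output of a program is at most as large as its input plus its work. -/
def Prog.run : Prog → Data → PMF (Data × Cost)
  | .skip, x => pure (x, .step 1)
  | .const d, _ => pure (d, .step d.size)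
  | .fst, x => pure (x.fst, .step 1)
  | .snd, x => pure (x.snd, .step 1)
  | .pair f g, x => do
      let a ← f.run x
      let b ← g.run x
      pure (.cons a.1 b.1, (Cost.step (x.size + 1)).seq (a.2.seq b.2))
  | .par f g, x => do
      let a ← f.run x
      let b ← g.run x
      pure (.cons a.1 b.1, (Cost.step (x.size + 1)).seq (a.2.par b.2))
  | .seq f g, x => do
      let a ← f.run x
      let b ← g.run a.1
      pure (b.1, a.2.seq b.2)
  | .ite c f g, x => do
      let a ← c.run x
      let b ← if a.1.toBool then f.run x else g.run x
      pure (b.1, (Cost.step (x.size + 1)).seq (a.2.seq b.2))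
  | .coin, _ => do
      let b ← PMF.uniformOfFintype Bool
      pure (code b, .step 3)
  | .rand, x => do
      let k ← unifBelow x.toNat
      pure (code k, ⟨x.size, x.size, 1⟩)
  | .iter f, x => iterRun f.run x.fst x.snd
  | .pmap f, x => do
      let y ← pmapRun f.run x.fst x.snd
      pure (y.1, (Cost.step 1).seq y.2)

/-- `f` is computed, exactly, by a program whose work is polynomial in the size of the input. -/
def PolyTime {α β : Type} [Coded α] [Coded β] (f : α → PMF β) : Prop :=
  ∃ (p : Prog) (q : Polynomial ℕ), ∀ a : α,
    (p.run (code a)).map Prod.fst = (f a).map code ∧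
      ∀ o ∈ (p.run (code a)).support, o.2.work ≤ q.eval (code a).size

/-- `μ` is a negligible function. -/
def Negligible (μ : ℕ → ℝ) : Prop :=
  Asymptotics.SuperpolynomialDecay Filter.atTop (fun n : ℕ => (n : ℝ)) μ

/-! ## Experiments -/

/-- The result of an experiment: whether the adversary won, and the resources used by the two
stages of the adversary. -/
structure Outcome : Type where
  win : Prop
  cost₁ : Cost
  cost₂ : Cost

/-- An experiment, for each value of the security parameter. -/
abbrev Experiment : Type := ℕ → PMF Outcome

namespace Experiment

def winProb (E : Experiment) (n : ℕ) : ℝ := ((E n).toOuterMeasure {o | o.win}).toReal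

/-- The adversary is probabilistic polynomial time in this experiment. -/
def IsPPT (E : Experiment) : Prop :=
  ∃ q : Polynomial ℕ, ∀ n, ∀ o ∈ (E n).support, o.cost₁.work + o.cost₂.work ≤ q.eval n

/-- The adversary wins with probability at most `1/2 + μ(n)`, `μ` negligible. -/
def CannotGuess (E : Experiment) : Prop :=
  ∃ μ : ℕ → ℝ, Negligible μ ∧ ∀ n, E.winProb n ≤ 1 / 2 + μ n

/-- The adversary wins with probability at most `μ(n)`, `μ` negligible. -/
def CannotWin (E : Experiment) : Prop :=
  ∃ μ : ℕ → ℝ, Negligible μ ∧ ∀ n, E.winProb n ≤ μ n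

end Experiment

/-- An interactive adversary: a program that is activated `acts(n)` times, each time mapping its
state and the reply to its previous query to its new state and its next query. -/
structure Interactive : Type where
  prog : Prog
  acts : Polynomial ℕ

/-- `k` activations of an interactive adversary against `h`, which maps the state of the environment
and a query to a reply and the new state of the environment. The arguments are the adversary's
state, the pending reply, the state of the environment, and the resources used so far (the work
includes reading the replies). -/
def Interactive.play {W : Type} (A : Interactive) (h : W → Data → PMF (Data × W)) :
    ℕ → Data → Data → W → Cost → PMF (Data × W × Cost)
  | 0, st, _, w, c => pure (st, w, c)
  | k + 1, st, rep, w, c => do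
      let o ← A.prog.run (.cons st rep)
      let r ← h w o.1.snd
      A.play h k o.1.fst r.1 r.2 (c.seq ((Cost.step rep.size).seq o.2))

/-- Interaction from the start, at security parameter `n`. -/
def Interactive.run {W : Type} (A : Interactive) (h : W → Data → PMF (Data × W))
    (n : ℕ) (input reply : Data) (w : W) : PMF (Data × W × Cost) :=
  A.play h (A.acts.eval n) input reply w .zero

/-! ## Symmetric-key encryption and signatures -/

structure SKE : Type where
  keyGen : ℕ → PMF Bits
  enc : Bits → Bits → PMF Bits
  dec : Bits → Bits → Bits
  dec_enc : ∀ n, ∀ k ∈ (keyGen n).support, ∀ m, ∀ c ∈ (enc k m).support, dec k c = m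

namespace SKE

def Efficient (E : SKE) : Prop :=
  PolyTime (fun n : Unary => E.keyGen n.val) ∧
  PolyTime (fun x : Bits × Bits => E.enc x.1 x.2) ∧
  PolyTime (fun x : Bits × Bits => (pure (E.dec x.1 x.2) : PMF Bits))

/-- The challenger of the chosen-plaintext game with key `k` and bit `b`. A query `(nil, m)` asks for
an encryption of `m`; a query `(cons _ _, (m₀, m₁))` is the challenge, which is answered once, and
only for messages of equal length. -/
def cpaOracle (E : SKE) (k : Bits) (b : Bool) : Bool → Data → PMF (Data × Bool)
  | used, .cons .nil m => do
      let c ← E.enc k m.toBits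
      pure (code c, used)
  | false, .cons (.cons _ _) m =>
      if m.fst.toBits.length = m.snd.toBits.length then do
        let c ← E.enc k (if b then m.snd.toBits else m.fst.toBits)
        pure (code c, true)
      else pure (.nil, false)
  | used, _ => pure (.nil, used)

def cpaExp (E : SKE) (A : Interactive) : Experiment := fun n => do
  let k ← E.keyGen n
  let b ← PMF.uniformOfFintype Bool
  let r ← A.run (E.cpaOracle k b) n (code (Unary.mk n)) .nil false
  pure ⟨r.1.fst.toBool = b, r.2.2, .zero⟩

/-- Indistinguishability under chosen-plaintext attacks. -/
def INDCPA (E : SKE) : Prop := ∀ A : Interactive, (E.cpaExp A).IsPPT → (E.cpaExp A).CannotGuess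

end SKE

structure Sig : Type where
  /-- (verification key, signing key) -/
  keyGen : ℕ → PMF (Data × Data)
  sign : Data → Data → PMF Data
  verify : Data → Data → Data → Bool
  verify_sign : ∀ n, ∀ k ∈ (keyGen n).support, ∀ m, ∀ σ ∈ (sign k.2 m).support,
    verify k.1 m σ = true

namespace Sig

def Efficient (G : Sig) : Prop :=
  PolyTime (fun n : Unary => G.keyGen n.val) ∧
  PolyTime (fun x : Data × Data => G.sign x.1 x.2) ∧
  PolyTime (fun x : Data × Data × Data => (pure (G.verify x.1 x.2.1 x.2.2) : PMF Bool))

/-- The signing oracle, which also records the signed messages. A query `nil` is ignored. -/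
def signOracle (G : Sig) (sk : Data) : List Data → Data → PMF (Data × List Data)
  | log, .cons _ m => do
      let σ ← G.sign sk m
      pure (σ, m :: log)
  | log, .nil => pure (.nil, log)

def forgeExp (G : Sig) (A : Interactive) : Experiment := fun n => do
  let k ← G.keyGen n
  let r ← A.run (G.signOracle k.2) n (code (Unary.mk n, k.1)) .nil []
  pure ⟨G.verify k.1 r.1.fst r.1.snd = true ∧ r.1.fst ∉ r.2.1, r.2.2, .zero⟩

/-- Existential unforgeability under chosen-message attacks. -/
def EUFCMA (G : Sig) : Prop := ∀ A : Interactive, (G.forgeExp A).IsPPT → (G.forgeExp A).CannotWin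

end Sig

/-! ## Generic multi-instance time-lock puzzles -/

/-- The strongest solver: at security parameter `n`, it makes `speed n` elementary steps per second on
each processor, and at most `S n` squarings per second. The second stage of an adversary may use, for a
period of `D` seconds, `δ D < D` seconds, and at most `ξ D'` processors, where `D'` is the longest
interval. -/
structure Timing : Type where
  S : ℕ → ℕ
  speed : ℕ → ℕ
  δ : ℕ → ℝ
  ξ : Polynomial ℕ
  δ_zero : δ 0 ≤ 0
  δ_lt : ∀ D, 0 < D → δ D < D

/-- The second stage is fast enough with respect to the first `j + 1` intervals (indices start at
`0`). -/
def Timing.Bounds (τ : Timing) {z : ℕ} (Δ : ℕ → Fin z → ℕ) (j : Fin z) (E : Experiment) : Prop :=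
  ∀ n, ∀ o ∈ (E n).support,
    (o.cost₂.time : ℝ) ≤ τ.speed n * τ.δ (∑ i ∈ Finset.Iic j, Δ n i) ∧
      o.cost₂.procs ≤ τ.ξ.eval ((Finset.Iic j).sup (Δ n))

/-- The first stage runs in polynomial time. -/
def Experiment.FirstPPT (E : Experiment) : Prop :=
  ∃ q : Polynomial ℕ, ∀ n, ∀ o ∈ (E n).support, o.cost₁.work ≤ q.eval n

/-- An adversary in two non-interactive stages. -/
structure TwoStage : Type where
  first : Prog
  second : Prog

/-- The vector of bit strings in a list. -/
def toMsgs (z : ℕ) (d : Data) : Fin z → Bits := fun i => (d.nth i).toBits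

/-- The entry of `m₀` or of `m₁`, as selected by the bits `b`. -/
def mix {z : ℕ} (b : Fin z → Bool) (m₀ m₁ : Fin z → Bits) : Fin z → Bits :=
  fun i => if b i then m₁ i else m₀ i

/-- A multi-instance time-lock puzzle scheme for `z` puzzles. -/
structure GMTLP (z : ℕ) : Type where
  /-- `setup n Δ S`: (public, secret) parameters -/
  setup : ℕ → (Fin z → ℕ) → ℕ → PMF (Data × Data)
  /-- `gen m pk sk`: puzzles and public statements -/
  gen : (Fin z → Bits) → Data → Data → PMF ((Fin z → Data) × (Fin z → Data))
  /-- `solve pk p`: solutions and messages -/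
  solve : Data → (Fin z → Data) → (Fin z → Data) × (Fin z → Bits)
  /-- `prove pk s`: the message in the solution `s` and its proof -/
  prove : Data → Data → Bits × Data
  /-- `verify pk j m π g` -/
  verify : Data → Fin z → Bits → Data → Data → Bool

namespace GMTLP

variable {z : ℕ}

def Efficient (G : GMTLP z) : Prop :=
  PolyTime (fun x : Unary × (Fin z → Unary) × Unary =>
    G.setup x.1.val (fun i => (x.2.1 i).val) x.2.2.val) ∧
  PolyTime (fun x : (Fin z → Bits) × Data × Data => G.gen x.1 x.2.1 x.2.2) ∧
  PolyTime (fun x : Data × (Fin z → Data) =>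
    (pure (G.solve x.1 x.2) : PMF ((Fin z → Data) × (Fin z → Bits)))) ∧
  PolyTime (fun x : Data × Data => (pure (G.prove x.1 x.2) : PMF (Bits × Data))) ∧
  PolyTime (fun x : Data × Fin z × Bits × Data × Data =>
    (pure (G.verify x.1 x.2.1 x.2.2.1 x.2.2.2.1 x.2.2.2.2) : PMF Bool))

/-- Intervals that are computable in time polynomial in the security parameter (in
particular, polynomially bounded). -/
def EfficientTimes (Δ : ℕ → Fin z → ℕ) : Prop :=
  PolyTime fun n : Unary => (pure (fun i => ⟨Δ n.val i⟩) : PMF (Fin z → Unary))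

/-- The first stage chooses two message vectors; the second stage has to guess the bit that selected
the `k`-th message, for an index `k ≥ j` of its choice. As the public key may contain the starting point
of the computation that solves the first puzzle, it is, like the puzzles, given to the second stage
only. -/
def privacyExp (G : GMTLP z) (Δ : ℕ → Fin z → ℕ) (S : ℕ → ℕ) (j : Fin z) (A : TwoStage) :
    Experiment := fun n => do
  let keys ← G.setup n (Δ n) (S n)
  let o ← A.first.run (code (Unary.mk n, Unary.mk z))
  let m₀ := toMsgs z o.1.fst
  let m₁ := toMsgs z o.1.snd.fst
  let state := o.1.snd.snd
  let b ← unifBits z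
  let p ← G.gen (mix b m₀ m₁) keys.1 keys.2
  let o' ← A.second.run (code (keys.1, p, state))
  pure ⟨(∀ i, (m₀ i).length = (m₁ i).length) ∧
      ∃ k : Fin z, (k : ℕ) = o'.1.snd.toNat ∧ j ≤ k ∧ o'.1.fst.toBool = b k, o.2, o'.2⟩

def Private (G : GMTLP z) (τ : Timing) : Prop :=
  ∀ Δ : ℕ → Fin z → ℕ, EfficientTimes Δ → ∀ (j : Fin z) (A : TwoStage),
    (G.privacyExp Δ τ.S j A).FirstPPT → τ.Bounds Δ j (G.privacyExp Δ τ.S j A) →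
      (G.privacyExp Δ τ.S j A).CannotGuess

/-- The adversary has to find a message and an accepted proof for it where the message is not the
one that the public statement was made for. -/
def validityExp (G : GMTLP z) (Δ : ℕ → Fin z → ℕ) (S : ℕ → ℕ) (A : TwoStage) :
    Experiment := fun n => do
  let keys ← G.setup n (Δ n) (S n)
  let o ← A.first.run (code (Unary.mk n, keys.1, Δ n))
  let m := toMsgs z o.1.fst
  let state := o.1.snd
  let p ← G.gen m keys.1 keys.2
  let sol := G.solve keys.1 p.1
  let o' ← A.second.run (code (keys.1, sol.1, p, state))
  pure ⟨∃ j : Fin z, (j : ℕ) = o'.1.fst.toNat ∧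
      G.verify keys.1 j o'.1.snd.snd.toBits o'.1.snd.fst (p.2 j) = true ∧
      o'.1.snd.snd.toBits ≠ m j, o.2, o'.2⟩

def Valid (G : GMTLP z) (τ : Timing) : Prop :=
  ∀ Δ : ℕ → Fin z → ℕ, EfficientTimes Δ → ∀ A : TwoStage,
    (G.validityExp Δ τ.S A).IsPPT → (G.validityExp Δ τ.S A).CannotWin

def Secure (G : GMTLP z) (τ : Timing) : Prop := G.Private τ ∧ G.Valid τ

end GMTLP

/-! ## The chained time-lock puzzle -/

/-- The components of the chained time-lock puzzle: an encryption scheme, a generator of pairs of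
distinct primes, a hash function family, and the lengths of encoded generators and of commitment
randomness. -/
structure ChainedParams : Type where
  ske : SKE
  primes : ℕ → PMF (ℕ × ℕ)
  primes_prime : ∀ n, ∀ q ∈ (primes n).support, q.1.Prime ∧ q.2.Prime ∧ q.1 ≠ q.2
  hashKey : ℕ → PMF Bits
  hash : Bits → Bits → Bits
  ω₁ : ℕ → ℕ
  ω₂ : ℕ → ℕ

namespace Chained

/-- A uniformly random element of `ℤ_N^*`, as a residue. -/
def unifUnit (N : ℕ) : PMF ℕ := (PMF.uniformOfFintype (ZMod (N - 1 + 1))ˣ).map fun u => u.val.val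

/-- Keys as numbers (with a leading bit that marks the length). -/
def keyToNat (k : Bits) : ℕ := bitsToNat (k ++ [true])

def natToKey (a : ℕ) : Bits := (Nat.bits a).dropLast

/-- `parse w y` splits off the last `w` bits of `y`. -/
def parse (w : ℕ) (y : Bits) : Bits × Bits := (y.take (y.length - w), y.drop (y.length - w))

/-- `T` squarings modulo `N`. -/
def squarings (N T r : ℕ) : ℕ := (fun x => x ^ 2 % N)^[T] r

/-! The public key is the coded tuple `(hk, N, T, r₁, ω₁, ω₂)`. The secret key is the coded tuple
`(q₁, q₂, a, k, r, d)`. -/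

def pkHash (pk : Data) : Bits := pk.fst.toBits
def pkMod (pk : Data) : ℕ := max 1 pk.snd.fst.toNat
def pkT (pk : Data) (j : ℕ) : ℕ := (pk.snd.snd.fst.nth j).len
def pkR (pk : Data) : ℕ := pk.snd.snd.snd.fst.toNat
def pkω₁ (pk : Data) : ℕ := pk.snd.snd.snd.snd.fst.len
def pkω₂ (pk : Data) : ℕ := pk.snd.snd.snd.snd.snd.len
def skA (sk : Data) (j : ℕ) : ℕ := (sk.snd.snd.fst.nth j).toNat
def skK (sk : Data) (j : ℕ) : Bits := (sk.snd.snd.snd.fst.nth j).toBits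
def skR (sk : Data) (j : ℕ) : ℕ := (sk.snd.snd.snd.snd.fst.nth j).toNat
def skD (sk : Data) (j : ℕ) : Bits := (sk.snd.snd.snd.snd.snd.nth j).toBits

/-- Solving a single puzzle `p` with generator `r`, modulus `N` and `T` squarings. -/
def solveOne (E : SKE) (N T r : ℕ) (p : Data) : Bits :=
  let b := squarings N T r % N
  E.dec (natToKey ((p.snd.toNat % N + N - b) % N)) p.fst.toBits

/-- The generator for the `j`-th puzzle: public for the first one, and contained in the plaintext of
the previous puzzle for the others. -/
def generator (E : SKE) (pk : Data) {z : ℕ} (p : Fin z → Data) : ℕ → ℕ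
  | 0 => pkR pk
  | j + 1 =>
    if h : j < z then
      bitsToNat (parse (pkω₁ pk)
        (solveOne E (pkMod pk) (pkT pk j) (generator E pk p j) (p ⟨j, h⟩))).2
    else 0

end Chained

open Chained in
/-- The generic chained time-lock puzzle. -/
def chainedTLP (P : ChainedParams) (z : ℕ) : GMTLP z where
  setup n Δ S := do
    let q ← P.primes n
    let hk ← P.hashKey n
    let r ← drawVec (z + 1) fun _ => unifUnit (q.1 * q.2)
    let k ← drawVec z fun _ => P.ske.keyGen n
    let d ← drawVec z fun _ => (unifBits (P.ω₂ n)).map List.ofFn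
    let a : Fin z → ℕ := fun j => 2 ^ (S * Δ j) % ((q.1 - 1) * (q.2 - 1))
    pure (code (hk, q.1 * q.2, (fun j => ⟨S * Δ j⟩ : Fin z → Unary), r 0,
        Unary.mk (P.ω₁ n), Unary.mk (P.ω₂ n)),
      code (q.1, q.2, a, k, r, d))
  gen m pk sk := do
    let p ← drawVec z fun j => do
      let c ← P.ske.enc (skK sk j)
        (m j ++ skD sk j ++ natToBits (pkω₁ pk) (skR sk (j + 1)))
      pure (code (c, (keyToNat (skK sk j) + skR sk j ^ skA sk j) % pkMod pk))
    pure (p, fun j => code (P.hash (pkHash pk) (m j ++ skD sk j)))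
  solve pk p :=
    let s : Fin z → Bits := fun j => (parse (pkω₁ pk)
      (solveOne P.ske (pkMod pk) (pkT pk j) (generator P.ske pk p j) (p j))).1
    (fun j => code (s j), fun j => (parse (pkω₂ pk) (s j)).1)
  prove pk s := ((parse (pkω₂ pk) s.toBits).1, code (parse (pkω₂ pk) s.toBits).2)
  verify pk _ m π g := decide (π.toBits.length = pkω₂ pk ∧
    code (P.hash (pkHash pk) (m ++ π.toBits)) = g)

/-! ## Smart contracts and blockchains -/

/-- Client, server, the client's helper, the server's helper. -/
inductive Party : Type
  | C | S | HC | HS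

/-- What is fixed when the contract is deployed: the parties' addresses (verification keys), the
intervals, extra delays, the starting time, the network delay, and the payments. -/
structure Contract (z : ℕ) : Type where
  acct : Party → Data
  Δ : Fin z → ℕ
  Ψ : Fin z → ℕ
  t₀ : ℕ
  Υ : ℕ
  coins : Fin z → ℕ

/-- The address of a contract determines its deployer and its contents. -/
def Contract.adr {z : ℕ} (c : Contract z) : Data :=
  code ((c.acct .C, c.acct .S, c.acct .HC, c.acct .HS), c.Δ, c.Ψ, c.t₀, c.Υ, c.coins)

/-- Calls of the functions of the contract. -/
inductive Call (z : ℕ) : Type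
  /-- the server deploys the contract with a deposit -/
  | deploy (amount : ℕ)
  /-- the client's helper publishes the public key and the statements -/
  | publish (pk : Data) (g : Fin z → Data)
  /-- the server's helper registers the `j`-th message and its proof -/
  | register (j : Fin z) (m : Bits) (π : Data)
  /-- the client or the server has the `j`-th solution verified and paid for -/
  | pay (j : Fin z)

namespace Call

variable {z : ℕ}

def toData : Call z → Data
  | deploy a => code (0, a)
  | publish pk g => code (1, pk, g)
  | register j m π => code (2, j, m, π)
  | pay j => code (3, j)

def ofData (z : ℕ) (d : Data) : Option (Call z) :=
  match d.fst.toNat with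
  | 0 => some (deploy d.snd.toNat)
  | 1 => some (publish d.snd.fst fun i => d.snd.snd.nth i)
  | 2 => if h : d.snd.fst.toNat < z then
      some (register ⟨_, h⟩ d.snd.snd.fst.toBits d.snd.snd.snd) else none
  | 3 => if h : d.snd.toNat < z then some (pay ⟨_, h⟩) else none
  | _ => none

end Call

/-- The signed part of a transaction: contract address, nonce, call. -/
def payload {z : ℕ} (c : Contract z) (nonce : ℕ) (f : Call z) : Data :=
  code (c.adr, nonce, f.toData)

/-- A transaction: address of the account, signed part, signature. -/
def mkTx (vk body σ : Data) : Data := code (vk, body, σ)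

/-- `tx` is a properly signed transaction of account `vk` that calls `f` of the contract `c`. -/
def IsCall (G : Sig) {z : ℕ} (c : Contract z) (tx vk : Data) (f : Call z) : Prop :=
  tx.fst = vk ∧ G.verify vk tx.snd.fst tx.snd.snd = true ∧
    tx.snd.fst.fst = c.adr ∧ Call.ofData z tx.snd.fst.snd.snd = some f

/-- The state of a contract. `reg j` is the registered message, proof and time; `ver` and `paid` are
the bits `v_j` and `u_j`; `transfers` lists the payments made (recipient and amount). -/
structure SCState (z : ℕ) : Type where
  deployed : Bool
  published : Option (Data × (Fin z → Data))
  reg : Fin z → Option (Bits × Data × ℕ)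
  ver : Fin z → Option Bool
  paid : Fin z → Option Bool
  transfers : List (Data × ℕ)

def SCState.empty (z : ℕ) : SCState z := ⟨false, none, fun _ => none, fun _ => none, fun _ => none, []⟩

/-- What the environment may hand to the blockchain system: the end of a round, a transaction that is
broadcast to all honest parties, or any message of the adversary (to corrupted parties and to the
network). -/
inductive Action : Type
  | tick
  | bcast (tx : Data)
  | adv (a : Data)

instance : Coded Action :=
  ⟨fun a => match a with
    | .tick => .nil
    | .bcast tx => .cons .nil tx
    | .adv a => .cons (.cons .nil .nil) a⟩

def Action.ofData : Data → Action
  | .nil => .tick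
  | .cons .nil tx => .bcast tx
  | .cons (.cons _ _) a => .adv a

/-- A blockchain protocol with `N` honest parties, together with the network and the interface of the
corrupted parties, as a reactive system with global states in `Data`. -/
structure Blockchain (z : ℕ) : Type where
  N : ℕ
  start : ℕ → PMF Data
  step : Data → Action → PMF (Data × Data)
  /-- the chain of an honest party: a list of blocks, each a list of transactions -/
  view : Fin N → Data → List (List Data)
  /-- the state of a contract according to an honest party -/
  report : Fin N → Data → Contract z → SCState z
  /-- the last `depth n` blocks of a chain are not yet part of the ledger -/
  depth : ℕ → ℕ
  /-- the network delay -/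
  delay : ℕ → ℕ

namespace Blockchain

variable {z : ℕ}

/-- States that can be reached by actions of the given total size. -/
inductive Reach (B : Blockchain z) (n : ℕ) : ℕ → Data → Prop
  | start (s : Data) : s ∈ (B.start n).support → Reach B n 0 s
  | step (k : ℕ) (s : Data) (a : Action) (o : Data × Data) : Reach B n k s →
      o ∈ (B.step s a).support → Reach B n (k + (code a).size) o.1

/-- The protocol runs in polynomial time, and its states stay polynomially bounded. -/
def Efficient (B : Blockchain z) : Prop :=
  PolyTime (fun n : Unary => B.start n.val) ∧
  PolyTime (fun x : Data × Action => B.step x.1 x.2) ∧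
  (∀ p, PolyTime fun s : Data => (pure (B.view p s) : PMF (List (List Data)))) ∧
  PolyTime (fun n : Unary => (pure (B.delay n.val) : PMF ℕ)) ∧
  ∃ q : Polynomial ℕ, ∀ n k s, B.Reach n k s → s.size ≤ q.eval (n + k)

/-- The ledger reported by the honest party `p`: its chain without the last blocks. -/
def ledger (B : Blockchain z) (n : ℕ) (p : Fin B.N) (s : Data) : List (List Data) :=
  (B.view p s).take ((B.view p s).length - B.depth n)

/-- An execution: `hist` lists the states at the end of rounds `0, 1, …`, `cur` is the current state,
and `log` lists the transactions issued by honest account holders, with the contents and the round. -/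
structure World (α : Type) : Type where
  hist : List Data
  cur : Data
  log : List (α × Data × ℕ)

def World.round {α : Type} (w : World α) : ℕ := w.hist.length - 1

def init (B : Blockchain z) (α : Type) (n : ℕ) : PMF (World α) := do
  let s ← B.start n
  pure ⟨[s], s, []⟩

def act (B : Blockchain z) {α : Type} (w : World α) : Action → PMF (Data × World α)
  | .tick => do
      let o ← B.step w.cur .tick
      pure (o.2, ⟨w.hist ++ [o.1], o.1, w.log⟩)
  | a => do
      let o ← B.step w.cur a
      pure (o.2, ⟨w.hist, o.1, w.log⟩)

/-- An honest account holder signs `body` and broadcasts the transaction, which the adversary sees. -/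
def issue (B : Blockchain z) (G : Sig) {α : Type} (key : Data × Data) (x : α) (body : Data)
    (w : World α) : PMF (Data × World α) := do
  let σ ← G.sign key.2 body
  let o ← B.act w (.bcast (mkTx key.1 body σ))
  pure (code (mkTx key.1 body σ, o.1),
    { o.2 with log := o.2.log ++ [(x, mkTx key.1 body σ, w.round)] })

/-- The environment hands actions to the system; `nil` is ignored. -/
def envOracle (B : Blockchain z) : World Unit → Data → PMF (Data × World Unit)
  | w, .nil => pure (.nil, w)
  | w, .cons _ a => B.act w (Action.ofData a)

/-- The execution in an environment `A` wins if `bad` holds for the hist. -/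
def traceExp (B : Blockchain z) (bad : ℕ → List Data → Prop) (A : Interactive) : Experiment :=
  fun n => do
    let w ← B.init Unit n
    let r ← A.run B.envOracle n (code (Unary.mk n)) .nil w
    pure ⟨bad n r.2.1.hist, r.2.2, .zero⟩

/-- Some honest party reported a ledger that is later, or elsewhere, not a part of the chain of an
honest party. -/
def PersistenceFails (B : Blockchain z) (n : ℕ) (hist : List Data) : Prop :=
  ∃ (r r' : ℕ) (s s' : Data) (p p' : Fin B.N), r ≤ r' ∧ hist[r]? = some s ∧ hist[r']? = some s' ∧
    ¬ B.ledger n p s <+: B.view p' s'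

def Persistent (B : Blockchain z) : Prop :=
  ∀ A : Interactive, (B.traceExp B.PersistenceFails A).IsPPT →
    (B.traceExp B.PersistenceFails A).CannotWin

/-- As `envOracle`; in addition, a query `(nil, body)` has the honest account holder sign and issue
`body`. -/
def liveOracle (B : Blockchain z) (G : Sig) (key : Data × Data) :
    World Unit → Data → PMF (Data × World Unit)
  | w, .nil => pure (.nil, w)
  | w, .cons .nil body => B.issue G key () body w
  | w, .cons (.cons _ _) a => B.act w (Action.ofData a)

/-- Some transaction of the honest account holder is, after the network delay, missing from the
ledger of an honest party. -/
def LivenessFails (B : Blockchain z) (n : ℕ) (w : World Unit) : Prop :=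
  ∃ x ∈ w.log, ∃ (r : ℕ) (s : Data) (p : Fin B.N), x.2.2 + B.delay n ≤ r ∧ w.hist[r]? = some s ∧
    x.2.1 ∉ (B.ledger n p s).flatten

def liveExp (B : Blockchain z) (G : Sig) (A : Interactive) : Experiment := fun n => do
  let key ← G.keyGen n
  let w ← B.init Unit n
  let r ← A.run (B.liveOracle G key) n (code (Unary.mk n, key.1)) .nil w
  pure ⟨B.LivenessFails n r.2.1, r.2.2, .zero⟩

def Live (B : Blockchain z) (G : Sig) : Prop :=
  ∀ A : Interactive, (B.liveExp G A).IsPPT → (B.liveExp G A).CannotWin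

/-- The transactions in the ledger of party `p` in round `r`, in order, each with its registration
time: the first round in which the ledger of `p` contained the position of its block. -/
def stampedTxs (B : Blockchain z) (n : ℕ) (p : Fin B.N) (hist : List Data) (s : Data) :
    List (ℕ × Data) :=
  (B.ledger n p s).zipIdx.flatMap fun x =>
    x.1.map fun tx => (hist.findIdx fun s' => decide (x.2 < (B.ledger n p s').length), tx)

end Blockchain

/-! ## Delegated time-lock puzzles -/

/-- A delegated time-lock puzzle scheme for `z` puzzles. Deadlines, extra delays and coins are
vectors; `Ψ'` and `coins'` are the extra delays and payments that the server's helper insists on. -/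
structure DTLP (z : ℕ) : Type where
  /-- client setup: `(cpk, csk)` -/
  cSetup : ℕ → (Fin z → ℕ) → PMF (Data × Data)
  /-- client delegation `m cpk csk t₀`: encoded messages and starting time -/
  cDelegate : (Fin z → Bits) → Data → Data → ℕ → PMF ((Fin z → Bits) × ℕ)
  /-- server delegation `ToC S Δ aux accts t₀ Υ coins`: the contract -/
  sDelegate : Data → ℕ → (Fin z → ℕ) → Data → (Party → Data) → ℕ → ℕ → (Fin z → ℕ) → Contract z
  /-- setup of the client's helper -/
  hSetup : ℕ → (Fin z → ℕ) → ℕ → PMF (Data × Data)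
  /-- puzzle generation `m* cpk pk sk t₀` -/
  gen : (Fin z → Bits) → Data → Data → Data → ℕ → PMF ((Fin z → Data) × (Fin z → Data))
  /-- `solve Ψ Ψ' aux pk p c coins' coins`: solutions, unless the conditions are rejected -/
  solve : (Fin z → ℕ) → (Fin z → ℕ) → Data → Data → (Fin z → Data) → Contract z →
    (Fin z → ℕ) → (Fin z → ℕ) → Option (Fin z → Data)
  prove : Data → Data → Data
  /-- `register pk j s π`: the call that registers a solution -/
  register : Data → Fin z → Data → Data → Call z
  /-- `verify pk j m* π g Ψ t_j t₀ Δ Υ` -/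
  verify : Data → Fin z → Bits → Data → Data → (Fin z → ℕ) → ℕ → ℕ → (Fin z → ℕ) → ℕ → Bool
  /-- payment by the contract, given the result of the verification -/
  pay : Bool → Contract z → Fin z → SCState z → SCState z
  retrieve : Data → Data → Bits → Bits

/-- The time by which the `j`-th solution is due. -/
def deadline {z : ℕ} (t₀ : ℕ) (Δ Ψ : Fin z → ℕ) (Υ : ℕ) (j : Fin z) : ℕ :=
  t₀ + ∑ i ∈ Finset.Iic j, (Δ i + Ψ i + Υ)

/-- The efficient delegated time-lock puzzle, from an encryption scheme, a multi-instance puzzle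
scheme, and a customized extra delay generating function. -/
def edTLP {z : ℕ} (E : SKE) (G : GMTLP z) (cedg : Data → ℕ → ℕ → Data → ℕ) : DTLP z where
  cSetup n Δ := do
    let k ← E.keyGen n
    pure (code Δ, code k)
  cDelegate m _ csk t₀ := do
    let c ← drawVec z fun i => E.enc csk.toBits (m i)
    pure (c, t₀)
  sDelegate toc S Δ aux acct t₀ Υ coins := ⟨acct, Δ, fun j => cedg toc S (Δ j) aux, t₀, Υ, coins⟩
  hSetup := G.setup
  gen m _ pk sk _ := G.gen m pk sk
  solve Ψ Ψ' _ pk p _ coins' coins :=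
    if (∀ j, coins' j ≤ coins j) ∧ ∀ j, Ψ' j ≤ Ψ j then some (G.solve pk p).1 else none
  prove pk s := (G.prove pk s).2
  register pk j s π := .register j (G.prove pk s).1 π
  verify pk j m π g Ψ t t₀ Δ Υ := decide (t ≤ deadline t₀ Δ Ψ Υ j) && G.verify pk j m π g
  pay v c j st :=
    if v then
      if st.paid j = some true then st
      else { st with
        paid := Function.update st.paid j (some true)
        transfers := st.transfers ++ [(c.acct .HS, c.coins j)] }
    else
      if st.paid j = none then { st with
        paid := Function.update st.paid j (some false)
        transfers := st.transfers ++ [(c.acct .S, c.coins j)] }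
      else st
  retrieve _ csk m := E.dec csk.toBits m

namespace DTLP

variable {z : ℕ}

/-! ### The smart contract -/

/-- A call by the account `vk` at time `t`. Calls by accounts that are not entitled to make them have
no effect; of several registrations (or publications), the first counts. -/
def call (D : DTLP z) (c : Contract z) (t : ℕ) (vk : Data) (st : SCState z) : Call z → SCState z
  | .deploy a =>
      if vk = c.acct .S ∧ a = ∑ i, c.coins i then { st with deployed := true } else st
  | .publish pk g =>
      if vk = c.acct .HC ∧ st.published.isNone then { st with published := some (pk, g) } else st
  | .register j m π =>
      if vk = c.acct .HS ∧ (st.reg j).isNone then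
        { st with reg := Function.update st.reg j (some (m, π, t)) }
      else st
  | .pay j =>
      if (vk = c.acct .C ∨ vk = c.acct .S) ∧ st.deployed = true then
        match st.published, st.reg j with
        | some (pk, g), some (m, π, t') =>
            let v := D.verify pk j m π (g j) c.Ψ t' c.t₀ c.Δ c.Υ
            D.pay v c j { st with ver := Function.update st.ver j (some v) }
        | _, _ => st
      else st

/-- The effect of a transaction; it has none unless it is properly signed and addressed. -/
def exec (D : DTLP z) (G : Sig) (c : Contract z) (st : SCState z) (x : ℕ × Data) : SCState z :=
  if G.verify x.2.fst x.2.snd.fst x.2.snd.snd = true ∧ x.2.snd.fst.fst = c.adr then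
    match Call.ofData z x.2.snd.fst.snd.snd with
    | some f => D.call c x.1 x.2.fst st f
    | none => st
  else st

/-- The state of the contract `c` that results from the ledger of party `p` in state `s`. -/
def scState (D : DTLP z) (G : Sig) (B : Blockchain z) (n : ℕ) (p : Fin B.N) (hist : List Data)
    (s : Data) (c : Contract z) : SCState z :=
  (B.stampedTxs n p hist s).foldl (D.exec G c) (SCState.empty z)

/-- Some honest party reports a contract state that is not the result of executing the contract on
its ledger. -/
def ContractFails (D : DTLP z) (G : Sig) (B : Blockchain z) (n : ℕ) (hist : List Data) : Prop :=
  ∃ (r : ℕ) (s : Data) (p : Fin B.N) (c : Contract z), hist[r]? = some s ∧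
    B.report p s c ≠ D.scState G B n p hist s c

/-- Correctness of the smart contract on the blockchain. -/
def ContractCorrect (D : DTLP z) (G : Sig) (B : Blockchain z) : Prop :=
  ∀ A : Interactive, (B.traceExp (D.ContractFails G B) A).IsPPT →
    (B.traceExp (D.ContractFails G B) A).CannotWin

/-! ### Security -/

/-- The public parameters chosen by the parties. -/
structure Params (z : ℕ) : Type where
  toc : Data
  Δ : Fin z → ℕ
  aux : Data
  t₀ : ℕ
  coins : Fin z → ℕ
  coins' : Fin z → ℕ
  Ψ' : Fin z → ℕ

instance : Coded (Params z) :=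
  ⟨fun P => code (P.toc, (fun i => ⟨P.Δ i⟩ : Fin z → Unary), P.aux, P.t₀,
    P.coins, P.coins', P.Ψ')⟩

/-- Parameters that are computable in time polynomial in the security parameter. -/
def EfficientParams (P : ℕ → Params z) : Prop :=
  PolyTime fun n : Unary => (pure (P n.val) : PMF (Params z))

/-- The account keys of all parties. -/
def accounts (G : Sig) (n : ℕ) : PMF (Party → Data × Data) := do
  let k₁ ← G.keyGen n
  let k₂ ← G.keyGen n
  let k₃ ← G.keyGen n
  let k₄ ← G.keyGen n
  pure fun | .C => k₁ | .S => k₂ | .HC => k₃ | .HS => k₄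

/-- The contract that results from the server's delegation. -/
def contractOf (D : DTLP z) (B : Blockchain z) (S : ℕ → ℕ) (n : ℕ) (P : Params z)
    (keys : Party → Data × Data) (t₀ : ℕ) : Contract z :=
  D.sDelegate P.toc (S n) P.Δ P.aux (fun i => (keys i).1) t₀ (B.delay n) P.coins

/-- Privacy against the helpers. -/
def helperExp (D : DTLP z) (G : Sig) (B : Blockchain z) (S : ℕ → ℕ)
    (P : ℕ → Params z) (A : TwoStage) :
    Experiment := fun n => do
  let keys ← accounts G n
  let ck ← D.cSetup n (P n).Δ
  let o ← A.first.run (code (Unary.mk n, ck.1, Unary.mk z))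
  let m₀ := toMsgs z o.1.fst
  let m₁ := toMsgs z o.1.snd.fst
  let state := o.1.snd.snd
  let b ← unifBits z
  let e ← D.cDelegate (mix b m₀ m₁) ck.1 ck.2 (P n).t₀
  let c := D.contractOf B S n (P n) keys e.2
  let hk ← D.hSetup n (P n).Δ (S n)
  let p ← D.gen e.1 ck.1 hk.1 hk.2 e.2
  let sol := D.solve c.Ψ (P n).Ψ' (P n).aux hk.1 p.1 c (P n).coins' (P n).coins
  let o' ← A.second.run (code (hk.1, ck.1, (m₀, m₁), e.1, state, e.2,
    ((P n).toc, (P n).aux, c.Ψ, (P n).Δ), sol, p, (P n).coins, c.acct .HS, c.adr))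
  pure ⟨(∀ i, (m₀ i).length = (m₁ i).length) ∧
      ∃ k : Fin z, (k : ℕ) = o'.1.snd.toNat ∧ o'.1.fst.toBool = b k, o.2, o'.2⟩

/-- Privacy of the encoded messages against the server and its helper. -/
def solverExp (D : DTLP z) (G : Sig) (B : Blockchain z) (S : ℕ → ℕ)
    (P : ℕ → Params z) (j : Fin z) (A : TwoStage) : Experiment := fun n => do
  let keys ← accounts G n
  let ck ← D.cSetup n (P n).Δ
  let o ← A.first.run (code (Unary.mk n, ck.1, ck.2, Unary.mk z))
  let m₀ := toMsgs z o.1.fst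
  let m₁ := toMsgs z o.1.snd.fst
  let state := o.1.snd.snd
  let c := D.contractOf B S n (P n) keys (P n).t₀
  let hk ← D.hSetup n (P n).Δ (S n)
  let b ← unifBits z
  let p ← D.gen (mix b m₀ m₁) ck.1 hk.1 hk.2 (P n).t₀
  let o' ← A.second.run (code (hk.1, p, (state, ck.1, c.Ψ, (P n).Δ, c.acct .HS, c.adr,
    (P n).aux, (P n).toc, (P n).t₀)))
  pure ⟨(∀ i, (m₀ i).length = (m₁ i).length) ∧
      ∃ k : Fin z, (k : ℕ) = o'.1.snd.toNat ∧ j ≤ k ∧ o'.1.fst.toBool = b k, o.2, o'.2⟩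

def Private (D : DTLP z) (G : Sig) (B : Blockchain z) (τ : Timing) : Prop :=
  ∀ P : ℕ → Params z, EfficientParams P →
    (∀ A : TwoStage, (D.helperExp G B τ.S P A).IsPPT → (D.helperExp G B τ.S P A).CannotGuess) ∧
    (∀ (j : Fin z) (A : TwoStage), (D.solverExp G B τ.S P j A).FirstPPT →
      τ.Bounds (fun n => (P n).Δ) j (D.solverExp G B τ.S P j A) → (D.solverExp G B τ.S P j A).CannotGuess)

/-- An adversary whose second stage interacts with the blockchain. -/
structure ChainAdversary : Type where
  first : Prog
  second : Interactive

/-- An execution of the blockchain in which honest calls are logged with the issuing party. -/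
abbrev CallWorld (z : ℕ) : Type := Blockchain.World (Party × Call z)

/-- Party `i` calls `f`, with a fresh nonce. -/
def issueCall (G : Sig) (B : Blockchain z) (c : Contract z) (keys : Party → Data × Data)
    (i : Party) (f : Call z) (w : CallWorld z) : PMF (Data × CallWorld z) :=
  B.issue G (keys i) (i, f) (payload c w.log.length f) w

/-- The adversary acts on the blockchain, and decides when the client (query `((cons, nil), j)`) or
the server (query `((cons, cons), j)`) asks for verification and payment of the `j`-th solution. -/
def chainOracle (G : Sig) (B : Blockchain z) (c : Contract z) (keys : Party → Data × Data) :
    CallWorld z → Data → PMF (Data × CallWorld z)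
  | w, .nil => pure (.nil, w)
  | w, .cons .nil a => B.act w (Action.ofData a)
  | w, .cons (.cons _ i) d =>
      if h : d.toNat < z then
        issueCall G B c keys (if i.toBool then .S else .C) (.pay ⟨_, h⟩) w
      else pure (.nil, w)

/-- The blockchain is started, the server deploys the contract, the client's helper publishes the
public key and the statements, and then the adversary interacts with the blockchain. -/
def runChain (G : Sig) (B : Blockchain z) (n : ℕ) (c : Contract z) (keys : Party → Data × Data)
    (pk : Data) (g : Fin z → Data) (A : Interactive) (input : Data) :
    PMF (Data × CallWorld z × Cost) := do
  let w₀ ← B.init (Party × Call z) n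
  let w₁ ← issueCall G B c keys .S (.deploy (∑ i, c.coins i)) w₀
  let w₂ ← issueCall G B c keys .HC (.publish pk g) w₁.2
  A.run (chainOracle G B c keys) n input (.cons w₁.1 w₂.1) w₂.2

/-- By round `r`, the `j`-th solution `m` with proof `π` has been delivered: it is registered in the
ledger of an honest party. -/
def DeliveredAt (G : Sig) (B : Blockchain z) (n : ℕ) (c : Contract z) (hist : List Data)
    (j : Fin z) (m : Bits) (π : Data) (r : ℕ) : Prop :=
  ∃ (s : Data) (p : Fin B.N), hist[r]? = some s ∧
    ∃ tx ∈ (B.ledger n p s).flatten, IsCall G c tx (c.acct .HS) (.register j m π)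

/-- `t` is the delivery time, and it is within the deadline. -/
def OnTime (G : Sig) (B : Blockchain z) (n : ℕ) (c : Contract z) (hist : List Data)
    (j : Fin z) (m : Bits) (π : Data) (t : ℕ) : Prop :=
  IsLeast {r | DeliveredAt G B n c hist j m π r} t ∧ t ≤ deadline c.t₀ c.Δ c.Ψ c.Υ j

/-- Solution validity. The adversary, who acts for the server's helper and knows `csk`, wins if a
solution other than the encoded one is delivered on time and accepted, or if the encoded one is not
delivered on time and yet accepted with the registration time that the contract reports. -/
def validityExp (D : DTLP z) (G : Sig) (B : Blockchain z) (S : ℕ → ℕ)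
    (P : ℕ → Params z) (A : ChainAdversary) : Experiment := fun n => do
  let keys ← accounts G n
  let ck ← D.cSetup n (P n).Δ
  let o ← A.first.run (code (Unary.mk n, ck.1, (P n).Δ, Unary.mk z))
  let e := toMsgs z o.1.fst
  let state := o.1.snd
  let c := D.contractOf B S n (P n) keys (P n).t₀
  let hk ← D.hSetup n (P n).Δ (S n)
  let p ← D.gen e ck.1 hk.1 hk.2 (P n).t₀
  let sol := D.solve c.Ψ (P n).Ψ' (P n).aux hk.1 p.1 c (P n).coins' (P n).coins
  let r ← runChain G B n c keys hk.1 p.2 A.second (code (Unary.mk n, hk.1, ck.1, sol, p, state,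
    ck.2, c.Ψ, (P n).Δ, (P n).aux, (P n).coins, c.adr, keys .HS, (P n).toc, (P n).t₀))
  let π := r.1.snd.fst
  let m := r.1.snd.snd.toBits
  let hist := r.2.1.hist
  pure ⟨∃ j : Fin z, (j : ℕ) = r.1.fst.toNat ∧
      ((∃ t, OnTime G B n c hist j m π t ∧ m ≠ e j ∧
          D.verify hk.1 j m π (p.2 j) c.Ψ t c.t₀ c.Δ c.Υ = true) ∨
       ((¬ ∃ t, OnTime G B n c hist j m π t) ∧ m = e j ∧
          ∃ (i : ℕ) (s : Data) (q : Fin B.N) (t' : ℕ), hist[i]? = some s ∧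
            (B.report q s c).reg j = some (m, π, t') ∧
            D.verify hk.1 j m π (p.2 j) c.Ψ t' c.t₀ c.Δ c.Υ = true)), o.2, r.2.2⟩

def Valid (D : DTLP z) (G : Sig) (B : Blockchain z) (τ : Timing) : Prop :=
  ∀ P : ℕ → Params z, EfficientParams P → ∀ A : ChainAdversary,
    (D.validityExp G B τ.S P A).IsPPT → (D.validityExp G B τ.S P A).CannotWin

/-- Payment and verification disagree in the report of an honest party: either `u_j` is set but is
not the result of verifying the registered solution; or `u_j` is not the result of verifying the
solution that was registered (in a deployed contract with published statements) when the client or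
the server called for payment, although the network delay has passed since. Here `v` is the
verification with the true public key and statement. -/
def PaymentFails (B : Blockchain z) (n : ℕ) (c : Contract z) (w : CallWorld z) (j : Fin z)
    (v : Bits → Data → ℕ → Bool) : Prop :=
  ∃ (r : ℕ) (s : Data) (p : Fin B.N), w.hist[r]? = some s ∧
    ((∃ u, (B.report p s c).paid j = some u ∧
        ¬ ∃ m π t, (B.report p s c).reg j = some (m, π, t) ∧ v m π t = u) ∨
     (∃ x ∈ w.log, x.1.2 = .pay j ∧ x.2.2 + B.delay n ≤ r ∧
        ∃ (s₀ : Data) (m : Bits) (π : Data) (t : ℕ), w.hist[x.2.2]? = some s₀ ∧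
          (B.report p s₀ c).deployed = true ∧ (B.report p s₀ c).published.isSome = true ∧
          (B.report p s₀ c).reg j = some (m, π, t) ∧
          (B.report p s c).paid j ≠ some (v m π t)))

/-- Fair payment for the `j`-th solution. -/
def paymentExp (D : DTLP z) (G : Sig) (B : Blockchain z) (S : ℕ → ℕ)
    (P : ℕ → Params z) (j : Fin z) (A : ChainAdversary) : Experiment := fun n => do
  let keys ← accounts G n
  let ck ← D.cSetup n (P n).Δ
  let o ← A.first.run (code (Unary.mk n, ck.1, Unary.mk z))
  let m := toMsgs z o.1.fst
  let state := o.1.snd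
  let e ← D.cDelegate m ck.1 ck.2 (P n).t₀
  let c := D.contractOf B S n (P n) keys e.2
  let hk ← D.hSetup n (P n).Δ (S n)
  let p ← D.gen e.1 ck.1 hk.1 hk.2 e.2
  let r ← runChain G B n c keys hk.1 p.2 A.second (code (Unary.mk n, ck.1, m, state, e.2, (P n).toc,
    (P n).aux, c.Ψ, (P n).Δ, (P n).coins, c.adr, keys .HS, hk.1, p))
  pure ⟨PaymentFails B n c r.2.1 j fun m π t =>
      D.verify hk.1 j m π (p.2 j) c.Ψ t c.t₀ c.Δ c.Υ, o.2, r.2.2⟩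

def FairPayment (D : DTLP z) (G : Sig) (B : Blockchain z) (τ : Timing) : Prop :=
  ∀ P : ℕ → Params z, EfficientParams P → ∀ (j : Fin z) (A : ChainAdversary),
    (D.paymentExp G B τ.S P j A).IsPPT → (D.paymentExp G B τ.S P j A).CannotWin

/-- Security of a delegated time-lock puzzle. -/
def Secure (D : DTLP z) (G : Sig) (B : Blockchain z) (τ : Timing) : Prop :=
  D.Private G B τ ∧ D.Valid G B τ ∧ D.FairPayment G B τ

end DTLP

end DelegatedTLP

end

open scoped BigOperators

noncomputable section

namespace DelegatedTLP

open Coded (code)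

section

/-! ## Distributions -/

/-! The inner structure of the chained puzzle plays no role: the argument works for every efficient
multi-instance puzzle that is private and valid. Each conclusion is reduced to its assumptions by an
adversary that simulates the rest of the protocol; what remains for validity and payment is a
deterministic analysis of the execution of the contract.

Privacy against the helpers (`helper_private`). Apart from the two candidate message vectors, a
helper sees only the ciphertexts of the selected messages and data computed from them with
independent randomness. For each index `κ`, a chosen-plaintext attacker draws the other bits itself,
obtains the `κ`-th ciphertext as its challenge, and builds the puzzles on its own; the challenge bit
then is the `κ`-th bit. The attacker uses the helper's guess only if the announced index is `κ`, and
tosses a coin otherwise. By `coin_unless_good`, the probability of a correct guess at `κ` exceeds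
half the probability of announcing `κ` at most negligibly. These announcements are disjoint events,
so the sum over all `κ` is at most one half plus a negligible term.

Privacy against the server and its helper (`solver_private`). The second stage is limited in
parallel time, so it must be reused unchanged. What it gets besides the public key and the puzzles
is independent of them, and the first stage of the reduction, which has polynomial time, puts it
into the state.

Solution validity (`valid`). A win in the first case is an accepted proof for a wrong message,
whatever its time; `cheat_secure` turns it into an attack on the validity of the puzzles, by running
the whole blockchain inside the second stage. A win in the second case is impossible unless
persistence or the contract fails (`not_backdated`): a registration time that a correct contract
reports is a round at whose end the registration was in an honest ledger, so the true delivery is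
not later.

Fair payment (`fairPayment`). `Honest.fair` shows that an execution is fair if persistence and the
contract's correctness hold, and liveness and unforgeability hold for the client, the server and the
client's helper. Unforgeability makes the published key and statements the true ones. The first
registration and the first publication are final, so the verification result is the same at every
payment. A payment call is not in the ledger at the end of the round to which it is assigned, by
unforgeability and the nonces, and it is there after the delay, by liveness; hence it is executed
after the registration that the caller saw.

For these reductions, the interaction with the blockchain is written as the iteration of one random
step (`chainStep`), and a `ChainGame` collects what validity and payment have in common.
`sim_chainStep` compares one step of the game with one step of a simulation against an oracle;
`trace_secure`, `live_secure` and `forge_secure` follow from it.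

The bulk of the work is to exhibit the reductions as programs of polynomial work. An adversary is
known to be efficient only in runs of its own experiment. Therefore `PolyOn` and `PolyFun` express
efficiency on a domain of inputs (`Dom`), such domains are closed under the usual constructions, and
the loops carry invariants that describe the reachable states. -/

theorem PMF.bind_eq {α β : Type} (p : PMF α) (f : α → PMF β) : (p >>= f) = p.bind f := rfl

theorem PMF.pure_eq {α : Type} (a : α) : (pure a : PMF α) = PMF.pure a := rfl

theorem PMF.bind_congr {α β : Type} {p : PMF α} {f g : α → PMF β}
    (h : ∀ a ∈ p.support, f a = g a) : p.bind f = p.bind g := by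
  ext b
  simp only [PMF.bind_apply]
  refine tsum_congr fun a => ?_
  by_cases ha : a ∈ p.support
  · rw [h a ha]
  · rw [PMF.mem_support_iff, not_not] at ha
    simp [ha]

theorem PMF.map_congr {α β : Type} {p : PMF α} {f g : α → β}
    (h : ∀ a ∈ p.support, f a = g a) : p.map f = p.map g :=
  PMF.bind_congr fun a ha => by simp [h a ha]

theorem PMF.mem_support_bind {α β : Type} {p : PMF α} {f : α → PMF β} {b : β} :
    b ∈ (p.bind f).support ↔ ∃ a ∈ p.support, b ∈ (f a).support := by
  simp

theorem PMF.mem_support_map {α β : Type} {p : PMF α} {f : α → β} {b : β} :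
    b ∈ (p.map f).support ↔ ∃ a ∈ p.support, f a = b := by
  simp [PMF.support_map]

theorem PMF.mem_support_pure {α : Type} {a b : α} : b ∈ (PMF.pure a).support ↔ b = a := by
  simp

theorem PMF.exists_mem_support {α : Type} (p : PMF α) : ∃ a, a ∈ p.support :=
  p.support_nonempty

/-! ## Data -/

theorem Data.size_pos (d : Data) : 1 ≤ d.size := by
  cases d <;> simp [Data.size]

theorem Data.size_fst_le (d : Data) : d.fst.size ≤ d.size := by
  cases d <;> simp [Data.size, Data.fst]; omega

theorem Data.size_snd_le (d : Data) : d.snd.size ≤ d.size := by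
  cases d <;> simp [Data.size, Data.snd]; omega

@[simp] theorem Data.toList_ofList (l : List Data) : (Data.ofList l).toList = l := by
  induction l with
  | nil => rfl
  | cons a l ih => simp [Data.ofList, Data.toList, ih]

@[simp] theorem Data.ofList_toList (d : Data) : Data.ofList d.toList = d := by
  induction d with
  | nil => rfl
  | cons a b _ ih => simp [Data.ofList, Data.toList, ih]

@[simp] theorem code_data (d : Data) : code d = d := rfl
@[simp] theorem code_prod {α β : Type} [Coded α] [Coded β] (x : α × β) :
    code x = .cons (code x.1) (code x.2) := rfl
theorem code_list {α : Type} [Coded α] (l : List α) : code l = Data.ofList (l.map code) := rfl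
@[simp] theorem code_list_nil {α : Type} [Coded α] : code ([] : List α) = .nil := rfl
@[simp] theorem code_list_cons {α : Type} [Coded α] (a : α) (l : List α) :
    code (a :: l) = .cons (code a) (code l) := rfl
@[simp] theorem code_none {α : Type} [Coded α] : code (none : Option α) = .nil := rfl
@[simp] theorem code_some {α : Type} [Coded α] (a : α) : code (some a) = .cons .nil (code a) := rfl
@[simp] theorem code_true : code true = .cons .nil .nil := rfl
@[simp] theorem code_false : code false = .nil := rfl
theorem code_fun {α : Type} [Coded α] {k : ℕ} (v : Fin k → α) : code v = code (List.ofFn v) := rfl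
theorem code_nat (k : ℕ) : code k = code (Nat.bits k) := rfl
theorem code_unary (k : Unary) : code k = Data.ofList (List.replicate k.val .nil) := rfl
@[simp] theorem toBool_code (b : Bool) : (code b).toBool = b := by cases b <;> rfl
@[simp] theorem fst_cons (a b : Data) : (Data.cons a b).fst = a := rfl
@[simp] theorem snd_cons (a b : Data) : (Data.cons a b).snd = b := rfl
@[simp] theorem fst_nil : Data.nil.fst = .nil := rfl
@[simp] theorem snd_nil : Data.nil.snd = .nil := rfl
@[simp] theorem toBool_cons (a b : Data) : (Data.cons a b).toBool = true := rfl
@[simp] theorem toBool_nil : Data.nil.toBool = false := rfl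
@[simp] theorem toList_cons (a b : Data) : (Data.cons a b).toList = a :: b.toList := rfl
@[simp] theorem toList_nil : Data.nil.toList = [] := rfl
@[simp] theorem len_cons (a b : Data) : (Data.cons a b).len = b.len + 1 := rfl
@[simp] theorem len_nil : Data.nil.len = 0 := rfl
@[simp] theorem size_cons (a b : Data) : (Data.cons a b).size = a.size + b.size + 1 := rfl
@[simp] theorem size_nil : Data.nil.size = 1 := rfl

@[simp] theorem toList_code {α : Type} [Coded α] (l : List α) : (code l).toList = l.map code := by
  simp [code_list]

@[simp] theorem len_code {α : Type} [Coded α] (l : List α) : (code l).len = l.length := by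
  simp [Data.len]

@[simp] theorem len_code_unary (k : Unary) : (code k).len = k.val := by
  simp [Data.len, code_unary]

@[simp] theorem toBits_code (l : Bits) : (code l).toBits = l := by
  simp [Data.toBits, Function.comp_def]

theorem Data.len_le_size (d : Data) : 2 * d.len + 1 ≤ d.size := by
  induction d with
  | nil => simp
  | cons a b _ ih => have := a.size_pos; simp; omega

@[simp] theorem size_code_unary (k : Unary) : (code k).size = 2 * k.val + 1 := by
  obtain ⟨k⟩ := k
  simp only [code_unary]
  induction k with
  | zero => simp [Data.ofList]
  | succ k ih => simp only [List.replicate_succ, Data.ofList, size_cons, ih, size_nil]; ring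

theorem bitsToNat_bits (k : ℕ) : bitsToNat (Nat.bits k) = k := by
  induction k using Nat.binaryRec' with
  | zero => simp [bitsToNat]
  | bit b k h ih =>
    rw [Nat.bits_append_bit k b h]
    simp only [bitsToNat, List.foldr_cons] at ih ⊢
    rw [ih, Nat.bit_val]; cases b <;> (simp; try ring)

@[simp] theorem toNat_code (k : ℕ) : (code k).toNat = k := by
  simp [Data.toNat, code_nat, bitsToNat_bits]

theorem bitsToNat_lt (l : Bits) : bitsToNat l < 2 ^ l.length := by
  induction l with
  | nil => simp [bitsToNat]
  | cons b l ih =>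
    simp only [bitsToNat, List.foldr_cons, List.length_cons, pow_succ] at ih ⊢
    cases b <;> simp <;> omega

theorem size_code_bits_le (l : Bits) : (code l).size ≤ 4 * l.length + 1 := by
  induction l with
  | nil => simp
  | cons b l ih => cases b <;> simp <;> omega

theorem size_code_nat_le {k l : ℕ} (h : k < 2 ^ l) : (code k).size ≤ 4 * l + 1 := by
  rw [code_nat]
  refine (size_code_bits_le _).trans ?_
  have : (Nat.bits k).length ≤ l := by rw [Nat.size_eq_bits_len]; exact Nat.size_le.2 h
  omega

/-! ## Results and work of programs -/

/-- The distribution of the result of a program. -/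
def Prog.out (p : Prog) (d : Data) : PMF Data := (p.run d).map Prod.fst

/-- On this input, the work is bounded. -/
def Prog.WorkLe (p : Prog) (d : Data) (w : ℕ) : Prop := ∀ o ∈ (p.run d).support, o.2.work ≤ w

namespace Prog

theorem out_skip (d : Data) : skip.out d = PMF.pure d := by
  simp [out, run, PMF.pure_eq, PMF.pure_map]

theorem out_const (c d : Data) : (const c).out d = PMF.pure c := by
  simp [out, run, PMF.pure_eq, PMF.pure_map]

theorem out_fst (d : Data) : fst.out d = PMF.pure d.fst := by
  simp [out, run, PMF.pure_eq, PMF.pure_map]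

theorem out_snd (d : Data) : snd.out d = PMF.pure d.snd := by
  simp [out, run, PMF.pure_eq, PMF.pure_map]

theorem out_pair (f g : Prog) (d : Data) :
    (pair f g).out d = (f.out d).bind fun a => (g.out d).bind fun b => PMF.pure (.cons a b) := by
  simp [out, run, PMF.pure_eq, PMF.bind_eq, PMF.map_bind, PMF.bind_map, PMF.pure_map,
    Function.comp_def]

theorem out_seq (f g : Prog) (d : Data) : (seq f g).out d = (f.out d).bind g.out := by
  simp only [out, run, PMF.pure_eq, PMF.bind_eq, PMF.map_bind, PMF.bind_map, PMF.pure_map,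
    Function.comp_def]
  rfl

theorem out_ite (c f g : Prog) (d : Data) :
    (ite c f g).out d = (c.out d).bind fun a => if a.toBool then f.out d else g.out d := by
  simp only [out, run, PMF.pure_eq, PMF.bind_eq, PMF.map_bind, PMF.bind_map,
    Function.comp_def]
  congr 1; funext a
  split_ifs <;> simp only [PMF.map_bind, PMF.pure_map] <;> rfl

theorem out_coin (d : Data) :
    coin.out d = (PMF.uniformOfFintype Bool).map code := by
  simp only [out, run, PMF.pure_eq, PMF.bind_eq, PMF.map_bind, PMF.pure_map]
  rfl

variable {f g c : Prog} {d : Data} {v w : ℕ}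

theorem WorkLe.mono (h : f.WorkLe d v) (hw : v ≤ w) : f.WorkLe d w := fun o ho => (h o ho).trans hw

theorem mem_out_iff {p : Prog} {a : Data} : a ∈ (p.out d).support ↔ ∃ o ∈ (p.run d).support, o.1 = a := by
  simp [out, PMF.support_map]

theorem mem_out {p : Prog} {o : Data × Cost} (h : o ∈ (p.run d).support) : o.1 ∈ (p.out d).support :=
  mem_out_iff.2 ⟨o, h, rfl⟩

theorem workLe_skip : skip.WorkLe d 1 := by
  intro o ho; simp only [run, PMF.pure_eq, PMF.mem_support_pure] at ho; simp [ho, Cost.step]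

theorem workLe_const {c : Data} : (const c).WorkLe d c.size := by
  intro o ho; simp only [run, PMF.pure_eq, PMF.mem_support_pure] at ho; simp [ho, Cost.step]

theorem workLe_fst : fst.WorkLe d 1 := by
  intro o ho; simp only [run, PMF.pure_eq, PMF.mem_support_pure] at ho; simp [ho, Cost.step]

theorem workLe_snd : snd.WorkLe d 1 := by
  intro o ho; simp only [run, PMF.pure_eq, PMF.mem_support_pure] at ho; simp [ho, Cost.step]

theorem workLe_coin : coin.WorkLe d 3 := by
  intro o ho
  simp only [run, PMF.pure_eq, PMF.bind_eq, PMF.mem_support_bind, PMF.mem_support_pure] at ho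
  obtain ⟨a, -, rfl⟩ := ho; simp [Cost.step]

theorem workLe_pair (hf : f.WorkLe d v) (hg : g.WorkLe d w) :
    (pair f g).WorkLe d (d.size + 1 + v + w) := by
  intro o ho
  simp only [run, PMF.pure_eq, PMF.bind_eq, PMF.mem_support_bind, PMF.mem_support_pure] at ho
  obtain ⟨a, ha, b, hb, rfl⟩ := ho
  have := hf a ha; have := hg b hb
  simp [Cost.step, Cost.seq]; omega

theorem workLe_seq (hf : f.WorkLe d v) (hg : ∀ a ∈ (f.out d).support, g.WorkLe a w) :
    (seq f g).WorkLe d (v + w) := by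
  intro o ho
  simp only [run, PMF.pure_eq, PMF.bind_eq, PMF.mem_support_bind, PMF.mem_support_pure] at ho
  obtain ⟨a, ha, b, hb, rfl⟩ := ho
  have := hf a ha; have := hg a.1 (mem_out ha) b hb
  simp [Cost.seq]; omega

theorem mem_run_ite {o : Data × Cost} : o ∈ ((ite c f g).run d).support ↔
    ∃ a ∈ (c.run d).support, ∃ b ∈ (if a.1.toBool then f.run d else g.run d).support,
      o = (b.1, (Cost.step (d.size + 1)).seq (a.2.seq b.2)) := by
  simp only [run, PMF.pure_eq, PMF.bind_eq, PMF.mem_support_bind]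
  refine exists_congr fun a => and_congr_right fun _ => ?_
  split_ifs <;> simp only [PMF.mem_support_bind, PMF.mem_support_pure]

theorem workLe_ite {v₁ v₂ : ℕ} (hc : c.WorkLe d w)
    (hf : (∃ a ∈ (c.out d).support, a.toBool = true) → f.WorkLe d v₁)
    (hg : (∃ a ∈ (c.out d).support, a.toBool = false) → g.WorkLe d v₂) :
    (ite c f g).WorkLe d (d.size + 1 + w + v₁ + v₂) := by
  intro o ho
  obtain ⟨a, ha, b, hb, rfl⟩ := mem_run_ite.1 ho
  have h1 := hc a ha
  have h2 : b.2.work ≤ v₁ + v₂ := by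
    cases hab : a.1.toBool
    · rw [hab] at hb; have := hg ⟨_, mem_out ha, hab⟩ b (by simpa using hb); omega
    · rw [hab] at hb; have := hf ⟨_, mem_out ha, hab⟩ b (by simpa using hb); omega
  simp [Cost.step, Cost.seq]; omega

theorem iterRun_size {f : Data → PMF (Data × Cost)}
    (hf : ∀ d, ∀ o ∈ (f d).support, 1 ≤ o.2.work ∧ o.1.size ≤ d.size + o.2.work) (l : Data) :
    ∀ x, ∀ o ∈ (iterRun f l x).support, 1 ≤ o.2.work ∧ o.1.size ≤ x.size + o.2.work := by
  induction l with
  | nil =>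
    intro x o ho
    simp only [iterRun, PMF.pure_eq, PMF.mem_support_pure] at ho
    simp [ho, Cost.step]
  | cons a l _ ih =>
    intro x o ho
    simp only [iterRun, PMF.pure_eq, PMF.bind_eq, PMF.mem_support_bind, PMF.mem_support_pure] at ho
    obtain ⟨y, hy, w, hw, rfl⟩ := ho
    have := hf x y hy
    have := ih y.1 w hw
    simp [Cost.step, Cost.seq]; omega

theorem pmapRun_size {f : Data → PMF (Data × Cost)}
    (hf : ∀ d, ∀ o ∈ (f d).support, 1 ≤ o.2.work ∧ o.1.size ≤ d.size + o.2.work) (e l : Data) :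
    ∀ o ∈ (pmapRun f e l).support, 1 ≤ o.2.work ∧ o.1.size ≤ l.size + o.2.work := by
  induction l with
  | nil =>
    intro o ho
    simp only [pmapRun, PMF.pure_eq, PMF.mem_support_pure] at ho
    simp [ho]
  | cons a l _ ih =>
    intro o ho
    simp only [pmapRun, PMF.pure_eq, PMF.bind_eq, PMF.mem_support_bind, PMF.mem_support_pure] at ho
    obtain ⟨y, hy, w, hw, rfl⟩ := ho
    have := hf _ y hy
    have := ih w hw
    simp [Cost.par] at *
    omega

theorem toNat_lt (d : Data) : d.toNat < 2 ^ d.len := by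
  have := bitsToNat_lt d.toBits
  simpa [Data.toBits, Data.toNat, Data.len] using this

/-- Induction on the program: whatever is duplicated is charged as work. Hence a bound for the work
also bounds the result, and the results of one efficient computation are admissible inputs of the
next. -/
theorem run_size (p : Prog) : ∀ d, ∀ o ∈ (p.run d).support,
    1 ≤ o.2.work ∧ o.1.size ≤ d.size + o.2.work := by
  induction p with
  | skip =>
    intro d o ho; simp only [run, PMF.pure_eq, PMF.mem_support_pure] at ho; simp [ho, Cost.step]
  | const c =>
    intro d o ho; simp only [run, PMF.pure_eq, PMF.mem_support_pure] at ho
    have := c.size_pos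
    simp [ho, Cost.step]; omega
  | fst =>
    intro d o ho; simp only [run, PMF.pure_eq, PMF.mem_support_pure] at ho
    have := d.size_fst_le
    simp [ho, Cost.step]; omega
  | snd =>
    intro d o ho; simp only [run, PMF.pure_eq, PMF.mem_support_pure] at ho
    have := d.size_snd_le
    simp [ho, Cost.step]; omega
  | pair f g hf hg =>
    intro d o ho
    simp only [run, PMF.pure_eq, PMF.bind_eq, PMF.mem_support_bind, PMF.mem_support_pure] at ho
    obtain ⟨a, ha, b, hb, rfl⟩ := ho
    have := hf d a ha; have := hg d b hb
    simp [Cost.step, Cost.seq]; omega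
  | par f g hf hg =>
    intro d o ho
    simp only [run, PMF.pure_eq, PMF.bind_eq, PMF.mem_support_bind, PMF.mem_support_pure] at ho
    obtain ⟨a, ha, b, hb, rfl⟩ := ho
    have := hf d a ha; have := hg d b hb
    simp [Cost.step, Cost.seq, Cost.par]; omega
  | seq f g hf hg =>
    intro d o ho
    simp only [run, PMF.pure_eq, PMF.bind_eq, PMF.mem_support_bind, PMF.mem_support_pure] at ho
    obtain ⟨a, ha, b, hb, rfl⟩ := ho
    have := hf d a ha; have := hg _ b hb
    simp [Cost.seq]; omega
  | ite c f g hc hf hg =>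
    intro d o ho
    obtain ⟨a, ha, b, hb, rfl⟩ := mem_run_ite.1 ho
    have h1 := hc d a ha
    have h2 : 1 ≤ b.2.work ∧ b.1.size ≤ d.size + b.2.work := by
      split_ifs at hb
      exacts [hf d b hb, hg d b hb]
    simp [Cost.step, Cost.seq]; omega
  | coin =>
    intro d o ho
    simp only [run, PMF.pure_eq, PMF.bind_eq, PMF.mem_support_bind, PMF.mem_support_pure] at ho
    obtain ⟨a, -, rfl⟩ := ho
    cases a <;> simp [Cost.step]
  | rand =>
    intro d o ho
    simp only [run, PMF.pure_eq, PMF.bind_eq, PMF.mem_support_bind, PMF.mem_support_pure] at ho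
    obtain ⟨a, ha, rfl⟩ := ho
    -- A number of `d.len` bits has a code of size at most `4 * d.len + 1`. The work `d.size` is at
    -- least `2 * d.len + 1`, so input and work together suffice. For the value `0` the draw is `0`,
    -- which is still below `2 ^ d.len`.
    have h1 : a < d.toNat - 1 + 1 := 
      Finset.mem_range.1 ((PMF.mem_support_uniformOfFinset_iff _ _).1 ha)
    have h2 := toNat_lt d
    have h3 : a < 2 ^ d.len := by have := Nat.one_le_two_pow (n := d.len); omega
    have := size_code_nat_le h3
    have := d.len_le_size
    simp; omega
  | iter f hf =>
    intro d o ho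
    have := iterRun_size hf d.fst d.snd o ho
    have := d.size_snd_le
    omega
  | pmap f hf =>
    intro d o ho
    simp only [run, PMF.pure_eq, PMF.bind_eq, PMF.mem_support_bind, PMF.mem_support_pure] at ho
    obtain ⟨a, ha, rfl⟩ := ho
    have := pmapRun_size hf _ _ a ha
    have := d.size_snd_le
    simp [Cost.step, Cost.seq]; omega

theorem WorkLe.size_le (h : f.WorkLe d w) {a : Data} (ha : a ∈ (f.out d).support) :
    a.size ≤ d.size + w := by
  obtain ⟨o, ho, rfl⟩ := mem_out_iff.1 ha
  have := (f.run_size d o ho).2; have := h o ho; omega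

end Prog

theorem eval_le_eval {q : Polynomial ℕ} {a b : ℕ} (h : a ≤ b) : q.eval a ≤ q.eval b := by
  simp only [Polynomial.eval_eq_sum, Polynomial.sum]
  exact Finset.sum_le_sum fun i _ => Nat.mul_le_mul_left _ (Nat.pow_le_pow_left h i)

end

section

/-! ## Polynomial-time computations on families of inputs -/

/-- For each security parameter, a set of inputs whose codes are polynomially bounded. -/
structure Dom (α : Type) [Coded α] : Type where
  mem : ℕ → α → Prop
  bound : ∃ q : Polynomial ℕ, ∀ n a, mem n a → (code a).size ≤ q.eval n

/-- On the given inputs, `f` is computed by a program in polynomial time. -/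
def PolyOn {α β : Type} [Coded α] [Coded β] (D : Dom α) (f : α → PMF β) : Prop :=
  ∃ (p : Prog) (q : Polynomial ℕ), ∀ n a, D.mem n a →
    p.out (code a) = (f a).map code ∧ p.WorkLe (code a) (q.eval n)

/-- On the given inputs, the function `f` is computed by a program in polynomial time. -/
def PolyFun {α β : Type} [Coded α] [Coded β] (D : Dom α) (f : α → β) : Prop :=
  PolyOn D fun a => PMF.pure (f a)

variable {α β γ δ ε : Type} [Coded α] [Coded β] [Coded γ] [Coded δ] [Coded ε]

namespace Dom

/-- All inputs, with the size as the parameter. -/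
def all (α : Type) [Coded α] : Dom α := ⟨fun n a => (code a).size ≤ n, Polynomial.X, by simp⟩

def restrict (D : Dom α) (P : α → Prop) : Dom α :=
  ⟨fun n a => D.mem n a ∧ P a, D.bound.imp fun _ h n a ha => h n a ha.1⟩

end Dom

/-- In `Dom.all` the parameter is any bound for the size of the input. Polynomials with natural
coefficients are monotone, so a bound in terms of the exact size and a bound in terms of the
parameter amount to the same. -/
theorem polyTime_iff {f : α → PMF β} : PolyTime f ↔ PolyOn (Dom.all α) f := by
  constructor
  · rintro ⟨p, q, h⟩
    exact ⟨p, q, fun n a ha => ⟨(h a).1, fun o ho => ((h a).2 o ho).trans (eval_le_eval ha)⟩⟩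
  · rintro ⟨p, q, h⟩
    exact ⟨p, q, fun a => h _ a (le_refl (code a).size)⟩

/-- Input plus work bounds the output, by `Prog.run_size`. This is why the possible results, alone
or together with the inputs, form a domain again (`Dom.img`, `Dom.ext`). -/
theorem PolyOn.exists_bound {D : Dom α} {f : α → PMF β} (h : PolyOn D f) :
    ∃ q : Polynomial ℕ, ∀ n a, D.mem n a → ∀ b ∈ (f a).support, (code b).size ≤ q.eval n := by
  obtain ⟨p, q, h⟩ := h
  obtain ⟨r, hr⟩ := D.bound
  refine ⟨r + q, fun n a ha b hb => ?_⟩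
  have h1 : code b ∈ (p.out (code a)).support := by
    rw [(h n a ha).1]; exact PMF.mem_support_map.2 ⟨b, hb, rfl⟩
  have := (h n a ha).2.size_le h1
  have := hr n a ha
  simp; omega

namespace Dom

/-- The possible results of a computation. -/
def img (D : Dom α) {f : α → PMF β} (h : PolyOn D f) : Dom β :=
  ⟨fun n b => ∃ a, D.mem n a ∧ b ∈ (f a).support,
    h.exists_bound.imp fun _ hq n b ⟨a, ha, hb⟩ => hq n a ha b hb⟩

/-- Inputs together with possible results of a computation. -/
def ext (D : Dom α) {f : α → PMF β} (h : PolyOn D f) : Dom (α × β) :=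
  ⟨fun n x => D.mem n x.1 ∧ x.2 ∈ (f x.1).support, by
    obtain ⟨q, hq⟩ := D.bound
    obtain ⟨r, hr⟩ := h.exists_bound
    refine ⟨q + r + 1, fun n x hx => ?_⟩
    have := hq n _ hx.1; have := hr n _ hx.1 _ hx.2
    simp; omega⟩

end Dom

namespace PolyOn

theorem mono {D E : Dom α} {f : α → PMF β} (h : PolyOn E f)
    (hD : ∀ n a, D.mem n a → E.mem n a) : PolyOn D f := by
  obtain ⟨p, q, h⟩ := h
  exact ⟨p, q, fun n a ha => h n a (hD n a ha)⟩

theorem congr {D : Dom α} {f g : α → PMF β} (h : PolyOn D g)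
    (hfg : ∀ n a, D.mem n a → f a = g a) : PolyOn D f := by
  obtain ⟨p, q, h⟩ := h
  exact ⟨p, q, fun n a ha => by rw [hfg n a ha]; exact h n a ha⟩

/-- Change of the types of arguments and results, without change of their codes. -/
theorem retype {D : Dom α} {f : α → PMF β} {E : Dom γ} {g : γ → PMF δ} (h : PolyOn E g)
    (hfg : ∀ n a, D.mem n a → ∃ c, E.mem n c ∧ code c = code a ∧ (f a).map code = (g c).map code) :
    PolyOn D f := by
  obtain ⟨p, q, h⟩ := h
  refine ⟨p, q, fun n a ha => ?_⟩
  obtain ⟨c, hc, hca, hf⟩ := hfg n a ha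
  rw [hf, ← hca]; exact h n c hc

/-- Programs see codes only. Pairs, vectors, options and lists share their codes with plain trees,
so all operations on them can be obtained from those on trees. -/
theorem of_code {D : Dom α} {f : α → PMF β} {g : α → PMF γ} (h : PolyOn D g)
    (hfg : ∀ n a, D.mem n a → (f a).map code = (g a).map code) : PolyOn D f :=
  h.retype fun n a ha => ⟨a, ha, rfl, hfg n a ha⟩

theorem of_polyTime {D : Dom α} {f : α → PMF β} (h : PolyTime f) : PolyOn D f := by
  obtain ⟨p, q, h⟩ := h
  obtain ⟨r, hr⟩ := D.bound
  refine ⟨p, q.comp r, fun n a ha => ⟨(h a).1, fun o ho => ((h a).2 o ho).trans ?_⟩⟩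
  rw [Polynomial.eval_comp]
  exact eval_le_eval (hr n a ha)

/-- A program of which only the work is known to be bounded. -/
theorem of_workLe {D : Dom α} (p : Prog) (q : Polynomial ℕ)
    (h : ∀ n a, D.mem n a → p.WorkLe (code a) (q.eval n)) :
    PolyOn D fun a => p.out (code a) :=
  ⟨p, q, fun n a ha => ⟨by simp only [show (code : Data → Data) = id from rfl, PMF.map_id], h n a ha⟩⟩

theorem bind {D : Dom α} {E : Dom β} {f : α → PMF β} {g : β → PMF γ} (hf : PolyOn D f)
    (hg : PolyOn E g) (h : ∀ n a, D.mem n a → ∀ b ∈ (f a).support, E.mem n b) :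
    PolyOn D fun a => (f a).bind g := by
  obtain ⟨p, q, hp⟩ := hf
  obtain ⟨p', q', hp'⟩ := hg
  refine ⟨.seq p p', q + q', fun n a ha => ⟨?_, ?_⟩⟩
  · rw [Prog.out_seq, (hp n a ha).1, PMF.bind_map, PMF.map_bind]
    exact PMF.bind_congr fun b hb => (hp' n b (h n a ha b hb)).1
  · rw [Polynomial.eval_add]
    refine Prog.workLe_seq (hp n a ha).2 fun d hd => ?_
    rw [(hp n a ha).1] at hd
    obtain ⟨b, hb, rfl⟩ := PMF.mem_support_map.1 hd
    exact (hp' n b (h n a ha b hb)).2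

theorem pair {D : Dom α} {f : α → PMF β} {g : α → PMF γ} (hf : PolyOn D f) (hg : PolyOn D g) :
    PolyOn D fun a => (f a).bind fun b => (g a).bind fun c => PMF.pure (b, c) := by
  obtain ⟨p, q, hp⟩ := hf
  obtain ⟨p', q', hp'⟩ := hg
  obtain ⟨r, hr⟩ := D.bound
  refine ⟨.pair p p', r + 1 + q + q', fun n a ha => ⟨?_, ?_⟩⟩
  · simp only [Prog.out_pair, (hp n a ha).1, (hp' n a ha).1, PMF.bind_map, PMF.map_bind,
      PMF.pure_map]
    rfl
  · have := hr n a ha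
    simp only [Polynomial.eval_add, Polynomial.eval_one]
    exact (Prog.workLe_pair (hp n a ha).2 (hp' n a ha).2).mono (by omega)

end PolyOn

namespace PolyFun

variable {D : Dom α}

theorem mono {D E : Dom α} {f : α → β} (h : PolyFun E f)
    (hD : ∀ n a, D.mem n a → E.mem n a) : PolyFun D f := PolyOn.mono h hD

theorem congr {f g : α → β} (h : PolyFun D g) (hfg : ∀ n a, D.mem n a → f a = g a) :
    PolyFun D f := PolyOn.congr h fun n a ha => by rw [hfg n a ha]

theorem of_code {f : α → β} {g : α → γ} (h : PolyFun D g)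
    (hfg : ∀ n a, D.mem n a → code (f a) = code (g a)) : PolyFun D f :=
  PolyOn.of_code h fun n a ha => by rw [PMF.pure_map, PMF.pure_map, hfg n a ha]

theorem id : PolyFun D fun a => a := by
  refine ⟨.skip, 1, fun n a _ => ⟨?_, ?_⟩⟩
  · rw [Prog.out_skip, PMF.pure_map]
  · simpa using Prog.workLe_skip

theorem const (b : β) : PolyFun D fun _ => b := by
  refine ⟨.const (code b), Polynomial.C (code b).size, fun n a _ => ⟨?_, ?_⟩⟩
  · rw [Prog.out_const, PMF.pure_map]
  · simpa using Prog.workLe_const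

theorem bind {E : Dom β} {f : α → β} {g : β → PMF γ} (hf : PolyFun D f)
    (hg : PolyOn E g) (h : ∀ n a, D.mem n a → E.mem n (f a)) : PolyOn D fun a => g (f a) := by
  refine (PolyOn.bind hf hg fun n a ha b hb => ?_).congr fun n a ha => (PMF.pure_bind _ _).symm
  rw [PMF.mem_support_pure.1 hb]; exact h n a ha

theorem comp {E : Dom β} {f : α → β} {g : β → γ} (hg : PolyFun E g) (hf : PolyFun D f)
    (h : ∀ n a, D.mem n a → E.mem n (f a)) : PolyFun D fun a => g (f a) :=
  bind (f := f) (g := fun b => PMF.pure (g b)) hf hg h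

theorem bound {f : α → β} (h : PolyFun D f) :
    ∃ q : Polynomial ℕ, ∀ n a, D.mem n a → (code (f a)).size ≤ q.eval n := by
  obtain ⟨q, hq⟩ := h.exists_bound
  exact ⟨q, fun n a ha => hq n a ha _ (by simp)⟩

/-- The values of a function. -/
def _root_.DelegatedTLP.Dom.map (D : Dom α) {f : α → β} (h : PolyFun D f) : Dom β :=
  ⟨fun n b => ∃ a, D.mem n a ∧ f a = b, by
    obtain ⟨q, hq⟩ := h.bound
    exact ⟨q, by rintro n _ ⟨a, ha, rfl⟩; exact hq n a ha⟩⟩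

theorem polyTime_comp {f : α → β} {g : β → PMF γ} (hg : PolyTime g) (hf : PolyFun D f) :
    PolyOn D fun a => g (f a) :=
  bind hf (PolyOn.of_polyTime (D := D.map hf) hg) fun _ a ha => ⟨a, ha, rfl⟩

theorem polyTime_comp_pure {f : α → β} {g : β → γ} (hg : PolyTime fun b => (pure (g b) : PMF γ))
    (hf : PolyFun D f) : PolyFun D fun a => g (f a) :=
  polyTime_comp (g := fun b => PMF.pure (g b)) hg hf

/-- The values of `f` form a domain of their own, so a function that is efficient on every domain
can be composed without naming one. -/
theorem all_comp {f : α → β} {g : β → γ} (hg : ∀ E : Dom β, PolyFun E g) (hf : PolyFun D f) :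
    PolyFun D fun a => g (f a) :=
  comp (hg (D.map hf)) hf fun _ a ha => ⟨a, ha, rfl⟩

theorem fstD : PolyFun D fun a => (code a).fst := by
  refine ⟨.fst, 1, fun n a _ => ⟨?_, ?_⟩⟩
  · rw [Prog.out_fst, PMF.pure_map]; rfl
  · simpa using Prog.workLe_fst

theorem sndD : PolyFun D fun a => (code a).snd := by
  refine ⟨.snd, 1, fun n a _ => ⟨?_, ?_⟩⟩
  · rw [Prog.out_snd, PMF.pure_map]; rfl
  · simpa using Prog.workLe_snd

theorem coded {f : α → β} (h : PolyFun D f) : PolyFun D fun a => code (f a) :=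
  h.of_code fun _ _ _ => rfl

theorem dfst {f : α → Data} (h : PolyFun D f) : PolyFun D fun a => (f a).fst :=
  all_comp (g := fun d : Data => d.fst) (fun _ => fstD) h

theorem dsnd {f : α → Data} (h : PolyFun D f) : PolyFun D fun a => (f a).snd :=
  all_comp (g := fun d : Data => d.snd) (fun _ => sndD) h

theorem fst {f : α → β × γ} (h : PolyFun D f) : PolyFun D fun a => (f a).1 :=
  h.coded.dfst.of_code fun _ _ _ => rfl

theorem snd {f : α → β × γ} (h : PolyFun D f) : PolyFun D fun a => (f a).2 :=
  h.coded.dsnd.of_code fun _ _ _ => rfl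

theorem pair {f : α → β} {g : α → γ} (hf : PolyFun D f) (hg : PolyFun D g) :
    PolyFun D fun a => (f a, g a) :=
  (PolyOn.pair hf hg).congr fun _ _ _ => by simp

theorem dcons {f g : α → Data} (hf : PolyFun D f) (hg : PolyFun D g) :
    PolyFun D fun a => Data.cons (f a) (g a) := (pair hf hg).of_code fun _ _ _ => rfl

theorem cons {f : α → β} {g : α → List β} (hf : PolyFun D f) (hg : PolyFun D g) :
    PolyFun D fun a => f a :: g a := (pair hf hg).of_code fun _ _ _ => rfl

theorem some {f : α → β} (hf : PolyFun D f) : PolyFun D fun a => some (f a) :=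
  (dcons (const .nil) hf.coded).of_code fun _ _ _ => rfl

theorem toBool {f : α → Data} (h : PolyFun D f) : PolyFun D fun a => (f a).toBool := by
  refine all_comp (g := fun d : Data => d.toBool) (fun E => ?_) h
  obtain ⟨q, hq⟩ := E.bound
  refine ⟨.ite .skip (.const (.cons .nil .nil)) (.const .nil), q + 7, fun n a ha => ⟨?_, ?_⟩⟩
  · rw [Prog.out_ite, Prog.out_skip, PMF.pure_bind, Prog.out_const, Prog.out_const, PMF.pure_map]
    cases a <;> simp
  · have := hq n a ha
    simp only [Polynomial.eval_add, Polynomial.eval_ofNat]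
    exact (Prog.workLe_ite Prog.workLe_skip (fun _ => Prog.workLe_const)
      (fun _ => Prog.workLe_const)).mono (by simp at this ⊢; omega)

end PolyFun

namespace PolyOn

variable {D : Dom α}

theorem coin : PolyOn D fun _ => PMF.uniformOfFintype Bool := by
  refine ⟨.coin, 3, fun n a _ => ⟨Prog.out_coin _, ?_⟩⟩
  simpa using Prog.workLe_coin

/-- Each branch has to be efficient only on the inputs that reach it. This permits running an
adversary in just those states in which its work is known to be bounded. -/
theorem ite {c : α → Bool} {f g : α → PMF β} (hc : PolyFun D c)
    (hf : PolyOn (D.restrict fun a => c a = true) f)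
    (hg : PolyOn (D.restrict fun a => c a = false) g) :
    PolyOn D fun a => if c a = true then f a else g a := by
  obtain ⟨p, q, hp⟩ := hc
  obtain ⟨pf, qf, hf⟩ := hf
  obtain ⟨pg, qg, hg⟩ := hg
  obtain ⟨r, hr⟩ := D.bound
  refine ⟨.ite p pf pg, r + 1 + q + qf + qg, fun n a ha => ⟨?_, ?_⟩⟩
  · rw [Prog.out_ite, (hp n a ha).1, PMF.pure_map, PMF.pure_bind, toBool_code]
    cases h : c a
    · simpa [h] using (hg n a ⟨ha, h⟩).1
    · simpa [h] using (hf n a ⟨ha, h⟩).1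
  · have := hr n a ha
    simp only [Polynomial.eval_add, Polynomial.eval_one]
    have hp' := hp n a ha
    refine (Prog.workLe_ite hp'.2 (v₁ := qf.eval n) (v₂ := qg.eval n) ?_ ?_).mono (by omega)
    · rintro ⟨d, hd, h⟩
      rw [hp'.1, PMF.pure_map, PMF.mem_support_pure] at hd
      rw [hd, toBool_code] at h
      exact (hf n a ⟨ha, h⟩).2
    · rintro ⟨d, hd, h⟩
      rw [hp'.1, PMF.pure_map, PMF.mem_support_pure] at hd
      rw [hd, toBool_code] at h
      exact (hg n a ⟨ha, h⟩).2

/-- A computation after another one, with the input still available. -/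
theorem bind₂ {f : α → PMF β} {g : α → β → PMF γ} (hf : PolyOn D f)
    (hg : PolyOn (D.ext hf) fun x => g x.1 x.2) : PolyOn D fun a => (f a).bind fun b => g a b := by
  refine ((PolyOn.pair PolyFun.id hf).bind hg ?_).congr ?_
  · intro n a ha b hb
    simp only [PMF.pure_bind, PMF.mem_support_bind, PMF.mem_support_pure] at hb
    obtain ⟨b, hb, rfl⟩ := hb
    exact ⟨ha, hb⟩
  · intro n a _
    simp [PMF.bind_bind, PMF.pure_bind]

theorem map {f : α → PMF β} {g : α → β → γ} (hf : PolyOn D f)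
    (hg : PolyFun (D.ext hf) fun x => g x.1 x.2) : PolyOn D fun a => (f a).map (g a) :=
  (bind₂ (g := fun a b => PMF.pure (g a b)) hf hg).congr fun _ _ _ => rfl

end PolyOn

namespace PolyFun

variable {D : Dom α}

/-- A function of the input, after a computation. -/
theorem up {f : α → β} {g : α → PMF γ} {hg : PolyOn D g} (hf : PolyFun D f) :
    PolyFun (D.ext hg) fun x => f x.1 := comp hf id.fst fun _ _ h => h.1

theorem ite {c : α → Bool} {f g : α → β} (hc : PolyFun D c)
    (hf : PolyFun (D.restrict fun a => c a = true) f)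
    (hg : PolyFun (D.restrict fun a => c a = false) g) :
    PolyFun D fun a => if c a = true then f a else g a :=
  (PolyOn.ite hc hf hg).congr fun _ a _ => by dsimp only; split_ifs <;> rfl

theorem restrict {f : α → β} (h : PolyFun D f) (P : α → Prop) : PolyFun (D.restrict P) f :=
  h.mono fun _ _ h => h.1

theorem not {c : α → Bool} (hc : PolyFun D c) : PolyFun D fun a => !c a :=
  (ite hc (const false) (const true)).congr fun _ a _ => by cases c a <;> rfl

theorem and {c d : α → Bool} (hc : PolyFun D c) (hd : PolyFun D d) :
    PolyFun D fun a => c a && d a :=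
  (ite hc (hd.restrict _) (const false)).congr fun _ a _ => by cases c a <;> rfl

theorem or {c d : α → Bool} (hc : PolyFun D c) (hd : PolyFun D d) :
    PolyFun D fun a => c a || d a :=
  (ite hc (const true) (hd.restrict _)).congr fun _ a _ => by cases c a <;> rfl

theorem beq {c d : α → Bool} (hc : PolyFun D c) (hd : PolyFun D d) :
    PolyFun D fun a => c a == d a :=
  (ite hc (hd.restrict _) (hd.restrict _).not).congr fun _ a _ => by cases c a <;> simp

/-! ### Vectors of constant length -/

theorem vec_nil {f : α → Fin 0 → β} : PolyFun D f :=
  (const Data.nil).of_code fun _ _ _ => by simp [code_fun]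

theorem vec {k : ℕ} {f : α → Fin k → β} (h : ∀ i, PolyFun D fun a => f a i) : PolyFun D f := by
  induction k with
  | zero => exact vec_nil
  | succ k ih =>
    refine (pair (h 0) (ih fun i => h i.succ)).of_code fun _ a _ => ?_
    simp [code_fun, List.ofFn_succ]

theorem dnth {f : α → Data} (h : PolyFun D f) (i : ℕ) : PolyFun D fun a => (f a).nth i := by
  induction i generalizing f with
  | zero => exact h.dfst.congr fun _ a _ => by cases f a <;> simp [Data.nth]
  | succ i ih => exact (ih h.dsnd).congr fun _ a _ => by cases f a <;> simp [Data.nth]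

theorem _root_.DelegatedTLP.nth_code {k : ℕ} (v : Fin k → α) (i : Fin k) :
    (code v).nth i = code (v i) := by
  simp [Data.nth, code_fun]

theorem app {k : ℕ} {f : α → Fin k → β} (h : PolyFun D f) (i : Fin k) : PolyFun D fun a => f a i :=
  (h.coded.dnth i).of_code fun _ a _ => (nth_code (f a) i).symm

end PolyFun

theorem mem_drawVec {α : Type} {k : ℕ} {f : Fin k → PMF α} {v : Fin k → α} :
    v ∈ (drawVec k f).support ↔ ∀ i, v i ∈ (f i).support := by
  induction k with
  | zero => simp [drawVec, PMF.pure_eq, eq_iff_true_of_subsingleton]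
  | succ k ih =>
    simp only [drawVec, PMF.pure_eq, PMF.bind_eq, PMF.mem_support_bind, PMF.mem_support_pure, ih]
    constructor
    · rintro ⟨a, ha, w, hw, rfl⟩ i
      cases i using Fin.cases <;> simp [ha, hw]
    · intro h
      exact ⟨v 0, h 0, Fin.tail v, fun i => h i.succ, (Fin.cons_self_tail v).symm⟩

theorem PolyOn.drawVec {D : Dom α} {k : ℕ} {f : α → Fin k → PMF β}
    (h : ∀ i, PolyOn D fun a => f a i) : PolyOn D fun a => drawVec k (f a) := by
  induction k with
  | zero => exact PolyFun.vec_nil (f := fun _ => Fin.elim0)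
  | succ k ih =>
    refine (PolyOn.pair (h 0) (ih fun i => h i.succ)).of_code fun n a _ => ?_
    simp only [DelegatedTLP.drawVec, PMF.bind_eq, PMF.pure_eq, PMF.map_bind, PMF.pure_map]
    simp [code_fun, List.ofFn_succ]

end

section

/-! ## Iteration -/

/-- The `k`-fold iteration of a random step. -/
def iterK {X : Type} (s : X → PMF X) : ℕ → X → PMF X
  | 0, x => PMF.pure x
  | k + 1, x => (s x).bind (iterK s k)

section IterK

variable {X Y : Type}

theorem iterK_pure (f : X → X) (k : ℕ) (x : X) :
    iterK (fun x => PMF.pure (f x)) k x = PMF.pure (f^[k] x) := by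
  induction k generalizing x with
  | zero => rfl
  | succ k ih => simp [iterK, ih]

theorem iterK_add (s : X → PMF X) (k l : ℕ) (x : X) :
    iterK s (k + l) x = (iterK s k x).bind (iterK s l) := by
  induction k generalizing x with
  | zero => simp [iterK]
  | succ k ih =>
    simp only [Nat.succ_add, iterK, PMF.bind_bind]
    exact congrArg _ (funext ih)

/-- Iteration commutes with a simulation; the invariant is indexed by the remaining steps. -/
theorem iterK_map {s : X → PMF X} {t : Y → PMF Y} (φ : X → Y) (I : ℕ → X → Prop)
    (hI : ∀ k x, I (k + 1) x → ∀ y ∈ (s x).support, I k y)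
    (h : ∀ k x, I (k + 1) x → t (φ x) = (s x).map φ) (k : ℕ) (x : X) (hx : I k x) :
    iterK t k (φ x) = (iterK s k x).map φ := by
  induction k generalizing x with
  | zero => simp [iterK, PMF.pure_map]
  | succ k ih =>
    rw [iterK, h k x hx, PMF.bind_map, iterK, PMF.map_bind]
    exact PMF.bind_congr fun y hy => ih y (hI k x hx y hy)

theorem iterK_inv {s : X → PMF X} (I : ℕ → X → Prop)
    (hI : ∀ k x, I (k + 1) x → ∀ y ∈ (s x).support, I k y) (k l : ℕ) (x : X) (hx : I (k + l) x)
    (y : X) (hy : y ∈ (iterK s k x).support) : I l y := by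
  induction k generalizing x with
  | zero => rw [iterK, PMF.mem_support_pure] at hy; subst hy; simpa using hx
  | succ k ih =>
    rw [iterK, PMF.mem_support_bind] at hy
    obtain ⟨z, hz, hy⟩ := hy
    exact ih z (hI _ x (by rwa [Nat.add_right_comm] at hx) z hz) hy

end IterK

variable {α β γ δ ε : Type} [Coded α] [Coded β] [Coded γ] [Coded δ] [Coded ε]

/-- The invariant depends on the number of cells that remain, so correctness and cost of the body
are required only along actual runs of the loop. -/
theorem iterRun_spec {b : Prog} {f : α → PMF α} {I : ℕ → α → Prop} {w : ℕ}
    (hb : ∀ k x, I (k + 1) x → b.out (code x) = (f x).map code ∧ b.WorkLe (code x) w ∧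
      ∀ y ∈ (f x).support, I k y) (l : Data) :
    ∀ x, I l.len x → (iterRun b.run l (code x)).map Prod.fst = (iterK f l.len x).map code ∧
      ∀ o ∈ (iterRun b.run l (code x)).support, o.2.work ≤ 1 + l.len * (1 + w) := by
  induction l with
  | nil =>
    intro x _
    simp [iterRun, iterK, PMF.pure_eq, PMF.pure_map, Cost.step]
  | cons a l _ ih =>
    intro x hx
    obtain ⟨h1, h2, h3⟩ := hb _ x hx
    simp only [iterRun, PMF.bind_eq, PMF.pure_eq]
    constructor
    · simp only [PMF.map_bind, PMF.pure_map, len_cons, iterK]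
      rw [← PMF.bind_congr (g := fun y => (iterK f l.len y).map code)
        (f := fun y => (iterRun b.run l (code y)).map Prod.fst) fun y hy => (ih y (h3 y hy)).1]
      have : (fun a : Data × Cost => (iterRun b.run l a.1).bind fun w => PMF.pure w.1) =
          (fun d => (iterRun b.run l d).map Prod.fst) ∘ Prod.fst := rfl
      rw [this, ← PMF.bind_map]
      change (b.out _).bind _ = _
      rw [h1, PMF.bind_map]; rfl
    · intro o ho
      simp only [PMF.mem_support_bind, PMF.mem_support_pure] at ho
      obtain ⟨y, hy, v, hv, rfl⟩ := ho
      have hy' := Prog.mem_out hy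
      rw [h1] at hy'
      obtain ⟨y', hy', hyy⟩ := PMF.mem_support_map.1 hy'
      rw [← hyy] at hv
      have := (ih y' (h3 y' hy')).2 v hv
      have := h2 y hy
      simp only [Cost.step, Cost.seq, len_cons]
      nlinarith

/-- Iteration, once for each cell of a list. -/
theorem PolyOn.iterate {D : Dom γ} {E : Dom α} {f : α → PMF α} (hf : PolyOn E f)
    {clock : γ → Data} (hclock : PolyFun D clock) {x : γ → α} (hx : PolyFun D x)
    (I : ℕ → ℕ → α → Prop)
    (hI : ∀ n k a, I n (k + 1) a → E.mem n a ∧ ∀ b ∈ (f a).support, I n k b)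
    (h0 : ∀ n g, D.mem n g → I n (clock g).len (x g)) :
    PolyOn D fun g => iterK f (clock g).len (x g) := by
  obtain ⟨b, q, hb⟩ := hf
  let F : Dom (Data × α) := D.map (hclock.pair hx)
  have key : PolyOn F fun y : Data × α => iterK f y.1.len y.2 := by
    obtain ⟨r, hr⟩ := F.bound
    refine ⟨.iter b, 1 + r * (1 + q), fun n y hy => ?_⟩
    have hsize := hr n y hy
    obtain ⟨g, hg, rfl⟩ := hy
    have := iterRun_spec (b := b) (f := f) (I := I n) (w := q.eval n)
      (fun k a ha => ⟨(hb n a (hI n k a ha).1).1, (hb n a (hI n k a ha).1).2, (hI n k a ha).2⟩)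
      (clock g) (x g) (h0 n g hg)
    refine ⟨this.1, fun o ho => (this.2 o ho).trans ?_⟩
    simp only [Polynomial.eval_add, Polynomial.eval_mul, Polynomial.eval_one]
    have := (clock g).len_le_size
    simp only [code_prod, code_data, size_cons] at hsize
    gcongr
    omega
  exact (hclock.pair hx).bind key fun n g hg => ⟨g, hg, rfl⟩

theorem PolyFun.iterate {D : Dom γ} {E : Dom α} {f : α → α} (hf : PolyFun E f)
    {clock : γ → Data} (hclock : PolyFun D clock) {x : γ → α} (hx : PolyFun D x)
    (h : ∀ n g, D.mem n g → ∀ k < (clock g).len, E.mem n (f^[k] (x g))) :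
    PolyFun D fun g => f^[(clock g).len] (x g) := by
  -- The invariant for a deterministic loop: with `k` steps to go, the state is the iterate of the
  -- complementary order.
  refine (PolyOn.iterate hf hclock hx
    (fun n k a => ∃ g, D.mem n g ∧ ∃ l, k + l = (clock g).len ∧ a = f^[l] (x g)) ?_ ?_).congr
      fun n g _ => (iterK_pure f _ _).symm
  · rintro n k a ⟨g, hg, l, hl, rfl⟩
    refine ⟨h n g hg l (by omega), fun b hb => ⟨g, hg, l + 1, by omega, ?_⟩⟩
    rw [PMF.mem_support_pure.1 hb, Function.iterate_succ_apply']
  · exact fun n g hg => ⟨g, hg, 0, rfl, rfl⟩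

/-! ### Lists -/

theorem PolyFun.headI {D : Dom γ} [Inhabited α] {l : γ → List α} (h : PolyFun D l)
    (hl : ∀ n g, D.mem n g → l g ≠ []) : PolyFun D fun g => (l g).headI := by
  refine h.coded.dfst.of_code fun n g hg => ?_
  cases hlg : l g with
  | nil => exact absurd hlg (hl n g hg)
  | cons a t => rfl

theorem PolyFun.tail {D : Dom γ} {l : γ → List α} (h : PolyFun D l) :
    PolyFun D fun g => (l g).tail := by
  refine h.coded.dsnd.of_code fun n g hg => ?_
  cases l g <;> rfl

theorem PolyFun.isEmpty {D : Dom γ} {l : γ → List α} (h : PolyFun D l) :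
    PolyFun D fun g => (l g).isEmpty := by
  refine h.coded.toBool.not.congr fun n g hg => ?_
  cases l g <;> rfl

theorem code_size_tail_le (l : List α) : (code l.tail).size ≤ (code l).size := by
  cases l <;> simp; omega

theorem code_size_drop_le (l : List α) (k : ℕ) : (code (l.drop k)).size ≤ (code l).size := by
  induction k generalizing l with
  | zero => simp
  | succ k ih =>
    rw [Nat.add_comm, ← List.drop_drop]
    exact (ih _).trans (by simpa using code_size_tail_le l)

/-- Folding over a list with a function of a parameter `e`, the entry, and the accumulator. -/
theorem PolyFun.foldl {D : Dom γ} [Inhabited δ] {l : γ → List δ} (hl : PolyFun D l)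
    {e : γ → ε} (he : PolyFun D e) {i : γ → β} (hi : PolyFun D i) {E : Dom (ε × δ × β)}
    {h : ε × δ × β → β} (hh : PolyFun E h)
    (hE : ∀ n g, D.mem n g → ∀ l₁ a l₂, l g = l₁ ++ a :: l₂ →
      E.mem n (e g, a, l₁.foldl (fun acc x => h (e g, x, acc)) (i g))) :
    PolyFun D fun g => (l g).foldl (fun acc x => h (e g, x, acc)) (i g) := by
  -- The loop state is the parameter, the remaining list and the accumulator. The list itself is the
  -- clock, so the default value of `headI` is never used.
  let f : ε × List δ × β → ε × List δ × β := fun s => (s.1, s.2.1.tail, h (s.1, s.2.1.headI, s.2.2))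
  have iter : ∀ (c : ε) (k : ℕ) (l : List δ) (b : β), k ≤ l.length → f^[k] (c, l, b) =
      (c, l.drop k, (l.take k).foldl (fun acc x => h (c, x, acc)) b) := by
    intro c k
    induction k with
    | zero => intro l b _; simp
    | succ k ih =>
      intro l b hk
      cases l with
      | nil => simp at hk
      | cons a l => rw [Function.iterate_succ_apply]; exact ih l _ (by simpa using hk)
  let F : Dom (ε × List δ × β) :=
    ⟨fun n s => s.2.1 ≠ [] ∧ E.mem n (s.1, s.2.1.headI, s.2.2) ∧
      ∃ g, D.mem n g ∧ (code s.2.1).size ≤ (code (l g)).size, by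
      obtain ⟨q, hq⟩ := E.bound
      obtain ⟨r, hr⟩ := hl.bound
      refine ⟨q + r + 1, ?_⟩
      rintro n s ⟨-, h1, g, hg, h2⟩
      have := hq n _ h1; have := hr n g hg
      simp at *; omega⟩
  have hf : PolyFun F f := by
    have h1 : PolyFun F fun s => s.2.1 := PolyFun.id.snd.fst
    refine PolyFun.id.fst.pair (h1.tail.pair ?_)
    exact PolyFun.comp hh (PolyFun.id.fst.pair ((h1.headI fun n g hg => hg.1).pair
      PolyFun.id.snd.snd)) fun n s hs => hs.2.1
  refine (PolyFun.iterate hf hl.coded (he.pair (hl.pair hi)) ?_).snd.snd.congr ?_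
  · intro n g hg k hk
    rw [len_code] at hk
    have hd := List.drop_eq_getElem_cons hk
    rw [iter _ _ _ _ hk.le]
    refine ⟨by change List.drop k (l g) ≠ []; rw [hd]; exact List.cons_ne_nil _ _, hE n g hg _ _ (l g |>.drop (k + 1)) ?_, g, hg, code_size_drop_le _ _⟩
    change l g = _ ++ (List.drop k (l g)).headI :: _
    rw [hd, List.headI_cons, ← hd, List.take_append_drop]
  · intro n g hg
    rw [len_code, iter _ _ _ _ le_rfl, List.take_length]

theorem pmapRun_spec {b : Prog} {e : ε} {f : ε × α → β} {w : ℕ} (l : List α)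
    (hb : ∀ x ∈ l, b.out (code (e, x)) = PMF.pure (code (f (e, x))) ∧ b.WorkLe (code (e, x)) w) :
    (pmapRun b.run (code e) (code l)).map Prod.fst = PMF.pure (code (l.map fun x => f (e, x))) ∧
      ∀ o ∈ (pmapRun b.run (code e) (code l)).support,
        o.2.work ≤ 1 + l.length * (w + (code e).size + 1) := by
  induction l with
  | nil => simp [pmapRun, PMF.pure_eq, PMF.pure_map]
  | cons a l ih =>
    obtain ⟨h1, h2⟩ := hb a (by simp)
    obtain ⟨h3, h4⟩ := ih fun x hx => hb x (by simp [hx])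
    simp only [code_list_cons, pmapRun, PMF.bind_eq, PMF.pure_eq]
    constructor
    · simp only [PMF.map_bind, PMF.pure_map]
      have : (fun y : Data × Cost => (pmapRun b.run (code e) (code l)).bind
            fun w => PMF.pure (Data.cons y.1 w.1)) =
          (fun d => ((pmapRun b.run (code e) (code l)).map Prod.fst).map (Data.cons d)) ∘
            Prod.fst := by
        funext y; simp only [Function.comp_apply, PMF.map_comp]; rfl
      rw [this, ← PMF.bind_map]
      change (b.out _).bind _ = _
      rw [← code_prod (x := (e, a)), h1, PMF.pure_bind, h3, PMF.pure_map]; rfl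
    · intro o ho
      simp only [PMF.mem_support_bind, PMF.mem_support_pure] at ho
      obtain ⟨y, hy, v, hv, rfl⟩ := ho
      have := h2 y hy
      have := h4 v hv
      simp only [Cost.par, List.length_cons]
      nlinarith

theorem PolyFun.listMap {D : Dom γ} {l : γ → List α} (hl : PolyFun D l) {e : γ → ε}
    (he : PolyFun D e) {E : Dom (ε × α)} {f : ε × α → β} (hf : PolyFun E f)
    (hE : ∀ n g, D.mem n g → ∀ a ∈ l g, E.mem n (e g, a)) :
    PolyFun D fun g => (l g).map fun a => f (e g, a) := by
  obtain ⟨b, q, hb⟩ := hf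
  let F : Dom (ε × List α) := D.map (he.pair hl)
  have key : PolyFun F fun y : ε × List α => y.2.map fun a => f (y.1, a) := by
    obtain ⟨r, hr⟩ := F.bound
    -- There are at most `r` entries; each costs `q` for the function and up to `r + 1` for its copy
    -- of the parameter.
    refine ⟨.pmap b, 2 + r * (q + r + 1), fun n y hy => ?_⟩
    have hsize := hr n y hy
    obtain ⟨g, hg, rfl⟩ := hy
    have := pmapRun_spec (b := b) (e := e g) (f := f) (w := q.eval n) (l g) fun x hx => by
      have := hb n _ (hE n g hg x hx)
      rw [PMF.pure_map] at this
      exact this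
    constructor
    · simp only [Prog.out, Prog.run, PMF.bind_eq, PMF.pure_eq, PMF.map_bind, PMF.pure_map,
        code_prod, fst_cons, snd_cons] at this ⊢
      rw [← this.1]; rfl
    · intro o ho
      simp only [Prog.run, PMF.bind_eq, PMF.pure_eq, code_prod, fst_cons, snd_cons,
        PMF.mem_support_bind, PMF.mem_support_pure] at ho
      obtain ⟨y, hy, rfl⟩ := ho
      have h2 := this.2 y hy
      have h3 := (code (l g)).len_le_size
      rw [len_code] at h3
      simp only [code_prod, size_cons] at hsize
      simp only [Cost.step, Cost.seq, Polynomial.eval_add, Polynomial.eval_mul,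
        Polynomial.eval_one, Polynomial.eval_ofNat]
      have : (l g).length * (q.eval n + (code (e g)).size + 1) ≤
          r.eval n * (q.eval n + r.eval n + 1) := by gcongr <;> omega
      omega
  exact PolyFun.comp key (he.pair hl) fun n g hg => ⟨g, hg, rfl⟩

theorem Data.size_mem_toList (d : Data) : ∀ a ∈ d.toList, a.size ≤ d.size := by
  induction d with
  | nil => simp
  | cons a b _ ih =>
    intro x hx
    rcases List.mem_cons.1 hx with rfl | hx
    · simp; omega
    · have := ih x hx; simp; omega

theorem PolyFun.toList {D : Dom γ} {d : γ → Data} (h : PolyFun D d) :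
    PolyFun D fun g => (d g).toList :=
  h.of_code fun _ g _ => by
    rw [code_list, show (code : Data → Data) = _root_.id from rfl, List.map_id, Data.ofList_toList]; rfl

theorem PolyFun.toBits {D : Dom γ} {d : γ → Data} (h : PolyFun D d) :
    PolyFun D fun g => (d g).toBits := by
  obtain ⟨q, hq⟩ := h.bound
  let E : Dom (Data × Data) := ⟨fun n x => x.1 = .nil ∧ x.2.size ≤ q.eval n, q + 2, by
    rintro n ⟨a, b⟩ ⟨rfl, h⟩; simp at *; omega⟩
  refine (PolyFun.listMap (f := fun x : Data × Data => x.2.toBool) h.toList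
    (PolyFun.const Data.nil) (E := E) PolyFun.id.snd.toBool ?_)
  exact fun n g hg a ha => ⟨rfl, (Data.size_mem_toList _ a ha).trans (hq n g hg)⟩

end

section

variable {α β γ δ ε : Type} [Coded α] [Coded β] [Coded γ] [Coded δ] [Coded ε]

instance : Inhabited Data := ⟨.nil⟩

/-! ## Arithmetic and comparisons in polynomial time -/

theorem size_code_append (l m : List α) :
    (code (l ++ m)).size + 1 = (code l).size + (code m).size := by
  induction l with
  | nil => simp; omega
  | cons a l ih => simp at ih ⊢; omega

theorem size_code_reverse (l : List α) : (code l.reverse).size = (code l).size := by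
  induction l with
  | nil => rfl
  | cons a l ih =>
    have := size_code_append l.reverse [a]
    simp at this ⊢; omega

namespace PolyFun

variable {D : Dom γ}

theorem reverse [Inhabited α] {l : γ → List α} (h : PolyFun D l) :
    PolyFun D fun g => (l g).reverse := by
  obtain ⟨q, hq⟩ := h.bound
  let E : Dom (Data × α × List α) := ⟨fun n x => x.1 = .nil ∧ (code (x.2.1 :: x.2.2)).size ≤ q.eval n,
    q + 3, by rintro n ⟨_, a, b⟩ ⟨rfl, h⟩; simp at *; omega⟩
  have hE : PolyFun E fun x : Data × α × List α => x.2.1 :: x.2.2 := id.snd.fst.cons id.snd.snd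
  refine (foldl h (const Data.nil) (const []) hE ?_).congr fun n g _ => ?_
  · intro n g hg l₁ a l₂ hl
    refine ⟨rfl, le_trans ?_ (hq n g hg)⟩
    have := size_code_append l₁ (a :: l₂)
    have h1 := size_code_reverse l₁
    have := (code l₂).size_pos
    simp [hl] at *; omega
  · simp

theorem append [Inhabited α] {l m : γ → List α} (hl : PolyFun D l) (hm : PolyFun D m) :
    PolyFun D fun g => l g ++ m g := by
  obtain ⟨q, hq⟩ := hl.bound
  obtain ⟨r, hr⟩ := hm.bound
  let E : Dom (Data × α × List α) :=
    ⟨fun n x => x.1 = .nil ∧ (code (x.2.1 :: x.2.2)).size ≤ q.eval n + r.eval n,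
      q + r + 3, by rintro n ⟨_, a, b⟩ ⟨rfl, h⟩; simp at *; omega⟩
  have hE : PolyFun E fun x : Data × α × List α => x.2.1 :: x.2.2 := id.snd.fst.cons id.snd.snd
  have key : ∀ (l m : List α), l.reverse.foldl (fun acc x => x :: acc) m = l ++ m := by
    intro l m; simp
  refine (foldl hl.reverse (const Data.nil) hm hE ?_).congr fun n g _ => (key _ _).symm
  intro n g hg l₁ a l₂ hl
  refine ⟨rfl, ?_⟩
  have h1 := hq n g hg
  have h2 := hr n g hg
  rw [← size_code_reverse, hl] at h1
  have := size_code_append l₁ (a :: l₂)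
  have := size_code_append l₁.reverse (m g)
  have := size_code_reverse l₁
  have := (code l₂).size_pos
  simp at *; omega

/-! ### Binary numbers -/

theorem _root_.DelegatedTLP.Data.toNat_eq (d : Data) :
    d.toNat = d.fst.toBool.toNat + 2 * d.snd.toNat := by
  cases d <;> simp [Data.toNat, Data.toBits, bitsToNat]

theorem _root_.DelegatedTLP.Data.toNat_eq_zero {d : Data} (h : d.len = 0) : d.toNat = 0 := by
  cases d <;> simp at *; rfl

theorem _root_.DelegatedTLP.Data.len_snd (d : Data) : d.snd.len = d.len - 1 := by
  cases d <;> simp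

theorem bit {b : γ → Bool} {v : γ → ℕ} (hb : PolyFun D b) (hv : PolyFun D v) :
    PolyFun D fun g => 2 * v g + (b g).toNat := by
  -- Codes of numbers have no leading zeros, so a new lowest bit may be attached in all cases but
  -- one: the bit `false` at the number `0` must leave the empty list.
  refine (ite (c := fun g => b g || (code (v g)).toBool) (hb.or hv.coded.toBool)
    ((hb.coded.dcons hv.coded).restrict _) (const Data.nil)).of_code fun n g _ => ?_
  cases hbg : b g
  · rcases Nat.eq_zero_or_pos (v g) with h | h
    · simp [h, code_nat]
    · have : Nat.bits (2 * v g) = false :: Nat.bits (v g) := by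
        simpa [Nat.bit_val] using Nat.bits_append_bit (v g) false (by omega)
      have h2 : (code (v g)).toBool = true := by
        cases hc : code (v g) with
        | nil =>
          have := toNat_code (v g)
          rw [hc] at this
          simp [Data.toNat, Data.toBits, bitsToNat] at this; omega
        | cons a b => rfl
      rw [code_nat] at h2
      simp [code_nat, h2, this]
  · have : Nat.bits (2 * v g + 1) = true :: Nat.bits (v g) := by
      simp
    simp [code_nat]

/-- Horner's rule, bit by bit. It turns a list of bits, possibly with leading zeros and in the order
in which `addStep` leaves them, into the canonical code of a number. -/
theorem ofMSB {l : γ → List Bool} (h : PolyFun D l) :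
    PolyFun D fun g => (l g).foldl (fun v b => 2 * v + b.toNat) 0 := by
  obtain ⟨q, hq⟩ := h.bound
  let E : Dom (Data × Bool × ℕ) := ⟨fun n x => x.1 = .nil ∧ x.2.2 < 2 ^ q.eval n, 4 * q + 10, by
    rintro n ⟨_, a, b⟩ ⟨rfl, h⟩
    have := size_code_nat_le h
    cases a <;> simp at * <;> omega⟩
  refine foldl (E := E) (h := fun x : Data × Bool × ℕ => 2 * x.2.2 + x.2.1.toNat) h
    (const Data.nil) (const 0) (bit id.snd.fst id.snd.snd) ?_
  intro n g hg l₁ a l₂ hl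
  refine ⟨rfl, ?_⟩
  have h1 : ∀ l : List Bool, l.foldl (fun v b => 2 * v + b.toNat) 0 < 2 ^ l.length := by
    intro l
    induction l using List.reverseRecOn with
    | nil => simp
    | append_singleton l b ih => cases b <;> simp [pow_succ] <;> omega
  refine (h1 l₁).trans_le (Nat.pow_le_pow_right (by simp) ?_)
  have := (code (l g)).len_le_size
  have := hq n g hg
  rw [hl] at *
  simp at *; omega

/-- One step of the addition of binary numbers, with carry and the bits computed so far. -/
def addStep (s : Data × Data × Bool × List Bool) : Data × Data × Bool × List Bool :=
  (s.1.snd, s.2.1.snd,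
    (s.1.fst.toBool && s.2.1.fst.toBool) || (s.2.2.1 && (s.1.fst.toBool || s.2.1.fst.toBool)),
    ((s.1.fst.toBool == s.2.1.fst.toBool) == s.2.2.1) :: s.2.2.2)

/-- Schoolbook addition from the lowest bit. New bits are put in front, so Horner's rule meets the
highest ones first and the bits `l` from before last. One step more than the lengths of the summands
lets the last carry out. -/
theorem addStep_iterate (k : ℕ) (x y : Data) (c : Bool) (l : List Bool) (m : ℕ)
    (hx : x.len ≤ k) (hy : y.len ≤ k) :
    (addStep^[k + 1] (x, y, c, l)).2.2.2.foldl (fun v b => 2 * v + b.toNat) m =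
      l.foldl (fun v b => 2 * v + b.toNat) (m * 2 ^ (k + 1) + x.toNat + y.toNat + c.toNat) := by
  induction k generalizing x y c l with
  | zero =>
    rw [Data.toNat_eq_zero (by omega : x.len = 0), Data.toNat_eq_zero (by omega : y.len = 0)]
    have h1 : x = .nil := by cases x <;> simp at *
    have h2 : y = .nil := by cases y <;> simp at *
    subst h1 h2
    cases c <;> simp [addStep, mul_comm]
  | succ k ih =>
    rw [Function.iterate_succ_apply]
    rw [addStep, ih _ _ _ _ (by simp only [Data.len_snd]; omega) (by simp only [Data.len_snd]; omega),
      List.foldl_cons, x.toNat_eq, y.toNat_eq]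
    congr 1
    generalize x.snd.toNat = X
    generalize y.snd.toNat = Y
    rw [pow_succ 2 (k + 1)]
    generalize 2 ^ (k + 1) = P
    simp only
    cases x.fst.toBool <;> cases y.fst.toBool <;> cases c <;> simp <;> ring

theorem addStep_bound (k : ℕ) (s : Data × Data × Bool × List Bool) :
    (addStep^[k] s).1.size ≤ s.1.size ∧ (addStep^[k] s).2.1.size ≤ s.2.1.size ∧
      (addStep^[k] s).2.2.2.length = s.2.2.2.length + k := by
  induction k with
  | zero => simp
  | succ k ih =>
    rw [Function.iterate_succ_apply']
    refine ⟨(Data.size_snd_le _).trans ih.1, (Data.size_snd_le _).trans ih.2.1, ?_⟩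
    simp [addStep, ih.2.2]; omega

/-- Addition of binary numbers. -/
theorem addD {x y : γ → Data} (hx : PolyFun D x) (hy : PolyFun D y) :
    PolyFun D fun g => (x g).toNat + (y g).toNat := by
  let clock : γ → List Data := fun g => .nil :: ((x g).toList ++ (y g).toList)
  have hclock : PolyFun D clock := (const Data.nil).cons (hx.toList.append hy.toList)
  obtain ⟨q, hq⟩ := hx.bound
  obtain ⟨r, hr⟩ := hy.bound
  obtain ⟨u, hu⟩ := hclock.bound
  let E : Dom (Data × Data × Bool × List Bool) :=
    ⟨fun n s => s.1.size ≤ q.eval n ∧ s.2.1.size ≤ r.eval n ∧ s.2.2.2.length ≤ u.eval n,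
      q + r + 4 * u + 10, by
      rintro n ⟨x, y, c, l⟩ ⟨h1, h2, h3⟩
      have := size_code_bits_le l
      cases c <;> simp at * <;> omega⟩
  have hE : PolyFun E addStep := by
    have a : PolyFun E fun s => s.1.fst.toBool := id.fst.dfst.toBool
    have b : PolyFun E fun s => s.2.1.fst.toBool := id.snd.fst.dfst.toBool
    have c : PolyFun E fun s => s.2.2.1 := id.snd.snd.fst
    exact id.fst.dsnd.pair (id.snd.fst.dsnd.pair (((a.and b).or (c.and (a.or b))).pair
      (((a.beq b).beq c).cons id.snd.snd.snd)))
  have := iterate hE hclock.coded (hx.pair (hy.pair ((const false).pair (const [])))) ?_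
  · refine this.snd.snd.snd.ofMSB.congr fun n g _ => ?_
    have h1 : (code (clock g)).len = ((x g).len + (y g).len) + 1 := by
      simp [clock, Data.len]
    rw [h1, addStep_iterate _ _ _ _ _ _ (by omega) (by omega)]
    simp
  · intro n g hg k hk
    obtain ⟨h1, h2, h3⟩ := addStep_bound k (x g, y g, false, [])
    refine ⟨h1.trans (hq n g hg), h2.trans (hr n g hg), ?_⟩
    have := hu n g hg
    have := (code (clock g)).len_le_size
    rw [h3]; simp; omega

theorem toNat {x : γ → Data} (hx : PolyFun D x) : PolyFun D fun g => (x g).toNat :=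
  (addD hx (const Data.nil)).congr fun _ _ _ => by simp [Data.toNat_eq_zero (d := .nil) rfl]

theorem add {x y : γ → ℕ} (hx : PolyFun D x) (hy : PolyFun D y) : PolyFun D fun g => x g + y g :=
  (addD hx.coded hy.coded).congr fun _ _ _ => by simp

theorem sum {k : ℕ} {f : γ → Fin k → ℕ} (h : PolyFun D f) : PolyFun D fun g => ∑ i, f g i := by
  induction k with
  | zero => exact (const 0).congr fun _ _ _ => by simp
  | succ k ih =>
    refine ((h.app 0).add (ih (f := fun g i => f g i.succ) (vec fun i => h.app i.succ))).congr ?_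
    intro n g _; rw [Fin.sum_univ_succ]

/-- One step of the comparison of binary numbers. -/
def leStep (s : Data × Data × Bool) : Data × Data × Bool :=
  (s.1.snd, s.2.1.snd,
    if (s.1.fst.toBool == s.2.1.fst.toBool) = true then s.2.2 else s.2.1.fst.toBool)

/-- The bits are read from the lowest one, so the last position where they differ decides; the
initial flag survives only if the numbers are equal. -/
theorem leStep_iterate (k : ℕ) (x y : Data) (c : Bool) (hx : x.len ≤ k) (hy : y.len ≤ k) :
    (leStep^[k] (x, y, c)).2.2 = if x.toNat = y.toNat then c else decide (x.toNat < y.toNat) := by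
  induction k generalizing x y c with
  | zero => simp [Data.toNat_eq_zero (by omega : x.len = 0), Data.toNat_eq_zero (by omega : y.len = 0)]
  | succ k ih =>
    rw [Function.iterate_succ_apply, leStep, ih _ _ _ (by simp only [Data.len_snd]; omega)
      (by simp only [Data.len_snd]; omega), x.toNat_eq, y.toNat_eq]
    simp only
    generalize x.snd.toNat = X
    generalize y.snd.toNat = Y
    cases x.fst.toBool <;> cases y.fst.toBool <;> simp <;> split_ifs <;>
      first | rfl | grind

theorem leStep_bound (k : ℕ) (s : Data × Data × Bool) :
    (leStep^[k] s).1.size ≤ s.1.size ∧ (leStep^[k] s).2.1.size ≤ s.2.1.size := by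
  induction k with
  | zero => simp
  | succ k ih =>
    rw [Function.iterate_succ_apply']
    exact ⟨(Data.size_snd_le _).trans ih.1, (Data.size_snd_le _).trans ih.2⟩

theorem leD {x y : γ → Data} (hx : PolyFun D x) (hy : PolyFun D y) :
    PolyFun D fun g => decide ((x g).toNat ≤ (y g).toNat) := by
  obtain ⟨q, hq⟩ := hx.bound
  obtain ⟨r, hr⟩ := hy.bound
  let E : Dom (Data × Data × Bool) :=
    ⟨fun n s => s.1.size ≤ q.eval n ∧ s.2.1.size ≤ r.eval n, q + r + 10, by
      rintro n ⟨x, y, c⟩ ⟨h1, h2⟩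
      cases c <;> simp at * <;> omega⟩
  have hE : PolyFun E leStep := by
    have a : PolyFun E fun s => s.1.fst.toBool := id.fst.dfst.toBool
    have b : PolyFun E fun s => s.2.1.fst.toBool := id.snd.fst.dfst.toBool
    exact id.fst.dsnd.pair (id.snd.fst.dsnd.pair (ite (a.beq b) (id.snd.snd.restrict _)
      (b.restrict _)))
  have := iterate hE (hx.toList.append hy.toList).coded (hx.pair (hy.pair (const true))) ?_
  · refine this.snd.snd.congr fun n g _ => ?_
    have h1 : (code ((x g).toList ++ (y g).toList)).len = ((x g).len + (y g).len) := by
      simp [Data.len]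
    rw [h1, leStep_iterate _ _ _ _ (by omega) (by omega)]
    split_ifs with h <;> simp [h]
    omega
  · intro n g hg k hk
    obtain ⟨h1, h2⟩ := leStep_bound k (x g, y g, true)
    exact ⟨h1.trans (hq n g hg), h2.trans (hr n g hg)⟩

theorem le {x y : γ → ℕ} (hx : PolyFun D x) (hy : PolyFun D y) :
    PolyFun D fun g => decide (x g ≤ y g) :=
  (leD hx.coded hy.coded).congr fun _ _ _ => by simp

theorem natEq {x y : γ → ℕ} (hx : PolyFun D x) (hy : PolyFun D y) :
    PolyFun D fun g => decide (x g = y g) :=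
  ((le hx hy).and (le hy hx)).congr fun _ _ _ => by
    rw [← Bool.decide_and]; congr 1; exact propext le_antisymm_iff

theorem decideAll {k : ℕ} {P : γ → Fin k → Prop} [∀ g i, Decidable (P g i)]
    (h : ∀ i, PolyFun D fun g => decide (P g i)) : PolyFun D fun g => decide (∀ i, P g i) := by
  induction k with
  | zero => exact (const true).congr fun _ _ _ => by simp
  | succ k ih =>
    refine ((h 0).and (ih (P := fun g i => P g i.succ) fun i => h i.succ)).congr fun _ _ _ => ?_
    rw [← Bool.decide_and]; congr 1; exact propext Fin.forall_fin_succ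

/-! ### Unary numbers -/

theorem unaryAdd {x y : γ → Unary} (hx : PolyFun D x) (hy : PolyFun D y) :
    PolyFun D fun g => (⟨(x g).val + (y g).val⟩ : Unary) := by
  refine (hx.coded.toList.append hy.coded.toList).of_code fun n g _ => ?_
  simp [code_unary, code_list]

theorem unaryMul {x y : γ → Unary} (hx : PolyFun D x) (hy : PolyFun D y) :
    PolyFun D fun g => (⟨(x g).val * (y g).val⟩ : Unary) := by
  let f : Unary × Unary → Unary × Unary := fun s => (⟨s.1.val + s.2.val⟩, s.2)
  have hf : ∀ k s, f^[k] s = (⟨s.1.val + k * s.2.val⟩, s.2) := by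
    intro k s
    induction k with
    | zero => simp
    | succ k ih =>
      rw [Function.iterate_succ_apply', ih]
      simp only [f, Prod.mk.injEq, Unary.mk.injEq, and_true]; ring
  obtain ⟨q, hq⟩ := hx.bound
  obtain ⟨r, hr⟩ := hy.bound
  let E : Dom (Unary × Unary) :=
    ⟨fun n s => s.1.val ≤ q.eval n * r.eval n ∧ s.2.val ≤ r.eval n, 2 * (q * r + r) + 3, by
      rintro n ⟨⟨x⟩, ⟨y⟩⟩ ⟨h1, h2⟩
      simp at *; omega⟩
  have := iterate (E := E) (f := f) (unaryAdd id.fst id.snd |>.pair id.snd) hx.coded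
    ((const ⟨0⟩).pair hy) ?_
  · refine this.fst.congr fun n g _ => ?_
    rw [hf]; simp
  · intro n g hg k hk
    have h1 := hq n g hg
    have h2 := hr n g hg
    rw [hf]
    simp at *
    exact ⟨Nat.mul_le_mul (by omega) (by omega), by simp; omega⟩

/-- Supplies clocks: a loop with polynomially many steps needs a list of that length. -/
theorem unaryPoly {x : γ → Unary} (hx : PolyFun D x) (q : Polynomial ℕ) :
    PolyFun D fun g => (⟨q.eval (x g).val⟩ : Unary) := by
  induction q using Polynomial.induction_on' with
  | add p q hp hq => exact (unaryAdd hp hq).congr fun _ _ _ => by simp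
  | monomial k c =>
    induction k with
    | zero => exact (const ⟨c⟩).congr fun _ _ _ => by simp
    | succ k ih => exact (unaryMul ih hx).congr fun _ _ _ => by simp [pow_succ, mul_assoc]

theorem unaryToNat {x : γ → Unary} (hx : PolyFun D x) : PolyFun D fun g => (x g).val := by
  obtain ⟨q, hq⟩ := hx.bound
  let E : Dom ℕ := ⟨fun n s => s ≤ q.eval n, 4 * q + 5, by
    intro n k h
    have := size_code_nat_le (lt_of_le_of_lt h (Nat.lt_two_pow_self (n := q.eval n)))
    simp; omega⟩
  have hf : ∀ k s, (fun s => s + 1)^[k] s = s + k := by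
    intro k s
    induction k with
    | zero => simp
    | succ k ih => rw [Function.iterate_succ_apply', ih]; ring
  refine (iterate (E := E) (f := fun s => s + 1) (id.add (const 1)) hx.coded (const 0) ?_).congr
    fun n g _ => by rw [hf]; simp
  intro n g hg k hk
  have := hq n g hg
  rw [hf]
  simp [E] at *; omega

/-! ### Equality of data -/

/-- One step of a comparison: a stack of pairs that remain to be compared, and the result so far. -/
def eqStep (s : List (Data × Data) × Bool) : List (Data × Data) × Bool :=
  if s.1.isEmpty = true then s
  else if s.1.headI.1.toBool = true then
    if s.1.headI.2.toBool = true then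
      ((s.1.headI.1.fst, s.1.headI.2.fst) :: (s.1.headI.1.snd, s.1.headI.2.snd) :: s.1.tail, s.2)
    else ([], false)
  else if s.1.headI.2.toBool = true then ([], false)
  else (s.1.tail, s.2)

/-- A pair of inner nodes is replaced by the two pairs of children. This preserves the conjunction
of the equations, removes one node from the total size of the left-hand sides, and does not enlarge
the stack. The second fact gives termination, the third a bound for the loop state. -/
theorem eqStep_spec (s : List (Data × Data) × Bool) :
    ((eqStep s).2 && (eqStep s).1.all fun p => decide (p.1 = p.2)) =
        (s.2 && s.1.all fun p => decide (p.1 = p.2)) ∧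
      ((eqStep s).1.map fun p => p.1.size).sum ≤ (s.1.map fun p => p.1.size).sum - 1 ∧
      (code (eqStep s).1).size ≤ (code s.1).size := by
  obtain ⟨l, c⟩ := s
  rcases l with _ | ⟨⟨x, y⟩, l⟩
  · simp [eqStep]
  · cases x <;> cases y <;> simp [eqStep] <;>
      first | omega | exact ⟨by simp only [Bool.and_assoc], by omega, by omega⟩

theorem eqStep_iterate (k : ℕ) (s : List (Data × Data) × Bool) :
    ((eqStep^[k] s).2 && (eqStep^[k] s).1.all fun p => decide (p.1 = p.2)) =
        (s.2 && s.1.all fun p => decide (p.1 = p.2)) ∧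
      ((eqStep^[k] s).1.map fun p => p.1.size).sum ≤ (s.1.map fun p => p.1.size).sum - k ∧
      (code (eqStep^[k] s).1).size ≤ (code s.1).size := by
  induction k with
  | zero => simp
  | succ k ih =>
    rw [Function.iterate_succ_apply']
    obtain ⟨h1, h2, h3⟩ := eqStep_spec (eqStep^[k] s)
    exact ⟨h1.trans ih.1, by omega, h3.trans ih.2.2⟩

/-- Equality of data, given a list that is longer than the data. -/
theorem dataEq {x y clock : γ → Data} (hx : PolyFun D x) (hy : PolyFun D y)
    (hc : PolyFun D clock) (h : ∀ n g, D.mem n g → (x g).size ≤ (clock g).len) :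
    PolyFun D fun g => decide (x g = y g) := by
  obtain ⟨q, hq⟩ := ((hx.pair hy).cons (const [])).bound
  let E : Dom (List (Data × Data) × Bool) := ⟨fun n s => (code s.1).size ≤ q.eval n, q + 5, by
    rintro n ⟨l, c⟩ h; cases c <;> simp at * <;> omega⟩
  have hE : PolyFun E eqStep := by
    refine ite id.fst.isEmpty (id.restrict _) ?_
    let E' := E.restrict fun s => s.1.isEmpty = false
    have hh : PolyFun E' fun s => s.1.headI := id.fst.headI fun n s hs h => by
      have := hs.2; simp [h] at this
    have ht : PolyFun E' fun s => s.1.tail := id.fst.tail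
    have hs : PolyFun E' fun s => s.2 := id.snd
    refine ite hh.fst.toBool (ite (hh.snd.toBool.restrict _) ?_ (const _))
      (ite (hh.snd.toBool.restrict _) (const _) ?_)
    · exact (((hh.fst.dfst.pair hh.snd.dfst).cons ((hh.fst.dsnd.pair hh.snd.dsnd).cons ht)).pair
        hs).mono fun n s h => h.1.1
    · exact (ht.pair hs).mono fun n s h => h.1.1
  refine (iterate hE hc (((hx.pair hy).cons (const [])).pair (const true)) ?_).snd.congr ?_
  · exact fun n g hg k _ => (eqStep_iterate k _).2.2.trans (hq n g hg)
  · intro n g hg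
    obtain ⟨h1, h2, -⟩ := eqStep_iterate (clock g).len ([(x g, y g)], true)
    have := h n g hg
    have h3 : (eqStep^[(clock g).len] ([(x g, y g)], true)).1 = [] := by
      cases hl : (eqStep^[(clock g).len] ([(x g, y g)], true)).1 with
      | nil => rfl
      | cons p l =>
        rw [hl] at h2
        have := p.1.size_pos
        simp at h2; omega
    rw [h3] at h1
    simpa using h1.symm

end PolyFun

end

section

/-! ## Interactive reductions -/

namespace Interactive

variable {W : Type}

/-- One activation, without the cost. -/
def step (A : Interactive) (h : W → Data → PMF (Data × W)) (x : Data × Data × W) :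
    PMF (Data × Data × W) :=
  (A.prog.out (.cons x.1 x.2.1)).bind fun o => (h x.2.2 o.snd).map fun r => (o.fst, r.1, r.2)

/-- Costs are recorded but never influence the run. Without them, the interaction is a Markov chain
on the adversary's state, the pending reply and the world. -/
theorem play_map (A : Interactive) (h : W → Data → PMF (Data × W)) (k : ℕ) (st rep : Data) (w : W)
    (c : Cost) : (A.play h k st rep w c).map (fun o => (o.1, o.2.1)) =
      (iterK (A.step h) k (st, rep, w)).map fun x => (x.1, x.2.2) := by
  induction k generalizing st rep w c with
  | zero => simp [play, iterK, PMF.pure_eq, PMF.pure_map]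
  | succ k ih =>
    simp only [play, iterK, step, PMF.bind_eq, PMF.map_bind, PMF.bind_bind, PMF.bind_map,
      Function.comp_def, ih, Prog.out]

/-- Each activation costs at most `b` for the program and `b` for reading the reply. The invariant
is indexed by the remaining activations, so that it can follow the phases of a reduction. -/
theorem play_work (A : Interactive) (h : W → Data → PMF (Data × W)) (b : ℕ)
    (J : ℕ → Data → Data → W → Prop)
    (hJ : ∀ k st rep w, J (k + 1) st rep w → A.prog.WorkLe (.cons st rep) b ∧ rep.size ≤ b ∧
      ∀ o ∈ (A.prog.out (.cons st rep)).support, ∀ r ∈ (h w o.snd).support, J k o.fst r.1 r.2)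
    (k : ℕ) (st rep : Data) (w : W) (c : Cost) (hx : J k st rep w) :
    ∀ o ∈ (A.play h k st rep w c).support, o.2.2.work ≤ c.work + k * (2 * b) := by
  induction k generalizing st rep w c with
  | zero =>
    intro o ho
    simp only [play, PMF.pure_eq, PMF.mem_support_pure] at ho
    simp [ho]
  | succ k ih =>
    intro o ho
    simp only [play, PMF.bind_eq, PMF.mem_support_bind] at ho
    obtain ⟨a, ha, r, hr, ho⟩ := ho
    obtain ⟨h1, h2, h3⟩ := hJ k st rep w hx
    have h4 := ih _ _ _ _ (h3 a.1 (Prog.mem_out ha) r hr) o ho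
    have h5 := h1 a ha
    simp only [Cost.seq, Cost.step] at h4
    nlinarith

end Interactive

/-- If the result of the test is certain, then nothing needs to be known about the work of the other
branch. -/
theorem Prog.ite_spec {c f g : Prog} {d a : Data} {u : ℕ} (hc : c.out d = PMF.pure a)
    (hw : c.WorkLe d u) (b : Bool) (hb : a.toBool = b) :
    (ite c f g).out d = (if b = true then f else g).out d ∧
      ∀ v, (if b = true then f else g).WorkLe d v → (ite c f g).WorkLe d (d.size + 1 + u + v) := by
  constructor
  · rw [out_ite, hc, PMF.pure_bind, hb]
    split_ifs <;> rfl
  · intro v hv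
    cases b
    · refine (workLe_ite (v₁ := 0) (v₂ := v) hw ?_ fun _ => hv).mono (by omega)
      rintro ⟨x, hx, h⟩
      rw [hc, PMF.mem_support_pure] at hx
      rw [hx, hb] at h; cases h
    · refine (workLe_ite (v₁ := v) (v₂ := 0) hw (fun _ => hv) ?_).mono (by omega)
      rintro ⟨x, hx, h⟩
      rw [hc, PMF.mem_support_pure] at hx
      rw [hx, hb] at h; cases h

theorem Prog.workLe_path {f g : Prog} {d : Data} {u v : ℕ} (hf : ∀ d, f.WorkLe d u)
    (hg : ∀ d, g.WorkLe d v) : (seq f g).WorkLe d (u + v) :=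
  workLe_seq (hf d) fun a _ => hg a

section Reduction

variable {ι S M O W : Type} [Coded ι] [Coded S] [Coded M] [Coded O]

/-- One step of a reduction that prepares a query, and then processes the reply. -/
def redStep (pre : S → PMF (M × Data)) (post : M × Data → PMF S)
    (h : W → Data → PMF (Data × W)) (x : S × W) : PMF (S × W) :=
  (pre x.1).bind fun mq => (h x.2 mq.2).bind fun r => (post (mq.1, r.1)).map fun s => (s, r.2)

/-- The states of the reduction: before the preparation of a query, with the number of remaining
steps. -/
def preState (k : ℕ) (s : S) : Data := code (Data.cons (.cons .nil .nil) .nil, Unary.mk k, s)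

/-- The states of the reduction when the reply is awaited. -/
def postState (k : ℕ) (m : M) : Data :=
  code (Data.cons (.cons .nil .nil) (.cons .nil .nil), Unary.mk k, m)

theorem PolyOn.initState {Dι : Dom ι} {num : ι → Unary} (hnum : PolyFun Dι num) {f₀ : ι → PMF S}
    (h₀ : PolyOn Dι f₀) (T : Polynomial ℕ) : PolyOn Dι fun i => (f₀ i).bind fun s =>
      PMF.pure (preState (T.eval (num i).val) s, Data.nil) := by
  refine PolyOn.bind₂ h₀ ?_
  have hn : PolyFun (Dι.ext h₀) fun x => num x.1 :=
    hnum.comp PolyFun.id.fst fun n a ha => ha.1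
  exact (((PolyFun.const (Data.cons (.cons .nil .nil) .nil)).pair
    ((hn.unaryPoly T).pair PolyFun.id.snd)).coded).pair (PolyFun.const _)

/-- An interactive adversary has the same program at every activation, so the phases of a reduction
(initialisation, preparing a query, processing a reply, final output) become the branches of one
program. They are told apart by a tag in the state and by a unary counter. The original input is
recognised by its lack of a tag. -/
theorem exists_redProg (T : Polynomial ℕ) {Dι : Dom ι}
    {num : ι → Unary} (hnum : PolyFun Dι num) {f₀ : ι → PMF S} (h₀ : PolyOn Dι f₀)
    {pre : S → PMF (M × Data)} {Dpre : Dom S} (hpre : PolyOn Dpre pre)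
    {post : M × Data → PMF S} {Dpost : Dom (M × Data)} (hpost : PolyOn Dpost post)
    {fin : S → PMF O} {Dfin : Dom S} (hfin : PolyOn Dfin fin) :
    ∃ (p : Prog) (b : Polynomial ℕ), (∀ n, 1 ≤ b.eval n) ∧
      (∀ n i, Dι.mem n i → (num i).val = n → (code i).fst.fst = .nil →
        p.out (.cons (code i) .nil) = ((f₀ i).map fun s => Data.cons (preState (T.eval n) s) .nil) ∧
        p.WorkLe (.cons (code i) .nil) (b.eval n)) ∧
      (∀ n k s, k < T.eval n → Dpre.mem n s → p.out (.cons (preState (k + 1) s) .nil) =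
        ((pre s).map fun mq => Data.cons (postState k mq.1) mq.2) ∧
        p.WorkLe (.cons (preState (k + 1) s) .nil) (b.eval n)) ∧
      (∀ n k m r, k ≤ T.eval n → Dpost.mem n (m, r) → p.out (.cons (postState k m) r) =
        ((post (m, r)).map fun s => Data.cons (preState k s) .nil) ∧
        p.WorkLe (.cons (postState k m) r) (b.eval n) ∧ r.size ≤ b.eval n) ∧
      (∀ n s, Dfin.mem n s → p.out (.cons (preState 0 s) .nil) =
        ((fin s).map fun o => Data.cons (code o) .nil) ∧
        p.WorkLe (.cons (preState 0 s) .nil) (b.eval n)) := by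
  obtain ⟨pI, qI, hpI⟩ := PolyOn.initState hnum h₀ T
  -- preparation of a query
  let EA : Dom ((Data × Unary × S) × Data) :=
    ⟨fun n x => x.1.1 = Data.cons (.cons .nil .nil) .nil ∧ 0 < x.1.2.1.val ∧
      x.1.2.1.val ≤ T.eval n ∧ Dpre.mem n x.1.2.2 ∧ x.2 = .nil, by
      obtain ⟨q, hq⟩ := Dpre.bound
      refine ⟨q + 2 * T + 20, ?_⟩
      rintro n ⟨⟨_, ⟨k⟩, s⟩, _⟩ ⟨rfl, -, h2, h3, rfl⟩
      have := hq n s h3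
      simp at *; omega⟩
  have hEA : PolyOn EA fun x => (pre x.1.2.2).bind fun mq =>
      PMF.pure (postState (x.1.2.1.val - 1) mq.1, mq.2) := by
    have h1 : PolyOn EA fun x => pre x.1.2.2 :=
      PolyFun.bind PolyFun.id.fst.snd.snd hpre fun n a ha => ha.2.2.2.1
    refine PolyOn.bind₂ h1 (PolyFun.pair (PolyFun.coded ((PolyFun.const _).pair (PolyFun.pair ?_
      PolyFun.id.snd.fst))) PolyFun.id.snd.snd)
    -- Removing a cell of the unary code decrements the counter, which is positive here.
    refine (PolyFun.id.fst.fst.snd.fst.coded.dsnd).of_code fun n a ha => ?_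
    obtain ⟨⟨⟨d, ⟨k⟩, s⟩, r⟩, m⟩ := a
    cases k with
    | zero => exact absurd ha.1.2.1 (by simp)
    | succ k => simp [code_unary, List.replicate_succ, Data.ofList]
  obtain ⟨pA, qA, hpA⟩ := hEA
  -- processing of a reply
  let EB : Dom ((Data × Unary × M) × Data) :=
    ⟨fun n x => x.1.1 = Data.cons (.cons .nil .nil) (.cons .nil .nil) ∧
      x.1.2.1.val ≤ T.eval n ∧ Dpost.mem n (x.1.2.2, x.2), by
      obtain ⟨q, hq⟩ := Dpost.bound
      refine ⟨q + 2 * T + 20, ?_⟩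
      rintro n ⟨⟨_, ⟨k⟩, s⟩, r⟩ ⟨rfl, h2, h3⟩
      have := hq n _ h3
      simp at *; omega⟩
  have hEB : PolyOn EB fun x => (post (x.1.2.2, x.2)).bind fun s =>
      PMF.pure (preState x.1.2.1.val s, Data.nil) := by
    have h1 : PolyOn EB fun x => post (x.1.2.2, x.2) :=
      PolyFun.bind (PolyFun.id.fst.snd.snd.pair PolyFun.id.snd) hpost fun n a ha => ha.2.2
    refine PolyOn.bind₂ h1 (PolyFun.pair (PolyFun.coded ((PolyFun.const _).pair (PolyFun.pair ?_
      PolyFun.id.snd))) (PolyFun.const _))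
    exact PolyFun.id.fst.fst.snd.fst
  obtain ⟨pB, qB, hpB⟩ := hEB
  -- the end
  let EF : Dom ((Data × Unary × S) × Data) :=
    ⟨fun n x => x.1.1 = Data.cons (.cons .nil .nil) .nil ∧ x.1.2.1.val = 0 ∧
      Dfin.mem n x.1.2.2 ∧ x.2 = .nil, by
      obtain ⟨q, hq⟩ := Dfin.bound
      refine ⟨q + 20, ?_⟩
      rintro n ⟨⟨_, ⟨k⟩, s⟩, _⟩ ⟨rfl, h2, h3, rfl⟩
      have := hq n s h3
      simp at *; omega⟩
  have hEF : PolyOn EF fun x => (fin x.1.2.2).bind fun o => PMF.pure (o, Data.nil) := by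
    have h1 : PolyOn EF fun x => fin x.1.2.2 :=
      PolyFun.bind PolyFun.id.fst.snd.snd hfin fun n a ha => ha.2.2.1
    exact PolyOn.bind₂ h1 (PolyFun.pair PolyFun.id.snd (PolyFun.const _))
  obtain ⟨pF, qF, hpF⟩ := hEF
  -- the initial activation
  let EI : Dom (ι × Data) := ⟨fun n x => Dι.mem n x.1 ∧ x.2 = .nil, by
      obtain ⟨q, hq⟩ := Dι.bound
      refine ⟨q + 2, ?_⟩
      rintro n ⟨i, _⟩ ⟨h1, rfl⟩
      have := hq n _ h1
      simp at *; omega⟩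
  obtain ⟨rI, hrI⟩ := EI.bound
  obtain ⟨rA, hrA⟩ := EA.bound
  obtain ⟨rB, hrB⟩ := EB.bound
  obtain ⟨rF, hrF⟩ := EF.bound
  have hw3 : ∀ (p₁ p₂ p₃ : Prog) (d : Data), (∀ d, p₁.WorkLe d 1) → (∀ d, p₂.WorkLe d 1) →
      (∀ d, p₃.WorkLe d 1) → (Prog.seq p₁ (.seq p₂ p₃)).WorkLe d 3 := fun p₁ p₂ p₃ d h₁ h₂ h₃ =>
    Prog.workLe_path h₁ fun d => Prog.workLe_path h₂ h₃
  have hfst : ∀ d, Prog.fst.WorkLe d 1 := fun _ => Prog.workLe_fst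
  have hsnd : ∀ d, Prog.snd.WorkLe d 1 := fun _ => Prog.workLe_snd
  have t1 : ∀ d, (Prog.seq .fst (.seq .fst .fst)).out d = PMF.pure d.fst.fst.fst := fun d => by
    simp [Prog.out_seq, Prog.out_fst]
  have t2 : ∀ d, (Prog.seq .fst (.seq .fst .snd)).out d = PMF.pure d.fst.fst.snd := fun d => by
    simp [Prog.out_seq, Prog.out_fst, Prog.out_snd]
  have t3 : ∀ d, (Prog.seq .fst (.seq .snd .fst)).out d = PMF.pure d.fst.snd.fst := fun d => by
    simp [Prog.out_seq, Prog.out_fst, Prog.out_snd]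
  -- The three tests decide between a tagged state and the original input, between awaiting a reply
  -- and not, and between a positive and an exhausted counter.
  refine ⟨.ite (.seq .fst (.seq .fst .fst))
    (.ite (.seq .fst (.seq .fst .snd)) pB (.ite (.seq .fst (.seq .snd .fst)) pA pF))
    (.seq .fst pI), (qI + qA + qB + qF) + 3 * (rI + rA + rB + rF) + 13, by simp, ?_, ?_, ?_, ?_⟩
  · intro n i hi hn ht
    have hs := hrI n (i, .nil) ⟨hi, rfl⟩
    obtain ⟨e1, e2⟩ := Prog.ite_spec (f := .ite (.seq .fst (.seq .fst .snd)) pB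
      (.ite (.seq .fst (.seq .snd .fst)) pA pF)) (g := .seq .fst pI) (t1 (.cons (code i) .nil))
      (hw3 _ _ _ _ hfst hfst hfst) false (by simp [ht])
    obtain ⟨o1, o2⟩ := hpI n i hi
    constructor
    · refine e1.trans ?_
      simp only [Bool.false_eq_true, if_false, Prog.out_seq, Prog.out_fst, PMF.pure_bind, fst_cons,
        o1, hn, PMF.map_bind, PMF.pure_map]
      rfl
    · refine (e2 (1 + qI.eval n) ?_).mono ?_
      · refine Prog.workLe_seq Prog.workLe_fst fun a ha => ?_
        rw [Prog.out_fst, PMF.mem_support_pure] at ha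
        rw [ha]; exact o2
      · simp at hs ⊢; omega
  · intro n k s hk hs
    have hm : EA.mem n ((Data.cons (.cons .nil .nil) .nil, Unary.mk (k + 1), s), .nil) :=
      ⟨rfl, by simp, hk, hs, rfl⟩
    have hsz := hrA n _ hm
    obtain ⟨o1, o2⟩ := hpA n _ hm
    obtain ⟨e5, e6⟩ := Prog.ite_spec (f := pA) (g := pF) (t3 (.cons (preState (k + 1) s) .nil))
      (hw3 _ _ _ _ hfst hsnd hfst) true (by simp [preState, code_unary, List.replicate_succ, Data.ofList])
    obtain ⟨e3, e4⟩ := Prog.ite_spec (f := pB) (g := .ite (.seq .fst (.seq .snd .fst)) pA pF)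
      (t2 (.cons (preState (k + 1) s) .nil))
      (hw3 _ _ _ _ hfst hfst hsnd) false (by simp [preState])
    obtain ⟨e1, e2⟩ := Prog.ite_spec (f := .ite (.seq .fst (.seq .fst .snd)) pB
      (.ite (.seq .fst (.seq .snd .fst)) pA pF)) (g := .seq .fst pI) (t1 (.cons (preState (k + 1) s) .nil))
      (hw3 _ _ _ _ hfst hfst hfst) true (by simp [preState])
    constructor
    · refine (e1.trans (e3.trans e5)).trans (o1.trans ?_)
      simp only [PMF.map_bind, PMF.pure_map]
      rfl
    · refine (e2 _ (e4 _ (e6 _ o2))).mono ?_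
      simp [preState] at hsz ⊢; omega
  · intro n k m r hk hs
    have hm : EB.mem n ((Data.cons (.cons .nil .nil) (.cons .nil .nil), Unary.mk k, m), r) :=
      ⟨rfl, hk, hs⟩
    have hsz := hrB n _ hm
    obtain ⟨o1, o2⟩ := hpB n _ hm
    obtain ⟨e3, e4⟩ := Prog.ite_spec (f := pB) (g := .ite (.seq .fst (.seq .snd .fst)) pA pF)
      (t2 (.cons (postState k m) r))
      (hw3 _ _ _ _ hfst hfst hsnd) true (by simp [postState])
    obtain ⟨e1, e2⟩ := Prog.ite_spec (f := .ite (.seq .fst (.seq .fst .snd)) pB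
      (.ite (.seq .fst (.seq .snd .fst)) pA pF)) (g := .seq .fst pI) (t1 (.cons (postState k m) r))
      (hw3 _ _ _ _ hfst hfst hfst) true (by simp [postState])
    refine ⟨?_, ?_, ?_⟩
    · refine (e1.trans e3).trans (o1.trans ?_)
      simp only [PMF.map_bind, PMF.pure_map]
      rfl
    · refine (e2 _ (e4 _ o2)).mono ?_
      simp [postState] at hsz ⊢; omega
    · simp at hsz ⊢; omega
  · intro n s hs
    have hm : EF.mem n ((Data.cons (.cons .nil .nil) .nil, Unary.mk 0, s), .nil) :=
      ⟨rfl, rfl, hs, rfl⟩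
    have hsz := hrF n _ hm
    obtain ⟨o1, o2⟩ := hpF n _ hm
    obtain ⟨e5, e6⟩ := Prog.ite_spec (f := pA) (g := pF) (t3 (.cons (preState 0 s) .nil))
      (hw3 _ _ _ _ hfst hsnd hfst) false (by simp [preState, code_unary, Data.ofList])
    obtain ⟨e3, e4⟩ := Prog.ite_spec (f := pB) (g := .ite (.seq .fst (.seq .snd .fst)) pA pF)
      (t2 (.cons (preState 0 s) .nil))
      (hw3 _ _ _ _ hfst hfst hsnd) false (by simp [preState])
    obtain ⟨e1, e2⟩ := Prog.ite_spec (f := .ite (.seq .fst (.seq .fst .snd)) pB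
      (.ite (.seq .fst (.seq .snd .fst)) pA pF)) (g := .seq .fst pI) (t1 (.cons (preState 0 s) .nil))
      (hw3 _ _ _ _ hfst hfst hfst) true (by simp [preState])
    constructor
    · refine (e1.trans (e3.trans e5)).trans (o1.trans ?_)
      simp only [PMF.map_bind, PMF.pure_map]
      rfl
    · refine (e2 _ (e4 _ (e6 _ o2))).mono ?_
      simp [preState] at hsz ⊢; omega

/-- A reduction, in two activations per step, as an interactive adversary. Invariants are indexed by
the security parameter and the number of remaining steps. -/
theorem exists_interactive (h : W → Data → PMF (Data × W)) (hnil : ∀ w, h w .nil = PMF.pure (.nil, w))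
    (T : Polynomial ℕ) (I : ℕ → ι → W → Prop) {Dι : Dom ι} (hI : ∀ n i w, I n i w → Dι.mem n i)
    {num : ι → Unary} (hnum : PolyFun Dι num) (hnum' : ∀ n i w, I n i w → (num i).val = n)
    (tag : ∀ n i w, I n i w → (code i).fst.fst = .nil)
    {f₀ : ι → PMF S} (h₀ : PolyOn Dι f₀)
    {pre : S → PMF (M × Data)} {Dpre : Dom S} (hpre : PolyOn Dpre pre)
    {post : M × Data → PMF S} {Dpost : Dom (M × Data)} (hpost : PolyOn Dpost post)
    {fin : S → PMF O} {Dfin : Dom S} (hfin : PolyOn Dfin fin)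
    (Inv : ℕ → ℕ → S → W → Prop)
    (hInit : ∀ n i w, I n i w → ∀ s ∈ (f₀ i).support, Inv n (T.eval n) s w)
    (hStep : ∀ n k s w, k < T.eval n → Inv n (k + 1) s w → Dpre.mem n s ∧
      ∀ mq ∈ (pre s).support, ∀ r ∈ (h w mq.2).support, Dpost.mem n (mq.1, r.1) ∧
        ∀ s' ∈ (post (mq.1, r.1)).support, Inv n k s' r.2)
    (hEnd : ∀ n s w, Inv n 0 s w → Dfin.mem n s) :
    ∃ A : Interactive,
      (∃ q : Polynomial ℕ, ∀ n i w, I n i w →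
        ∀ o ∈ (A.run h n (code i) .nil w).support, o.2.2.work ≤ q.eval n) ∧
      ∀ n i w, I n i w → (A.run h n (code i) .nil w).map (fun o => (o.1, o.2.1)) =
        (f₀ i).bind fun s => (iterK (redStep pre post h) (T.eval n) (s, w)).bind fun x =>
          (fin x.1).map fun o => (code o, x.2) := by
  obtain ⟨p, b, hb1, specI, specA, specB, specF⟩ :=
    exists_redProg T hnum h₀ hpre hpost hfin
  -- One activation initialises, each step takes two, and one produces the output. Activations
  -- without a query of their own send `nil`, which the oracle ignores.
  let A : Interactive := ⟨p, 1 + (2 * T + 1)⟩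
  have hp : A.prog = p := rfl
  refine ⟨A, ⟨(1 + (2 * T + 1)) * (2 * b), fun n i w hi => ?_⟩, fun n i w hi => ?_⟩
  -- The cases are: not yet initialised, about to prepare a query, awaiting a reply, and finished.
  -- The number `l` of remaining steps fixes the number of remaining activations.
  · let J : ℕ → Data → Data → W → Prop := fun k st rep w =>
      (k = 1 + (2 * T.eval n + 1) ∧ rep = .nil ∧ ∃ i, st = code i ∧ I n i w) ∨
      (∃ l s, l ≤ T.eval n ∧ k = 2 * l + 1 ∧ rep = .nil ∧ st = preState l s ∧ Inv n l s w) ∨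
      (∃ l m, l ≤ T.eval n ∧ k = 2 * l + 2 ∧ st = postState l m ∧ Dpost.mem n (m, rep) ∧
        ∀ s' ∈ (post (m, rep)).support, Inv n l s' w) ∨ k = 0
    have := A.play_work h (b.eval n) J ?_ (1 + (2 * T.eval n + 1)) (code i) .nil w .zero
      (Or.inl ⟨rfl, rfl, i, rfl, hi⟩)
    · simp only [Interactive.run, A] at *
      simpa [Cost.zero] using this
    · intro k st rep w hJ
      have := hb1 n
      rcases hJ with ⟨h1, rfl, i, rfl, hi⟩ | ⟨l, s, hl, hk, rfl, rfl, hs⟩ |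
        ⟨l, m, hl, hk, rfl, hd, hs⟩ | hk
      · obtain ⟨e1, e2⟩ := specI n i (hI n i w hi) (hnum' n i w hi) (tag n i w hi)
        refine ⟨e2, by simpa using hb1 n, fun o ho r hr => ?_⟩
        rw [e1] at ho
        obtain ⟨s, hs, rfl⟩ := PMF.mem_support_map.1 ho
        rw [snd_cons, hnil, PMF.mem_support_pure] at hr
        subst hr
        exact Or.inr (Or.inl ⟨_, s, le_rfl, by omega, rfl, rfl, hInit n i w hi s hs⟩)
      · rcases l with _ | l
        · obtain ⟨e1, e2⟩ := specF n s (hEnd n s w hs)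
          exact ⟨e2, by simpa using hb1 n, fun o ho r hr => by simp [J]; omega⟩
        · obtain ⟨h1, h2⟩ := hStep n l s w hl hs
          obtain ⟨e1, e2⟩ := specA n l s hl h1
          refine ⟨e2, by simpa using hb1 n, fun o ho r hr => ?_⟩
          rw [e1] at ho
          obtain ⟨mq, hmq, rfl⟩ := PMF.mem_support_map.1 ho
          obtain ⟨h3, h4⟩ := h2 mq hmq r hr
          exact Or.inr (Or.inr (Or.inl ⟨l, mq.1, by omega, by omega, rfl, h3, h4⟩))
      · obtain ⟨e1, e2, e3⟩ := specB n l m rep hl hd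
        refine ⟨e2, e3, fun o ho r hr => ?_⟩
        rw [e1] at ho
        obtain ⟨s, hs', rfl⟩ := PMF.mem_support_map.1 ho
        rw [snd_cons, hnil, PMF.mem_support_pure] at hr
        subst hr
        exact Or.inr (Or.inl ⟨_, s, hl, by omega, rfl, rfl, hs s hs'⟩)
      · omega
  · have loop : ∀ k s w, k ≤ T.eval n → Inv n k s w →
        iterK (A.step h) (2 * k + 1) (preState k s, .nil, w) =
          (iterK (redStep pre post h) k (s, w)).bind fun x =>
            (fin x.1).map fun o => (code o, Data.nil, x.2) := by
      intro k
      induction k with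
      | zero =>
        intro s w _ hs
        simp only [iterK, PMF.pure_bind, Interactive.step, hp, (specF n s (hEnd n s w hs)).1,
          PMF.bind_map, Function.comp_def, fst_cons, snd_cons, hnil, PMF.pure_map]
        rw [PMF.bind_pure]
        rfl
      | succ k ih =>
        intro s w hk hs
        obtain ⟨h1, h2⟩ := hStep n k s w hk hs
        rw [show 2 * (k + 1) + 1 = (2 * k + 1) + 1 + 1 by ring, iterK]
        simp only [Interactive.step, hp, (specA n k s hk h1).1, PMF.bind_map, Function.comp_def,
          fst_cons, snd_cons, PMF.bind_bind]
        simp only [iterK, redStep, PMF.bind_bind, PMF.bind_map, Function.comp_def]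
        refine PMF.bind_congr fun mq hmq => PMF.bind_congr fun r hr => ?_
        obtain ⟨h3, h4⟩ := h2 mq hmq r hr
        simp only [Interactive.step, hp, (specB n k mq.1 r.1 (by omega) h3).1, PMF.bind_map,
          Function.comp_def, fst_cons, snd_cons, hnil, PMF.pure_map, PMF.pure_bind, PMF.bind_bind]
        refine PMF.bind_congr fun s' hs' => ?_
        have := ih s' r.2 (by omega) (h4 s' hs')
        simpa only [iterK, Interactive.step, hp, PMF.bind_bind, PMF.bind_map, Function.comp_def]
          using this
    rw [Interactive.run, A.play_map]
    have hT : A.acts.eval n = (2 * T.eval n + 1) + 1 := by simp [A]; ring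
    rw [hT, iterK]
    simp only [Interactive.step, hp, (specI n i (hI n i w hi) (hnum' n i w hi) (tag n i w hi)).1, PMF.bind_map, Function.comp_def, fst_cons,
      snd_cons, hnil, PMF.pure_map, PMF.map_bind, PMF.pure_bind]
    rw [PMF.bind_bind]
    refine PMF.bind_congr fun s hs => ?_
    rw [PMF.pure_bind, loop _ s w le_rfl (hInit n i w hi s hs)]
    simp only [PMF.map_bind, PMF.map_comp, Function.comp_def]

end Reduction

end

section

/-! ## The setting -/

/-- Schemes and functions that are computable in polynomial time. -/
structure Setting (z : ℕ) : Type where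
  E : SKE
  G : Sig
  T : GMTLP z
  cedg : Data → ℕ → ℕ → Data → ℕ
  τ : Timing
  B : Blockchain z
  hE : E.Efficient
  hG : G.Efficient
  hT : T.Efficient
  hB : B.Efficient
  hS : PolyTime fun n : Unary => (pure ⟨τ.S n.val⟩ : PMF Unary)
  hcedg : PolyTime fun x : Data × Unary × Unary × Data =>
    (pure (cedg x.1 x.2.1.val x.2.2.1.val x.2.2.2) : PMF ℕ)

/-- The delegated time-lock puzzle. -/
abbrev Setting.D {z : ℕ} (U : Setting z) : DTLP z := edTLP U.E U.T U.cedg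

instance {α : Type} [Coded α] : Coded (Party → α) :=
  ⟨fun f => code (f .C, f .S, f .HC, f .HS)⟩

theorem code_party {α : Type} [Coded α] (f : Party → α) :
    code f = code (f .C, f .S, f .HC, f .HS) := rfl

/-- The account keys: verification and signing keys. -/
abbrev Keys : Type := Party → Data × Data

instance : DecidableEq Party := fun a b => by
  cases a <;> cases b <;> first | exact isTrue rfl | exact isFalse (by simp)

variable {α β γ δ : Type} [Coded α] [Coded β] [Coded γ] [Coded δ] {D : Dom γ} {z : ℕ}

theorem PolyFun.party {f : γ → Party → α} (h : PolyFun D f) (i : Party) :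
    PolyFun D fun g => f g i := by
  have h' : PolyFun D fun g => (f g .C, f g .S, f g .HC, f g .HS) := h.of_code fun _ _ _ => rfl
  cases i
  exacts [h'.fst, h'.snd.fst, h'.snd.snd.fst, h'.snd.snd.snd]

theorem PolyFun.mkParty {f : γ → Party → α} (h : ∀ i, PolyFun D fun g => f g i) :
    PolyFun D f :=
  ((h .C).pair ((h .S).pair ((h .HC).pair (h .HS)))).of_code fun _ _ _ => rfl

theorem Prog.run_bind {ε : Type} (p : Prog) (d : Data) (F : Data → PMF ε) :
    ((p.run d).bind fun o => F o.1) = (p.out d).bind F := by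
  rw [Prog.out, PMF.bind_map]; rfl

namespace DTLP

theorem accounts_eq (G : Sig) (n : ℕ) : accounts G n =
    (G.keyGen n).bind fun k₁ => (G.keyGen n).bind fun k₂ => (G.keyGen n).bind fun k₃ =>
      (G.keyGen n).bind fun k₄ => PMF.pure fun | .C => k₁ | .S => k₂ | .HC => k₃ | .HS => k₄ := rfl

theorem mem_accounts {G : Sig} {n : ℕ} {keys : Keys} (h : keys ∈ (accounts G n).support)
    (i : Party) : keys i ∈ (G.keyGen n).support := by
  simp only [accounts_eq, PMF.mem_support_bind, PMF.mem_support_pure] at h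
  obtain ⟨k₁, h₁, k₂, h₂, k₃, h₃, k₄, h₄, rfl⟩ := h
  cases i <;> assumption

/-- The key of one party may be generated independently of the others. -/
theorem accounts_update (G : Sig) (n : ℕ) (i : Party) :
    ((G.keyGen n).bind fun k => (accounts G n).map fun keys : Keys => Function.update keys i k) =
      accounts G n := by
  have u : ∀ (k₁ k₂ k₃ k₄ k : Data × Data),
      Function.update (fun | .C => k₁ | .S => k₂ | .HC => k₃ | .HS => k₄ : Keys) i k =
        match i with
        | .C => (fun | .C => k | .S => k₂ | .HC => k₃ | .HS => k₄ : Keys)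
        | .S => (fun | .C => k₁ | .S => k | .HC => k₃ | .HS => k₄ : Keys)
        | .HC => (fun | .C => k₁ | .S => k₂ | .HC => k | .HS => k₄ : Keys)
        | .HS => (fun | .C => k₁ | .S => k₂ | .HC => k₃ | .HS => k : Keys) := by
    intro k₁ k₂ k₃ k₄ k
    funext p
    cases i <;> cases p <;> simp [Function.update]
  simp only [accounts_eq, PMF.map_bind, PMF.pure_map, u]
  cases i
  · simp only [PMF.bind_const]
  · simp only [PMF.bind_const]
    rw [PMF.bind_comm]
  · simp only [PMF.bind_const]
    rw [PMF.bind_comm]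
    refine congrArg _ (funext fun k₁ => ?_)
    rw [PMF.bind_comm]
  · simp only [PMF.bind_const]
    rw [PMF.bind_comm]
    refine congrArg _ (funext fun k₁ => ?_)
    rw [PMF.bind_comm]
    refine congrArg _ (funext fun k₁ => ?_)
    rw [PMF.bind_comm]

end DTLP

namespace Setting

variable (U : Setting z) {n : γ → Unary}

theorem keyGen_poly (hn : PolyFun D n) : PolyOn D fun g => U.G.keyGen (n g).val :=
  PolyFun.polyTime_comp (g := fun n : Unary => U.G.keyGen n.val) U.hG.1 hn

theorem accounts_poly (hn : PolyFun D n) : PolyOn D fun g => DTLP.accounts U.G (n g).val := by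
  simp only [DTLP.accounts_eq]
  refine PolyOn.bind₂ (U.keyGen_poly hn) ?_
  have h1 := hn.up (hg := U.keyGen_poly hn)
  refine PolyOn.bind₂ (U.keyGen_poly h1) ?_
  have h2 := h1.up (hg := U.keyGen_poly h1)
  refine PolyOn.bind₂ (U.keyGen_poly h2) ?_
  have h3 := h2.up (hg := U.keyGen_poly h2)
  refine PolyOn.bind₂ (U.keyGen_poly h3) ?_
  refine PolyFun.mkParty fun i => ?_
  cases i
  exacts [PolyFun.id.fst.fst.fst.snd, PolyFun.id.fst.fst.snd, PolyFun.id.fst.snd, PolyFun.id.snd]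

theorem S_poly (hn : PolyFun D n) : PolyFun D fun g => (⟨U.τ.S (n g).val⟩ : Unary) :=
  PolyFun.polyTime_comp_pure (g := fun n : Unary => (⟨U.τ.S n.val⟩ : Unary)) U.hS hn

variable {P : ℕ → DTLP.Params z}

theorem params_poly (hP : DTLP.EfficientParams P) (hn : PolyFun D n) : PolyFun D fun g => ((P (n g).val).toc,
    (fun i => ⟨(P (n g).val).Δ i⟩ : Fin z → Unary), (P (n g).val).aux, (P (n g).val).t₀,
    (P (n g).val).coins, (P (n g).val).coins', (P (n g).val).Ψ') :=
  (PolyFun.polyTime_comp_pure (g := fun n : Unary => P n.val) hP hn).of_code fun _ _ _ => rfl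

theorem efficientTimes (hP : DTLP.EfficientParams P) : GMTLP.EfficientTimes fun n => (P n).Δ :=
  polyTime_iff.2 (params_poly hP (D := Dom.all Unary) PolyFun.id).snd.fst

theorem Δ_poly (hP : DTLP.EfficientParams P) (hn : PolyFun D n) : PolyFun D fun g => (P (n g).val).Δ :=
  PolyFun.vec fun i => PolyFun.unaryToNat ((params_poly hP hn).snd.fst.app i)

/-- The extra delays. -/
def Ψ (n : ℕ) (P : DTLP.Params z) (j : Fin z) : ℕ := U.cedg P.toc (U.τ.S n) (P.Δ j) P.aux

/-- The contract, for given accounts. -/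
def contract (n : ℕ) (P : DTLP.Params z) (keys : Keys) : Contract z :=
  ⟨fun i => (keys i).1, P.Δ, U.Ψ n P, P.t₀, U.B.delay n, P.coins⟩

theorem Ψ_poly (hP : DTLP.EfficientParams P) (hn : PolyFun D n) : PolyFun D fun g => U.Ψ (n g).val (P (n g).val) := by
  have h := params_poly hP hn
  refine PolyFun.vec fun j => ?_
  exact PolyFun.polyTime_comp_pure U.hcedg
    (h.fst.pair ((U.S_poly hn).pair ((h.snd.fst.app j).pair h.snd.snd.fst)))

theorem adr_poly (hP : DTLP.EfficientParams P) (hn : PolyFun D n) {keys : γ → Keys} (hk : PolyFun D keys) :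
    PolyFun D fun g => (U.contract (n g).val (P (n g).val) (keys g)).adr := by
  have h := params_poly hP hn
  have hd : PolyFun D fun g => U.B.delay (n g).val := 
    PolyFun.polyTime_comp_pure (g := fun n : Unary => U.B.delay n.val) U.hB.2.2.2.1 hn
  exact ((((hk.party .C).fst.pair ((hk.party .S).fst.pair ((hk.party .HC).fst.pair
    (hk.party .HS).fst))).pair ((Δ_poly hP hn).pair ((U.Ψ_poly hP hn).pair
    (h.snd.snd.snd.fst.pair (hd.pair h.snd.snd.snd.snd.fst))))).coded)

theorem setup_poly (hP : DTLP.EfficientParams P) (hn : PolyFun D n) :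
    PolyOn D fun g => U.T.setup (n g).val (P (n g).val).Δ (U.τ.S (n g).val) :=
  PolyFun.polyTime_comp U.hT.1 (hn.pair ((params_poly hP hn).snd.fst.pair
    (U.S_poly hn)))

end Setting

/-! ## Experiments -/

theorem Experiment.winProb_eq (E : Experiment) (n : ℕ) :
    E.winProb n = (((E n).map Outcome.win).toOuterMeasure {p | p}).toReal := by
  rw [Experiment.winProb, PMF.toOuterMeasure_map_apply]; rfl

/-- A lemma for computing `winProb` of experiments that differ only in their costs. -/
theorem Experiment.winProb_congr {E F : Experiment} {n : ℕ}
    (h : (E n).map Outcome.win = (F n).map Outcome.win) : E.winProb n = F.winProb n := by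
  rw [Experiment.winProb_eq, Experiment.winProb_eq, h]

end

section

/-! ## Privacy against the server and its helper -/

namespace Setting

variable {z : ℕ} (U : Setting z) (P : ℕ → DTLP.Params z)

/-- What the second stage of the solver gets in addition to the public key and the puzzles. -/
def solverAux (n : ℕ) (keys : Keys) (o : Data) : Data :=
  code (o.snd.snd, code (P n).Δ, U.Ψ n (P n), (P n).Δ, (keys .HS).1, (U.contract n (P n) keys).adr,
    (P n).aux, (P n).toc, (P n).t₀)

/-- The first stage of the reduction. -/
def solverFirst (p : Prog) (x : Unary × Unary) : PMF Data :=
  (DTLP.accounts U.G x.1.val).bind fun keys => (U.E.keyGen x.1.val).bind fun k =>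
    (p.out (code (x.1, code (P x.1.val).Δ, code k, x.2))).map fun o =>
      .cons o.fst (.cons o.snd.fst (U.solverAux P x.1.val keys o))

/-- Brings the input of the second stage into the shape of the puzzle privacy experiment: public
key, puzzles, and a remainder (`solverAux`) that can serve as the state. -/
theorem solverExp_eq (j : Fin z) (A : TwoStage) (n : ℕ) : U.D.solverExp U.G U.B U.τ.S P j A n =
    (DTLP.accounts U.G n).bind fun keys => (U.E.keyGen n).bind fun k =>
      (A.first.run (code (Unary.mk n, code (P n).Δ, code k, Unary.mk z))).bind fun o =>
      (U.T.setup n (P n).Δ (U.τ.S n)).bind fun hk =>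
      (unifBits z).bind fun b =>
      (U.T.gen (mix b (toMsgs z o.1.fst) (toMsgs z o.1.snd.fst)) hk.1 hk.2).bind fun p =>
      (A.second.run (code (hk.1, p, U.solverAux P n keys o.1))).map fun o' =>
        ⟨(∀ i, (toMsgs z o.1.fst i).length = (toMsgs z o.1.snd.fst i).length) ∧
          ∃ k : Fin z, (k : ℕ) = o'.1.snd.toNat ∧ j ≤ k ∧ o'.1.fst.toBool = b k, o.2, o'.2⟩ := by
  simp only [DTLP.solverExp, edTLP, PMF.bind_eq, PMF.pure_eq, PMF.bind_bind, PMF.pure_bind]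
  rfl

theorem privacyExp_eq (Δ : ℕ → Fin z → ℕ) (j : Fin z) (A : TwoStage) (n : ℕ) :
    U.T.privacyExp Δ U.τ.S j A n =
      (U.T.setup n (Δ n) (U.τ.S n)).bind fun hk =>
      (A.first.run (code (Unary.mk n, Unary.mk z))).bind fun o =>
      (unifBits z).bind fun b =>
      (U.T.gen (mix b (toMsgs z o.1.fst) (toMsgs z o.1.snd.fst)) hk.1 hk.2).bind fun p =>
      (A.second.run (code (hk.1, p, o.1.snd.snd))).map fun o' =>
        ⟨(∀ i, (toMsgs z o.1.fst i).length = (toMsgs z o.1.snd.fst i).length) ∧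
          ∃ k : Fin z, (k : ℕ) = o'.1.snd.toNat ∧ j ≤ k ∧ o'.1.fst.toBool = b k, o.2, o'.2⟩ := rfl

/-- The second stage is kept as it is, for it has no time to spare. The first stage of the reduction
samples the accounts and the client's key and appends to the state all that the solver expects to
see; none of this depends on the puzzles. -/
theorem solver_private (hT : U.T.Private U.τ) (hP : DTLP.EfficientParams P) (j : Fin z)
    (A : TwoStage) (hA : (U.D.solverExp U.G U.B U.τ.S P j A).FirstPPT)
    (hB : U.τ.Bounds (fun n => (P n).Δ) j (U.D.solverExp U.G U.B U.τ.S P j A)) :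
    (U.D.solverExp U.G U.B U.τ.S P j A).CannotGuess := by
  let Dz : Dom (Unary × Unary) := ⟨fun n x => x = (⟨n⟩, ⟨z⟩), 2 * .X + 2 * .C z + 3, by
    rintro n _ rfl; simp; omega⟩
  have hfirst : PolyOn Dz (U.solverFirst P A.first) := by
    have hn : PolyFun Dz fun x => x.1 := PolyFun.id.fst
    refine PolyOn.bind₂ (U.accounts_poly hn) ?_
    have hk : PolyOn (Dz.ext (U.accounts_poly hn)) fun x => U.E.keyGen x.1.1.val :=
      PolyFun.polyTime_comp (g := fun n : Unary => U.E.keyGen n.val) U.hE.1 hn.up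
    refine PolyOn.bind₂ hk ?_
    have hin : PolyFun (Dom.ext _ hk) fun x => code (x.1.1.1, code (P x.1.1.1.val).Δ, code x.2,
        x.1.1.2) :=
      (hn.up.up.pair ((Δ_poly hP hn.up.up).coded.pair (PolyFun.id.snd.coded.pair
        PolyFun.id.fst.fst.snd))).coded
    have hout : PolyOn (Dom.ext _ hk) fun x => A.first.out (code (x.1.1.1, code (P x.1.1.1.val).Δ,
        code x.2, x.1.1.2)) := by
      obtain ⟨q, hq⟩ := hA
      refine PolyFun.bind (E := Dom.map _ hin) hin (PolyOn.of_workLe A.first q ?_)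
        fun n a ha => ⟨a, ha, rfl⟩
      rintro n _ ⟨⟨⟨_, keys⟩, k⟩, ⟨⟨rfl, h1⟩, h2⟩, rfl⟩ o ho
      -- The adversary's work is bounded by assumption only in complete runs of its experiment.
      -- Distributions have nonempty support, so a run of the first stage can be continued to a
      -- complete one.
      obtain ⟨hk, hhk⟩ := PMF.exists_mem_support (U.T.setup n (P n).Δ (U.τ.S n))
      obtain ⟨b, hb⟩ := PMF.exists_mem_support (unifBits z)
      obtain ⟨p, hp⟩ := PMF.exists_mem_support
        (U.T.gen (mix b (toMsgs z o.1.fst) (toMsgs z o.1.snd.fst)) hk.1 hk.2)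
      obtain ⟨o', ho'⟩ := PMF.exists_mem_support
        (A.second.run (code (hk.1, p, U.solverAux P n keys o.1)))
      have hmem : ∃ w, (⟨w, o.2, o'.2⟩ : Outcome) ∈
          (U.D.solverExp U.G U.B U.τ.S P j A n).support := by
        rw [solverExp_eq]
        simp only [PMF.mem_support_bind, PMF.mem_support_map]
        exact ⟨_, keys, h1, k, h2, o, ho, hk, hhk, b, hb, p, hp, o', ho', rfl⟩
      exact hq n _ hmem.choose_spec
    refine PolyOn.map hout ?_
    have ho : PolyFun (Dom.ext _ hout) fun x => x.2 := PolyFun.id.snd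
    have hn' := hn.up (hg := U.accounts_poly hn) |>.up (hg := hk) |>.up (hg := hout)
    have hkeys : PolyFun (Dom.ext _ hout) fun x => x.1.1.2 := PolyFun.id.fst.fst.snd
    have hp := params_poly hP hn'
    refine ho.dfst.dcons (ho.dsnd.dfst.dcons (PolyFun.coded ?_))
    exact ho.dsnd.dsnd.pair ((Δ_poly hP hn').coded.pair ((U.Ψ_poly hP hn').pair
      ((Δ_poly hP hn').pair ((hkeys.party .HS).fst.pair ((U.adr_poly hP hn' hkeys).pair
      (hp.snd.snd.fst.pair (hp.fst.pair hp.snd.snd.snd.fst)))))))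
  obtain ⟨p, q, hp⟩ := hfirst
  let A' : TwoStage := ⟨p, A.second⟩
  have hmem : ∀ n, Dz.mem n (Unary.mk n, Unary.mk z) := fun n => rfl
  have hwin : ∀ n, (U.T.privacyExp (fun n => (P n).Δ) U.τ.S j A').winProb n =
      (U.D.solverExp U.G U.B U.τ.S P j A).winProb n := by
    intro n
    apply Experiment.winProb_congr
    rw [solverExp_eq, privacyExp_eq]
    simp only [PMF.map_bind, PMF.map_comp, Function.comp_def]
    -- The puzzle experiment draws the keys before the first stage runs; as the first stage does not
    -- see them, the order is immaterial.
    rw [PMF.bind_comm]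
    have e := Prog.run_bind (ε := Prop) p (code (Unary.mk n, Unary.mk z)) fun o =>
      (U.T.setup n (P n).Δ (U.τ.S n)).bind fun hk => (unifBits z).bind fun b =>
      (U.T.gen (mix b (toMsgs z o.fst) (toMsgs z o.snd.fst)) hk.1 hk.2).bind fun p =>
      (A.second.run (code (hk.1, p, o.snd.snd))).map fun o' =>
        ((∀ i, (toMsgs z o.fst i).length = (toMsgs z o.snd.fst i).length) ∧
          ∃ k : Fin z, (k : ℕ) = o'.1.snd.toNat ∧ j ≤ k ∧ o'.1.fst.toBool = b k)
    refine e.trans ?_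
    rw [(hp n _ (hmem n)).1, PMF.bind_map]
    simp only [solverFirst, PMF.bind_bind, PMF.bind_map, Function.comp_def]
    refine congrArg _ (funext fun keys => congrArg _ (funext fun k => ?_))
    rw [← Prog.run_bind]
    rfl
  have h1 : (U.T.privacyExp (fun n => (P n).Δ) U.τ.S j A').FirstPPT := by
    refine ⟨q, fun n o ho => ?_⟩
    rw [privacyExp_eq] at ho
    simp only [PMF.mem_support_bind, PMF.mem_support_map] at ho
    obtain ⟨hk, -, o₁, ho₁, b, -, p', -, o', -, rfl⟩ := ho
    exact (hp n _ (hmem n)).2 o₁ ho₁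
  have h2 : U.τ.Bounds (fun n => (P n).Δ) j (U.T.privacyExp (fun n => (P n).Δ) U.τ.S j A') := by
    intro n o ho
    rw [privacyExp_eq] at ho
    simp only [PMF.mem_support_bind, PMF.mem_support_map] at ho
    obtain ⟨hk, hhk, o₁, ho₁, b, hb, p', hp', o', ho', rfl⟩ := ho
    -- The output of the new first stage is traced back to accounts, a key and a run of the original
    -- first stage. Together with the rest of the run this is a run of the solver's experiment, in
    -- which the limits for the second stage are known.
    have h1 := Prog.mem_out ho₁
    rw [show A'.first = p from rfl, (hp n _ (hmem n)).1] at h1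
    simp only [solverFirst, PMF.mem_support_bind, PMF.mem_support_map] at h1
    obtain ⟨_, ⟨keys, hkeys, k, hk', o₂, ho₂, rfl⟩, h2⟩ := h1
    obtain ⟨o₂, ho₂', rfl⟩ := Prog.mem_out_iff.1 ho₂
    rw [← h2] at hp' ho'
    have hmem : ∃ w, (⟨w, o₂.2, o'.2⟩ : Outcome) ∈
        (U.D.solverExp U.G U.B U.τ.S P j A n).support := by
      rw [solverExp_eq]
      simp only [PMF.mem_support_bind, PMF.mem_support_map]
      exact ⟨_, keys, hkeys, k, hk', o₂, ho₂', hk, hhk, b, hb, p', hp', o', ho', rfl⟩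
    exact (hB n _ hmem.choose_spec :)
  obtain ⟨μ, hμ, h⟩ := hT (fun n => (P n).Δ) (efficientTimes hP) j A' h1 h2
  exact ⟨μ, hμ, fun n => (hwin n).symm.le.trans (h n)⟩

end Setting

end

section

/-! ## Probabilities -/

/-- If the adversary tosses a coin unless the outcome is good, then its advantage is the advantage
on the good outcomes. -/
theorem coin_unless_good (X : PMF (Bool × Bool × Bool)) :
    ((X.bind fun x => if x.1 = true then PMF.pure (x.2.1 = x.2.2)
        else (PMF.uniformOfFintype Bool).map fun c => c = x.2.2).toOuterMeasure {p | p}).toReal =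
      (X.toOuterMeasure {x | x.1 = true ∧ x.2.1 = x.2.2}).toReal +
        (1 - (X.toOuterMeasure {x | x.1 = true}).toReal) / 2 := by
  have hX : ∑ x, (X x).toReal = 1 := by
    rw [← ENNReal.toReal_sum fun x _ => X.apply_ne_top x, ← tsum_fintype (L := .unconditional _), X.tsum_coe]; rfl
  have h1 : ∀ S : Set (Bool × Bool × Bool), (X.toOuterMeasure S).toReal =
      ∑ x, S.indicator (fun x => (X x).toReal) x := by
    intro S
    rw [PMF.toOuterMeasure_apply_fintype, ENNReal.toReal_sum]
    · refine Finset.sum_congr rfl fun x _ => ?_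
      by_cases hx : x ∈ S <;> simp [hx]
    · intro x _
      by_cases hx : x ∈ S <;> simp [hx, X.apply_ne_top x]
  have hc : ∀ t : Bool, ((PMF.uniformOfFintype Bool).map fun c => c = t).toOuterMeasure {p | p} =
      2⁻¹ := by
    intro t
    rw [PMF.toOuterMeasure_map_apply, PMF.toOuterMeasure_apply_fintype]
    cases t <;> simp [Set.indicator]
  rw [PMF.toOuterMeasure_bind_apply, tsum_fintype, ENNReal.toReal_sum, h1, h1, ← hX]
  · simp only [ENNReal.toReal_mul, Fintype.sum_prod_type, Fintype.sum_bool, Set.indicator,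
      Set.mem_setOf_eq]
    simp [hc, PMF.toOuterMeasure_pure_apply]
    ring
  · intro x _
    refine ENNReal.mul_ne_top (X.apply_ne_top x) ?_
    split_ifs
    · rw [PMF.toOuterMeasure_pure_apply]; split_ifs <;> simp
    · rw [hc]; simp

theorem PMF.toOuterMeasure_le_one {α : Type} (p : PMF α) (s : Set α) : p.toOuterMeasure s ≤ 1 := by
  rw [PMF.toOuterMeasure_apply, ← p.tsum_coe]
  exact ENNReal.tsum_le_tsum fun a => Set.indicator_le_self' (fun _ _ => zero_le') a

theorem PMF.toOuterMeasure_ne_top {α : Type} (p : PMF α) (s : Set α) : p.toOuterMeasure s ≠ ⊤ :=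
  ((PMF.toOuterMeasure_le_one p s).trans_lt (by simp)).ne

/-- A vector of uniform bits may be drawn in two parts. -/
theorem drawVec_update {α : Type} {k : ℕ} (f : Fin k → PMF α) (i : Fin k) :
    ((f i).bind fun a => (drawVec k f).map fun v => Function.update v i a) = drawVec k f := by
  induction k with
  | zero => exact i.elim0
  | succ k ih =>
    simp only [drawVec, PMF.bind_eq, PMF.pure_eq, PMF.map_bind, PMF.pure_map]
    cases i using Fin.cases with
    | zero =>
      simp only [Fin.update_cons_zero, PMF.bind_const]
    | succ i =>
      rw [PMF.bind_comm]
      refine congrArg _ (funext fun a => ?_)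
      simp only [← Fin.cons_update]
      have := ih (fun i => f i.succ) i
      conv_rhs => rw [← this]
      simp only [PMF.bind_bind, PMF.map, PMF.pure_bind, Function.comp_def]

variable {z : ℕ}

namespace PolyFun

variable {γ : Type} [Coded γ] {D : Dom γ}

theorem length {α : Type} [Coded α] {l : γ → List α} (hl : PolyFun D l) :
    PolyFun D fun g => (l g).length := by
  obtain ⟨q, hq⟩ := hl.bound
  let E : Dom (Data × Data) := ⟨fun n x => x.1 = .nil ∧ x.2.size ≤ q.eval n, q + 2, by
    rintro n ⟨a, b⟩ ⟨rfl, h⟩; simp at *; omega⟩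
  have h := listMap (f := fun _ : Data × Data => Data.nil) hl.coded.toList (const Data.nil) (E := E)
    (const _) fun n g hg a ha => ⟨rfl, (Data.size_mem_toList _ a ha).trans (hq n g hg)⟩
  have h2 : PolyFun D fun g => (⟨(l g).length⟩ : Unary) := h.of_code fun n g _ => by
    simp [code_unary, code_list, Function.comp_def]
  exact unaryToNat h2

theorem toMsgs {d : γ → Data} (hd : PolyFun D d) : PolyFun D fun g => toMsgs z (d g) :=
  vec fun i => (hd.dnth i).toBits

end PolyFun

namespace Setting

variable (U : Setting z)

/-- The solutions, unless the server's helper rejects the conditions. -/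
def sol (n : ℕ) (P : DTLP.Params z) (pk : Data) (p : Fin z → Data) : Option (Fin z → Data) :=
  if (∀ j, P.coins' j ≤ P.coins j) ∧ ∀ j, P.Ψ' j ≤ U.Ψ n P j then some (U.T.solve pk p).1 else none

variable {P : ℕ → DTLP.Params z} {γ : Type} [Coded γ] {D : Dom γ} {n : γ → Unary}

theorem sol_poly (hP : DTLP.EfficientParams P) (hn : PolyFun D n) {pk : γ → Data}
    {p : γ → Fin z → Data} (hpk : PolyFun D pk) (hp : PolyFun D p) :
    PolyFun D fun g => U.sol (n g).val (P (n g).val) (pk g) (p g) := by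
  have h := params_poly hP hn
  have hΨ := U.Ψ_poly hP hn
  have h1 : PolyFun D fun g => decide (∀ j, (P (n g).val).coins' j ≤ (P (n g).val).coins j) :=
    PolyFun.decideAll fun j =>
      (h.snd.snd.snd.snd.snd.fst.app j).le (h.snd.snd.snd.snd.fst.app j)
  have h2 : PolyFun D fun g => decide (∀ j, (P (n g).val).Ψ' j ≤ U.Ψ (n g).val (P (n g).val) j) :=
    PolyFun.decideAll fun j => (h.snd.snd.snd.snd.snd.snd.app j).le (hΨ.app j)
  have h3 : PolyFun D fun g => some (U.T.solve (pk g) (p g)).1 :=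
    (PolyFun.polyTime_comp_pure (g := fun x : Data × (Fin z → Data) => U.T.solve x.1 x.2)
      U.hT.2.2.1 (hpk.pair hp)).fst.some
  refine (PolyFun.ite (h1.and h2) (h3.restrict _) (PolyFun.const none)).congr fun m g _ => ?_
  simp only [sol, Bool.and_eq_true, decide_eq_true_eq]

theorem gen_poly {m : γ → Fin z → Bits} {pk sk : γ → Data} (hm : PolyFun D m) (hpk : PolyFun D pk)
    (hsk : PolyFun D sk) : PolyOn D fun g => U.T.gen (m g) (pk g) (sk g) :=
  PolyFun.polyTime_comp (g := fun x : (Fin z → Bits) × Data × Data => U.T.gen x.1 x.2.1 x.2.2)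
    U.hT.2.1 (hm.pair (hpk.pair hsk))

end Setting

end

section

/-- A domain with an additional condition. -/
def Dom.restrict' {α : Type} [Coded α] (D : Dom α) (P : ℕ → α → Prop) : Dom α :=
  ⟨fun n a => D.mem n a ∧ P n a, D.bound.imp fun _ h n a ha => h n a ha.1⟩

/-! ## Oracles with parameters, and batches of queries -/

section Param

variable {Θ W : Type}

/-- An oracle with a parameter, which becomes a part of the state. -/
def withParam (h : Θ → W → Data → PMF (Data × W)) (x : Θ × W) (q : Data) : PMF (Data × Θ × W) :=
  (h x.1 x.2 q).map fun r => (r.1, x.1, r.2)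

/-- A reduction must be one program for all values of a secret key that is drawn in the experiment.
Moving the key into the state of the environment reduces this to a single fixed oracle. -/
theorem Interactive.play_withParam (A : Interactive) (h : Θ → W → Data → PMF (Data × W)) (p : Θ)
    (k : ℕ) (st rep : Data) (w : W) (c : Cost) : A.play (withParam h) k st rep (p, w) c =
      (A.play (h p) k st rep w c).map fun o => (o.1, (p, o.2.1), o.2.2) := by
  induction k generalizing st rep w c with
  | zero => simp [play, PMF.pure_eq, PMF.pure_map]
  | succ k ih =>
    simp only [play, withParam, PMF.bind_eq, PMF.map_bind, PMF.bind_map, Function.comp_def, ih]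

variable {ι S M O : Type} [Coded ι] [Coded S] [Coded M] [Coded O]

theorem redStep_withParam (pre : S → PMF (M × Data)) (post : M × Data → PMF S)
    (h : Θ → W → Data → PMF (Data × W)) (p : Θ) (k : ℕ) (s : S) (w : W) :
    iterK (redStep pre post (withParam h)) k (s, p, w) =
      (iterK (redStep pre post (h p)) k (s, w)).map fun x => (x.1, p, x.2) := by
  refine iterK_map (fun x : S × W => (x.1, p, x.2)) (fun _ _ => True) (fun _ _ _ _ _ => trivial)
    (fun _ x _ => ?_) k (s, w) trivial
  simp only [redStep, withParam, PMF.map_bind, PMF.bind_map, Function.comp_def, PMF.map_comp]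

/-- `exists_interactive` for an oracle with a parameter. -/
theorem exists_interactive_param (h : Θ → W → Data → PMF (Data × W))
    (hnil : ∀ p w, h p w .nil = PMF.pure (.nil, w))
    (T : Polynomial ℕ) (I : ℕ → ι → Θ → W → Prop) {Dι : Dom ι} (hI : ∀ n i p w, I n i p w → Dι.mem n i)
    {num : ι → Unary} (hnum : PolyFun Dι num) (hnum' : ∀ n i p w, I n i p w → (num i).val = n)
    (tag : ∀ n i p w, I n i p w → (code i).fst.fst = .nil)
    {f₀ : ι → PMF S} (h₀ : PolyOn Dι f₀)
    {pre : S → PMF (M × Data)} {Dpre : Dom S} (hpre : PolyOn Dpre pre)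
    {post : M × Data → PMF S} {Dpost : Dom (M × Data)} (hpost : PolyOn Dpost post)
    {fin : S → PMF O} {Dfin : Dom S} (hfin : PolyOn Dfin fin)
    (Inv : ℕ → ℕ → S → Θ → W → Prop)
    (hInit : ∀ n i p w, I n i p w → ∀ s ∈ (f₀ i).support, Inv n (T.eval n) s p w)
    (hStep : ∀ n k s p w, k < T.eval n → Inv n (k + 1) s p w → Dpre.mem n s ∧
      ∀ mq ∈ (pre s).support, ∀ r ∈ (h p w mq.2).support, Dpost.mem n (mq.1, r.1) ∧
        ∀ s' ∈ (post (mq.1, r.1)).support, Inv n k s' p r.2)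
    (hEnd : ∀ n s p w, Inv n 0 s p w → Dfin.mem n s) :
    ∃ A : Interactive,
      (∃ q : Polynomial ℕ, ∀ n i p w, I n i p w →
        ∀ o ∈ (A.run (h p) n (code i) .nil w).support, o.2.2.work ≤ q.eval n) ∧
      ∀ n i p w, I n i p w → (A.run (h p) n (code i) .nil w).map (fun o => (o.1, o.2.1)) =
        (f₀ i).bind fun s => (iterK (redStep pre post (h p)) (T.eval n) (s, w)).bind fun x =>
          (fin x.1).map fun o => (code o, x.2) := by
  obtain ⟨A, ⟨q, hq⟩, hA⟩ := exists_interactive (withParam h)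
    (fun x => by simp only [withParam, hnil, PMF.pure_map]) T (fun n i x => I n i x.1 x.2)
    (fun n i x => hI n i x.1 x.2) hnum (fun n i x => hnum' n i x.1 x.2)
    (fun n i x => tag n i x.1 x.2) h₀ hpre hpost hfin (fun n k s x => Inv n k s x.1 x.2)
    (fun n i x => hInit n i x.1 x.2) (fun n k s x hk hs => by
      obtain ⟨h1, h2⟩ := hStep n k s x.1 x.2 hk hs
      refine ⟨h1, fun mq hmq r hr => ?_⟩
      obtain ⟨r', hr', rfl⟩ := PMF.mem_support_map.1 hr
      exact h2 mq hmq r' hr') (fun n s x => hEnd n s x.1 x.2)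
  refine ⟨A, ⟨q, fun n i p w hi o ho => ?_⟩, fun n i p w hi => ?_⟩
  · refine hq n i (p, w) hi (o.1, (p, o.2.1), o.2.2) ?_
    rw [Interactive.run, A.play_withParam]
    exact PMF.mem_support_map.2 ⟨o, ho, rfl⟩
  · have := congrArg (PMF.map fun o : Data × Θ × W => (o.1, o.2.2)) (hA n i (p, w) hi)
    simpa only [Interactive.run, A.play_withParam, PMF.map_comp, Function.comp_def, PMF.map_bind,
      redStep_withParam, PMF.bind_map] using this

end Param

section Batch

variable {C Θ W O : Type} [Coded C] [Coded O]

/-- The state of a reduction that asks a list of queries: context, pending queries, and the replies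
in reversed order. -/
abbrev Batch (C : Type) : Type := C × List Data × List Data

namespace Batch

def pre (s : Batch C) : PMF (Batch C × Data) := PMF.pure ((s.1, s.2.1.tail, s.2.2), s.2.1.headI)

def post (x : Batch C × Data) : PMF (Batch C) := PMF.pure (x.1.1, x.1.2.1, x.2 :: x.1.2.2)

theorem pre_poly (D : Dom (Batch C)) : PolyOn D pre := by
  have h : PolyFun D fun s => s.2.1.headI :=
    (PolyFun.id.snd.fst.coded.dfst).of_code fun n s _ => by cases h : s.2.1 <;> rfl
  exact ((PolyFun.id.fst.pair (PolyFun.id.snd.fst.tail.pair PolyFun.id.snd.snd)).pair h : PolyFun D _)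

theorem post_poly (D : Dom (Batch C × Data)) : PolyOn D post :=
  (PolyFun.id.fst.fst.pair (PolyFun.id.fst.snd.fst.pair (PolyFun.id.snd.cons PolyFun.id.fst.snd.snd)) :
    PolyFun D _)

/-- If the states of the oracle follow a predetermined path `wd`, then the answers are independent
draws. The replies pile up in reverse order. -/
theorem iterK_eq {α : Type} [Coded α] (h : W → Data → PMF (Data × W)) {k : ℕ} (q : Fin k → Data)
    (dist : Fin k → PMF α) (wd : ℕ → W)
    (hh : ∀ i : Fin k, h (wd i) (q i) = (dist i).map fun c => (code c, wd (i + 1))) (c : C)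
    (acc : List Data) : iterK (redStep pre post h) k ((c, List.ofFn q, acc), wd 0) =
      (drawVec k dist).map fun v =>
        ((c, [], (List.ofFn fun i => code (v i)).reverse ++ acc), wd k) := by
  induction k generalizing wd acc with
  | zero => simp [iterK, drawVec, PMF.pure_eq, PMF.pure_map]
  | succ k ih =>
    have h0 := hh 0
    simp only [Fin.val_zero, Nat.zero_add] at h0
    have := fun acc => ih (fun i => q i.succ) (fun i => dist i.succ) (fun i => wd (i + 1))
      (fun i => by simpa using hh i.succ) acc
    simp only [Nat.zero_add] at this
    simp only [iterK, redStep, pre, post, PMF.pure_bind, PMF.pure_map, List.ofFn_succ,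
      List.headI_cons, List.tail_cons, h0, PMF.bind_map, PMF.bind_bind, Function.comp_def,
      this, drawVec, PMF.bind_eq, PMF.pure_eq, PMF.map_bind, PMF.map]
    simp [Function.comp_def]

/-- A reduction that asks a bounded number of queries at once. -/
theorem exists_interactive (h : Θ → W → Data → PMF (Data × W))
    (hnil : ∀ p w, h p w .nil = PMF.pure (.nil, w)) (z : ℕ) (I : ℕ → Θ → W → Prop)
    {D : Dom Unary} (hD : ∀ n m, D.mem n m ↔ m = ⟨n⟩)
    (hR : ∀ Q : Polynomial ℕ, ∃ R : Polynomial ℕ, ∀ n p w₀ w q, I n p w₀ → q.size ≤ Q.eval n →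
      ∀ r ∈ (h p w q).support, r.1.size ≤ R.eval n)
    {f₀ : Unary → PMF (C × List Data)} (h₀ : PolyOn D f₀)
    {fin : Batch C → PMF O} (F : ℕ → Batch C → Prop)
    (hfin : ∀ E : Dom (Batch C), (∀ n s, E.mem n s → F n s) → PolyOn E fin)
    (hEnd : ∀ n p w, I n p w → ∀ x ∈ (f₀ ⟨n⟩).support,
      ∀ y ∈ (iterK (redStep pre post (h p)) z ((x.1, x.2, []), w)).support, F n y.1) :
    ∃ A : Interactive,
      (∃ q : Polynomial ℕ, ∀ n p w, I n p w →
        ∀ o ∈ (A.run (h p) n (code (Unary.mk n)) .nil w).support, o.2.2.work ≤ q.eval n) ∧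
      ∀ n p w, I n p w → (A.run (h p) n (code (Unary.mk n)) .nil w).map (fun o => (o.1, o.2.1)) =
        (f₀ ⟨n⟩).bind fun x => (iterK (redStep pre post (h p)) z ((x.1, x.2, []), w)).bind fun y =>
          (fin y.1).map fun o => (code o, y.2) := by
  obtain ⟨Q, hQ⟩ := h₀.exists_bound
  obtain ⟨R, hR⟩ := hR Q
  have hQ' : ∀ n, ∀ x ∈ (f₀ ⟨n⟩).support, (code x.1).size ≤ Q.eval n ∧ (code x.2).size ≤ Q.eval n := by
    intro n x hx
    have := hQ n ⟨n⟩ ((hD n _).2 rfl) x hx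
    simp at this
    omega
  let Dpre : Dom (Batch C) := ⟨fun n s => (code s.1).size ≤ Q.eval n ∧ (code s.2.1).size ≤ Q.eval n ∧
    (code s.2.2).size ≤ z * (R.eval n + 1) + 1, 2 * Q + .C z * (R + 1) + 3, by
    rintro n ⟨c, p, a⟩ ⟨h1, h2, h3⟩; simp at *; omega⟩
  let Dpost : Dom (Batch C × Data) := ⟨fun n s => (code s.1.1).size ≤ Q.eval n ∧
    (code s.1.2.1).size ≤ Q.eval n ∧
    (code s.1.2.2).size ≤ z * (R.eval n + 1) + 1 ∧ s.2.size ≤ R.eval n,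
    2 * Q + .C z * (R + 1) + 4 + R, by
    rintro n ⟨⟨c, p, a⟩, r⟩ ⟨h1, h2, h3, h4⟩; simp at *; omega⟩
  have h₀' : PolyOn D fun m => (f₀ m).map fun x => (x.1, x.2, ([] : List Data)) :=
    PolyOn.map h₀ (PolyFun.id.snd.fst.pair (PolyFun.id.snd.snd.pair (PolyFun.const [])))
  have key := exists_interactive_param h hnil (.C z) (fun n i p w => i = ⟨n⟩ ∧ I n p w)
    (fun n i p w hi => (hD n i).2 hi.1) (num := fun i => i) PolyFun.id
    (fun n i p w hi => by rw [hi.1]) (fun n i p w hi => by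
      cases i with | mk v => cases v <;> simp [code_unary, Data.ofList, List.replicate_succ])
    h₀' (pre_poly Dpre) (post_poly Dpost) (hfin (Dpre.restrict' F) fun n s hs => hs.2)
    -- After `z - k` queries the collected replies occupy at most `z - k` times `R + 1`, beyond the
    -- final `nil`. Reachability from the start is kept as well, since the condition on the final
    -- computation is stated for reachable states.
    (fun n k s p w => k ≤ z ∧ (∃ x ∈ (f₀ ⟨n⟩).support, ∃ w₀, I n p w₀ ∧
      (s, w) ∈ (iterK (redStep pre post (h p)) (z - k) ((x.1, x.2, []), w₀)).support) ∧
      (code s.1).size ≤ Q.eval n ∧ (code s.2.1).size ≤ Q.eval n ∧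
      (code s.2.2).size ≤ (z - k) * (R.eval n + 1) + 1)
    ?_ ?_ ?_
  · obtain ⟨A, hA, hA'⟩ := key
    refine ⟨A, hA.imp fun q hq n p w hp => hq n _ p w ⟨rfl, hp⟩, fun n p w hp => ?_⟩
    rw [hA' n _ p w ⟨rfl, hp⟩]
    simp only [PMF.bind_map, Function.comp_def, Polynomial.eval_C]
  · rintro n _ p w ⟨rfl, hp⟩ s hs
    obtain ⟨x, hx, rfl⟩ := PMF.mem_support_map.1 hs
    obtain ⟨h1, h2⟩ := hQ' n x hx
    refine ⟨by simp, ⟨x, hx, w, hp, ?_⟩, h1, h2, by simp⟩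
    simp [iterK]
  · rintro n k ⟨c, pe, a⟩ p w hk ⟨hkz, ⟨x, hx, w₀, hp, hr⟩, h1, h2, h3⟩
    simp only at h1 h2 h3
    have hz : z - k = (z - (k + 1)) + 1 := by omega
    refine ⟨⟨h1, h2, h3.trans ?_⟩, ?_⟩
    · have := Nat.mul_le_mul_right (R.eval n + 1) (show z - (k + 1) ≤ z by omega)
      omega
    intro mq hmq r hr'
    simp only [pre, PMF.mem_support_pure] at hmq
    subst hmq
    have hhead : (pe.headI).size ≤ Q.eval n := by
      refine le_trans ?_ h2
      cases pe with
      | nil => simp [List.headI, default]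
      | cons d l => simp [show code d = d from rfl]; omega
    have htail : (code pe.tail).size ≤ Q.eval n := (code_size_tail_le pe).trans h2
    have hrr := hR n p w₀ w _ hp hhead r hr'
    refine ⟨⟨h1, htail, h3.trans ?_, hrr⟩, ?_⟩
    · have := Nat.mul_le_mul_right (R.eval n + 1) (show z - (k + 1) ≤ z by omega)
      omega
    intro s' hs'
    refine ⟨by omega, ⟨x, hx, w₀, hp, ?_⟩, ?_⟩
    · rw [hz, iterK_add, PMF.mem_support_bind]
      refine ⟨_, hr, ?_⟩
      simp only [iterK, PMF.bind_pure, redStep, pre, PMF.pure_bind, PMF.mem_support_bind,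
        PMF.mem_support_map]
      exact ⟨r, hr', s', hs', rfl⟩
    · simp only [post, PMF.mem_support_pure] at hs'
      subst hs'
      refine ⟨h1, htail, ?_⟩
      rw [hz]
      simp [show code r.1 = r.1 from rfl] at h3 ⊢
      nlinarith
  · rintro n ⟨c, pe, a⟩ p w ⟨hkz, ⟨x, hx, w₀, hp, hr⟩, h1, h2, h3⟩
    exact ⟨⟨h1, h2, by simpa using h3⟩, hEnd n p w₀ hp x hx _ hr⟩

end Batch

end Batch

end

section

/-! ## Privacy against the helpers -/

theorem uniformBool_true_mem (b : Bool) : b ∈ (PMF.uniformOfFintype Bool).support := by simp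

theorem unifBits_mem {k : ℕ} (b : Fin k → Bool) : b ∈ (unifBits k).support :=
  mem_drawVec.2 fun i => uniformBool_true_mem (b i)

namespace Setting

variable {z : ℕ} (U : Setting z) (P : ℕ → DTLP.Params z)

/-- The input of the helper's second stage. -/
def helperInput (n : ℕ) (keys : Keys) (o : Data) (e : Fin z → Bits) (pk : Data)
    (p : (Fin z → Data) × (Fin z → Data)) : Data :=
  code (pk, code (P n).Δ, (toMsgs z o.fst, toMsgs z o.snd.fst), e, o.snd.snd, (P n).t₀,
    ((P n).toc, (P n).aux, U.Ψ n (P n), (P n).Δ), U.sol n (P n) pk p.1, p, (P n).coins,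
    (keys .HS).1, (U.contract n (P n) keys).adr)

theorem helperExp_eq (A : TwoStage) (n : ℕ) : U.D.helperExp U.G U.B U.τ.S P A n =
    (DTLP.accounts U.G n).bind fun keys => (U.E.keyGen n).bind fun k =>
      (A.first.run (code (Unary.mk n, code (P n).Δ, Unary.mk z))).bind fun o =>
      (unifBits z).bind fun b =>
      (drawVec z fun i => U.E.enc k (mix b (toMsgs z o.1.fst) (toMsgs z o.1.snd.fst) i)).bind fun e =>
      (U.T.setup n (P n).Δ (U.τ.S n)).bind fun hk =>
      (U.T.gen e hk.1 hk.2).bind fun p =>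
      (A.second.run (U.helperInput P n keys o.1 e hk.1 p)).map fun o' =>
        ⟨(∀ i, (toMsgs z o.1.fst i).length = (toMsgs z o.1.snd.fst i).length) ∧
          ∃ k : Fin z, (k : ℕ) = o'.1.snd.toNat ∧ o'.1.fst.toBool = b k, o.2, o'.2⟩ := by
  simp only [DTLP.helperExp, edTLP, PMF.bind_eq, PMF.pure_eq, PMF.bind_bind, PMF.pure_bind,
    toBits_code]
  rfl

/-- Whether the lengths of the messages agree. -/
def lengthsAgree (z : ℕ) (o : Data) : Bool :=
  decide (∀ i : Fin z, (toMsgs z o.fst i).length = (toMsgs z o.snd.fst i).length)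

theorem lengthsAgree_poly {γ : Type} [Coded γ] {D : Dom γ} {o : γ → Data} (ho : PolyFun D o) :
    PolyFun D fun g => lengthsAgree z (o g) :=
  PolyFun.decideAll fun i => PolyFun.natEq (PolyFun.length ((PolyFun.toMsgs ho.dfst).app i))
    (PolyFun.length ((PolyFun.toMsgs ho.dsnd.dfst).app i))

/-- What the reduction remembers: the security parameter, the accounts, the output of the first
stage, and random bits. -/
abbrev CPAContext (z : ℕ) : Type := Unary × Keys × Data × (Fin z → Bool)

/-- The queries: the `κ`-th one is the challenge. -/
def cpaQuery (κ : Fin z) (c : CPAContext z) (i : Fin z) : Data :=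
  if i = κ then .cons (.cons .nil .nil) (.cons (code (toMsgs z c.2.2.1.fst i))
    (code (toMsgs z c.2.2.1.snd.fst i)))
  else .cons .nil (code (mix c.2.2.2 (toMsgs z c.2.2.1.fst) (toMsgs z c.2.2.1.snd.fst) i))

/-- If the lengths disagree, then the helper cannot win and the challenge might be refused. In this
case no queries are asked; `headI` of the empty list gives `nil`, which the oracle ignores. -/
def cpaFirst (A : TwoStage) (κ : Fin z) (n : Unary) : PMF (CPAContext z × List Data) :=
  (DTLP.accounts U.G n.val).bind fun keys =>
    (A.first.out (code (n, code (P n.val).Δ, Unary.mk z))).bind fun o => (unifBits z).map fun b =>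
      ((n, keys, o, b), if lengthsAgree z o = true then List.ofFn (cpaQuery κ (n, keys, o, b)) else [])

/-- Tossing a coin unless the lengths agree and the index is `κ` makes all other cases contribute
exactly one half. The second component of the output is a filler: the challenger reads the first
component only. -/
def cpaLast (A : TwoStage) (κ : Fin z) (s : Batch (CPAContext z)) : PMF (Bool × Bool) :=
  if lengthsAgree z s.1.2.2.1 = true then
    (U.T.setup s.1.1.val (P s.1.1.val).Δ (U.τ.S s.1.1.val)).bind fun hk =>
    (U.T.gen (toMsgs z (code s.2.2.reverse)) hk.1 hk.2).bind fun p =>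
    (A.second.out (U.helperInput P s.1.1.val s.1.2.1 s.1.2.2.1 (toMsgs z (code s.2.2.reverse))
      hk.1 p)).bind fun o =>
    if decide ((κ : ℕ) = o.snd.toNat) = true then PMF.pure (o.fst.toBool, false)
    else (PMF.uniformOfFintype Bool).map fun b => (b, false)
  else (PMF.uniformOfFintype Bool).map fun b => (b, false)

variable {P}

theorem cpaFirst_poly (hP : DTLP.EfficientParams P) (A : TwoStage)
    (hA : (U.D.helperExp U.G U.B U.τ.S P A).IsPPT) (κ : Fin z) {D : Dom Unary}
    (hD : ∀ n m, D.mem n m ↔ m = ⟨n⟩) : PolyOn D (U.cpaFirst P A κ) := by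
  have hn : PolyFun D fun n => n := PolyFun.id
  refine PolyOn.bind₂ (U.accounts_poly hn) ?_
  have hin : PolyFun (D.ext (U.accounts_poly hn)) fun x =>
      code (x.1, code (P x.1.val).Δ, Unary.mk z) :=
    (hn.up.pair ((Δ_poly hP hn.up).coded.pair (PolyFun.const _))).coded
  have hout : PolyOn (D.ext (U.accounts_poly hn)) fun x =>
      A.first.out (code (x.1, code (P x.1.val).Δ, Unary.mk z)) := by
    obtain ⟨q, hq⟩ := hA
    refine PolyFun.bind (E := Dom.map _ hin) hin (PolyOn.of_workLe A.first q ?_)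
      fun n a ha => ⟨a, ha, rfl⟩
    rintro n _ ⟨⟨m, keys⟩, ⟨h0, h1⟩, rfl⟩ o ho
    obtain rfl := (hD _ _).1 h0
    obtain ⟨k, hk⟩ := PMF.exists_mem_support (U.E.keyGen n)
    obtain ⟨b, hb⟩ := PMF.exists_mem_support (unifBits z)
    obtain ⟨e, he⟩ := PMF.exists_mem_support (drawVec z fun i =>
      U.E.enc k (mix b (toMsgs z o.1.fst) (toMsgs z o.1.snd.fst) i))
    obtain ⟨hk', hhk⟩ := PMF.exists_mem_support (U.T.setup n (P n).Δ (U.τ.S n))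
    obtain ⟨p, hp⟩ := PMF.exists_mem_support (U.T.gen e hk'.1 hk'.2)
    obtain ⟨o', ho'⟩ := PMF.exists_mem_support
      (A.second.run (U.helperInput P n keys o.1 e hk'.1 p))
    have hmem : ∃ w, (⟨w, o.2, o'.2⟩ : Outcome) ∈
        (U.D.helperExp U.G U.B U.τ.S P A n).support := by
      rw [helperExp_eq]
      simp only [PMF.mem_support_bind, PMF.mem_support_map]
      exact ⟨_, keys, h1, k, hk, o, ho, b, hb, e, he, hk', hhk, p, hp, o', ho', rfl⟩
    exact (Nat.le_add_right _ _).trans (hq n _ hmem.choose_spec)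
  refine PolyOn.bind₂ hout ?_
  have hb : PolyOn (Dom.ext _ hout) fun _ => unifBits z := PolyOn.drawVec fun i => PolyOn.coin
  refine PolyOn.map hb ?_
  have hc : PolyFun (Dom.ext _ hb) fun x => (x.1.1.1, x.1.1.2, x.1.2, x.2) :=
    PolyFun.id.fst.fst.fst.pair (PolyFun.id.fst.fst.snd.pair (PolyFun.id.fst.snd.pair PolyFun.id.snd))
  have ho : PolyFun (Dom.ext _ hb) fun x => x.1.2 := PolyFun.id.fst.snd
  have hq : PolyFun (Dom.ext _ hb) fun x => cpaQuery κ (x.1.1.1, x.1.1.2, x.1.2, x.2) := by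
    refine PolyFun.vec fun i => ?_
    have h0 := ((PolyFun.toMsgs (z := z) ho.dfst).app i)
    have h1 := ((PolyFun.toMsgs (z := z) ho.dsnd.dfst).app i)
    simp only [cpaQuery]
    by_cases hi : i = κ
    · simp only [hi, if_true] at h0 h1 ⊢
      exact (PolyFun.const _).dcons (h0.coded.dcons h1.coded)
    · simp only [hi, if_false]
      refine (PolyFun.const _).dcons (PolyFun.coded ?_)
      exact PolyFun.ite (PolyFun.id.snd.app i) (h1.restrict _) (h0.restrict _)
  refine hc.pair (PolyFun.ite (lengthsAgree_poly ho) ?_ (PolyFun.const _))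
  have hl : PolyFun (Dom.ext _ hb) fun x =>
      List.ofFn (cpaQuery κ (x.1.1.1, x.1.1.2, x.1.2, x.2)) := hq.coded.of_code fun _ _ _ => rfl
  exact hl.restrict _

/-- The results of the queries that the last stage of the reduction can rely on. -/
def CPAEnd (U : Setting z) (P : ℕ → DTLP.Params z) (A : TwoStage) (n : ℕ)
    (s : Batch (CPAContext z)) : Prop :=
  s.1.1.val = n ∧ s.1.2.1 ∈ (DTLP.accounts U.G n).support ∧
    s.1.2.2.1 ∈ (A.first.out (code (Unary.mk n, code (P n).Δ, Unary.mk z))).support ∧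
    (lengthsAgree z s.1.2.2.1 = true → ∃ k ∈ (U.E.keyGen n).support, ∃ b,
      toMsgs z (code s.2.2.reverse) ∈ (drawVec z fun i => U.E.enc k
        (mix b (toMsgs z s.1.2.2.1.fst) (toMsgs z s.1.2.2.1.snd.fst) i)).support)

theorem cpaLast_poly (hP : DTLP.EfficientParams P) (A : TwoStage)
    (hA : (U.D.helperExp U.G U.B U.τ.S P A).IsPPT) (κ : Fin z) (D : Dom (Batch (CPAContext z)))
    (hD : ∀ n s, D.mem n s → CPAEnd U P A n s) : PolyOn D (U.cpaLast P A κ) := by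
  have hcoin : ∀ {γ : Type} [Coded γ] {D : Dom γ}, PolyOn D fun _ =>
      (PMF.uniformOfFintype Bool).map fun b => (b, false) := fun {γ} _ {D} =>
    PolyOn.map PolyOn.coin (PolyFun.id.snd.pair (PolyFun.const _))
  have hc : PolyFun D fun s => lengthsAgree z s.1.2.2.1 := lengthsAgree_poly PolyFun.id.fst.snd.snd.fst
  refine PolyOn.ite hc ?_ hcoin
  have hn : PolyFun (D.restrict fun a => lengthsAgree z a.1.2.2.1 = true) fun s => s.1.1 := PolyFun.id.fst.fst
  have h1 := U.setup_poly hP hn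
  refine PolyOn.bind₂ h1 ?_
  have he : PolyFun (Dom.ext _ h1) fun x => toMsgs z (code x.1.2.2.reverse) :=
    PolyFun.toMsgs (PolyFun.coded PolyFun.id.fst.snd.snd.reverse)
  have h2 := U.gen_poly he PolyFun.id.snd.fst PolyFun.id.snd.snd
  refine PolyOn.bind₂ h2 ?_
  have hn' : PolyFun (Dom.ext _ h2) fun x => x.1.1.1.1 := PolyFun.id.fst.fst.fst.fst
  have hkeys : PolyFun (Dom.ext _ h2) fun x => x.1.1.1.2.1 := PolyFun.id.fst.fst.fst.snd.fst
  have hpk : PolyFun (Dom.ext _ h2) fun x => x.1.2.1 := PolyFun.id.fst.snd.fst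
  have ho : PolyFun (Dom.ext _ h2) fun x => x.1.1.1.2.2.1 := PolyFun.id.fst.fst.fst.snd.snd.fst
  have he' : PolyFun (Dom.ext _ h2) fun x => toMsgs z (code x.1.1.2.2.reverse) :=
    he.comp PolyFun.id.fst fun n a ha => ha.1
  have hp := params_poly hP hn'
  have hin : PolyFun (Dom.ext _ h2) fun x => U.helperInput P x.1.1.1.1.val x.1.1.1.2.1 x.1.1.1.2.2.1
      (toMsgs z (code x.1.1.2.2.reverse)) x.1.2.1 x.2 := by
    refine PolyFun.coded (hpk.pair ((Δ_poly hP hn').coded.pair (((PolyFun.toMsgs ho.dfst).pair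
      (PolyFun.toMsgs ho.dsnd.dfst)).pair (he'.pair (ho.dsnd.dsnd.pair (hp.snd.snd.snd.fst.pair
      ((hp.fst.pair (hp.snd.snd.fst.pair ((U.Ψ_poly hP hn').pair (Δ_poly hP hn')))).pair
      ((U.sol_poly hP hn' hpk PolyFun.id.snd.fst).pair (PolyFun.id.snd.pair
      (hp.snd.snd.snd.snd.fst.pair ((hkeys.party .HS).fst.pair (U.adr_poly hP hn' hkeys))))))))))))
  have hout : PolyOn (Dom.ext _ h2) fun x => A.second.out (U.helperInput P x.1.1.1.1.val x.1.1.1.2.1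
      x.1.1.1.2.2.1 (toMsgs z (code x.1.1.2.2.reverse)) x.1.2.1 x.2) := by
    obtain ⟨q, hq⟩ := hA
    refine PolyFun.bind (E := Dom.map _ hin) hin (PolyOn.of_workLe A.second q ?_)
      fun n a ha => ⟨a, ha, rfl⟩
    rintro n _ ⟨⟨⟨s, hk⟩, p⟩, ⟨⟨⟨h0, h1⟩, h2⟩, h3⟩, rfl⟩ o' ho'
    obtain ⟨rfl, h4, h5, h6⟩ := hD _ _ h0
    -- The ciphertexts collected from the challenger are possible ciphertexts for some bits `b`, so
    -- this is a run of the helper's own experiment and its work bound applies.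
    obtain ⟨k, hk', b, he⟩ := h6 h1
    obtain ⟨o, ho, heq⟩ := Prog.mem_out_iff.1 h5
    simp only at heq he ho' h2 h3
    rw [← heq] at he ho'
    have hmem : ∃ w, (⟨w, o.2, o'.2⟩ : Outcome) ∈
        (U.D.helperExp U.G U.B U.τ.S P A s.1.1.val).support := by
      rw [helperExp_eq]
      simp only [PMF.mem_support_bind, PMF.mem_support_map]
      exact ⟨_, _, h4, k, hk', o, ho, b, unifBits_mem b, _, he, hk, h2, p, h3, o', ho', rfl⟩
    exact (Nat.le_add_left _ _).trans (hq _ _ hmem.choose_spec)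
  refine PolyOn.bind₂ hout ?_
  have ho' : PolyFun (Dom.ext _ hout) fun x => x.2 := PolyFun.id.snd
  have h9 : PolyFun (Dom.ext _ hout) fun x => (x.2.fst.toBool, false) :=
    ho'.dfst.toBool.pair (PolyFun.const false)
  exact PolyOn.ite (PolyFun.natEq (PolyFun.const (κ : ℕ)) ho'.dsnd.toNat) (h9.restrict _) hcoin

end Setting

end

/-! ### Privacy against the helpers: the hybrid over the indices. -/

section

theorem PMF.bind_const' {α β : Type} (p : PMF α) (q : PMF β) {f : α → PMF β}
    (h : ∀ a ∈ p.support, f a = q) : p.bind f = q := by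
  rw [PMF.bind_congr h, PMF.bind_const]

theorem negligible_zero : Negligible fun _ => 0 := Asymptotics.superpolynomialDecay_zero _ _

theorem Negligible.sum {ι : Type} (s : Finset ι) {μ : ι → ℕ → ℝ} (h : ∀ i, Negligible (μ i)) :
    Negligible fun n => ∑ i ∈ s, μ i n := by
  classical
  induction s using Finset.induction_on with
  | empty => simpa using negligible_zero
  | insert i s hi ih => simp only [Finset.sum_insert hi]; exact Asymptotics.SuperpolynomialDecay.add (h i) ih

namespace Setting

variable {z : ℕ} (U : Setting z) (P : ℕ → DTLP.Params z)

/-- Whether the lengths of the messages agree, the bits, and the result of the adversary. -/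
def helperJoint (A : TwoStage) (n : ℕ) : PMF (Bool × (Fin z → Bool) × Data) :=
  (DTLP.accounts U.G n).bind fun keys => (U.E.keyGen n).bind fun k =>
    (A.first.out (code (Unary.mk n, code (P n).Δ, Unary.mk z))).bind fun o =>
    (unifBits z).bind fun b =>
    (drawVec z fun i => U.E.enc k (mix b (toMsgs z o.fst) (toMsgs z o.snd.fst) i)).bind fun e =>
    (U.T.setup n (P n).Δ (U.τ.S n)).bind fun hk =>
    (U.T.gen e hk.1 hk.2).bind fun p =>
    (A.second.out (U.helperInput P n keys o e hk.1 p)).map fun o' => (lengthsAgree z o, b, o')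

theorem helperExp_win (A : TwoStage) (n : ℕ) :
    (U.D.helperExp U.G U.B U.τ.S P A n).map Outcome.win = (U.helperJoint P A n).map fun x =>
      x.1 = true ∧ ∃ k : Fin z, (k : ℕ) = x.2.2.snd.toNat ∧ x.2.2.fst.toBool = x.2.1 k := by
  rw [helperExp_eq, helperJoint]
  simp only [PMF.map_bind, PMF.map_comp, Function.comp_def, Prog.out, PMF.bind_map, lengthsAgree,
    decide_eq_true_eq]

/-- The joint distribution of success in guessing the `κ`-th bit. -/
def helperGuess (A : TwoStage) (κ : Fin z) (n : ℕ) : PMF (Bool × Bool × Bool) :=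
  (U.helperJoint P A n).map fun x =>
    (x.1 && decide ((κ : ℕ) = x.2.2.snd.toNat), x.2.2.fst.toBool, x.2.1 κ)

/-- As the queries come in order, the challenge has been used before query `i` exactly if `κ < i`.
The reduction's own bits select the messages at all other positions, so the ciphertexts are those
for its bits with the `κ`-th one replaced by the challenge bit. -/
theorem cpaOracle_query (κ : Fin z) (k : Bits) (bb : Bool) (c : CPAContext z)
    (hc : lengthsAgree z c.2.2.1 = true) (i : Fin z) :
    U.E.cpaOracle k bb (decide ((κ : ℕ) < i)) (cpaQuery κ c i) =
      (U.E.enc k (mix (Function.update c.2.2.2 κ bb) (toMsgs z c.2.2.1.fst)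
        (toMsgs z c.2.2.1.snd.fst) i)).map fun e => (code e, decide ((κ : ℕ) < (i : ℕ) + 1)) := by
  have hc' := of_decide_eq_true hc i
  by_cases hi : i = κ
  · subst hi
    simp [cpaQuery, SKE.cpaOracle, hc', mix, PMF.map, PMF.bind_eq, PMF.pure_eq, Function.comp_def]
  · have h1 : decide ((κ : ℕ) < (i : ℕ) + 1) = decide ((κ : ℕ) < i) := by
      have : (i : ℕ) ≠ κ := fun h => hi (Fin.ext h)
      congr 1
      simp only [eq_iff_iff]
      omega
    simp only [cpaQuery, hi, if_false, h1]
    cases decide ((κ : ℕ) < i) <;>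
      simp [SKE.cpaOracle, mix, PMF.map, PMF.bind_eq, PMF.pure_eq, Function.comp_def, hi]

theorem batch_context {C W : Type} {h : W → Data → PMF (Data × W)} {k : ℕ} {x y : Batch C × W}
    (hy : y ∈ (iterK (redStep Batch.pre Batch.post h) k x).support) : y.1.1 = x.1.1 := by
  refine iterK_inv (fun (_ : ℕ) (y : Batch C × W) => y.1.1 = x.1.1) (fun l a ha b hb => ?_) k 0 x rfl y hy
  simp only [redStep, Batch.pre, Batch.post, PMF.pure_bind, PMF.pure_map, PMF.mem_support_bind,
    PMF.mem_support_pure] at hb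
  obtain ⟨r, -, rfl⟩ := hb
  exact ha

theorem toMsgs_code (v : Fin z → Bits) : toMsgs z (code v) = v := by
  funext i; simp [toMsgs, nth_code]

theorem iterK_cpa (κ : Fin z) (k : Bits) (bb : Bool) (c : CPAContext z)
    (hc : lengthsAgree z c.2.2.1 = true) :
    iterK (redStep Batch.pre Batch.post (U.E.cpaOracle k bb)) z
        ((c, List.ofFn (cpaQuery κ c), []), false) =
      (drawVec z fun i => U.E.enc k (mix (Function.update c.2.2.2 κ bb) (toMsgs z c.2.2.1.fst)
        (toMsgs z c.2.2.1.snd.fst) i)).map fun v =>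
        ((c, [], (List.ofFn fun i => code (v i)).reverse), decide ((κ : ℕ) < z)) := by
  simpa using Batch.iterK_eq (U.E.cpaOracle k bb) (cpaQuery κ c) _ (fun i => decide ((κ : ℕ) < i))
    (U.cpaOracle_query κ k bb c hc) c []

theorem cpaOracle_nil (E : SKE) (p : Bits × Bool) (w : Bool) :
    E.cpaOracle p.1 p.2 w .nil = PMF.pure (.nil, w) := by cases w <;> rfl

/-- Replies are ciphertexts of bounded messages under keys of bounded size, hence bounded since
encryption is efficient. The work of the reduction includes reading them. -/
theorem cpaOracle_size (hE : U.E.Efficient) (Q : Polynomial ℕ) : ∃ R : Polynomial ℕ,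
    ∀ n (p : Bits × Bool) (w₀ w : Bool) q, (p.1 ∈ (U.E.keyGen n).support ∧ w₀ = false) →
      q.size ≤ Q.eval n → ∀ r ∈ (U.E.cpaOracle p.1 p.2 w q).support, r.1.size ≤ R.eval n := by
  let D : Dom Unary := ⟨fun n m => m = ⟨n⟩, 2 * .X + 1, by rintro n _ rfl; simp⟩
  obtain ⟨q₁, h₁⟩ := (PolyOn.of_polyTime hE.1 : PolyOn D _).exists_bound
  obtain ⟨q₂, h₂⟩ := (PolyOn.of_polyTime hE.2.1 : PolyOn (Dom.all _) _).exists_bound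
  refine ⟨q₂.comp (q₁ + 2 * Q + 2) + 1, ?_⟩
  rintro n ⟨k, bb⟩ w₀ w q ⟨hk, -⟩ hq r hr
  have hk' := h₁ n ⟨n⟩ rfl k hk
  have key : ∀ m : Data, m.size ≤ q.size → ∀ c ∈ (U.E.enc k m.toBits).support,
      (code c).size ≤ (q₂.comp (q₁ + 2 * Q + 2) + 1).eval n := by
    intro m hm c hc
    refine (h₂ ((q₁ + 2 * Q + 2).eval n) (k, m.toBits) ?_ c hc).trans (by simp)
    have := size_code_bits_le m.toBits
    have h3 : m.toBits.length = m.len := by simp [Data.toBits, Data.len]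
    have h4 := m.len_le_size
    simp [Dom.all]
    omega
  have hnil : ∀ w' : Bool, r ∈ (PMF.pure (Data.nil, w') : PMF (Data × Bool)).support →
      r.1.size ≤ (q₂.comp (q₁ + 2 * Q + 2) + 1).eval n := by
    intro w' h
    rw [PMF.mem_support_pure.1 h]
    simp
  rcases q with _ | ⟨_ | ⟨a, a'⟩, m⟩
  · exact hnil w (by cases w <;> exact hr)
  · have hr : r ∈ ((U.E.enc k m.toBits).bind fun c => PMF.pure (code c, w)).support := by
      cases w <;> exact hr
    simp only [PMF.mem_support_bind, PMF.mem_support_pure] at hr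
    obtain ⟨c, hc, rfl⟩ := hr
    exact key m (by simp; omega) c hc
  · cases w
    · simp only [SKE.cpaOracle, PMF.bind_eq, PMF.pure_eq] at hr
      split_ifs at hr with h1 h2
      · simp only [PMF.mem_support_bind, PMF.mem_support_pure] at hr
        obtain ⟨c, hc, rfl⟩ := hr
        exact key m.snd (by cases m <;> simp; omega) c hc
      · simp only [PMF.mem_support_bind, PMF.mem_support_pure] at hr
        obtain ⟨c, hc, rfl⟩ := hr
        exact key m.fst (by cases m <;> simp; omega) c hc
      · exact hnil _ hr
    · exact hnil true hr

/-- The simulation is perfect: the challenge bit is uniform and independent of the bits that the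
reduction draws, so putting it in place of the `κ`-th one leaves their distribution unchanged. The
success probability is therefore known exactly. -/
theorem cpa_reduction (hP : DTLP.EfficientParams P) (A : TwoStage)
    (hA : (U.D.helperExp U.G U.B U.τ.S P A).IsPPT) (κ : Fin z) :
    ∃ A' : Interactive, (U.E.cpaExp A').IsPPT ∧ ∀ n, (U.E.cpaExp A' n).map Outcome.win =
      (U.helperGuess P A κ n).bind fun x => if x.1 = true then PMF.pure (x.2.1 = x.2.2)
        else (PMF.uniformOfFintype Bool).map fun c => c = x.2.2 := by
  let Dn : Dom Unary := ⟨fun n m => m = ⟨n⟩, 2 * .X + 1, by rintro n _ rfl; simp⟩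
  have hDn : ∀ n m, Dn.mem n m ↔ m = ⟨n⟩ := fun n m => Iff.rfl
  obtain ⟨A', ⟨q, hq⟩, h⟩ := Batch.exists_interactive (fun p : Bits × Bool => U.E.cpaOracle p.1 p.2)
    (cpaOracle_nil U.E) z (fun n p w => p.1 ∈ (U.E.keyGen n).support ∧ w = false) hDn
    (U.cpaOracle_size U.hE) (U.cpaFirst_poly hP A hA κ hDn) (U.CPAEnd P A)
    (U.cpaLast_poly hP A hA κ) (by
      rintro n ⟨k, bb⟩ w ⟨hk, rfl⟩ x hx y hy
      simp only [cpaFirst, PMF.mem_support_bind, PMF.mem_support_map] at hx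
      obtain ⟨keys, hkeys, o, ho, b, hb, rfl⟩ := hx
      have hctx := batch_context hy
      simp only at hctx
      refine ⟨by rw [hctx], by rw [hctx]; exact hkeys, by rw [hctx]; exact ho, fun hl => ?_⟩
      rw [hctx] at hl ⊢
      simp only at hl ⊢
      refine ⟨k, hk, Function.update b κ bb, ?_⟩
      rw [if_pos hl, U.iterK_cpa κ k bb (⟨n⟩, keys, o, b) hl] at hy
      obtain ⟨v, hv, rfl⟩ := PMF.mem_support_map.1 hy
      simp only [List.reverse_reverse]
      rw [show code (List.ofFn fun i => code (v i)) = code v by simp [code_fun, code_list]; rfl,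
        toMsgs_code]
      exact hv)
  refine ⟨A', ⟨q, fun n o ho => ?_⟩, fun n => ?_⟩
  · simp only [SKE.cpaExp, PMF.bind_eq, PMF.pure_eq, PMF.mem_support_bind,
      PMF.mem_support_pure] at ho
    obtain ⟨k, hk, b, hb, r, hr, rfl⟩ := ho
    exact hq n (k, b) false ⟨hk, rfl⟩ r hr
  · have e1 : (U.E.cpaExp A' n).map Outcome.win = (U.E.keyGen n).bind fun k =>
        (PMF.uniformOfFintype Bool).bind fun bb =>
          ((A'.run (U.E.cpaOracle k bb) n (code (Unary.mk n)) .nil false).map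
            fun o => (o.1, o.2.1)).map fun r => r.1.fst.toBool = bb := by
      simp only [SKE.cpaExp, PMF.bind_eq, PMF.pure_eq, PMF.map_bind, PMF.pure_map, PMF.map_comp]
      rfl
    rw [e1, helperGuess, PMF.bind_map, helperJoint]
    simp only [PMF.bind_bind]
    conv_rhs => rw [PMF.bind_comm]
    refine PMF.bind_congr fun k hk => ?_
    have e2 := fun bb => h n (k, bb) false ⟨hk, rfl⟩
    simp only at e2
    simp only [e2, cpaFirst, PMF.bind_bind, PMF.bind_map, PMF.map_bind]
    conv_lhs => rw [PMF.bind_comm]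
    refine congrArg _ (funext fun keys => ?_)
    conv_lhs => rw [PMF.bind_comm]
    refine congrArg _ (funext fun o => ?_)
    -- The `κ`-th bit is drawn separately, to be matched with the challenge bit.
    conv_rhs => rw [unifBits, ← drawVec_update _ κ]
    simp only [PMF.bind_bind, PMF.bind_map, Function.comp_def]
    refine congrArg _ (funext fun bb => congrArg _ (funext fun b => ?_))
    -- If the lengths disagree, then both sides are a coin compared with the challenge bit, whatever
    -- else is drawn.
    cases hl : lengthsAgree z o
    · rw [PMF.map_bind]
      refine (PMF.bind_const' _ ((PMF.uniformOfFintype Bool).map fun c => c = bb) ?_).trans ?_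
      · intro y hy
        have hctx := batch_context hy
        simp only at hctx
        simp only [cpaLast, hctx, hl, PMF.map_comp, Function.comp_def]
        simp [PMF.map_comp, Function.comp_def, code_prod]
      · refine (PMF.bind_const' _ _ fun e _ => PMF.bind_const' _ _ fun hk _ =>
          PMF.bind_const' _ _ fun p _ => PMF.bind_const' _ _ fun o' _ => ?_).symm
        simp
    · simp only [if_true]
      rw [U.iterK_cpa κ k bb (⟨n⟩, keys, o, b) hl, PMF.bind_map, PMF.map_bind]
      refine congrArg _ (funext fun v => ?_)
      simp only [Function.comp_def, cpaLast, hl, if_true, List.reverse_reverse]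
      rw [show code (List.ofFn fun i => code (v i)) = code v by simp [code_fun, code_list]; rfl,
        toMsgs_code]
      simp only [PMF.map_bind]
      refine congrArg _ (funext fun hk => congrArg _ (funext fun p => congrArg _ (funext fun o' => ?_)))
      by_cases hκ : (κ : ℕ) = o'.snd.toNat
      · simp [hκ, PMF.pure_map, code_prod]
      · simp [hκ, PMF.map_comp, Function.comp_def, code_prod]

/-- With `g` the probability of a correct guess at `κ` and `p` that of announcing `κ` (both for
agreeing lengths), the reduction succeeds with probability `g + (1 - p) / 2`, so IND-CPA gives `g ≤
p / 2 + μ`. It remains to sum over `κ`; the number `z` of indices is constant. -/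
theorem helper_private (hCPA : U.E.INDCPA) (hP : DTLP.EfficientParams P) (A : TwoStage)
    (hA : (U.D.helperExp U.G U.B U.τ.S P A).IsPPT) :
    (U.D.helperExp U.G U.B U.τ.S P A).CannotGuess := by
  have key : ∀ κ, ∃ μ, Negligible μ ∧ ∀ n,
      ((U.helperGuess P A κ n).toOuterMeasure {x | x.1 = true ∧ x.2.1 = x.2.2}).toReal ≤
        ((U.helperGuess P A κ n).toOuterMeasure {x | x.1 = true}).toReal / 2 + μ n := by
    intro κ
    obtain ⟨A', h1, h2⟩ := U.cpa_reduction P hP A hA κ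
    obtain ⟨μ, hμ, h⟩ := hCPA A' h1
    refine ⟨μ, hμ, fun n => ?_⟩
    have h3 := h n
    rw [Experiment.winProb_eq, h2, coin_unless_good] at h3
    linarith
  choose μ hμ h using key
  refine ⟨fun n => ∑ κ, μ κ n, Negligible.sum _ hμ, fun n => ?_⟩
  have e1 : (U.D.helperExp U.G U.B U.τ.S P A).winProb n ≤ ∑ κ, ((U.helperGuess P A κ n).toOuterMeasure
      {x | x.1 = true ∧ x.2.1 = x.2.2}).toReal := by
    rw [Experiment.winProb_eq, helperExp_win, PMF.toOuterMeasure_map_apply,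
      ← ENNReal.toReal_sum fun κ _ => PMF.toOuterMeasure_ne_top _ _]
    refine ENNReal.toReal_mono (ENNReal.sum_ne_top.2 fun κ _ => PMF.toOuterMeasure_ne_top _ _) ?_
    simp only [helperGuess, PMF.toOuterMeasure_map_apply]
    refine le_trans (MeasureTheory.measure_mono ?_) (MeasureTheory.measure_iUnion_fintype_le _ _)
    rintro x ⟨h1, κ, h2, h3⟩
    exact Set.mem_iUnion.2 ⟨κ, by simp [h1, h2, h3]⟩
  -- An output announces at most one index, so the events are disjoint and their probabilities add
  -- up to at most one.
  have e2 : ∑ κ, ((U.helperGuess P A κ n).toOuterMeasure {x | x.1 = true}).toReal ≤ 1 := by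
    rw [← ENNReal.toReal_sum fun κ _ => PMF.toOuterMeasure_ne_top _ _, ← ENNReal.toReal_one]
    refine ENNReal.toReal_mono ENNReal.one_ne_top ?_
    simp only [helperGuess, PMF.toOuterMeasure_map_apply]
    simp only [PMF.toOuterMeasure_apply]
    rw [← tsum_fintype (L := .unconditional _), ENNReal.tsum_comm]
    rw [← (U.helperJoint P A n).tsum_coe]
    refine ENNReal.tsum_le_tsum fun x => ?_
    rw [tsum_fintype]
    by_cases hx : ∃ κ : Fin z, (κ : ℕ) = x.2.2.snd.toNat
    · obtain ⟨κ, hκ⟩ := hx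
      rw [Finset.sum_eq_single κ]
      · exact Set.indicator_le_self' (fun _ _ => zero_le') x
      · intro κ' _ hne
        refine Set.indicator_of_notMem (fun hm => hne (Fin.ext ?_)) _
        simp only [Set.mem_preimage, Set.mem_setOf_eq, Bool.and_eq_true, decide_eq_true_eq] at hm
        rw [hm.2, hκ]
      · simp
    · refine (Finset.sum_eq_zero fun κ _ => Set.indicator_of_notMem (fun hm => hx ⟨κ, ?_⟩) _).trans_le
        zero_le'
      simp only [Set.mem_preimage, Set.mem_setOf_eq, Bool.and_eq_true, decide_eq_true_eq] at hm
      exact hm.2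
  refine e1.trans ((Finset.sum_le_sum fun κ _ => h κ n).trans ?_)
  rw [Finset.sum_add_distrib, ← Finset.sum_div]
  linarith

end Setting

end

section

/-! ## The interaction with the blockchain as an iteration -/

instance : Coded Party := ⟨fun
  | .C => code (false, false)
  | .S => code (false, true)
  | .HC => code (true, false)
  | .HS => code (true, true)⟩

theorem Action.ofData_code (a : Action) : Action.ofData (code a) = a := by cases a <;> rfl

variable {z : ℕ}

/-- A state of the interaction: `stage` tells whether the contract has been deployed and published;
`st` and `rep` are the state of the adversary and the pending reply. -/
structure ChainState (z : ℕ) : Type where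
  n : ℕ
  keys : Keys
  pk : Data
  g : Fin z → Data
  stage : Option Bool
  st : Data
  rep : Data
  w : DTLP.CallWorld z
  cost : Cost

namespace Setting

variable (U : Setting z) (P : ℕ → DTLP.Params z) (A : Interactive)

/-- One step of the interaction. -/
def chainStep (x : ChainState z) : PMF (ChainState z) :=
  match x.stage with
  | none => (DTLP.issueCall U.G U.B (U.contract x.n (P x.n) x.keys) x.keys .S
      (.deploy (∑ i, (P x.n).coins i)) x.w).map fun r =>
        { x with stage := some false, rep := r.1, w := r.2 }
  | some false => (DTLP.issueCall U.G U.B (U.contract x.n (P x.n) x.keys) x.keys .HC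
      (.publish x.pk x.g) x.w).map fun r =>
        { x with stage := some true, rep := .cons x.rep r.1, w := r.2 }
  | some true => (A.prog.run (.cons x.st x.rep)).bind fun o =>
      (DTLP.chainOracle U.G U.B (U.contract x.n (P x.n) x.keys) x.keys x.w o.1.snd).map fun r =>
        { x with st := o.1.fst, rep := r.1, w := r.2,
                 cost := x.cost.seq ((Cost.step x.rep.size).seq o.2) }

/-- The state at the start. -/
def chainInit (n : ℕ) (keys : Keys) (y : Data × (Fin z → Data) × Data) (s : Data) : ChainState z :=
  ⟨n, keys, y.1, y.2.1, none, y.2.2, .nil, ⟨[s], s, []⟩, .zero⟩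

theorem play_eq_iterK (n : ℕ) (keys : Keys) (pk : Data) (g : Fin z → Data) (k : ℕ) (st rep : Data)
    (w : DTLP.CallWorld z) (cost : Cost) :
    A.play (DTLP.chainOracle U.G U.B (U.contract n (P n) keys) keys) k st rep w cost =
      (iterK (U.chainStep P A) k ⟨n, keys, pk, g, some true, st, rep, w, cost⟩).map fun x =>
        (x.st, x.w, x.cost) := by
  induction k generalizing st rep w cost with
  | zero => simp [Interactive.play, iterK, PMF.pure_eq, PMF.pure_map]
  | succ k ih =>
    simp only [Interactive.play, iterK, chainStep, PMF.bind_eq, PMF.bind_bind, PMF.bind_map,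
      Function.comp_def, PMF.map_bind, ih]

/-- Deployment and publication become the first two steps, which accounts for `acts + 2`. The whole
execution is then one iteration, to which `iterK_map` and `iterK_inv` apply. -/
theorem runChain_eq (n : ℕ) (keys : Keys) (y : Data × (Fin z → Data) × Data) :
    DTLP.runChain U.G U.B n (U.contract n (P n) keys) keys y.1 y.2.1 A y.2.2 =
      (U.B.start n).bind fun s =>
        (iterK (U.chainStep P A) ((A.acts + 2).eval n) (chainInit n keys y s)).map fun x =>
          (x.st, x.w, x.cost) := by
  have h : (A.acts + 2).eval n = A.acts.eval n + 1 + 1 := by simp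
  rw [h]
  simp only [DTLP.runChain, Blockchain.init, PMF.bind_eq, PMF.pure_eq, PMF.bind_bind, PMF.pure_bind,
    iterK, chainStep, chainInit, PMF.bind_map, Function.comp_def, PMF.map_bind,
    Interactive.run, U.play_eq_iterK P A n keys y.1 y.2.1]
  rfl

/-- What is known from the start: security parameter, account keys, public key and statements. -/
abbrev ChainContext (z : ℕ) : Type := Unary × Keys × Data × (Fin z → Data)

/-- The state of a simulation: context, stage, state of the adversary, pending reply, and the number
of transactions issued. -/
abbrev SimState (z : ℕ) : Type := ChainContext z × Option Bool × Data × Data × ℕ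

/-- An operation: an action, or the issuing of a signed transaction by a party. -/
abbrev Op : Type := Option (Option Party × Data)

/-- The contract in a given context. -/
def simContract (c : ChainContext z) : Contract z := U.contract c.1.val (P c.1.val) c.2.1

/-- The operation that corresponds to a query. -/
def opOf (c : ChainContext z) (count : ℕ) : Data → Op
  | .nil => none
  | .cons .nil a => some (none, a)
  | .cons (.cons _ i) d =>
      if h : d.toNat < z then
        some (some (if i.toBool then .S else .C),
          payload (U.simContract P c) count (.pay ⟨_, h⟩))
      else none

/-- The new state of the adversary, and the next operation. -/
def nextOp (s : SimState z) : PMF (Data × Op) :=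
  match s.2.1 with
  | none => PMF.pure (s.2.2.1, some (some .S, payload (U.simContract P s.1) s.2.2.2.2
      (.deploy (∑ i, (P s.1.1.val).coins i))))
  | some false => PMF.pure (s.2.2.1, some (some .HC, payload (U.simContract P s.1) s.2.2.2.2
      (.publish s.1.2.2.1 s.1.2.2.2)))
  | some true => (A.prog.out (.cons s.2.2.1 s.2.2.2.1)).map fun o =>
      (o.fst, U.opOf P s.1 s.2.2.2.2 o.snd)

/-- What is remembered while a query is answered: the state, the new state of the adversary, a
transaction to be reported, and whether a transaction has been issued. -/
abbrev SimMid (z : ℕ) : Type := SimState z × Data × Option Data × Bool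

/-- The query for an operation: transactions of the party `i₀` are signed by the oracle. -/
def opQuery (i₀ : Option Party) (s : SimState z) (st : Data) : Op → PMF (SimMid z × Data)
  | none => PMF.pure ((s, st, none, false), .nil)
  | some (none, a) => PMF.pure ((s, st, none, false), .cons (.cons .nil .nil) a)
  | some (some i, body) =>
      if some i = i₀ then PMF.pure ((s, st, none, true), .cons .nil body)
      else (U.G.sign (s.1.2.1 i).2 body).map fun σ =>
        ((s, st, some (mkTx (s.1.2.1 i).1 body σ), true),
          .cons (.cons .nil .nil) (code (Action.bcast (mkTx (s.1.2.1 i).1 body σ))))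

def simPre (i₀ : Option Party) (s : SimState z) : PMF (SimMid z × Data) :=
  (U.nextOp P A s).bind fun o => U.opQuery i₀ s o.1 o.2

/-- The reply, together with a transaction to be reported. -/
def wrapReply (t : Option Data) (r : Data) : Data := t.elim r fun t => .cons t r

/-- The next stage, and the pending reply. -/
def nextReply (stage : Option Bool) (rep r : Data) : Option Bool × Data :=
  match stage with
  | none => (some false, r)
  | some false => (some true, .cons rep r)
  | some true => (some true, r)

def simPost (x : SimMid z × Data) : SimState z :=
  (x.1.1.1, (nextReply x.1.1.2.1 x.1.1.2.2.2.1 (wrapReply x.1.2.2.1 x.2)).1, x.1.2.1,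
    (nextReply x.1.1.2.1 x.1.1.2.2.2.1 (wrapReply x.1.2.2.1 x.2)).2,
    x.1.1.2.2.2.2 + x.1.2.2.2.toNat)

/-- The keys without the signing key of `i₀`. -/
def hideKey (i₀ : Option Party) (keys : Keys) : Keys := fun i =>
  if some i = i₀ then ((keys i).1, .nil) else keys i

/-- The world as seen by the account holder `i₀`. -/
def partyWorld (i₀ : Option Party) (w : DTLP.CallWorld z) : Blockchain.World Unit :=
  ⟨w.hist, w.cur, (w.log.filter fun y => decide (some y.1.1 = i₀)).map fun y => ((), y.2)⟩

/-- The state of the simulation. -/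
def simState (i₀ : Option Party) (x : ChainState z) : SimState z :=
  ((⟨x.n⟩, hideKey i₀ x.keys, x.pk, x.g), x.stage, x.st, x.rep, x.w.log.length)

/-- The contract contains verification keys only, so a simulation that lacks a signing key still
knows the contract and its address. -/
theorem contract_hideKey (i₀ : Option Party) (n : ℕ) (Q : DTLP.Params z) (keys : Keys) :
    U.contract n Q (hideKey i₀ keys) = U.contract n Q keys := by
  simp only [contract, hideKey]
  congr 1
  funext i
  split_ifs <;> rfl

theorem act_partyWorld (i₀ : Option Party) (w : DTLP.CallWorld z) (a : Action) :
    U.B.act (partyWorld i₀ w) a = (U.B.act w a).map fun r => (r.1, partyWorld i₀ r.2) := by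
  cases a <;>
    simp [Blockchain.act, partyWorld, PMF.map_bind, PMF.bind_eq, PMF.pure_eq, PMF.pure_map]

theorem act_log {α : Type} (w : Blockchain.World α) (a : Action) :
    ∀ r ∈ (U.B.act w a).support, r.2.log = w.log := by
  intro r hr
  cases a <;> simp only [Blockchain.act, PMF.bind_eq, PMF.pure_eq, PMF.mem_support_bind,
    PMF.mem_support_pure] at hr <;> obtain ⟨o, -, rfl⟩ := hr <;> rfl

/-- Transactions of `i₀` are signed and broadcast by the oracle; for all other parties the
simulation signs with the keys it holds and broadcasts. The oracle reports its own transaction,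
while in the other case the simulation adds it to the reply. In this way both produce the reply of
the game, and the log of the oracle contains the transactions of `i₀` only. -/
theorem sim_issue (i₀ : Option Party) (key : Data × Data) (x : ChainState z)
    (hkey : ∀ i, i₀ = some i → key = x.keys i) (i : Party) (f : Call z) (st : Data) :
    ((U.opQuery i₀ (simState i₀ x) st (some (some i, payload (U.contract x.n (P x.n) x.keys)
        x.w.log.length f))).bind fun mq =>
      (U.B.liveOracle U.G key (partyWorld i₀ x.w) mq.2).map fun r => (simPost (mq.1, r.1), r.2)) =
    (DTLP.issueCall U.G U.B (U.contract x.n (P x.n) x.keys) x.keys i f x.w).map fun r =>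
      (((simState i₀ x).1, (nextReply x.stage x.rep r.1).1, st, (nextReply x.stage x.rep r.1).2,
        r.2.log.length), partyWorld i₀ r.2) := by
  by_cases hi : some i = i₀
  · obtain rfl := hkey i hi.symm
    simp only [opQuery, if_pos hi, PMF.pure_bind, Blockchain.liveOracle, Blockchain.issue,
      DTLP.issueCall, PMF.bind_eq, PMF.pure_eq, PMF.map_bind, PMF.pure_map, act_partyWorld,
      PMF.bind_map, Function.comp_def]
    refine congrArg _ (funext fun σ => PMF.bind_congr fun o ho => ?_)
    have hlog := U.act_log _ _ o ho
    simp [simPost, simState, wrapReply, partyWorld, hlog, hi, Blockchain.World.round]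
  · have hk : hideKey i₀ x.keys i = x.keys i := by simp [hideKey, hi]
    simp only [opQuery, if_neg hi, PMF.bind_map, Blockchain.liveOracle, Blockchain.issue, code,
      Action.ofData, simState, hk,
      DTLP.issueCall, PMF.bind_eq, PMF.pure_eq, PMF.map_bind, PMF.pure_map, act_partyWorld,
      PMF.map_comp, Function.comp_def]
    refine congrArg _ (funext fun σ => PMF.bind_congr fun o ho => ?_)
    have hlog := U.act_log _ _ o ho
    simp [simPost, wrapReply, partyWorld, hlog, hi, code]

/-- The central comparison for the blockchain: the simulation follows the game in distribution, step
by step. The party `i₀` is the honest account holder whose key belongs to the oracle. The case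
`none` leaves nothing to be signed by the oracle and covers plain environments. -/
theorem sim_chainStep (i₀ : Option Party) (key : Data × Data) (x : ChainState z)
    (hkey : ∀ i, i₀ = some i → key = x.keys i) :
    redStep (U.simPre P A i₀) (fun m => PMF.pure (simPost m)) (U.B.liveOracle U.G key)
        (simState i₀ x, partyWorld i₀ x.w) =
      (U.chainStep P A x).map fun y => (simState i₀ y, partyWorld i₀ y.w) := by
  have hc : U.simContract P (simState i₀ x).1 = U.contract x.n (P x.n) x.keys :=
    U.contract_hideKey i₀ _ _ _
  have key := U.sim_issue P i₀ key x hkey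
  obtain ⟨n, keys, pk, g, stage, st, rep, w, cost⟩ := x
  rcases stage with _ | _ | _
  · have := key .S (.deploy (∑ i, (P n).coins i)) st
    simp only [redStep, simPre, nextOp, simState, hc, PMF.pure_bind, PMF.pure_map, chainStep,
      PMF.map_comp, Function.comp_def] at this hc ⊢
    exact this
  · have := key .HC (.publish pk g) st
    simp only [redStep, simPre, nextOp, simState, hc, PMF.pure_bind, PMF.pure_map, chainStep,
      PMF.map_comp, Function.comp_def] at this hc ⊢
    exact this
  · simp only [redStep, simPre, nextOp, simState, PMF.pure_map, chainStep, PMF.bind_map,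
      PMF.map_bind, Function.comp_def, PMF.map_comp, PMF.bind_bind] at hc ⊢
    rw [← Prog.run_bind]
    refine congrArg _ (funext fun o => ?_)
    rcases hq : o.1.snd with _ | ⟨_ | ⟨a, i⟩, d⟩
    · simp [opOf, opQuery, Blockchain.liveOracle, DTLP.chainOracle, PMF.pure_eq, PMF.pure_map,
        simPost, wrapReply, nextReply]
    · simp only [opOf, opQuery, Blockchain.liveOracle, DTLP.chainOracle, PMF.pure_bind,
        act_partyWorld, PMF.bind_map, Function.comp_def]
      refine PMF.bind_congr fun r hr => ?_
      simp [simPost, wrapReply, nextReply, U.act_log _ _ r hr]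
    · simp only [opOf, hc, DTLP.chainOracle]
      by_cases h : d.toNat < z
      · rw [dif_pos h, dif_pos h]
        exact key _ (.pay ⟨_, h⟩) o.1.fst
      · rw [dif_neg h, dif_neg h]
        simp [opQuery, Blockchain.liveOracle, PMF.pure_eq, PMF.pure_map, simPost, wrapReply,
          nextReply]

end Setting

end

section

/-! ## Games on the blockchain -/

/-- An efficient game on the blockchain: the adversary, and the distribution of the public key, the
statements and the input of the adversary, given the account keys. -/
structure ChainGame {z : ℕ} (U : Setting z) (P : ℕ → DTLP.Params z) : Type where
  A : Interactive
  start : Unary × Keys → PMF (Data × (Fin z → Data) × Data)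
  bound : Polynomial ℕ
  start_poly : ∀ D : Dom (Unary × Keys), (∀ n x, D.mem n x → x.1.val = n) → PolyOn D start
  -- The adversary is given the signing key of the server's helper, and no other signing key. Hence
  -- any other one can be withheld from the start of the game.
  start_hide : ∀ n keys i₀, i₀ ≠ some Party.HS → start (n, Setting.hideKey i₀ keys) = start (n, keys)
  ppt : ∀ n, ∀ keys ∈ (DTLP.accounts U.G n).support, ∀ y ∈ (start (⟨n⟩, keys)).support,
    ∀ s ∈ (U.B.start n).support,
    ∀ x ∈ (iterK (U.chainStep P A) ((A.acts + 2).eval n) (Setting.chainInit n keys y s)).support,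
      x.cost.work ≤ bound.eval n

variable {z : ℕ}

namespace Setting

variable (U : Setting z) (P : ℕ → DTLP.Params z) (A : Interactive)

theorem cost_le_of_step {x y : ChainState z} (hy : y ∈ (U.chainStep P A x).support) :
    x.cost.work ≤ y.cost.work := by
  obtain ⟨n, keys, pk, g, stage, st, rep, w, cost⟩ := x
  rcases stage with _ | _ | _ <;>
    simp only [chainStep, PMF.mem_support_bind, PMF.mem_support_map] at hy
  · obtain ⟨r, -, rfl⟩ := hy; exact le_rfl
  · obtain ⟨r, -, rfl⟩ := hy; exact le_rfl
  · obtain ⟨o, -, r, -, rfl⟩ := hy; simp [Cost.seq]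

theorem cost_le_of_iterK (k : ℕ) {x y : ChainState z}
    (hy : y ∈ (iterK (U.chainStep P A) k x).support) : x.cost.work ≤ y.cost.work :=
  iterK_inv (fun _ y => x.cost.work ≤ y.cost.work)
    (fun _ _ ha _ hb => ha.trans (U.cost_le_of_step P A hb)) k 0 x le_rfl y hy

theorem step_const {x y : ChainState z} (hy : y ∈ (U.chainStep P A x).support) :
    y.n = x.n ∧ y.keys = x.keys ∧ y.pk = x.pk ∧ y.g = x.g := by
  obtain ⟨n, keys, pk, g, stage, st, rep, w, cost⟩ := x
  rcases stage with _ | _ | _ <;>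
    simp only [chainStep, PMF.mem_support_bind, PMF.mem_support_map] at hy
  · obtain ⟨r, -, rfl⟩ := hy; simp
  · obtain ⟨r, -, rfl⟩ := hy; simp
  · obtain ⟨o, -, r, -, rfl⟩ := hy; simp

theorem mem_act {α : Type} {w : Blockchain.World α} {a : Action} {r : Data × Blockchain.World α}
    (hr : r ∈ (U.B.act w a).support) : ∃ o ∈ (U.B.step w.cur a).support, r.1 = o.2 ∧
      r.2.cur = o.1 ∧ r.2.log = w.log ∧
      (a ≠ .tick ∧ r.2.hist = w.hist ∨ a = .tick ∧ r.2.hist = w.hist ++ [o.1]) := by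
  cases a <;> simp only [Blockchain.act, PMF.bind_eq, PMF.pure_eq, PMF.mem_support_bind,
    PMF.mem_support_pure] at hr <;> obtain ⟨o, ho, rfl⟩ := hr <;> exact ⟨o, ho, by simp⟩

theorem mem_issueCall {c : Contract z} {keys : Keys} {i : Party} {f : Call z}
    {w : DTLP.CallWorld z} {r : Data × DTLP.CallWorld z}
    (hr : r ∈ (DTLP.issueCall U.G U.B c keys i f w).support) :
    ∃ σ ∈ (U.G.sign (keys i).2 (payload c w.log.length f)).support,
    ∃ o ∈ (U.B.step w.cur (.bcast (mkTx (keys i).1 (payload c w.log.length f) σ))).support,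
      r.1 = .cons (mkTx (keys i).1 (payload c w.log.length f) σ) o.2 ∧ r.2.cur = o.1 ∧
      r.2.hist = w.hist ∧
      r.2.log = w.log ++ [((i, f), mkTx (keys i).1 (payload c w.log.length f) σ, w.round)] := by
  simp only [DTLP.issueCall, Blockchain.issue, PMF.bind_eq, PMF.pure_eq, PMF.mem_support_bind,
    PMF.mem_support_pure] at hr
  obtain ⟨σ, hσ, o, ho, rfl⟩ := hr
  obtain ⟨o', ho', h1, h2, h3, h4⟩ := U.mem_act ho
  refine ⟨σ, hσ, o', ho', ?_, h2, by simpa using h4, by simp [h3]⟩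
  simp [code_prod, h1]

end Setting

namespace ChainGame

variable {U : Setting z} {P : ℕ → DTLP.Params z} (Γ : ChainGame U P)

/-- The number of steps. -/
def T : Polynomial ℕ := Γ.A.acts + 2

/-- States that can be reached, with the number of remaining steps. -/
def Reach (n k : ℕ) (x : ChainState z) : Prop :=
  k ≤ Γ.T.eval n ∧ ∃ keys ∈ (DTLP.accounts U.G n).support, ∃ y ∈ (Γ.start (⟨n⟩, keys)).support,
    ∃ s ∈ (U.B.start n).support,
    x ∈ (iterK (U.chainStep P Γ.A) (Γ.T.eval n - k) (Setting.chainInit n keys y s)).support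

variable {Γ}

theorem Reach.step {n k : ℕ} {x y : ChainState z} (hx : Γ.Reach n (k + 1) x)
    (hy : y ∈ (U.chainStep P Γ.A x).support) : Γ.Reach n k y := by
  obtain ⟨hk, keys, hkeys, v, hv, s, hs, hx⟩ := hx
  refine ⟨by omega, keys, hkeys, v, hv, s, hs, ?_⟩
  rw [show Γ.T.eval n - k = (Γ.T.eval n - (k + 1)) + 1 by omega, iterK_add, PMF.mem_support_bind]
  exact ⟨x, hx, by simpa [iterK] using hy⟩

theorem Reach.iterK {n k l : ℕ} {x y : ChainState z} (hx : Γ.Reach n (k + l) x)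
    (hy : y ∈ (iterK (U.chainStep P Γ.A) k x).support) : Γ.Reach n l y :=
  iterK_inv (Γ.Reach n) (fun _ _ h _ => h.step) k l x hx y hy

/-- Costs never decrease, and every reachable state can be continued to a final one, where the bound
holds by assumption. -/
theorem Reach.cost_le {n k : ℕ} {x : ChainState z} (hx : Γ.Reach n k x) :
    x.cost.work ≤ Γ.bound.eval n := by
  obtain ⟨y, hy⟩ := PMF.exists_mem_support (DelegatedTLP.iterK (U.chainStep P Γ.A) k x)
  refine (U.cost_le_of_iterK P Γ.A k hy).trans ?_
  obtain ⟨-, keys, hkeys, v, hv, s, hs, h⟩ := Reach.iterK (l := 0) hx hy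
  exact Γ.ppt n keys hkeys v hv s hs y h

/-- The work of an activation is part of the cost after the step. This is how the efficiency of the
adversary in its experiment becomes a bound for its program on the inputs that occur. -/
theorem Reach.work_le {n k : ℕ} {x : ChainState z} (hx : Γ.Reach n (k + 1) x)
    (hstage : x.stage = some true) (o : Data × Cost)
    (ho : o ∈ (Γ.A.prog.run (.cons x.st x.rep)).support) :
    x.cost.work + (x.rep.size + o.2.work) ≤ Γ.bound.eval n := by
  obtain ⟨r, hr⟩ := PMF.exists_mem_support (DTLP.chainOracle U.G U.B
    (U.contract x.n (P x.n) x.keys) x.keys x.w o.1.snd)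
  have h : ({ x with st := o.1.fst, rep := r.1, w := r.2,
                     cost := x.cost.seq ((Cost.step x.rep.size).seq o.2) } : ChainState z) ∈
      (U.chainStep P Γ.A x).support := by
    rw [Setting.chainStep, hstage]
    simp only [PMF.mem_support_bind, PMF.mem_support_map]
    exact ⟨o, ho, r, hr, by simp [hstage]⟩
  exact (hx.step h).cost_le

end ChainGame

end

section

/-! ## The simulation runs in polynomial time -/

variable {γ : Type} [Coded γ] {D : Dom γ} {z : ℕ}

namespace PolyFun

theorem partyBits {i : γ → Party} (hi : PolyFun D i) :
    PolyFun D (fun g => (code (i g)).fst.toBool) ∧ PolyFun D (fun g => (code (i g)).snd.toBool) :=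
  ⟨hi.coded.dfst.toBool, hi.coded.dsnd.toBool⟩

theorem partyAt {α : Type} [Coded α] {f : γ → Party → α} {i : γ → Party} (hf : PolyFun D f)
    (hi : PolyFun D i) : PolyFun D fun g => f g (i g) := by
  obtain ⟨h1, h2⟩ := partyBits hi
  refine (ite h1 (ite (h2.restrict _) (((hf.party .HS).restrict _).restrict _)
    (((hf.party .HC).restrict _).restrict _)) (ite (h2.restrict _)
    (((hf.party .S).restrict _).restrict _) (((hf.party .C).restrict _).restrict _))).congr
    fun n g _ => ?_
  cases i g <;> rfl

theorem partyEq {i : γ → Party} (hi : PolyFun D i) (j : Option Party) :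
    PolyFun D fun g => decide (Option.some (i g) = j) := by
  obtain ⟨h1, h2⟩ := partyBits hi
  rcases j with _ | j
  · exact (const false).congr fun n g _ => by simp
  · refine ((h1.beq (const (code j).fst.toBool)).and (h2.beq (const (code j).snd.toBool))).congr
      fun n g _ => ?_
    cases i g <;> cases j <;> rfl

end PolyFun

namespace Setting

variable (U : Setting z) {P : ℕ → DTLP.Params z}

theorem payload_poly (hP : DTLP.EfficientParams P) {c : γ → ChainContext z} {count : γ → ℕ}
    {d : γ → Data} (hc : PolyFun D c) (hcount : PolyFun D count) (hd : PolyFun D d) :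
    PolyFun D fun g => code ((U.simContract P (c g)).adr, count g, d g) :=
  ((U.adr_poly hP hc.fst hc.snd.fst).pair (hcount.pair hd)).coded

theorem opOf_poly (hP : DTLP.EfficientParams P) {c : γ → ChainContext z} {count : γ → ℕ}
    {q : γ → Data} (hc : PolyFun D c) (hcount : PolyFun D count) (hq : PolyFun D q) :
    PolyFun D fun g => U.opOf P (c g) (count g) (q g) := by
  have h1 : PolyFun D fun g => some (some (if (q g).fst.snd.toBool = true then Party.S else Party.C),
      code ((U.simContract P (c g)).adr, count g, code ((3 : ℕ), (q g).snd.toNat))) :=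
    ((PolyFun.some (PolyFun.ite hq.dfst.dsnd.toBool (PolyFun.const _) (PolyFun.const _))).pair
      (U.payload_poly hP hc hcount
        (((PolyFun.const (3 : ℕ)).pair hq.dsnd.toNat).coded))).some
  have h2 : PolyFun D fun g => some ((none : Option Party), (q g).snd) :=
    ((PolyFun.const _).pair hq.dsnd).some
  have h3 : PolyFun D fun g => decide ((q g).snd.toNat < z) :=
    ((PolyFun.const z).le hq.dsnd.toNat).not.congr fun n g _ => by
      rw [← decide_not]; exact decide_eq_decide.2 (by omega)
  refine (PolyFun.ite hq.toBool (PolyFun.ite (hq.dfst.toBool.restrict _)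
    (PolyFun.ite ((h3.restrict _).restrict _) (((h1.restrict _).restrict _).restrict _)
      (PolyFun.const none)) ((h2.restrict _).restrict _)) (PolyFun.const none)).congr fun n g _ => ?_
  rcases q g with _ | ⟨_ | ⟨a, i⟩, d⟩
  · rfl
  · rfl
  · simp only [opOf, decide_eq_true_eq]
    by_cases h : d.toNat < z
    · rw [dif_pos h]
      simp only [fst_cons, snd_cons, h, if_true, Data.toBool]
      rfl
    · rw [dif_neg h]
      simp [h, Data.toBool]

theorem calls_poly (hP : DTLP.EfficientParams P) {c : γ → ChainContext z} {count : γ → ℕ}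
    (hc : PolyFun D c) (hcount : PolyFun D count) :
    PolyFun D (fun g => payload (U.simContract P (c g)) (count g)
      (.deploy (∑ i, (P (c g).1.val).coins i))) ∧
    PolyFun D (fun g => payload (U.simContract P (c g)) (count g)
      (.publish (c g).2.2.1 (c g).2.2.2)) :=
  ⟨U.payload_poly hP hc hcount ((PolyFun.const (0 : ℕ)).pair
      (PolyFun.sum (params_poly hP hc.fst).snd.snd.snd.snd.fst)).coded,
    U.payload_poly hP hc hcount ((PolyFun.const (1 : ℕ)).pair
      (hc.snd.snd.fst.pair hc.snd.snd.snd)).coded⟩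

/-- The hypothesis restricts the work of the adversary only in the stage in which it is actually
run; the first two stages merely produce the calls for deployment and publication. -/
theorem nextOp_poly (hP : DTLP.EfficientParams P) (A : Interactive) {D : Dom (SimState z)}
    (hA : ∃ q : Polynomial ℕ, ∀ n s, D.mem n s → s.2.1 = some true →
      A.prog.WorkLe (.cons s.2.2.1 s.2.2.2.1) (q.eval n)) : PolyOn D (U.nextOp P A) := by
  have hstage : PolyFun D fun s => s.2.1 := PolyFun.id.snd.fst
  have hst : PolyFun D fun s => s.2.2.1 := PolyFun.id.snd.snd.fst
  have hrep : PolyFun D fun s => s.2.2.2.1 := PolyFun.id.snd.snd.snd.fst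
  have hcount : PolyFun D fun s => s.2.2.2.2 := PolyFun.id.snd.snd.snd.snd
  obtain ⟨h1, h2⟩ := U.calls_poly hP (PolyFun.id.fst : PolyFun D fun s => s.1) hcount
  have h1' : PolyFun D fun s => (s.2.2.1, some (some Party.S, payload (U.simContract P s.1) s.2.2.2.2
      (.deploy (∑ i, (P s.1.1.val).coins i)))) := hst.pair ((PolyFun.const _).pair h1).some
  have h2' : PolyFun D fun s => (s.2.2.1, some (some Party.HC, payload (U.simContract P s.1) s.2.2.2.2
      (.publish s.1.2.2.1 s.1.2.2.2))) := hst.pair ((PolyFun.const _).pair h2).some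
  -- An optional Boolean has the code `nil`, or a cell whose right part is the code of the Boolean,
  -- so these two tests single out the stage `some true`.
  let E := (D.restrict fun s => (code s.2.1).toBool = true).restrict
    fun s => (code s.2.1).snd.toBool = true
  have h3 : PolyOn E fun s => (A.prog.out (.cons s.2.2.1 s.2.2.2.1)).map fun o =>
      (o.fst, U.opOf P s.1 s.2.2.2.2 o.snd) := by
    obtain ⟨q, hq⟩ := hA
    have hin : PolyFun E fun s => Data.cons s.2.2.1 s.2.2.2.1 :=
      ((hst.dcons hrep).restrict _).restrict _
    have hout : PolyOn E fun s => A.prog.out (.cons s.2.2.1 s.2.2.2.1) := by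
      refine PolyFun.bind (E := Dom.map _ hin) hin (PolyOn.of_workLe A.prog q ?_)
        fun n a ha => ⟨a, ha, rfl⟩
      rintro n _ ⟨s, ⟨⟨h0, h1⟩, h2⟩, rfl⟩
      refine hq n s h0 ?_
      rcases hs : s.2.1 with _ | _ | _ <;> rw [hs] at h1 h2
      · cases h1
      · cases h2
    refine PolyOn.map hout (PolyFun.id.snd.dfst.pair (U.opOf_poly hP PolyFun.id.fst.fst
      PolyFun.id.fst.snd.snd.snd.snd PolyFun.id.snd.dsnd))
  refine (PolyOn.ite hstage.coded.toBool (PolyOn.ite (hstage.coded.dsnd.toBool.restrict _) h3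
    ((h2'.restrict _).restrict _)) (h1'.restrict _)).congr fun n s _ => ?_
  simp only [nextOp]
  rcases s.2.1 with _ | _ | _ <;> rfl

/-- The party of an operation. -/
def opParty (o : Op) : Party := (o.bind Prod.fst).getD .C

theorem opQuery_poly (i₀ : Option Party) (D : Dom (SimState z × Data × Op)) :
    PolyOn D fun x => U.opQuery i₀ x.1 x.2.1 x.2.2 := by
  have hs : PolyFun D fun x => x.1 := PolyFun.id.fst
  have hst : PolyFun D fun x => x.2.1 := PolyFun.id.snd.fst
  have hop : PolyFun D fun x => x.2.2 := PolyFun.id.snd.snd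
  have ho1 : PolyFun D fun x => (code x.2.2).toBool := hop.coded.toBool
  have ho2 : PolyFun D fun x => (code x.2.2).snd.fst.toBool := hop.coded.dsnd.dfst.toBool
  have hdata : PolyFun D fun x => (code x.2.2).snd.snd := hop.coded.dsnd.dsnd
  have hi : PolyFun D fun x => opParty x.2.2 := by
    refine (PolyFun.ite ho2 (hop.coded.dsnd.dfst.dsnd.restrict _)
      (PolyFun.const (code Party.C))).of_code fun n x _ => ?_
    rcases x.2.2 with _ | ⟨_ | i, d⟩ <;> rfl
  have hvk : PolyFun D fun x => (x.1.1.2.1 (opParty x.2.2)) := PolyFun.partyAt hs.fst.snd.fst hi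
  have hsign : PolyOn D fun x => (U.G.sign (x.1.1.2.1 (opParty x.2.2)).2 (code x.2.2).snd.snd) :=
    PolyFun.polyTime_comp (g := fun x : Data × Data => U.G.sign x.1 x.2) U.hG.2.1
      (hvk.snd.pair hdata)
  have h1 : PolyFun D fun x => (((x.1, x.2.1, none, false) : SimMid z), Data.nil) :=
    (hs.pair (hst.pair (PolyFun.const _))).pair (PolyFun.const _)
  have h2 : PolyFun D fun x => (((x.1, x.2.1, none, false) : SimMid z),
      Data.cons (.cons .nil .nil) (code x.2.2).snd.snd) :=
    (hs.pair (hst.pair (PolyFun.const _))).pair ((PolyFun.const _).dcons hdata)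
  have h3 : PolyFun D fun x => (((x.1, x.2.1, none, true) : SimMid z),
      Data.cons .nil (code x.2.2).snd.snd) :=
    (hs.pair (hst.pair (PolyFun.const _))).pair ((PolyFun.const _).dcons hdata)
  have h4 : PolyOn D fun x => (U.G.sign (x.1.1.2.1 (opParty x.2.2)).2 (code x.2.2).snd.snd).map
      fun σ => (((x.1, x.2.1, some (mkTx (x.1.1.2.1 (opParty x.2.2)).1 (code x.2.2).snd.snd σ), true) :
        SimMid z), Data.cons (.cons .nil .nil)
          (code (Action.bcast (mkTx (x.1.1.2.1 (opParty x.2.2)).1 (code x.2.2).snd.snd σ)))) := by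
    refine PolyOn.map hsign ?_
    have ht : PolyFun (Dom.ext _ hsign) fun x =>
        mkTx (x.1.1.1.2.1 (opParty x.1.2.2)).1 (code x.1.2.2).snd.snd x.2 :=
      (hvk.up.fst.pair (hdata.up.pair PolyFun.id.snd)).coded
    exact (hs.up.pair (hst.up.pair (ht.some.pair (PolyFun.const _)))).pair
      ((PolyFun.const _).dcons ((PolyFun.const Data.nil).dcons ht))
  refine (PolyOn.ite ho1 (PolyOn.ite (ho2.restrict _) (PolyOn.ite
    (((PolyFun.partyEq hi i₀).restrict _).restrict _) (((h3.restrict _).restrict _).restrict _)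
    (h4.mono fun _ _ h => h.1.1.1)) ((h2.restrict _).restrict _)) (h1.restrict _)).congr
    fun n x _ => ?_
  obtain ⟨s, st, op⟩ := x
  rcases op with _ | ⟨_ | i, d⟩
  · rfl
  · rfl
  · by_cases h : some i = i₀
    · rw [opQuery, if_pos h]
      exact (if_pos (c := decide (some i = i₀) = true) (decide_eq_true h)).symm
    · rw [opQuery, if_neg h]
      exact (if_neg (c := decide (some i = i₀) = true) (by simpa using h)).symm

theorem simPre_poly (hP : DTLP.EfficientParams P) (A : Interactive) (i₀ : Option Party)
    {D : Dom (SimState z)}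
    (hA : ∃ q : Polynomial ℕ, ∀ n s, D.mem n s → s.2.1 = some true →
      A.prog.WorkLe (.cons s.2.2.1 s.2.2.2.1) (q.eval n)) : PolyOn D (U.simPre P A i₀) := by
  have h := U.nextOp_poly hP A hA
  refine PolyOn.bind₂ (g := fun s o => U.opQuery i₀ s o.1 o.2) h ?_
  exact (U.opQuery_poly i₀ (Dom.ext _ h)).congr fun _ _ _ => rfl

theorem simPost_poly (D : Dom (SimMid z × Data)) : PolyFun D simPost := by
  have hs : PolyFun D fun x => x.1.1 := PolyFun.id.fst.fst
  have hstage : PolyFun D fun x => x.1.1.2.1 := hs.snd.fst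
  have hrep : PolyFun D fun x => x.1.1.2.2.2.1 := hs.snd.snd.snd.fst
  have ht : PolyFun D fun x => x.1.2.2.1 := PolyFun.id.fst.snd.snd.fst
  have hw : PolyFun D fun x => wrapReply x.1.2.2.1 x.2 := by
    refine (PolyFun.ite ht.coded.toBool ((ht.coded.dsnd.dcons PolyFun.id.snd).restrict _)
      (PolyFun.id.snd.restrict _)).congr fun n x _ => ?_
    rcases x.1.2.2.1 with _ | t <;> rfl
  have hstage' : PolyFun D fun x => (nextReply x.1.1.2.1 x.1.1.2.2.2.1 (wrapReply x.1.2.2.1 x.2)).1 := by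
    refine (PolyFun.ite hstage.coded.toBool (PolyFun.const (some true))
      (PolyFun.const (some false))).congr fun n x _ => ?_
    rcases x.1.1.2.1 with _ | _ | _ <;> rfl
  have hrep' : PolyFun D fun x => (nextReply x.1.1.2.1 x.1.1.2.2.2.1 (wrapReply x.1.2.2.1 x.2)).2 := by
    refine (PolyFun.ite (hstage.coded.toBool.and hstage.coded.dsnd.toBool.not)
      ((hrep.dcons hw).restrict _) (hw.restrict _)).congr fun n x _ => ?_
    rcases x.1.1.2.1 with _ | _ | _ <;> rfl
  have hcount : PolyFun D fun x => x.1.1.2.2.2.2 + x.1.2.2.2.toNat := by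
    have hb : PolyFun D fun x => x.1.2.2.2.toNat :=
      (PolyFun.ite (PolyFun.id.fst.snd.snd.snd) (PolyFun.const 1) (PolyFun.const 0)).congr
        fun n x _ => by cases x.1.2.2.2 <;> rfl
    exact hs.snd.snd.snd.snd.add hb
  exact hs.fst.pair (hstage'.pair (PolyFun.id.fst.snd.fst.pair (hrep'.pair hcount)))

end Setting

end

section

/-! ## Bounds for the states of a game -/

theorem size_ofData_le (d : Data) : (code (Action.ofData d)).size ≤ d.size := by
  rcases d with _ | ⟨_ | ⟨a, b⟩, d⟩
  · simp [Action.ofData, code]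
  · simp [Action.ofData, code]
  · have := a.size_pos
    have := b.size_pos
    simp [Action.ofData, code]
    omega

variable {z : ℕ}

/-- Bounds for a world after at most `j` steps: `R` for the size of actions, `H` for the size of
states, `L` for the size of transactions. -/
structure WorldBound {U : Setting z} (n R H L j : ℕ) (w : DTLP.CallWorld z) : Prop where
  reach : ∃ m ≤ j * R, U.B.Reach n m w.cur
  hist_ne : w.hist ≠ []
  hist_size : ∀ s ∈ w.hist, s.size ≤ H
  log_length : w.log.length ≤ j
  log_size : ∀ e ∈ w.log, e.2.1.size ≤ L
  log_round : ∀ e ∈ w.log, e.2.2 < w.hist.length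

namespace Setting

variable {U : Setting z} {n R H L T r : ℕ}

/-- Each step adds an action of size at most `R`. After `j` steps the state is therefore reachable
with total size `j * R`, and the efficiency of the blockchain bounds it by `H`; states do not have
to be bounded recursively. -/
theorem WorldBound_act (hH : ∀ m s, m ≤ T * R → U.B.Reach n m s → s.size ≤ H)
    (hr : ∀ s a, s.size ≤ H → (code a).size ≤ R → ∀ o ∈ (U.B.step s a).support, o.2.size ≤ r)
    {j : ℕ} {w : DTLP.CallWorld z} (hw : WorldBound (U := U) n R H L j w) (hj : j + 1 ≤ T)
    {a : Action} (ha : (code a).size ≤ R) {x : Data × DTLP.CallWorld z}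
    (hx : x ∈ (U.B.act w a).support) : WorldBound (U := U) n R H L (j + 1) x.2 ∧ x.1.size ≤ r := by
  obtain ⟨o, ho, h1, h2, h3, h4⟩ := U.mem_act hx
  obtain ⟨m, hm, hreach⟩ := hw.reach
  have hlt : j * R ≤ T * R := Nat.mul_le_mul_right _ (by omega)
  have hlt' : (j + 1) * R ≤ T * R := Nat.mul_le_mul_right _ hj
  have hm' : m + (code a).size ≤ (j + 1) * R := by rw [Nat.add_mul, Nat.one_mul]; omega
  have hreach' := Blockchain.Reach.step m w.cur a o hreach ho
  have hlen : w.hist.length ≤ x.2.hist.length := by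
    rcases h4 with ⟨-, h4⟩ | ⟨-, h4⟩ <;> rw [h4] <;> simp
  refine ⟨⟨⟨_, hm', by rw [h2]; exact hreach'⟩, ?_, ?_, ?_, ?_, ?_⟩, ?_⟩
  · intro h
    rw [h] at hlen
    exact hw.hist_ne (List.length_eq_zero_iff.1 (by simpa using hlen))
  · rcases h4 with ⟨-, h4⟩ | ⟨-, h4⟩
    · rw [h4]; exact hw.hist_size
    · rw [h4]
      intro s hs
      rcases List.mem_append.1 hs with hs | hs
      · exact hw.hist_size s hs
      · rw [List.mem_singleton.1 hs]
        exact hH _ _ (hm'.trans hlt') hreach'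
  · rw [h3]; exact hw.log_length.trans (by omega)
  · rw [h3]; exact hw.log_size
  · rw [h3]; exact fun e he => (hw.log_round e he).trans_le hlen
  · rw [h1]; exact hr _ a (hH _ _ (hm.trans hlt) hreach) ha o ho

theorem WorldBound_issue (hH : ∀ m s, m ≤ T * R → U.B.Reach n m s → s.size ≤ H)
    (hr : ∀ s a, s.size ≤ H → (code a).size ≤ R → ∀ o ∈ (U.B.step s a).support, o.2.size ≤ r)
    (hLR : L + 2 ≤ R)
    {j : ℕ} {w : DTLP.CallWorld z} (hw : WorldBound (U := U) n R H L j w) (hj : j + 1 ≤ T)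
    {c : Contract z} {keys : Keys} {i : Party} {f : Call z}
    (hL : ∀ σ ∈ (U.G.sign (keys i).2 (payload c w.log.length f)).support,
      (mkTx (keys i).1 (payload c w.log.length f) σ).size ≤ L)
    {x : Data × DTLP.CallWorld z} (hx : x ∈ (DTLP.issueCall U.G U.B c keys i f w).support) :
    WorldBound (U := U) n R H L (j + 1) x.2 ∧ x.1.size ≤ r + L + 1 := by
  obtain ⟨σ, hσ, o, ho, h1, h2, h3, h4⟩ := U.mem_issueCall hx
  have hL := hL σ hσ
  set tx := mkTx (keys i).1 (payload c w.log.length f) σ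
  obtain ⟨m, hm, hreach⟩ := hw.reach
  have hlt : j * R ≤ T * R := Nat.mul_le_mul_right _ (by omega)
  -- The code of a broadcast has a cell and a `nil` besides the transaction, whence `L + 2`.
  have hb : (code (Action.bcast tx)).size ≤ R := by simp [code]; omega
  have hm' : m + (code (Action.bcast tx)).size ≤ (j + 1) * R := by
    rw [Nat.add_mul, Nat.one_mul]; omega
  have hreach' := Blockchain.Reach.step m w.cur _ o hreach ho
  refine ⟨⟨⟨_, hm', by rw [h2]; exact hreach'⟩, by rw [h3]; exact hw.hist_ne,
    by rw [h3]; exact hw.hist_size, by rw [h4]; simpa using hw.log_length, ?_, ?_⟩, ?_⟩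
  · rw [h4]
    intro e he
    rcases List.mem_append.1 he with he | he
    · exact hw.log_size e he
    · rw [List.mem_singleton.1 he]; exact hL
  · rw [h4, h3]
    intro e he
    rcases List.mem_append.1 he with he | he
    · exact hw.log_round e he
    · rw [List.mem_singleton.1 he]
      have := List.length_pos_iff.2 hw.hist_ne
      simp only [Blockchain.World.round]
      omega
  · rw [h1]
    have := hr _ _ (hH _ _ (hm.trans hlt) hreach) hb o ho
    simp
    omega

end Setting

/-- Bounds for a state of a game. -/
structure ChainBound {U : Setting z} (q T : ℕ) (x : ChainState z) : Prop where
  sim_size : ∀ i₀, (code (Setting.simState i₀ x)).size ≤ q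
  cur_size : x.w.cur.size ≤ q
  log_length : x.w.log.length ≤ T
  log_size : ∀ e ∈ x.w.log, e.2.1.size ≤ q
  log_round : ∀ e ∈ x.w.log, e.2.2 < x.w.hist.length

theorem size_hideKey_le (i₀ : Option Party) (keys : Keys) :
    (code (Setting.hideKey i₀ keys)).size ≤ (code keys).size := by
  have h : ∀ i, (code (Setting.hideKey i₀ keys i)).size ≤ (code (keys i)).size := by
    intro i
    have := (keys i).2.size_pos
    simp only [Setting.hideKey]
    split_ifs
    · simp [code_prod, show ∀ d : Data, code d = d from fun _ => rfl]; omega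
    · exact le_rfl
  have h1 := h .C
  have h2 := h .S
  have h3 := h .HC
  have h4 := h .HS
  rw [code_party, code_party]
  simp only [code_prod (_ : Data × Data)] at h1 h2 h3 h4 ⊢
  simp at h1 h2 h3 h4 ⊢
  omega

namespace ChainGame

open Setting

variable {U : Setting z} {P : ℕ → DTLP.Params z} {Γ : ChainGame U P}

theorem Reach.const {n k : ℕ} {x : ChainState z} (hx : Γ.Reach n k x) :
    x.n = n ∧ x.keys ∈ (DTLP.accounts U.G n).support ∧
      ∃ d, (x.pk, x.g, d) ∈ (Γ.start (⟨n⟩, x.keys)).support := by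
  obtain ⟨-, keys, hkeys, y, hy, s, hs, hx⟩ := hx
  have := iterK_inv (s := U.chainStep P Γ.A)
    (fun _ x => x.n = n ∧ x.keys = keys ∧ x.pk = y.1 ∧ x.g = y.2.1) (fun l a ha b hb => by
      obtain ⟨h1, h2, h3, h4⟩ := U.step_const P Γ.A hb
      obtain ⟨e1, e2, e3, e4⟩ := ha
      exact ⟨h1.trans e1, h2.trans e2, h3.trans e3, h4.trans e4⟩) _ 0 _
    (by exact ⟨rfl, rfl, rfl, rfl⟩) x hx
  obtain ⟨h1, h2, h3, h4⟩ := this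
  exact ⟨h1, h2 ▸ hkeys, y.2.2, by rw [h2, h3, h4]; exact hy⟩

/-- Bounds for the payloads of transactions. -/
theorem exists_payload_bound (hP : DTLP.EfficientParams P) (q T : Polynomial ℕ) :
    ∃ r : Polynomial ℕ, ∀ n (c : ChainContext z) count, (code c).size ≤ q.eval n →
      count ≤ T.eval n → (payload (U.simContract P c) count (.deploy (∑ i, (P c.1.val).coins i))).size
        ≤ r.eval n ∧ (payload (U.simContract P c) count (.publish c.2.2.1 c.2.2.2)).size ≤ r.eval n ∧
        ∀ j, (payload (U.simContract P c) count (.pay j)).size ≤ r.eval n := by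
  have hcount : ∀ n count : ℕ, count ≤ T.eval n → (code count).size ≤ 4 * T.eval n + 5 := by
    intro n count h
    have := size_code_nat_le (lt_of_le_of_lt h (Nat.lt_two_pow_self (n := T.eval n)))
    omega
  let D : Dom (ChainContext z × ℕ) := ⟨fun n x => (code x.1).size ≤ q.eval n ∧ x.2 ≤ T.eval n,
    q + 4 * T + 6, by
      rintro n ⟨c, count⟩ ⟨h1, h2⟩
      have := hcount n count h2
      rw [code_prod]
      simp at *
      omega⟩
  let E : Dom ((ChainContext z × ℕ) × Fin z) := ⟨fun n x => D.mem n x.1, by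
    obtain ⟨q, hq⟩ := D.bound
    refine ⟨q + .C (4 * z + 6), ?_⟩
    rintro n ⟨x, j⟩ h
    have h1 := hq n x h
    have h2 := size_code_nat_le (lt_of_le_of_lt j.2.le (Nat.lt_two_pow_self (n := z)))
    have h3 : (code (x, j)).size = (code x).size + (code (j : ℕ)).size + 1 := rfl
    rw [h3]
    simp only [Polynomial.eval_add, Polynomial.eval_C]
    omega⟩
  obtain ⟨h1, h2⟩ := U.calls_poly hP (PolyFun.id.fst : PolyFun D fun x => x.1) PolyFun.id.snd
  have h3 : PolyFun E fun x => payload (U.simContract P x.1.1) x.1.2 (.pay x.2) :=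
    U.payload_poly hP PolyFun.id.fst.fst PolyFun.id.fst.snd
      ((PolyFun.const (3 : ℕ)).pair PolyFun.id.snd).coded
  obtain ⟨r₁, h1⟩ := h1.bound
  obtain ⟨r₂, h2⟩ := h2.bound
  obtain ⟨r₃, h3⟩ := h3.bound
  refine ⟨r₁ + r₂ + r₃, fun n c count hc hn => ⟨?_, ?_, fun j => ?_⟩⟩
  · have := h1 n (c, count) ⟨hc, hn⟩
    simp at this ⊢; exact le_trans this (by omega)
  · have := h2 n (c, count) ⟨hc, hn⟩
    simp at this ⊢; exact le_trans this (by omega)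
  · have := h3 n ((c, count), j) ⟨hc, hn⟩
    simp at this ⊢; exact le_trans this (by omega)

/-- The invariant from which the bounds follow. -/
structure Invariant (Γ : ChainGame U P) (n R H L Y r k : ℕ) (x : ChainState z) : Prop where
  world : WorldBound (U := U) n R H L (Γ.T.eval n - k) x.w
  st : x.st.size ≤ Y + 2 * x.cost.work
  rep : x.rep.size ≤ 2 * r + 1
  rep' : x.stage = some false → x.rep.size ≤ r

/-- A bound of each state in terms of the previous one could grow exponentially. Instead, the
adversary's state is bounded through the total cost so far, which `Γ.bound` limits, and the replies
through the absolute bound for states. The reply after deployment has a bound of its own, since it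
is joined with the reply to the publication. -/
theorem Invariant.step {n R H L Y r r' : ℕ} (hr' : r' + L + 1 ≤ r)
    (hH : ∀ m s, m ≤ Γ.T.eval n * R → U.B.Reach n m s → s.size ≤ H)
    (hr : ∀ s a, s.size ≤ H → (code a).size ≤ R → ∀ o ∈ (U.B.step s a).support, o.2.size ≤ r')
    (hLR : L + 2 ≤ R) (hYR : Y + 4 * Γ.bound.eval n + 1 ≤ R)
    (hL : ∀ keys ∈ (DTLP.accounts U.G n).support, ∀ y ∈ (Γ.start (⟨n⟩, keys)).support,
      ∀ count ≤ Γ.T.eval n, ∀ i f,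
      (f = .deploy (∑ i, (P n).coins i) ∨ f = .publish y.1 y.2.1 ∨ ∃ j, f = .pay j) →
      ∀ σ ∈ (U.G.sign (keys i).2 (payload (U.contract n (P n) keys) count f)).support,
        (mkTx (keys i).1 (payload (U.contract n (P n) keys) count f) σ).size ≤ L)
    {k : ℕ} {x y : ChainState z} (hx : Γ.Reach n (k + 1) x)
    (h : Invariant Γ n R H L Y r (k + 1) x) (hy : y ∈ (U.chainStep P Γ.A x).support) :
    Invariant Γ n R H L Y r k y := by
  obtain ⟨hn, hkeys, d, hd⟩ := hx.const
  have hk := hx.1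
  have hwork := hx.work_le
  obtain ⟨hw, hst, hrep, hrep'⟩ := h
  obtain ⟨n', keys, pk, g, stage, st, rep, w, cost⟩ := x
  simp only at hn hkeys hd hw hst hrep hrep' hwork
  subst hn
  have hj : Γ.T.eval n' - k = Γ.T.eval n' - (k + 1) + 1 := by omega
  have hjT : Γ.T.eval n' - (k + 1) + 1 ≤ Γ.T.eval n' := by omega
  have hlog : w.log.length ≤ Γ.T.eval n' := hw.log_length.trans (by omega)
  have hissue := fun i f hf x hx' => WorldBound_issue hH hr hLR hw hjT (f := f)
    (hL keys hkeys _ hd w.log.length hlog i f hf) (x := x) hx'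
  rcases stage with _ | _ | _ <;>
    simp only [chainStep, PMF.mem_support_bind, PMF.mem_support_map] at hy
  · obtain ⟨o, ho, rfl⟩ := hy
    obtain ⟨h1, h2⟩ := hissue _ _ (Or.inl rfl) o ho
    exact ⟨by rw [hj]; exact h1, hst, by simp only; omega, fun _ => by simp only; omega⟩
  · obtain ⟨o, ho, rfl⟩ := hy
    obtain ⟨h1, h2⟩ := hissue _ _ (Or.inr (Or.inl rfl)) o ho
    refine ⟨by rw [hj]; exact h1, hst, ?_, fun h => by cases h⟩
    have := hrep' rfl
    simp only [size_cons]
    omega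
  · obtain ⟨o, ho, q, hq, rfl⟩ := hy
    have h1 := hwork rfl o ho
    have h2 := Prog.run_size _ _ o ho
    have h3 := o.1.size_fst_le
    have h4 := o.1.size_snd_le
    simp only [size_cons] at h2
    have h5 : WorldBound (U := U) n' R H L (Γ.T.eval n' - (k + 1) + 1) q.2 ∧ q.1.size ≤ r := by
      rcases hd : o.1.snd with _ | ⟨_ | ⟨a, i⟩, d⟩ <;> rw [hd] at hq h4
      · simp only [DTLP.chainOracle, PMF.pure_eq, PMF.mem_support_pure] at hq
        subst hq
        obtain ⟨⟨m, hm, hm'⟩, e2, e3, e4, e5, e6⟩ := hw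
        exact ⟨⟨⟨m, hm.trans (Nat.mul_le_mul_right _ (by omega)), hm'⟩, e2, e3, e4.trans (by omega),
          e5, e6⟩, by simp; omega⟩
      · simp only [DTLP.chainOracle] at hq
        obtain ⟨e1, e2⟩ := WorldBound_act hH hr hw hjT
          ((size_ofData_le d).trans (by simp at h4; omega)) hq
        exact ⟨e1, by omega⟩
      · simp only [DTLP.chainOracle] at hq
        by_cases hz : d.toNat < z
        · rw [dif_pos hz] at hq
          obtain ⟨e1, e2⟩ := hissue _ _ (Or.inr (Or.inr ⟨_, rfl⟩)) q hq
          exact ⟨e1, by omega⟩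
        · rw [dif_neg hz, PMF.pure_eq, PMF.mem_support_pure] at hq
          subst hq
          obtain ⟨⟨m, hm, hm'⟩, e2, e3, e4, e5, e6⟩ := hw
          exact ⟨⟨⟨m, hm.trans (Nat.mul_le_mul_right _ (by omega)), hm'⟩, e2, e3,
            e4.trans (by omega), e5, e6⟩, by simp; omega⟩
    refine ⟨by rw [hj]; exact h5.1, ?_, ?_, fun h => by cases h⟩
    -- The new state is at most the old one plus reply, work and one cell. Reading the reply is
    -- charged and its size is positive, so twice the added cost suffices.
    · simp only [Cost.seq, Cost.step] at h1 ⊢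
      have := rep.size_pos
      omega
    · simp only; omega

/-- The bounds are chosen without circularity: keys and start, then payloads, signatures and
transactions, then actions, then states, then replies. The adversary's contribution to the actions
comes from its total work, which is bounded in advance. -/
theorem exists_bound (hP : DTLP.EfficientParams P) : ∃ q : Polynomial ℕ, ∀ n k x,
    Γ.Reach n k x → ChainBound (U := U) (q.eval n) (Γ.T.eval n) x := by
  -- the account keys and the start
  let Dn : Dom Unary := ⟨fun n m => m = ⟨n⟩, 2 * .X + 1, by rintro n _ rfl; simp⟩
  obtain ⟨qk, hqk⟩ := (U.accounts_poly (PolyFun.id : PolyFun Dn _)).exists_bound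
  let Dk : Dom (Unary × Keys) := ⟨fun n x => x.1 = ⟨n⟩ ∧ x.2 ∈ (DTLP.accounts U.G n).support,
    2 * .X + 2 + qk, by
      rintro n ⟨_, keys⟩ ⟨rfl, h⟩
      have := hqk n ⟨n⟩ rfl keys h
      rw [code_prod]
      simp at *
      omega⟩
  obtain ⟨qy, hqy⟩ := (Γ.start_poly Dk fun n x hx => by rw [hx.1]).exists_bound
  have hqy : ∀ n, ∀ keys ∈ (DTLP.accounts U.G n).support, ∀ y ∈ (Γ.start (⟨n⟩, keys)).support,
      (code y).size ≤ qy.eval n := fun n keys hk y hy => hqy n (⟨n⟩, keys) ⟨rfl, hk⟩ y hy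
  have hqk : ∀ n, ∀ keys ∈ (DTLP.accounts U.G n).support, (code keys).size ≤ qk.eval n :=
    fun n keys hk => hqk n ⟨n⟩ rfl keys hk
  obtain ⟨rb, hrb⟩ := exists_payload_bound (U := U) hP (2 * .X + qk + qy + 5) Γ.T
  -- signatures
  let Ds : Dom (Data × Data) := ⟨fun n x => x.1.size ≤ qk.eval n ∧ x.2.size ≤ rb.eval n, qk + rb + 1, by
    rintro n ⟨a, b⟩ ⟨h1, h2⟩; simp [show ∀ d : Data, code d = d from fun _ => rfl] at *; omega⟩
  obtain ⟨qs, hqs⟩ := (PolyOn.of_polyTime U.hG.2.1 : PolyOn Ds _).exists_bound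
  have hkey : ∀ n, ∀ keys ∈ (DTLP.accounts U.G n).support, ∀ i,
      (keys i).1.size ≤ qk.eval n ∧ (keys i).2.size ≤ qk.eval n := by
    intro n keys hk i
    have h := hqk n keys hk
    rw [code_party] at h
    simp only [code_prod (_ : Data × Data), code_prod] at h
    simp [show ∀ d : Data, code d = d from fun _ => rfl] at h
    cases i <;> constructor <;> omega
  -- actions, states and replies
  let L : Polynomial ℕ := qk + rb + qs + 2
  let R : Polynomial ℕ := L + 2 + qy + 4 * Γ.bound + 1
  obtain ⟨qB, hqB⟩ := U.hB.2.2.2.2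
  let H : Polynomial ℕ := qB.comp (.X + Γ.T * R)
  let DB : Dom (Data × Action) := ⟨fun n x => x.1.size ≤ H.eval n ∧ (code x.2).size ≤ R.eval n,
    H + R + 1, by
    rintro n ⟨a, b⟩ ⟨h1, h2⟩
    rw [code_prod]
    simp [show ∀ d : Data, code d = d from fun _ => rfl] at *
    omega⟩
  obtain ⟨r', hr'⟩ := (PolyOn.of_polyTime U.hB.2.1 : PolyOn DB _).exists_bound
  let r : Polynomial ℕ := r' + L + 1
  have hinv : ∀ n k x, Γ.Reach n k x →
      Invariant Γ n (R.eval n) (H.eval n) (L.eval n) (qy.eval n) (r.eval n) k x := by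
    intro n k x hx
    obtain ⟨hk, keys, hkeys, y, hy, s, hs, hx⟩ := hx
    have hstart := Blockchain.Reach.start s hs
    refine (iterK_inv (fun k x => Γ.Reach n k x ∧
      Invariant Γ n (R.eval n) (H.eval n) (L.eval n) (qy.eval n) (r.eval n) k x)
      (fun l a ha b hb => ⟨ha.1.step hb, Invariant.step (r' := r'.eval n) (by simp [r]) ?_ ?_ ?_ ?_ ?_
        ha.1 ha.2 hb⟩) (Γ.T.eval n - k) k (chainInit n keys y s) ⟨?_, ?_⟩ x hx).2
    · intro m s hm hs
      refine (hqB n m s hs).trans ((eval_le_eval (Nat.add_le_add_left hm n)).trans (le_of_eq ?_))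
      simp [H]
    · intro s a hs ha o ho
      refine le_trans ?_ (hr' n (s, a) ⟨hs, ha⟩ o ho)
      rw [code_prod]
      simp [show ∀ d : Data, code d = d from fun _ => rfl]
      omega
    · simp [R]; omega
    · simp [R]
    · intro keys hkeys y hy count hcount i f hf σ hσ
      have hc : (code ((⟨n⟩, keys, y.1, y.2.1) : ChainContext z)).size ≤
          (2 * .X + qk + qy + 5 : Polynomial ℕ).eval n := by
        have h1 := hqk n keys hkeys
        have h2 := hqy n keys hkeys y hy
        simp only [code_prod] at h2 ⊢
        simp at h1 h2 ⊢
        omega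
      obtain ⟨b1, b2, b3⟩ := hrb n (⟨n⟩, keys, y.1, y.2.1) count hc hcount
      have hbody : (payload (U.contract n (P n) keys) count f).size ≤ rb.eval n := by
        rcases hf with rfl | rfl | ⟨j, rfl⟩
        exacts [b1, b2, b3 j]
      obtain ⟨k1, k2⟩ := hkey n keys hkeys i
      have hsig := hqs n (_, _) ⟨k2, hbody⟩ σ hσ
      simp [mkTx, code_prod, L, show ∀ d : Data, code d = d from fun _ => rfl] at hsig ⊢
      omega
    · rw [Nat.sub_add_cancel hk]
      refine ⟨le_rfl, keys, hkeys, y, hy, s, hs, ?_⟩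
      simp [DelegatedTLP.iterK]
    · rw [Nat.sub_add_cancel hk]
      have h1 := hqy n keys hkeys y hy
      refine ⟨⟨⟨0, by simp, hstart⟩, by simp [chainInit], ?_, by simp [chainInit],
        by simp [chainInit], by simp [chainInit]⟩, ?_, by simp [chainInit], by simp [chainInit]⟩
      · intro s' hs'
        rw [List.mem_singleton.1 hs']
        refine (hqB n 0 s hstart).trans ((eval_le_eval (Nat.le_add_right _ (Γ.T.eval n * R.eval n))).trans
          (le_of_eq ?_))
        simp [H]
      · simp only [code_prod] at h1
        simp [chainInit, show ∀ d : Data, code d = d from fun _ => rfl] at h1 ⊢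
        omega
  refine ⟨2 * .X + 1 + qk + qy + 5 + qy + 2 * Γ.bound + (2 * r + 1) + 4 * Γ.T + 10 + H + L,
    fun n k x hx => ?_⟩
  have hi := hinv n k x hx
  obtain ⟨hn, hkeys, d, hd⟩ := hx.const
  have hlog : x.w.log.length ≤ Γ.T.eval n := hi.world.log_length.trans (by omega)
  have hcount := size_code_nat_le (lt_of_le_of_lt hlog (Nat.lt_two_pow_self (n := Γ.T.eval n)))
  obtain ⟨m, hm, hreach⟩ := hi.world.reach
  have hcur : x.w.cur.size ≤ H.eval n := by
    refine (hqB n m _ hreach).trans ((eval_le_eval (Nat.add_le_add_left (hm.trans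
      (Nat.mul_le_mul_right _ (Nat.sub_le (Γ.T.eval n) k))) n)).trans (le_of_eq ?_))
    simp [H]
  have hcost := hx.cost_le
  have hst := hi.st
  have hrep := hi.rep
  refine ⟨fun i₀ => ?_, ?_, hlog, fun e he => ?_,
    hi.world.log_round⟩
  · have h1 := (size_hideKey_le i₀ x.keys).trans (hqk n x.keys hkeys)
    have h2 := hqy n x.keys hkeys _ hd
    have h3 : (code x.stage).size ≤ 5 := by rcases x.stage with _ | _ | _ <;> simp [code]
    simp only [simState, code_prod, hn] at h2 ⊢
    simp [show ∀ d : Data, code d = d from fun _ => rfl] at h1 h2 ⊢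
    omega
  · simp; omega
  · have := hi.world.log_size e he
    simp; omega

end ChainGame

end

section

/-! ## Environments and liveness adversaries from games -/

variable {z : ℕ}

/-- A deterministic function as a random step. -/
abbrev purePost (x : Setting.SimMid z × Data) : PMF (Setting.SimState z) := PMF.pure (Setting.simPost x)

namespace Setting

variable (U : Setting z) (P : ℕ → DTLP.Params z) (A : Interactive)

theorem sim_iterK (i₀ : Option Party) (key : Data × Data) (k : ℕ) (x : ChainState z)
    (hkey : ∀ i, i₀ = some i → key = x.keys i) :
    iterK (redStep (U.simPre P A i₀) purePost (U.B.liveOracle U.G key)) k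
        (simState i₀ x, partyWorld i₀ x.w) =
      (iterK (U.chainStep P A) k x).map fun y => (simState i₀ y, partyWorld i₀ y.w) :=
  iterK_map (fun y => (simState i₀ y, partyWorld i₀ y.w))
    (fun (_ : ℕ) (y : ChainState z) => ∀ i, i₀ = some i → key = y.keys i)
    (fun _ y hy y' hy' i hi => by rw [(U.step_const P A hy').2.1]; exact hy i hi)
    (fun _ y hy => U.sim_chainStep P A i₀ key y hy) k x hkey

/-- Without an account holder, no query asks the oracle for a signature. On the remaining queries,
an environment and the liveness oracle behave alike. -/
theorem simPre_none {s : SimState z} {mq : SimMid z × Data}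
    (h : mq ∈ (U.simPre P A none s).support) : mq.2 = .nil ∨ ∃ a b d, mq.2 = .cons (.cons a b) d := by
  simp only [simPre, PMF.mem_support_bind] at h
  obtain ⟨⟨st, op⟩, -, h⟩ := h
  rcases op with _ | ⟨_ | i, d⟩
  · rw [opQuery, PMF.mem_support_pure] at h
    exact Or.inl (by rw [h])
  · rw [opQuery, PMF.mem_support_pure] at h
    exact Or.inr ⟨.nil, .nil, d, by rw [h]⟩
  · rw [opQuery, if_neg (by simp), PMF.mem_support_map] at h
    obtain ⟨σ, -, rfl⟩ := h
    exact Or.inr ⟨_, _, _, rfl⟩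

theorem redStep_envOracle (key : Data × Data) :
    redStep (U.simPre P A none) purePost U.B.envOracle =
      redStep (U.simPre P A none) purePost (U.B.liveOracle U.G key) := by
  funext x
  refine PMF.bind_congr fun mq hmq => ?_
  rcases U.simPre_none P A hmq with h | ⟨a, b, d, h⟩ <;> rw [h] <;> rfl

end Setting

theorem Setting.hideKey_none (keys : Keys) : Setting.hideKey none keys = keys := by
  funext i; simp [Setting.hideKey]

theorem Setting.hideKey_some (i : Party) (keys : Keys) :
    Setting.hideKey (some i) keys = Function.update keys i ((keys i).1, .nil) := by
  funext j
  by_cases h : j = i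
  · subst h; simp [Setting.hideKey]
  · simp [Setting.hideKey, h]

namespace ChainGame

open Setting

variable {U : Setting z} {P : ℕ → DTLP.Params z} (Γ : ChainGame U P)

/-- The final state of the game. -/
def final (n : ℕ) : PMF (ChainState z) :=
  (DTLP.accounts U.G n).bind fun keys => (Γ.start (⟨n⟩, keys)).bind fun y =>
    (U.B.start n).bind fun s => DelegatedTLP.iterK (U.chainStep P Γ.A) (Γ.T.eval n) (chainInit n keys y s)

/-- States of the simulation before the last step. -/
def simDom (hP : DTLP.EfficientParams P) (i₀ : Option Party) : Dom (SimState z) :=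
  ⟨fun n s => ∃ k x, Γ.Reach n (k + 1) x ∧ simState i₀ x = s, by
    obtain ⟨q, hq⟩ := Γ.exists_bound hP
    exact ⟨q, by rintro n _ ⟨k, x, hx, rfl⟩; exact (hq n _ x hx).sim_size i₀⟩⟩

theorem simDom_work (hP : DTLP.EfficientParams P) (i₀ : Option Party) : ∃ q : Polynomial ℕ,
    ∀ n s, (Γ.simDom hP i₀).mem n s → s.2.1 = some true →
      Γ.A.prog.WorkLe (.cons s.2.2.1 s.2.2.2.1) (q.eval n) := by
  refine ⟨Γ.bound, ?_⟩
  rintro n _ ⟨k, x, hx, rfl⟩ hs o ho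
  have := hx.work_le hs o ho
  omega

theorem pre_poly (hP : DTLP.EfficientParams P) (i₀ : Option Party) :
    PolyOn (Γ.simDom hP i₀) (U.simPre P Γ.A i₀) :=
  U.simPre_poly hP Γ.A i₀ (Γ.simDom_work hP i₀)

/-- Each reply is stored in the next state of the simulation. It is therefore bounded as soon as
reachable states are. -/
theorem size_reply_le (x : SimMid z × Data) : x.2.size ≤ (code (simPost x)).size := by
  have h1 : x.2.size ≤ (wrapReply x.1.2.2.1 x.2).size := by
    rcases x.1.2.2.1 with _ | t <;> simp [wrapReply]; omega
  have h2 : (wrapReply x.1.2.2.1 x.2).size ≤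
      (nextReply x.1.1.2.1 x.1.1.2.2.2.1 (wrapReply x.1.2.2.1 x.2)).2.size := by
    rcases x.1.1.2.1 with _ | _ | _ <;> simp [nextReply]; omega
  have h3 : ∀ s : SimState z, s.2.2.2.1.size ≤ (code s).size := by
    intro s
    simp only [code_prod]
    simp [show ∀ d : Data, code d = d from fun _ => rfl]
    omega
  exact h1.trans (h2.trans (h3 (simPost x)))

/-- Replies to the queries of the simulation. -/
def postDom (hP : DTLP.EfficientParams P) (i₀ : Option Party) : Dom (SimMid z × Data) :=
  ⟨fun n x => (∃ s q, (Γ.simDom hP i₀).mem n s ∧ (x.1, q) ∈ (U.simPre P Γ.A i₀ s).support) ∧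
      ∃ k y, Γ.Reach n k y ∧ simState i₀ y = simPost x, by
    obtain ⟨q, hq⟩ := Γ.exists_bound hP
    obtain ⟨r, hr⟩ := (Γ.pre_poly hP i₀).exists_bound
    refine ⟨q + r + 1, ?_⟩
    rintro n x ⟨⟨s, d, hs, hx⟩, k, y, hy, hxy⟩
    have h1 := hr n s hs _ hx
    have h2 := (hq n k y hy).sim_size i₀
    rw [hxy] at h2
    have h3 := size_reply_le x
    have h4 : (code x).size = (code x.1).size + x.2.size + 1 := rfl
    have h5 : (code (x.1, d)).size = (code x.1).size + d.size + 1 := rfl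
    simp only [Polynomial.eval_add, Polynomial.eval_one]
    omega⟩

variable {Γ}

/-- The comparison of the steps, for individual outcomes: every possible step of the simulation
comes from a step of the game, so all states of the simulation inherit the bounds for the game. -/
theorem Reach.sim_step (hP : DTLP.EfficientParams P) {n k : ℕ} {x : ChainState z}
    (hx : Γ.Reach n (k + 1) x) (i₀ : Option Party) (key : Data × Data)
    (hkey : ∀ i, i₀ = some i → key = x.keys i) :
    (Γ.simDom hP i₀).mem n (simState i₀ x) ∧
    ∀ mq ∈ (U.simPre P Γ.A i₀ (simState i₀ x)).support,
      ∀ r ∈ (U.B.liveOracle U.G key (partyWorld i₀ x.w) mq.2).support,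
        (Γ.postDom hP i₀).mem n (mq.1, r.1) ∧ ∃ y, Γ.Reach n k y ∧ y.keys = x.keys ∧
          simState i₀ y = simPost (mq.1, r.1) ∧ partyWorld i₀ y.w = r.2 := by
  refine ⟨⟨k, x, hx, rfl⟩, fun mq hmq r hr => ?_⟩
  have h : (simPost (mq.1, r.1), r.2) ∈ (redStep (U.simPre P Γ.A i₀) purePost
      (U.B.liveOracle U.G key) (simState i₀ x, partyWorld i₀ x.w)).support := by
    simp only [redStep, purePost, PMF.mem_support_bind, PMF.pure_map, PMF.mem_support_pure]
    exact ⟨mq, hmq, r, hr, rfl⟩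
  rw [U.sim_chainStep P Γ.A i₀ key x hkey, PMF.mem_support_map] at h
  obtain ⟨y, hy, h⟩ := h
  obtain ⟨h1, h2⟩ := Prod.mk.inj h
  exact ⟨⟨⟨_, mq.2, ⟨k, x, hx, rfl⟩, hmq⟩, k, y, hx.step hy, h1⟩, y, hx.step hy,
    (U.step_const P Γ.A hy).2.1, h1, h2⟩

variable (Γ)

/-- The start of a simulation, where the keys are modified. -/
def simStart {ι : Type} (num : ι → Unary) (m : ι → Keys → Keys) (i : ι) : PMF (SimState z) :=
  (DTLP.accounts U.G (num i).val).bind fun keys => (Γ.start (num i, m i keys)).map fun y =>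
    ((num i, m i keys, y.1, y.2.1), none, y.2.2, .nil, 0)

theorem simStart_poly {ι : Type} [Coded ι] {D : Dom ι} {num : ι → Unary} {m : ι → Keys → Keys}
    (hnum : PolyFun D num) (hn : ∀ n i, D.mem n i → (num i).val = n)
    (hm : PolyFun (D.ext (U.accounts_poly hnum)) fun x => m x.1 x.2) :
    PolyOn D (Γ.simStart num m) := by
  refine PolyOn.bind₂ (U.accounts_poly hnum) ?_
  have h := hnum.up (hg := U.accounts_poly hnum)
  have hs : PolyOn (D.ext (U.accounts_poly hnum)) fun x => Γ.start (num x.1, m x.1 x.2) := by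
    have h2 := h.pair hm
    refine PolyFun.bind (E := Dom.map _ h2) h2 (Γ.start_poly _ ?_) fun n a ha => ⟨a, ha, rfl⟩
    rintro n _ ⟨a, ha, rfl⟩
    exact hn n _ ha.1
  refine PolyOn.map hs ?_
  exact (h.up.pair (hm.up.pair (PolyFun.id.snd.fst.pair PolyFun.id.snd.snd.fst))).pair
    ((PolyFun.const _).pair (PolyFun.id.snd.snd.snd.pair ((PolyFun.const _).pair (PolyFun.const _))))

/-- Security of the blockchain in an environment that simulates the game. -/
theorem trace_secure (hP : DTLP.EfficientParams P) {bad : ℕ → List Data → Prop}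
    (hbad : ∀ A : Interactive, (U.B.traceExp bad A).IsPPT → (U.B.traceExp bad A).CannotWin) :
    ∃ μ, Negligible μ ∧ ∀ n, ((Γ.final n).toOuterMeasure {x | bad n x.w.hist}).toReal ≤ μ n := by
  let Dn : Dom Unary := ⟨fun n m => m = ⟨n⟩, 2 * .X + 1, by rintro n _ rfl; simp⟩
  -- Nothing is signed by the oracle here, so any value serves as the key of the account holder.
  let key : Data × Data := (.nil, .nil)
  have h₀ : PolyOn Dn (Γ.simStart (fun i => i) fun _ keys => keys) :=
    Γ.simStart_poly PolyFun.id (fun n i hi => by rw [hi]) PolyFun.id.snd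
  let Dfin : Dom (SimState z) := ⟨fun n s => ∃ x, Γ.Reach n 0 x ∧ simState none x = s, by
    obtain ⟨q, hq⟩ := Γ.exists_bound hP
    exact ⟨q, by rintro n _ ⟨x, hx, rfl⟩; exact (hq n _ x hx).sim_size none⟩⟩
  have hfin : PolyOn Dfin fun _ : SimState z => (PMF.pure Data.nil : PMF Data) := PolyFun.const _
  have hstep : ∀ n k s w, k < Γ.T.eval n →
      (∃ x, Γ.Reach n (k + 1) x ∧ simState none x = s ∧ partyWorld none x.w = w) →
      (Γ.simDom hP none).mem n s ∧ ∀ mq ∈ (U.simPre P Γ.A none s).support,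
        ∀ r ∈ (U.B.envOracle w mq.2).support, (Γ.postDom hP none).mem n (mq.1, r.1) ∧
          ∀ s' ∈ (purePost (mq.1, r.1)).support,
            ∃ x, Γ.Reach n k x ∧ simState none x = s' ∧ partyWorld none x.w = r.2 := by
    rintro n k _ _ - ⟨x, hx, rfl, rfl⟩
    obtain ⟨h1, h2⟩ := hx.sim_step hP none key (by simp)
    refine ⟨h1, fun mq hmq r hr => ?_⟩
    have hr' : r ∈ (U.B.liveOracle U.G key (partyWorld none x.w) mq.2).support := by
      rcases U.simPre_none P Γ.A hmq with h | ⟨a, b, d, h⟩ <;> rw [h] at hr ⊢ <;> exact hr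
    obtain ⟨h3, y, hy, -, h4, h5⟩ := h2 mq hmq r hr'
    refine ⟨h3, fun s' hs' => ?_⟩
    rw [PMF.mem_support_pure.1 hs']
    exact ⟨y, hy, h4, h5⟩
  obtain ⟨A, ⟨q, hq⟩, hA⟩ := exists_interactive U.B.envOracle (fun _ => rfl) Γ.T
    (fun n (i : Unary) w => i = ⟨n⟩ ∧ ∃ s ∈ (U.B.start n).support, w = ⟨[s], s, []⟩)
    (Dι := Dn) (fun n i w h => h.1) (num := fun i => i) PolyFun.id (fun n i w h => by rw [h.1])
    (fun n i w h => by cases i with | mk v => cases v <;> simp [code_unary, Data.ofList, List.replicate_succ])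
    h₀ (Γ.pre_poly hP none) (simPost_poly (Γ.postDom hP none)) hfin
    (fun n k s w => ∃ x, Γ.Reach n k x ∧ simState none x = s ∧ partyWorld none x.w = w)
    (by
      rintro n _ _ ⟨rfl, s, hs, rfl⟩ t ht
      simp only [simStart, PMF.mem_support_bind, PMF.mem_support_map] at ht
      obtain ⟨keys, hkeys, y, hy, rfl⟩ := ht
      refine ⟨chainInit n keys y s, ⟨le_rfl, keys, hkeys, y, hy, s, hs, by simp [DelegatedTLP.iterK]⟩, ?_, ?_⟩
      · simp [simState, chainInit, hideKey_none]
      · simp [partyWorld, chainInit])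
    hstep (by rintro n s w ⟨x, hx, rfl, -⟩; exact ⟨x, hx, rfl⟩)
  have hppt : (U.B.traceExp bad A).IsPPT := by
    refine ⟨q, fun n o ho => ?_⟩
    simp only [Blockchain.traceExp, Blockchain.init, PMF.bind_eq, PMF.pure_eq, PMF.bind_bind,
      PMF.pure_bind, PMF.mem_support_bind, PMF.mem_support_pure] at ho
    obtain ⟨s, hs, r, hr, rfl⟩ := ho
    exact hq n ⟨n⟩ _ ⟨rfl, s, hs, rfl⟩ r hr
  obtain ⟨μ, hμ, h⟩ := hbad A hppt
  refine ⟨μ, hμ, fun n => ?_⟩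
  have h := h n
  rw [Experiment.winProb_eq] at h
  have e : ((U.B.traceExp bad A n).map Outcome.win) =
      (Γ.final n).map fun x => bad n x.w.hist := by
    have e1 : ((U.B.traceExp bad A n).map Outcome.win) = (U.B.start n).bind fun s =>
        ((A.run U.B.envOracle n (code (Unary.mk n)) .nil ⟨[s], s, []⟩).map fun o => (o.1, o.2.1)).map
          fun r => bad n r.2.hist := by
      simp only [Blockchain.traceExp, Blockchain.init, PMF.bind_eq, PMF.pure_eq, PMF.map_bind,
        PMF.pure_map, PMF.map_comp, PMF.bind_bind, PMF.pure_bind]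
      rfl
    rw [e1, final]
    have e2 : ∀ s ∈ (U.B.start n).support, _ := fun s hs => hA n ⟨n⟩ ⟨[s], s, []⟩ ⟨rfl, s, hs, rfl⟩
    rw [PMF.bind_congr fun s hs => by rw [e2 s hs]]
    simp only [simStart, PMF.bind_bind, PMF.bind_map, PMF.map_bind, Function.comp_def, PMF.pure_map]
    rw [PMF.bind_comm]
    refine congrArg _ (funext fun keys => ?_)
    rw [PMF.bind_comm]
    refine congrArg _ (funext fun y => congrArg _ (funext fun s => ?_))
    have := U.sim_iterK P Γ.A none key (Γ.T.eval n) (chainInit n keys y s) (by simp)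
    simp only [simState, chainInit, hideKey_none, List.length_nil] at this
    rw [U.redStep_envOracle P Γ.A key]
    refine (congrArg (fun p => PMF.bind p _) this).trans ?_
    rw [PMF.bind_map]
    rfl
  rw [e, PMF.toOuterMeasure_map_apply] at h
  exact h

end ChainGame

end

section

/-! ## Liveness in a game -/

variable {z : ℕ}

theorem PolyFun.updateParty {γ α : Type} [Coded γ] [Coded α] {D : Dom γ} {f : γ → Party → α} {a : γ → α}
    (hf : PolyFun D f) (i : Party) (ha : PolyFun D a) :
    PolyFun D fun g => Function.update (f g) i (a g) := by
  refine PolyFun.mkParty fun j => ?_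
  by_cases h : j = i
  · subst h; simpa using ha
  · simpa [h] using hf.party j

theorem update_mem_accounts {G : Sig} {n : ℕ} {keys : Keys} {k : Data × Data} (i : Party)
    (hkeys : keys ∈ (DTLP.accounts G n).support) (hk : k ∈ (G.keyGen n).support) :
    Function.update keys i k ∈ (DTLP.accounts G n).support := by
  rw [← DTLP.accounts_update G n i]
  simp only [PMF.mem_support_bind, PMF.mem_support_map]
  exact ⟨k, hk, keys, hkeys, rfl⟩

namespace ChainGame

open Setting

variable {U : Setting z} {P : ℕ → DTLP.Params z} (Γ : ChainGame U P)

/-- Security parameter and verification key. -/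
abbrev KeyInput : Type := Unary × Data

/-- The inputs at a given security parameter. -/
def keyDom (U : Setting z) : Dom KeyInput :=
  ⟨fun n i => i.1 = ⟨n⟩ ∧ ∃ k ∈ (U.G.keyGen n).support, k.1 = i.2, by
    let D : Dom Unary := ⟨fun n m => m = ⟨n⟩, 2 * .X + 1, by rintro n _ rfl; simp⟩
    obtain ⟨q, hq⟩ := (U.keyGen_poly (D := D) PolyFun.id).exists_bound
    refine ⟨2 * .X + q + 2, ?_⟩
    rintro n ⟨_, _⟩ ⟨rfl, k, hk, rfl⟩
    have := hq n ⟨n⟩ rfl k hk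
    rw [code_prod] at this ⊢
    change k.1.size + k.2.size + 1 ≤ _ at this
    change (code (Unary.mk n)).size + k.1.size + 1 ≤ _
    simp
    omega⟩

/-- The start of a simulation without the signing key of party `i`. -/
def partyStart (i : Party) : KeyInput → PMF (SimState z) :=
  Γ.simStart (fun x => x.1) fun x keys => Function.update keys i (x.2, .nil)

theorem partyStart_poly (i : Party) : PolyOn (keyDom U) (Γ.partyStart i) :=
  Γ.simStart_poly PolyFun.id.fst (fun n x hx => by rw [hx.1])
    (PolyFun.updateParty PolyFun.id.snd i (PolyFun.id.fst.snd.pair (PolyFun.const _)))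

/-- The reduction knows the verification key of `i` only. By `start_hide` this is enough to sample
the start of the game, and the keys it holds are those of the game with one signing key hidden. -/
theorem partyStart_eq {i : Party} (hi : i ≠ .HS) (n : ℕ) (k : Data × Data) (s : Data) :
    Γ.partyStart i (⟨n⟩, k.1) = (DTLP.accounts U.G n).bind fun keys =>
      (Γ.start (⟨n⟩, Function.update keys i k)).map fun y =>
        simState (some i) (chainInit n (Function.update keys i k) y s) := by
  refine congrArg _ (funext fun keys => ?_)
  have h : Function.update keys i (k.1, Data.nil) = hideKey (some i) (Function.update keys i k) := by
    rw [hideKey_some]; simp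
  simp only [h]
  rw [Γ.start_hide _ _ (some i) (by simpa using hi)]
  rfl

theorem reach_init {n : ℕ} {keys : Keys} (hkeys : keys ∈ (DTLP.accounts U.G n).support)
    {y : Data × (Fin z → Data) × Data} (hy : y ∈ (Γ.start (⟨n⟩, keys)).support)
    {s : Data} (hs : s ∈ (U.B.start n).support) :
    Γ.Reach n (Γ.T.eval n) (chainInit n keys y s) :=
  ⟨le_rfl, keys, hkeys, y, hy, s, hs, by simp [DelegatedTLP.iterK]⟩

/-- The experiments for liveness and unforgeability begin by drawing one key pair. By
`accounts_update` the key of `i` can be drawn first and separately in the game too. -/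
theorem final_eq (i : Party) (n : ℕ) : Γ.final n =
    (U.G.keyGen n).bind fun k => (U.B.start n).bind fun s =>
      (DTLP.accounts U.G n).bind fun keys => (Γ.start (⟨n⟩, Function.update keys i k)).bind fun y =>
        DelegatedTLP.iterK (U.chainStep P Γ.A) (Γ.T.eval n) (chainInit n (Function.update keys i k) y s) := by
  rw [final]
  conv_lhs => rw [← DTLP.accounts_update U.G n i]
  simp only [PMF.bind_bind, PMF.bind_map, Function.comp_def]
  refine congrArg _ (funext fun k => ?_)
  conv_rhs => rw [PMF.bind_comm]
  refine congrArg _ (funext fun keys => ?_)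
  rw [PMF.bind_comm]

/-- The honest account holder of the liveness experiment plays the part of `i` in a simulated game;
the other accounts belong to the simulating environment. The server's helper is excluded because the
adversary needs its signing key. -/
theorem live_secure (hP : DTLP.EfficientParams P) (hLive : U.B.Live U.G) {i : Party} (hi : i ≠ .HS) :
    ∃ μ, Negligible μ ∧ ∀ n, ((Γ.final n).toOuterMeasure
      {x | U.B.LivenessFails n (partyWorld (some i) x.w)}).toReal ≤ μ n := by
  let Dfin : Dom (SimState z) := ⟨fun n s => ∃ x, Γ.Reach n 0 x ∧ simState (some i) x = s, by
    obtain ⟨q, hq⟩ := Γ.exists_bound hP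
    exact ⟨q, by rintro n _ ⟨x, hx, rfl⟩; exact (hq n _ x hx).sim_size (some i)⟩⟩
  have hfin : PolyOn Dfin fun _ : SimState z => (PMF.pure Data.nil : PMF Data) := PolyFun.const _
  obtain ⟨A, ⟨q, hq⟩, hA⟩ := exists_interactive_param (U.B.liveOracle U.G) (fun _ _ => rfl) Γ.T
    (fun n (x : KeyInput) p w => x = (⟨n⟩, p.1) ∧ p ∈ (U.G.keyGen n).support ∧
      ∃ s ∈ (U.B.start n).support, w = ⟨[s], s, []⟩)
    (Dι := keyDom U) (by rintro n _ p w ⟨rfl, hp, -⟩; exact ⟨rfl, p, hp, rfl⟩)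
    (num := fun x => x.1) PolyFun.id.fst (fun n x p w h => by rw [h.1])
    (by
      rintro n _ p w ⟨rfl, -⟩
      cases n <;> simp [code_prod, code_unary, Data.ofList, List.replicate_succ])
    (Γ.partyStart_poly i) (Γ.pre_poly hP (some i)) (simPost_poly (Γ.postDom hP (some i))) hfin
    (fun n k s p w => ∃ x, Γ.Reach n k x ∧ p = x.keys i ∧ simState (some i) x = s ∧
      partyWorld (some i) x.w = w)
    (by
      rintro n _ p _ ⟨rfl, hp, s, hs, rfl⟩ t ht
      rw [Γ.partyStart_eq hi n p s] at ht
      simp only [PMF.mem_support_bind, PMF.mem_support_map] at ht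
      obtain ⟨keys, hkeys, y, hy, rfl⟩ := ht
      refine ⟨_, Γ.reach_init (update_mem_accounts i hkeys hp) hy hs, ?_, rfl, ?_⟩
      · simp [chainInit]
      · simp [partyWorld, chainInit])
    (by
      rintro n k _ p _ - ⟨x, hx, rfl, rfl, rfl⟩
      obtain ⟨h1, h2⟩ := hx.sim_step hP (some i) (x.keys i) (by rintro _ ⟨⟩; rfl)
      refine ⟨h1, fun mq hmq r hr => ?_⟩
      obtain ⟨h3, y, hy, hk, h4, h5⟩ := h2 mq hmq r hr
      refine ⟨h3, fun s' hs' => ?_⟩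
      rw [PMF.mem_support_pure.1 hs']
      exact ⟨y, hy, by rw [hk], h4, h5⟩)
    (by rintro n s p w ⟨x, hx, -, rfl, -⟩; exact ⟨x, hx, rfl⟩)
  have hppt : (U.B.liveExp U.G A).IsPPT := by
    refine ⟨q, fun n o ho => ?_⟩
    simp only [Blockchain.liveExp, Blockchain.init, PMF.bind_eq, PMF.pure_eq, PMF.bind_bind,
      PMF.pure_bind, PMF.mem_support_bind, PMF.mem_support_pure] at ho
    obtain ⟨p, hp, s, hs, r, hr, rfl⟩ := ho
    exact hq n (⟨n⟩, p.1) p _ ⟨rfl, hp, s, hs, rfl⟩ r hr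
  obtain ⟨μ, hμ, h⟩ := hLive A hppt
  refine ⟨μ, hμ, fun n => ?_⟩
  have h := h n
  rw [Experiment.winProb_eq] at h
  have e : ((U.B.liveExp U.G A n).map Outcome.win) =
      (Γ.final n).map fun x => U.B.LivenessFails n (partyWorld (some i) x.w) := by
    have e1 : ((U.B.liveExp U.G A n).map Outcome.win) = (U.G.keyGen n).bind fun p =>
        (U.B.start n).bind fun s =>
        ((A.run (U.B.liveOracle U.G p) n (code (Unary.mk n, p.1)) .nil ⟨[s], s, []⟩).map
          fun o => (o.1, o.2.1)).map fun r => U.B.LivenessFails n r.2 := by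
      simp only [Blockchain.liveExp, Blockchain.init, PMF.bind_eq, PMF.pure_eq, PMF.map_bind,
        PMF.pure_map, PMF.map_comp, PMF.bind_bind, PMF.pure_bind]
      rfl
    rw [e1, Γ.final_eq i, PMF.map_bind]
    refine PMF.bind_congr fun p hp => ?_
    rw [PMF.map_bind]
    refine PMF.bind_congr fun s hs => ?_
    rw [hA n (⟨n⟩, p.1) p _ ⟨rfl, hp, s, hs, rfl⟩, Γ.partyStart_eq hi n p s]
    simp only [PMF.bind_bind, PMF.bind_map, PMF.map_bind, Function.comp_def, PMF.pure_map]
    refine congrArg _ (funext fun keys => congrArg _ (funext fun y => ?_))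
    have := U.sim_iterK P Γ.A (some i) p (Γ.T.eval n) (chainInit n (Function.update keys i p) y s)
      (by rintro _ ⟨⟩; simp [chainInit])
    have hw : partyWorld (some i) (chainInit n (Function.update keys i p) y s).w = ⟨[s], s, []⟩ := by
      simp [partyWorld, chainInit]
    rw [hw] at this
    refine (congrArg (fun p => PMF.bind p _) this).trans ?_
    rw [PMF.bind_map]
    rfl
  rw [e, PMF.toOuterMeasure_map_apply] at h
  exact h

end ChainGame

end

section

/-! ## Searching in lists -/

namespace PolyFun

variable {α γ ε : Type} [Coded α] [Coded γ] [Coded ε] {D : Dom γ}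

/-- Equality of data, in the presence of the security parameter. -/
theorem dataEq' {x y : γ → Data} {num : γ → Unary} (hx : PolyFun D x) (hy : PolyFun D y)
    (hn : PolyFun D num) (hnum : ∀ n g, D.mem n g → (num g).val = n) :
    PolyFun D fun g => decide (x g = y g) := by
  obtain ⟨q, hq⟩ := hx.bound
  -- Comparison takes as many steps as there are nodes, which can exceed the length of the spine.
  -- The clock is therefore computed from the unary security parameter, as the polynomial `q` that
  -- bounds the data.
  refine dataEq hx hy (unaryPoly hn q).coded fun n g hg => ?_
  rw [code_unary, Data.len, Data.toList_ofList, List.length_replicate, hnum n g hg]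
  exact hq n g hg

theorem size_code_flatten (l : List (List α)) :
    (code l.flatten).size ≤ (code l).size := by
  induction l with
  | nil => simp
  | cons a l ih =>
    have := size_code_append a l.flatten
    simp at *
    omega

theorem flatten [Inhabited α] {l : γ → List (List α)} (hl : PolyFun D l) :
    PolyFun D fun g => (l g).flatten := by
  obtain ⟨q, hq⟩ := hl.bound
  let E : Dom (Data × List α × List α) := ⟨fun n x => x.1 = .nil ∧ (code x.2.1).size ≤ q.eval n ∧
    (code x.2.2).size ≤ q.eval n, 2 * q + 3, by rintro n ⟨_, a, b⟩ ⟨rfl, h, h'⟩; simp at *; omega⟩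
  have hE : PolyFun E fun x => x.2.2 ++ x.2.1 := id.snd.snd.append id.snd.fst
  have key : ∀ (l : List (List α)) (m : List α),
      l.foldl (fun acc x => acc ++ x) m = m ++ l.flatten := by
    intro l
    induction l with
    | nil => simp
    | cons a l ih => intro m; simp [ih]
  refine (foldl hl (const Data.nil) (const []) hE ?_).congr fun n g _ => by simp [key]
  intro n g hg l₁ a l₂ h
  have h1 := hq n g hg
  have h2 := size_code_append l₁ (a :: l₂)
  have h3 := size_code_flatten l₁
  have h4 := (code l₂).size_pos
  have h5 := (code l₁).size_pos
  simp only [key, List.nil_append]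
  rw [h] at h1
  simp at h1 h2 ⊢
  exact ⟨rfl, show (code a).size ≤ q.eval n by omega, show (code l₁.flatten).size ≤ q.eval n by omega⟩

theorem filter [Inhabited α] {l : γ → List α} (hl : PolyFun D l) {e : γ → ε} (he : PolyFun D e)
    {E : Dom (ε × α)} {p : ε × α → Bool} (hp : PolyFun E p)
    (hE : ∀ n g, D.mem n g → ∀ a ∈ l g, E.mem n (e g, a)) :
    PolyFun D fun g => (l g).filter fun a => p (e g, a) := by
  have h : PolyFun E fun x => if p x then [x.2] else [] :=
    ite hp ((id.snd.cons (const [])).restrict _) (const [])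
  refine (listMap hl he h hE).flatten.congr fun n g _ => ?_
  induction l g with
  | nil => rfl
  | cons a l ih => by_cases ha : p (e g, a) = true <;> simp [ha, ih]

end PolyFun

theorem Data.size_code_mem {α : Type} [Coded α] {l : List α} {a : α} (h : a ∈ l) :
    (code a).size ≤ (code l).size := by
  refine Data.size_mem_toList (code l) _ ?_
  rw [code_list, Data.toList_ofList]
  exact List.mem_map_of_mem h

variable {z : ℕ}

theorem Action.ofData_poly {γ : Type} [Coded γ] {D : Dom γ} {d : γ → Data} (h : PolyFun D d) :
    PolyFun D fun g => Action.ofData (d g) := by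
  refine (PolyFun.ite h.toBool (PolyFun.ite (h.dfst.toBool.restrict _)
    ((((PolyFun.const (Data.cons .nil .nil)).dcons h.dsnd).restrict _).restrict _)
    ((h.restrict _).restrict _)) (h.restrict _)).of_code fun n g _ => ?_
  rcases d g with _ | ⟨_ | ⟨a, b⟩, c⟩ <;> rfl

namespace Setting

variable (U : Setting z)

/-- A blockchain whose current state is all that is kept. -/
def localOracle (cur : Data) : Data → PMF (Data × Data)
  | .nil => PMF.pure (.nil, cur)
  | .cons _ a => (U.B.step cur (Action.ofData a)).map fun o => (o.2, o.1)

theorem localOracle_poly {γ : Type} [Coded γ] {D : Dom γ} {cur q : γ → Data} (hcur : PolyFun D cur)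
    (hq : PolyFun D q) : PolyOn D fun g => U.localOracle (cur g) (q g) := by
  have h : PolyOn D fun g => U.B.step (cur g) (Action.ofData (q g).snd) :=
    PolyFun.polyTime_comp (g := fun x : Data × Action => U.B.step x.1 x.2) U.hB.2.1
      (hcur.pair (Action.ofData_poly hq.dsnd))
  have h' : PolyOn D fun g => (U.B.step (cur g) (Action.ofData (q g).snd)).map fun o => (o.2, o.1) :=
    PolyOn.map (g := fun _ o => (o.2, o.1)) h (PolyFun.id.snd.snd.pair PolyFun.id.snd.fst)
  refine (PolyOn.ite hq.toBool (h'.mono fun _ _ h => h.1) (((PolyFun.const Data.nil).pair hcur).restrict _ : PolyFun _ _)).congr fun n g _ => ?_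
  rcases q g with _ | ⟨_, a⟩ <;> rfl

theorem act_cur {α : Type} (w : Blockchain.World α) (a : Action) :
    (U.B.act w a).map (fun r => (r.1, r.2.cur, r.2.log)) =
      (U.B.step w.cur a).map fun o => (o.2, o.1, w.log) := by
  cases a <;> simp [Blockchain.act, PMF.bind_eq, PMF.pure_eq, PMF.map,
    Function.comp_def]

/-- All transactions in the chains of honest parties. -/
def allTxs (s : Data) : List Data := ((List.ofFn fun p => U.B.view p s).flatten).flatten

theorem mem_allTxs {s tx : Data} : tx ∈ U.allTxs s ↔ ∃ p, tx ∈ (U.B.view p s).flatten := by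
  simp only [allTxs, List.mem_flatten, List.mem_ofFn]
  constructor
  · rintro ⟨l, ⟨v, ⟨p, rfl⟩, hl⟩, h⟩
    exact ⟨p, l, hl, h⟩
  · rintro ⟨p, l, hl, h⟩
    exact ⟨l, ⟨_, ⟨p, rfl⟩, hl⟩, h⟩

theorem allTxs_poly {γ : Type} [Coded γ] {D : Dom γ} {s : γ → Data} (hs : PolyFun D s) :
    PolyFun D fun g => U.allTxs (s g) := by
  have h : PolyFun D fun g => List.ofFn fun p => U.B.view p (s g) :=
    (PolyFun.vec (f := fun g p => U.B.view p (s g)) fun p =>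
      PolyFun.polyTime_comp_pure (g := fun s : Data => U.B.view p s) (U.hB.2.2.1 p) hs).of_code
      fun _ _ _ => rfl
  exact h.flatten.flatten

/-- The transactions that are validly signed under `vk` although their content is not in the list. -/
def forgeries (vk : Data) (bodies : List Data) (s : Data) : List Data :=
  (U.allTxs s).filter fun tx => decide (tx.fst = vk) && U.G.verify vk tx.snd.fst tx.snd.snd &&
    (bodies.filter fun b => decide (tx.snd.fst = b)).isEmpty

theorem mem_forgeries {vk : Data} {bodies : List Data} {s tx : Data} :
    tx ∈ U.forgeries vk bodies s ↔ (∃ p, tx ∈ (U.B.view p s).flatten) ∧ tx.fst = vk ∧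
      U.G.verify vk tx.snd.fst tx.snd.snd = true ∧ tx.snd.fst ∉ bodies := by
  simp only [forgeries, List.mem_filter, mem_allTxs, Bool.and_eq_true, decide_eq_true_eq,
    List.isEmpty_iff, List.filter_eq_nil_iff, and_assoc]
  refine and_congr_right fun _ => and_congr_right fun _ => and_congr_right fun _ => ?_
  exact ⟨fun h hb => h _ hb rfl, fun h b hb e => h (e ▸ hb)⟩

theorem forgeries_poly {γ : Type} [Coded γ] {D : Dom γ} {num : γ → Unary} {vk s : γ → Data}
    {bodies : γ → List Data} (hn : PolyFun D num) (hnum : ∀ n g, D.mem n g → (num g).val = n)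
    (hvk : PolyFun D vk) (hb : PolyFun D bodies) (hs : PolyFun D s) :
    PolyFun D fun g => U.forgeries (vk g) (bodies g) (s g) := by
  have htx := U.allTxs_poly hs
  have he := hn.pair (hvk.pair hb)
  obtain ⟨q, hq⟩ := htx.bound
  obtain ⟨r, hr⟩ := he.bound
  let E : Dom ((Unary × Data × List Data) × Data) :=
    ⟨fun n x => x.1.1.val = n ∧ (code x.1).size ≤ r.eval n ∧ x.2.size ≤ q.eval n, r + q + 1, by
      rintro n ⟨a, b⟩ ⟨-, h1, h2⟩
      rw [code_prod]
      simp [show ∀ d : Data, code d = d from fun _ => rfl] at *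
      omega⟩
  let F : Dom ((Unary × Data) × Data) :=
    ⟨fun n x => x.1.1.val = n ∧ x.1.2.size ≤ q.eval n ∧ x.2.size ≤ r.eval n, 2 * .X + q + r + 3, by
      rintro n ⟨⟨a, b⟩, c⟩ ⟨rfl, h1, h2⟩
      rw [code_prod, code_prod]
      simp [show ∀ d : Data, code d = d from fun _ => rfl] at *
      omega⟩
  have hF : PolyFun F fun x => decide (x.1.2 = x.2) :=
    PolyFun.dataEq' PolyFun.id.fst.snd PolyFun.id.snd PolyFun.id.fst.fst fun n x hx => hx.1
  have hbody : PolyFun E fun x => x.2.snd.fst := PolyFun.id.snd.dsnd.dfst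
  have h1 : PolyFun E fun x => x.1.2.2.filter fun b => decide (x.2.snd.fst = b) := by
    refine PolyFun.filter PolyFun.id.fst.snd.snd (PolyFun.id.fst.fst.pair hbody) hF ?_
    rintro n ⟨⟨a, b, c⟩, d⟩ ⟨h1, h2, h3⟩ e he
    refine ⟨h1, le_trans ((Data.size_fst_le _).trans (Data.size_snd_le _)) h3, ?_⟩
    have := Data.size_code_mem he
    rw [code_prod, code_prod] at h2
    simp [show ∀ d : Data, code d = d from fun _ => rfl] at *
    omega
  have h2 : PolyFun E fun x => U.G.verify x.1.2.1 x.2.snd.fst x.2.snd.snd :=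
    PolyFun.polyTime_comp_pure (g := fun x : Data × Data × Data => U.G.verify x.1 x.2.1 x.2.2) U.hG.2.2
      (PolyFun.id.fst.snd.fst.pair (hbody.pair PolyFun.id.snd.dsnd.dsnd))
  have h3 : PolyFun E fun x => decide (x.2.fst = x.1.2.1) :=
    PolyFun.dataEq' PolyFun.id.snd.dfst PolyFun.id.fst.snd.fst PolyFun.id.fst.fst fun n x hx => hx.1
  refine PolyFun.filter htx he ((h3.and h2).and h1.isEmpty) ?_
  intro n g hg a ha
  refine ⟨hnum n g hg, hr n g hg, ?_⟩
  exact (Data.size_code_mem ha).trans (hq n g hg)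

end Setting

/-! ## Forgers from games -/

theorem PMF.toOuterMeasure_bind_mono {α β γ : Type} {p : PMF α} {f : α → PMF β} {g : α → PMF γ}
    {s : Set β} {t : Set γ} (h : ∀ a ∈ p.support, (f a).toOuterMeasure s ≤ (g a).toOuterMeasure t) :
    (p.bind f).toOuterMeasure s ≤ (p.bind g).toOuterMeasure t := by
  rw [PMF.toOuterMeasure_bind_apply, PMF.toOuterMeasure_bind_apply]
  refine ENNReal.tsum_le_tsum fun a => ?_
  by_cases ha : a ∈ p.support
  · exact mul_le_mul_right (h a ha) _
  · rw [PMF.mem_support_iff, not_not] at ha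
    simp [ha]

/-- An event that is preceded by a stopping event is at most as likely as the stopping event. -/
theorem iterK_stop {X : Type} {s : X → PMF X} {E S : X → Prop} [DecidablePred S] (I : ℕ → X → Prop)
    (hI : ∀ k x, I (k + 1) x → ∀ y ∈ (s x).support, I k y)
    (h : ∀ k x, I (k + 1) x → ¬ E x → ∀ y ∈ (s x).support, E y → S y) (k : ℕ) (x : X) (hx : I k x)
    (h₀ : E x → S x) : (iterK s k x).toOuterMeasure {y | E y} ≤
      (iterK (fun x => if S x then PMF.pure x else s x) k x).toOuterMeasure {y | S y} := by
  induction k generalizing x with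
  | zero =>
    by_cases h : E x
    · simp [iterK, h, h₀ h]
    · simp [iterK, h]
  | succ k ih =>
    by_cases hS : S x
    · have : ∀ k, iterK (fun x => if S x then PMF.pure x else s x) k x = PMF.pure x := by
        intro k
        induction k with
        | zero => simp [iterK]
        | succ k ih => simp only [iterK, if_pos hS, PMF.pure_bind]; exact ih
      rw [this, PMF.toOuterMeasure_pure_apply, if_pos (by exact hS)]
      exact PMF.toOuterMeasure_le_one _ _
    · simp only [iterK, if_neg hS]
      exact PMF.toOuterMeasure_bind_mono fun y hy =>
        ih y (hI k x hx y hy) (h k x hx (fun e => hS (h₀ e)) y hy)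

end

section

/-! ## Unforgeability in a game -/

variable {z : ℕ}

namespace Setting

variable (U : Setting z) (P : ℕ → DTLP.Params z) (A : Interactive)

/-- The contents of the logged transactions, last one first. -/
def bodies {α : Type} (log : List (α × Data × ℕ)) : List Data :=
  (log.map fun e => e.2.1.snd.fst).reverse

/-- The state of a forger: the simulation, the state of the blockchain, and the signed messages. -/
abbrev ForgeState (z : ℕ) : Type := SimState z × Data × List Data

/-- The forgeries that are visible in a state. -/
def found (i : Party) (σ : ForgeState z) : List Data :=
  U.forgeries (σ.1.1.2.1 i).1 σ.2.2 σ.2.1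

/-- Queries that ask for a signature. -/
def asksSign (q : Data) : Bool := q.toBool && !q.fst.toBool

/-- Only requests for signatures are passed on; the blockchain runs locally, and the signing oracle
gets `nil` in all other cases. The forger stops as soon as a forgery is visible, because a later
signature on the same content would spoil it. -/
def forgePre (i : Party) (σ : ForgeState z) :
    PMF ((ForgeState z × Option (SimMid z × Data)) × Data) :=
  if (U.found i σ).isEmpty then
    (U.simPre P A (some i) σ.1).map fun m => ((σ, some m), if asksSign m.2 then m.2 else .nil)
  else PMF.pure ((σ, none), .nil)

/-- The answer to the query `q` of the simulation, given the signature `sg`. -/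
def forgeAnswer (i : Party) (σ : ForgeState z) (m : SimMid z) (q sg : Data) : PMF (ForgeState z) :=
  if asksSign q then
    (U.localOracle σ.2.1 (.cons .nil
      (code (Action.bcast (mkTx (σ.1.1.2.1 i).1 q.snd sg))))).map fun r =>
        (simPost (m, .cons (mkTx (σ.1.1.2.1 i).1 q.snd sg) r.1), r.2, q.snd :: σ.2.2)
  else (U.localOracle σ.2.1 q).map fun r => (simPost (m, r.1), r.2, σ.2.2)

def forgePost (i : Party) (x : (ForgeState z × Option (SimMid z × Data)) × Data) :
    PMF (ForgeState z) :=
  match x.1.2 with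
  | none => PMF.pure x.1.1
  | some m => U.forgeAnswer i x.1.1 m.1 m.2 x.2

/-- The state of a forger that corresponds to a state of the simulation. -/
def forgeState (x : SimState z × Blockchain.World Unit) : ForgeState z × List Data :=
  ((x.1, x.2.cur, bodies x.2.log), bodies x.2.log)

variable {U P A}

/-- A signing oracle and a local copy of the blockchain together do what the liveness oracle does.
The list of messages recorded by the signing oracle is the list of logged contents, in reverse
order. -/
theorem forge_answer {i : Party} {key : Data × Data} {s : SimState z} {w : Blockchain.World Unit}
    (hkey : key.1 = (s.1.2.1 i).1) (m : SimMid z) (q : Data) :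
    ((U.G.signOracle key.2 (bodies w.log) (if asksSign q then q else .nil)).bind fun r =>
      (U.forgeAnswer i (forgeState (s, w)).1 m q r.1).map fun σ => (σ, r.2)) =
    (U.B.liveOracle U.G key w q).map fun r => forgeState (simPost (m, r.1), r.2) := by
  have hact : ∀ a : Action, (U.B.act w a).map (fun r => forgeState (simPost (m, r.1), r.2)) =
      (U.B.step w.cur a).map fun o => ((simPost (m, o.2), o.1, bodies w.log), bodies w.log) := by
    intro a
    have := congrArg (PMF.map fun r : Data × Data × List (Unit × Data × ℕ) =>
      (((simPost (m, r.1), r.2.1, bodies r.2.2), bodies r.2.2) : ForgeState z × List Data)) (U.act_cur w a)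
    simp only [PMF.map_comp, Function.comp_def] at this
    exact this
  rcases q with _ | ⟨_ | ⟨a, b⟩, d⟩
  · simp [asksSign, Data.toBool, Sig.signOracle, Blockchain.liveOracle, PMF.pure_eq, PMF.pure_map,
      forgeAnswer, localOracle, forgeState]
  · have h : asksSign (.cons .nil d) = true := rfl
    simp only [h, if_true, Sig.signOracle, PMF.bind_eq, PMF.pure_eq, PMF.bind_bind, PMF.pure_bind,
      Blockchain.liveOracle, Blockchain.issue, PMF.map_bind, PMF.pure_map, forgeAnswer, snd_cons,
      localOracle, Action.ofData_code, PMF.map_comp, Function.comp_def, forgeState, hkey]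
    refine congrArg _ (funext fun σ => ?_)
    have := congrArg (PMF.map fun r : Data × Data × List (Unit × Data × ℕ) =>
      (((simPost (m, .cons (mkTx (s.1.2.1 i).1 d σ) r.1), r.2.1, d :: bodies r.2.2),
        d :: bodies r.2.2) : ForgeState z × List Data))
        (U.act_cur w (.bcast (mkTx (s.1.2.1 i).1 d σ)))
    simp only [PMF.map_comp, Function.comp_def] at this
    refine this.symm.trans ?_
    rw [PMF.map]
    refine PMF.bind_congr fun o ho => ?_
    simp [bodies, code_prod, mkTx, show ∀ d : Data, code d = d from fun _ => rfl]
  · have h : asksSign (.cons (.cons a b) d) = false := rfl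
    simp only [h, Sig.signOracle, PMF.pure_eq, PMF.pure_bind, Blockchain.liveOracle, hact,
      forgeAnswer, forgeState, localOracle, PMF.map_comp, Function.comp_def, Bool.false_eq_true, if_false]
    exact (hact _).symm

theorem forge_step {i : Party} {key : Data × Data} {s : SimState z} {w : Blockchain.World Unit}
    (hkey : key.1 = (s.1.2.1 i).1) :
    redStep (U.forgePre P A i) (U.forgePost i) (U.G.signOracle key.2) (forgeState (s, w)) =
      if (U.found i (forgeState (s, w)).1).isEmpty then
        (redStep (U.simPre P A (some i)) purePost (U.B.liveOracle U.G key) (s, w)).map forgeState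
      else PMF.pure (forgeState (s, w)) := by
  by_cases h : (U.found i (forgeState (s, w)).1).isEmpty = true
  · rw [if_pos h]
    have hpre : U.forgePre P A i (forgeState (s, w)).1 = (U.simPre P A (some i) s).map fun m =>
        (((forgeState (s, w)).1, some m), if asksSign m.2 then m.2 else .nil) := by
      rw [forgePre, if_pos h]; rfl
    rw [redStep, hpre]
    simp only [redStep, purePost, PMF.bind_map, PMF.map_bind, Function.comp_def, PMF.pure_map]
    refine congrArg _ (funext fun mq => ?_)
    have := forge_answer (U := U) hkey (w := w) mq.1 mq.2
    exact this
  · rw [if_neg h]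
    have hpre : U.forgePre P A i (forgeState (s, w)).1 =
        PMF.pure (((forgeState (s, w)).1, none), .nil) := by
      rw [forgePre, if_neg h]
    rw [redStep, hpre]
    simp only [PMF.pure_bind, Sig.signOracle, PMF.pure_eq, forgePost, PMF.pure_map]

variable (U) in
/-- A transaction that party `i` has not issued is validly signed under the key of `i`, and in the
chain of an honest party. -/
def Forging (i : Party) (x : ChainState z) : Prop :=
  ∃ p, ∃ tx ∈ (U.B.view p x.w.cur).flatten, tx.fst = (x.keys i).1 ∧
    U.G.verify (x.keys i).1 tx.snd.fst tx.snd.snd = true ∧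
    ∀ e ∈ x.w.log, e.1.1 = i → tx.snd.fst ≠ e.2.1.snd.fst

variable (U) in
/-- In some round, a transaction that party `i` had not issued was validly signed under the key of `i`,
and in the chain of an honest party. -/
def Forged (i : Party) (x : ChainState z) : Prop :=
  ∃ r s p, x.w.hist[r]? = some s ∧ ∃ tx ∈ (U.B.view p s).flatten, tx.fst = (x.keys i).1 ∧
    U.G.verify (x.keys i).1 tx.snd.fst tx.snd.snd = true ∧
    ∀ e ∈ x.w.log, e.1.1 = i → e.2.2 < r → tx.snd.fst ≠ e.2.1.snd.fst

theorem found_isEmpty {i : Party} {x : ChainState z} :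
    (U.found i (forgeState (simState (some i) x, partyWorld (some i) x.w)).1).isEmpty = true ↔
      ¬ U.Forging i x := by
  rw [List.isEmpty_iff, List.eq_nil_iff_forall_not_mem, ← not_exists, not_iff_not]
  simp only [found, mem_forgeries, forgeState, simState, hideKey, Forging, bodies, partyWorld,
    if_pos]
  constructor
  · rintro ⟨tx, ⟨p, h1⟩, h2, h3, h4⟩
    refine ⟨p, tx, h1, h2, h3, fun e he hi hb => h4 ?_⟩
    simp only [List.mem_reverse, List.mem_map, List.mem_filter, decide_eq_true_eq]
    exact ⟨_, ⟨e, ⟨he, by rw [hi]⟩, rfl⟩, hb.symm⟩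
  · rintro ⟨p, tx, h1, h2, h3, h4⟩
    refine ⟨tx, ⟨p, h1⟩, h2, h3, fun h => ?_⟩
    simp only [List.mem_reverse, List.mem_map, List.mem_filter, decide_eq_true_eq] at h
    obtain ⟨_, ⟨e, ⟨he, hi⟩, rfl⟩, hb⟩ := h
    exact h4 e he (Option.some_inj.1 hi) hb.symm

variable (U P) in
/-- The calls that are made in the game. -/
def Issues (x : ChainState z) (i : Party) (f : Call z) : Prop :=
  (i = .S ∧ ∃ a, f = .deploy a) ∨ (i = .HC ∧ f = .publish x.pk x.g) ∨
    ((i = .C ∨ i = .S) ∧ ∃ j, f = .pay j)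

/-- The effects of a step. -/
theorem step_world {x y : ChainState z} (hy : y ∈ (U.chainStep P A x).support) :
    (y.w.log = x.w.log ∧ (y.w.hist = x.w.hist ∨ y.w.hist = x.w.hist ++ [y.w.cur])) ∨
    (y.w.hist = x.w.hist ∧ ∃ i f, Issues x i f ∧
      ∃ σ ∈ (U.G.sign (x.keys i).2 (payload (U.contract x.n (P x.n) x.keys) x.w.log.length f)).support,
      y.w.log = x.w.log ++ [((i, f), mkTx (x.keys i).1
        (payload (U.contract x.n (P x.n) x.keys) x.w.log.length f) σ, x.w.round)]) := by
  have hissue : ∀ i f r, Issues x i f →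
      r ∈ (DTLP.issueCall U.G U.B (U.contract x.n (P x.n) x.keys) x.keys i f x.w).support →
      (r.2.hist = x.w.hist ∧ ∃ i f, Issues x i f ∧
      ∃ σ ∈ (U.G.sign (x.keys i).2 (payload (U.contract x.n (P x.n) x.keys) x.w.log.length f)).support,
      r.2.log = x.w.log ++ [((i, f), mkTx (x.keys i).1
        (payload (U.contract x.n (P x.n) x.keys) x.w.log.length f) σ, x.w.round)]) := by
    intro i f r h hr
    obtain ⟨σ, hσ, o, -, -, -, h1, h2⟩ := U.mem_issueCall hr
    exact ⟨h1, i, f, h, σ, hσ, h2⟩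
  obtain ⟨n, keys, pk, g, stage, st, rep, w, cost⟩ := x
  rcases stage with _ | _ | _ <;>
    simp only [chainStep, PMF.mem_support_bind, PMF.mem_support_map] at hy
  · obtain ⟨r, hr, rfl⟩ := hy
    exact Or.inr (hissue _ _ r (Or.inl ⟨rfl, _, rfl⟩) hr)
  · obtain ⟨r, hr, rfl⟩ := hy
    exact Or.inr (hissue _ _ r (Or.inr (Or.inl ⟨rfl, rfl⟩)) hr)
  · obtain ⟨o, -, r, hr, rfl⟩ := hy
    rcases hq : o.1.snd with _ | ⟨_ | ⟨a, i⟩, d⟩ <;> rw [hq] at hr <;> simp only [DTLP.chainOracle] at hr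
    · rw [PMF.pure_eq, PMF.mem_support_pure] at hr
      subst hr
      exact Or.inl ⟨rfl, Or.inl rfl⟩
    · obtain ⟨o', -, -, h1, h2, h3⟩ := U.mem_act hr
      refine Or.inl ⟨h2, ?_⟩
      rcases h3 with h3 | h3
      · exact Or.inl h3.2
      · exact Or.inr (by simp only; rw [h1]; exact h3.2)
    · by_cases hz : d.toNat < z
      · rw [dif_pos hz] at hr
        refine Or.inr (hissue _ _ r (Or.inr (Or.inr ⟨?_, _, rfl⟩)) hr)
        split_ifs <;> simp
      · rw [dif_neg hz, PMF.pure_eq, PMF.mem_support_pure] at hr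
        subst hr
        exact Or.inl ⟨rfl, Or.inl rfl⟩

/-- The property can become true only when a round ends. The new round has the number
`x.w.hist.length`, and every logged transaction has a smaller one, so the restriction to earlier
transactions in `Forged` is void at this moment and the forgery is visible in the current state. -/
theorem Forged.step {i : Party} {x y : ChainState z} (hy : y ∈ (U.chainStep P A x).support)
    (hround : ∀ e ∈ x.w.log, e.2.2 < x.w.hist.length) (hx : ¬ U.Forged i x) (h : U.Forged i y) :
    U.Forging i y := by
  obtain ⟨r, s, p, hr, tx, h1, h2, h3, h4⟩ := h
  have hk := (U.step_const P A hy).2.1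
  have hlog : ∀ e ∈ x.w.log, e ∈ y.w.log := by
    rcases U.step_world hy with h | ⟨-, i, f, -, σ, -, h⟩
    · rw [h.1]; exact fun _ h => h
    · rw [h]; exact fun _ h => List.mem_append_left _ h
  have hold : x.w.hist[r]? ≠ some s := fun h =>
    hx ⟨r, s, p, h, tx, h1, by rw [← hk]; exact h2, by rw [← hk]; exact h3,
      fun e he => h4 e (hlog e he)⟩
  rcases U.step_world hy with ⟨h5, h6 | h6⟩ | ⟨h6, -⟩
  · rw [h6] at hr; exact absurd hr hold
  · rw [h6] at hr
    by_cases hlt : r < x.w.hist.length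
    · rw [List.getElem?_append_left hlt] at hr
      exact absurd hr hold
    · rw [List.getElem?_append_right (not_lt.1 hlt)] at hr
      have hr' : r - x.w.hist.length = 0 := by
        by_contra h
        rw [List.getElem?_eq_none (by simp; omega)] at hr
        cases hr
      rw [hr'] at hr
      obtain rfl : y.w.cur = s := by simpa using hr
      refine ⟨p, tx, h1, h2, h3, fun e he hi => h4 e he hi ?_⟩
      rw [h5] at he
      have := hround e he
      omega
  · rw [h6] at hr; exact absurd hr hold

end Setting

end

/-! ### The forger as an efficient simulation. -/

section

variable {z : ℕ}

namespace ChainGame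

open Setting

variable {U : Setting z} {P : ℕ → DTLP.Params z} (Γ : ChainGame U P)

/-- The state of the forger that corresponds to a state of the game. -/
def forger (i : Party) (x : ChainState z) : ForgeState z :=
  (forgeState (simState (some i) x, partyWorld (some i) x.w)).1

theorem exists_forger_bound (hP : DTLP.EfficientParams P) (i : Party) : ∃ q : Polynomial ℕ, ∀ n k x,
    Γ.Reach n k x → (code (forger i x)).size ≤ q.eval n := by
  obtain ⟨q, hq⟩ := Γ.exists_bound hP
  refine ⟨2 * q + Γ.T * (q + 1) + 3, fun n k x hx => ?_⟩
  have h := hq n k x hx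
  have h1 := h.sim_size (some i)
  have h2 := h.cur_size
  have hb : ∀ l : List (Unit × Data × ℕ), (∀ e ∈ l, e.2.1.size ≤ q.eval n) →
      (code (l.map fun e => e.2.1.snd.fst)).size ≤ l.length * (q.eval n + 1) + 1 := by
    intro l
    induction l with
    | nil => simp
    | cons e l ih =>
      intro h
      have h1 := ih fun e he => h e (List.mem_cons_of_mem _ he)
      have h2 := h e (List.mem_cons_self ..)
      have h3 : e.2.1.snd.fst.size ≤ e.2.1.size := (Data.size_fst_le _).trans (Data.size_snd_le _)
      simp only [List.map_cons, code_list_cons, size_cons, List.length_cons]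
      rw [Nat.add_mul, Nat.one_mul]
      change e.2.1.snd.fst.size + _ + 1 ≤ _
      omega
  have h3 := hb (partyWorld (some i) x.w).log (by
    intro e he
    simp only [partyWorld, List.mem_map, List.mem_filter] at he
    obtain ⟨e', ⟨he', -⟩, rfl⟩ := he
    exact h.log_size e' he')
  have h4 : (partyWorld (some i) x.w).log.length ≤ Γ.T.eval n := by
    simp only [partyWorld, List.length_map]
    exact (List.length_filter_le _ _).trans h.log_length
  have h5 : (code (forger i x)).size = (code (simState (some i) x)).size + (x.w.cur.size +
      (code ((partyWorld (some i) x.w).log.map fun e => e.2.1.snd.fst)).size + 1) + 1 := by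
    rw [← size_code_reverse]; rfl
  have h6 : (partyWorld (some i) x.w).log.length * (q.eval n + 1) ≤ Γ.T.eval n * (q.eval n + 1) :=
    Nat.mul_le_mul_right _ h4
  simp only [Polynomial.eval_add, Polynomial.eval_mul, Polynomial.eval_ofNat, Polynomial.eval_one]
  omega

/-- States of the forger that can be reached. -/
def forgeDom (hP : DTLP.EfficientParams P) (i : Party) : Dom (ForgeState z) :=
  ⟨fun n σ => ∃ k x, Γ.Reach n k x ∧ forger i x = σ, by
    obtain ⟨q, hq⟩ := Γ.exists_forger_bound hP i
    exact ⟨q, by rintro n _ ⟨k, x, hx, rfl⟩; exact hq n k x hx⟩⟩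

/-- States of the forger before the last step. -/
def forgePreDom (hP : DTLP.EfficientParams P) (i : Party) : Dom (ForgeState z) :=
  ⟨fun n σ => ∃ k x, Γ.Reach n (k + 1) x ∧ forger i x = σ,
    (Γ.forgeDom hP i).bound.imp fun _ h n σ ⟨k, x, hx⟩ => h n σ ⟨k + 1, x, hx⟩⟩

theorem found_poly {D : Dom (ForgeState z)} (hD : ∀ n σ, D.mem n σ → ∃ k x, Γ.Reach n k x ∧ forger i x = σ) :
    PolyFun D (U.found i) := by
  refine U.forgeries_poly (num := fun σ => σ.1.1.1) PolyFun.id.fst.fst.fst ?_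
    (PolyFun.id.fst.fst.snd.fst.party i).fst PolyFun.id.snd.snd PolyFun.id.snd.fst
  intro n σ hσ
  obtain ⟨k, x, hx, rfl⟩ := hD n σ hσ
  exact hx.const.1

theorem asksSign_poly {γ : Type} [Coded γ] {D : Dom γ} {q : γ → Data} (hq : PolyFun D q) :
    PolyFun D fun g => asksSign (q g) :=
  hq.toBool.and hq.dfst.toBool.not

theorem forgePre_poly (hP : DTLP.EfficientParams P) (i : Party) :
    PolyOn (Γ.forgePreDom hP i) (U.forgePre P Γ.A i) := by
  have h1 : PolyFun (Γ.forgePreDom hP i) (U.found i) :=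
    Γ.found_poly fun n σ ⟨k, x, hx⟩ => ⟨k + 1, x, hx⟩
  have h2 : PolyOn (Γ.forgePreDom hP i) fun σ => U.simPre P Γ.A (some i) σ.1 :=
    PolyFun.bind (E := Γ.simDom hP (some i)) PolyFun.id.fst (Γ.pre_poly hP (some i)) (by
      rintro n _ ⟨k, x, hx, rfl⟩
      exact ⟨k, x, hx, rfl⟩)
  have h3 : PolyOn (Γ.forgePreDom hP i) fun σ => (U.simPre P Γ.A (some i) σ.1).map fun m =>
      ((σ, some m), if asksSign m.2 then m.2 else .nil) := by
    refine PolyOn.map (g := fun σ m => ((σ, some m), if asksSign m.2 then m.2 else .nil)) h2 ?_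
    exact (PolyFun.id.fst.pair PolyFun.id.snd.some).pair (PolyFun.ite (asksSign_poly PolyFun.id.snd.snd)
      (PolyFun.id.snd.snd.restrict _) (PolyFun.const _))
  exact (PolyOn.ite h1.isEmpty (h3.mono fun _ _ h => h.1)
    ((PolyFun.id.pair (PolyFun.const none)).pair (PolyFun.const _) : PolyFun _ _)).congr fun _ _ _ => rfl

theorem forgePost_poly (i : Party)
    (D : Dom ((ForgeState z × Option (SimMid z × Data)) × Data)) : PolyOn D (U.forgePost i) := by
  let E : Dom ((ForgeState z × SimMid z × Data) × Data) :=
    ⟨fun n x => D.mem n ((x.1.1, some x.1.2), x.2), by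
      obtain ⟨q, hq⟩ := D.bound
      refine ⟨q, fun n x hx => le_trans ?_ (hq n _ hx)⟩
      have h1 : (code x).size = ((code x.1.1).size + (code x.1.2).size + 1) + x.2.size + 1 := rfl
      have h2 : (code ((x.1.1, some x.1.2), x.2)).size =
        ((code x.1.1).size + (1 + (code x.1.2).size + 1) + 1) + x.2.size + 1 := rfl
      omega⟩
  have hσ : PolyFun E fun x => x.1.1 := PolyFun.id.fst.fst
  have hm : PolyFun E fun x => x.1.2.1 := PolyFun.id.fst.snd.fst
  have hq : PolyFun E fun x => x.1.2.2 := PolyFun.id.fst.snd.snd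
  have htx : PolyFun E fun x => mkTx (x.1.1.1.1.2.1 i).1 x.1.2.2.snd x.2 :=
    ((hσ.fst.fst.snd.fst.party i).fst.pair (hq.dsnd.pair PolyFun.id.snd)).coded
  have h1 : PolyOn E fun x => (U.localOracle x.1.1.2.1 (.cons .nil
      (code (Action.bcast (mkTx (x.1.1.1.1.2.1 i).1 x.1.2.2.snd x.2))))).map fun r =>
        ((simPost (x.1.2.1, .cons (mkTx (x.1.1.1.1.2.1 i).1 x.1.2.2.snd x.2) r.1), r.2,
          x.1.2.2.snd :: x.1.1.2.2) : ForgeState z) := by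
    have h : PolyOn E fun x => U.localOracle x.1.1.2.1 (.cons .nil
        (code (Action.bcast (mkTx (x.1.1.1.1.2.1 i).1 x.1.2.2.snd x.2)))) :=
      U.localOracle_poly hσ.snd.fst ((PolyFun.const Data.nil).dcons ((PolyFun.const Data.nil).dcons htx))
    refine PolyOn.map (g := fun x r => ((simPost (x.1.2.1,
      .cons (mkTx (x.1.1.1.1.2.1 i).1 x.1.2.2.snd x.2) r.1), r.2,
      x.1.2.2.snd :: x.1.1.2.2) : ForgeState z)) h ?_
    exact (PolyFun.all_comp simPost_poly (hm.up.pair (htx.up.dcons PolyFun.id.snd.fst))).pair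
      (PolyFun.id.snd.snd.pair (hq.dsnd.up.cons hσ.snd.snd.up))
  have h2 : PolyOn E fun x => (U.localOracle x.1.1.2.1 x.1.2.2).map fun r =>
        ((simPost (x.1.2.1, r.1), r.2, x.1.1.2.2) : ForgeState z) := by
    have h : PolyOn E fun x => U.localOracle x.1.1.2.1 x.1.2.2 := U.localOracle_poly hσ.snd.fst hq
    refine PolyOn.map (g := fun x r => ((simPost (x.1.2.1, r.1), r.2, x.1.1.2.2) : ForgeState z)) h ?_
    exact (PolyFun.all_comp simPost_poly (hm.up.pair PolyFun.id.snd.fst)).pair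
      (PolyFun.id.snd.snd.pair hσ.snd.snd.up)
  have h3 : PolyOn E fun x => U.forgeAnswer i x.1.1 x.1.2.1 x.1.2.2 x.2 :=
    (PolyOn.ite (asksSign_poly hq) (h1.mono fun _ _ h => h.1) (h2.mono fun _ _ h => h.1)).congr
      fun _ _ _ => rfl
  have hmid : PolyFun D fun x => x.1.2 := PolyFun.id.fst.snd
  have h4 : PolyOn (D.restrict fun x => (code x.1.2).toBool = true) fun x => U.forgePost i x := by
    let D' := D.restrict fun x => (code x.1.2).toBool = true
    -- A default value for `getD`; on this domain the option is never empty.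
    let m₀ : SimMid z × Data := ((((⟨0⟩, fun _ => (.nil, .nil), .nil, fun _ => .nil), none, .nil,
      .nil, 0), .nil, none, false), .nil)
    have hmem : ∀ n x, D'.mem n x → ∃ m, x.1.2 = some m := by
      rintro n ⟨⟨σ, _ | m⟩, sg⟩ ⟨-, h⟩
      · cases h
      · exact ⟨m, rfl⟩
    have hget : PolyFun D' fun x => x.1.2.getD m₀ :=
      (hmid.coded.dsnd.restrict _).of_code fun n x hx => by
        obtain ⟨m, hm⟩ := hmem n x hx
        rw [hm]; rfl
    refine (PolyFun.bind (E := E) ((PolyFun.id.fst.fst.pair hget).pair PolyFun.id.snd) h3 ?_).congr ?_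
    · rintro n x hx
      obtain ⟨m, hm⟩ := hmem n x hx
      have h : x = ((x.1.1, some m), x.2) := by rw [← hm]
      simp only [E, hm, Option.getD_some]
      rw [← h]; exact hx.1
    · rintro n x hx
      obtain ⟨m, hm⟩ := hmem n x hx
      simp only [forgePost, hm, Option.getD_some]
  exact (PolyOn.ite hmid.coded.toBool h4 (PolyFun.id.fst.fst.restrict _ : PolyFun _ _)).congr
    fun n x _ => by
      rcases x with ⟨⟨σ, _ | m⟩, sg⟩ <;> rfl

/-- The input of the step function of the forger after a reply. -/
def forgePostDom (hP : DTLP.EfficientParams P) (i : Party) :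
    Dom ((ForgeState z × Option (SimMid z × Data)) × Data) :=
  ⟨fun n x => (∃ σ q, (Γ.forgePreDom hP i).mem n σ ∧ (x.1, q) ∈ (U.forgePre P Γ.A i σ).support) ∧
      (x.2 = .nil ∨ ∃ k y, Γ.Reach n k y ∧ x.2.size ≤ (code (simState (some i) y)).size), by
    obtain ⟨q, hq⟩ := Γ.exists_bound hP
    obtain ⟨r, hr⟩ := (Γ.forgePre_poly hP i).exists_bound
    refine ⟨q + r + 2, ?_⟩
    rintro n x ⟨⟨σ, d, hs, hx⟩, h⟩
    have h1 := hr n σ hs _ hx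
    have h2 : x.2.size ≤ q.eval n + 1 := by
      rcases h with h | ⟨k, y, hy, h⟩
      · rw [h]; simp
      · have := (hq n k y hy).sim_size (some i); omega
    have h4 : (code x).size = (code x.1).size + x.2.size + 1 := rfl
    have h5 : (code (x.1, d)).size = (code x.1).size + d.size + 1 := rfl
    simp only [Polynomial.eval_add, Polynomial.eval_ofNat]
    omega⟩

variable {Γ}

/-- The step of the forger, and the step of the game. -/
theorem forge_chainStep (i : Party) (x : ChainState z) [DecidablePred (U.Forging i)] :
    redStep (U.forgePre P Γ.A i) (U.forgePost i) (U.G.signOracle (x.keys i).2)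
        (forgeState (simState (some i) x, partyWorld (some i) x.w)) =
      (if U.Forging i x then PMF.pure x else U.chainStep P Γ.A x).map fun y =>
        forgeState (simState (some i) y, partyWorld (some i) y.w) := by
  rw [forge_step (key := x.keys i) (by simp [simState, hideKey])]
  by_cases h : U.Forging i x
  · rw [if_pos h, if_neg (by rw [found_isEmpty]; simpa using h), PMF.pure_map]
  · rw [if_neg h, if_pos (by rw [found_isEmpty]; exact h),
      U.sim_chainStep P Γ.A (some i) (x.keys i) x (by rintro _ ⟨⟩; rfl), PMF.map_comp]
    rfl

/-- A stopped forger stays where it is, so the game may have more steps left than the forger; hence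
`k ≤ l`. Apart from this, the states of the forger are those of reachable states of the game. -/
theorem forge_inv (hP : DTLP.EfficientParams P) (i : Party) {n k : ℕ} {x : ChainState z}
    (hx : Γ.Reach n (k + 1) x) :
    (Γ.forgePreDom hP i).mem n (forger i x) ∧
    ∀ mq ∈ (U.forgePre P Γ.A i (forger i x)).support,
      ∀ r ∈ (U.G.signOracle (x.keys i).2 (bodies (partyWorld (some i) x.w).log) mq.2).support,
        (Γ.forgePostDom hP i).mem n (mq.1, r.1) ∧ ∀ σ ∈ (U.forgePost i (mq.1, r.1)).support,
          ∃ l y, k ≤ l ∧ Γ.Reach n l y ∧ y.keys = x.keys ∧ forger i y = σ ∧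
            bodies (partyWorld (some i) y.w).log = r.2 := by
  classical
  refine ⟨⟨k, x, hx, rfl⟩, fun mq hmq r hr => ?_⟩
  have key : ∀ σ ∈ (U.forgePost i (mq.1, r.1)).support, ∃ l y, k ≤ l ∧ Γ.Reach n l y ∧
      y.keys = x.keys ∧ forger i y = σ ∧ bodies (partyWorld (some i) y.w).log = r.2 := by
    intro σ hσ
    have h : (σ, r.2) ∈ (redStep (U.forgePre P Γ.A i) (U.forgePost i) (U.G.signOracle (x.keys i).2)
        (forgeState (simState (some i) x, partyWorld (some i) x.w))).support := by
      simp only [redStep, PMF.mem_support_bind, PMF.mem_support_map]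
      exact ⟨mq, hmq, r, hr, σ, hσ, rfl⟩
    rw [forge_chainStep, PMF.mem_support_map] at h
    obtain ⟨y, hy, h⟩ := h
    obtain ⟨h1, h2⟩ := Prod.mk.inj h
    by_cases hF : U.Forging i x
    · rw [if_pos hF, PMF.mem_support_pure] at hy
      subst hy
      exact ⟨k + 1, _, by omega, hx, rfl, h1, h2⟩
    · rw [if_neg hF] at hy
      exact ⟨k, y, le_rfl, hx.step hy, (U.step_const P Γ.A hy).2.1, h1, h2⟩
  refine ⟨⟨⟨_, mq.2, ⟨k, x, hx, rfl⟩, hmq⟩, ?_⟩, key⟩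
  -- the size of the signature
  obtain ⟨m, q⟩ := mq
  rcases q with _ | ⟨a, d⟩
  · simp only [Sig.signOracle, PMF.pure_eq, PMF.mem_support_pure] at hr
    exact Or.inl (by rw [hr])
  -- The signature is part of the transaction that the reply reports, and the reply is contained in
  -- the next state, which belongs to a reachable state of the game.
  · obtain ⟨σ, hσ⟩ := PMF.exists_mem_support (U.forgePost i (m, r.1))
    obtain ⟨l, y, -, hy, -, h1, -⟩ := key σ hσ
    refine Or.inr ⟨l, y, hy, ?_⟩
    have h2 : simState (some i) y = σ.1 := by rw [← h1]; rfl
    rw [h2]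
    by_cases hF : (U.found i (forger i x)).isEmpty = true
    · simp only [forgePre, if_pos hF, PMF.mem_support_map] at hmq
      obtain ⟨⟨m', q'⟩, hm', hmq⟩ := hmq
      obtain ⟨rfl, hq⟩ := Prod.mk.inj hmq
      by_cases ha : asksSign q' = true
      · simp only [forgePost, forgeAnswer, if_pos ha, PMF.mem_support_map] at hσ
        obtain ⟨t, ht, rfl⟩ := hσ
        refine le_trans ?_ (size_reply_le _)
        simp [mkTx, code_prod, show ∀ d : Data, code d = d from fun _ => rfl]
        omega
      · rw [if_neg ha] at hq; cases hq
    · simp only [forgePre, if_neg hF, PMF.mem_support_pure] at hmq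
      cases (Prod.mk.inj hmq).2

end ChainGame

end

/-! ### Reduction of forgeries in a game to the security of the signature scheme. -/

section

variable {z : ℕ}

namespace ChainGame

open Setting

variable {U : Setting z} {P : ℕ → DTLP.Params z} (Γ : ChainGame U P)

/-- The start of the forger. -/
def forgeStart (i : Party) (x : KeyInput) : PMF (ForgeState z) :=
  (Γ.partyStart i x).bind fun s => (U.B.start x.1.val).map fun c => (s, c, [])

theorem forgeStart_poly (i : Party) : PolyOn (keyDom U) (Γ.forgeStart i) := by
  refine PolyOn.bind₂ (g := fun x s => (U.B.start x.1.val).map fun c => ((s, c, []) : ForgeState z))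
    (Γ.partyStart_poly i) ?_
  have h : PolyOn (Dom.ext _ (Γ.partyStart_poly i)) fun x => U.B.start x.1.1.val :=
    PolyFun.polyTime_comp (g := fun n : Unary => U.B.start n.val) U.hB.1 PolyFun.id.fst.fst
  refine PolyOn.map (g := fun x c => ((x.2, c, []) : ForgeState z)) h ?_
  exact PolyFun.id.fst.snd.pair (PolyFun.id.snd.pair (PolyFun.const _))

theorem forgeStart_eq {i : Party} (hi : i ≠ .HS) (n : ℕ) (k : Data × Data) :
    Γ.forgeStart i (⟨n⟩, k.1) = (U.B.start n).bind fun s => (DTLP.accounts U.G n).bind fun keys =>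
      (Γ.start (⟨n⟩, Function.update keys i k)).map fun y =>
        forger i (chainInit n (Function.update keys i k) y s) := by
  rw [forgeStart]
  have : ∀ s, Γ.partyStart i (⟨n⟩, k.1) = _ := fun s => Γ.partyStart_eq hi n k s
  simp only [PMF.map]
  rw [PMF.bind_comm]
  refine congrArg _ (funext fun s => ?_)
  rw [this s]
  simp only [PMF.bind_bind, PMF.map, Function.comp_def, PMF.pure_bind]
  rfl

/-- Transactions of honest parties are not forged. -/
theorem forge_secure (hP : DTLP.EfficientParams P) (hEUF : U.G.EUFCMA) {i : Party} (hi : i ≠ .HS) :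
    ∃ μ, Negligible μ ∧ ∀ n, ((Γ.final n).toOuterMeasure {x | U.Forged i x}).toReal ≤ μ n := by
  classical
  obtain ⟨qb, hbound⟩ := Γ.exists_bound hP
  -- The output is the first visible forgery without its account: content and signature, which is
  -- the format of a forgery in the experiment.
  have hfin : PolyFun (Γ.forgeDom hP i) fun σ => (code (U.found i σ)).fst.snd :=
    (Γ.found_poly fun n σ h => h).coded.dfst.dsnd
  obtain ⟨A, ⟨q, hq⟩, hA⟩ := exists_interactive_param (fun p : Data × Data => U.G.signOracle p.2)
    (fun _ _ => rfl) Γ.T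
    (fun n (x : KeyInput) p w => x = (⟨n⟩, p.1) ∧ p ∈ (U.G.keyGen n).support ∧ w = [])
    (Dι := keyDom U) (by rintro n _ p w ⟨rfl, hp, -⟩; exact ⟨rfl, p, hp, rfl⟩)
    (num := fun x => x.1) PolyFun.id.fst (fun n x p w h => by rw [h.1])
    (by
      rintro n _ p w ⟨rfl, -⟩
      cases n <;> simp [code_prod, code_unary, Data.ofList, List.replicate_succ])
    (Γ.forgeStart_poly i) (Γ.forgePre_poly hP i) (forgePost_poly i (Γ.forgePostDom hP i)) hfin
    (fun n k s p w => ∃ l x, k ≤ l ∧ Γ.Reach n l x ∧ p = x.keys i ∧ forger i x = s ∧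
      bodies (partyWorld (some i) x.w).log = w)
    (by
      rintro n _ p _ ⟨rfl, hp, rfl⟩ t ht
      rw [Γ.forgeStart_eq hi n p] at ht
      simp only [PMF.mem_support_bind, PMF.mem_support_map] at ht
      obtain ⟨s, hs, keys, hkeys, y, hy, rfl⟩ := ht
      refine ⟨_, _, le_rfl, Γ.reach_init (update_mem_accounts i hkeys hp) hy hs, ?_, rfl, ?_⟩
      · simp [chainInit]
      · simp [partyWorld, chainInit, bodies])
    (by
      rintro n k _ p _ - ⟨l, x, hl, hx, rfl, rfl, rfl⟩
      obtain ⟨l, rfl⟩ : ∃ l', l = l' + 1 := ⟨l - 1, by omega⟩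
      obtain ⟨h1, h2⟩ := forge_inv hP i hx
      refine ⟨h1, fun mq hmq r hr => ?_⟩
      obtain ⟨h3, h4⟩ := h2 mq hmq r hr
      refine ⟨h3, fun s' hs' => ?_⟩
      obtain ⟨l', y, hl', hy, hk, h5, h6⟩ := h4 s' hs'
      exact ⟨l', y, by omega, hy, by rw [hk], h5, h6⟩)
    (by rintro n s p w ⟨l, x, -, hx, -, rfl, -⟩; exact ⟨l, x, hx, rfl⟩)
  have hppt : (U.G.forgeExp A).IsPPT := by
    refine ⟨q, fun n o ho => ?_⟩
    simp only [Sig.forgeExp, PMF.bind_eq, PMF.pure_eq, PMF.mem_support_bind, PMF.mem_support_pure] at ho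
    obtain ⟨p, hp, r, hr, rfl⟩ := ho
    exact hq n (⟨n⟩, p.1) p _ ⟨rfl, hp, rfl⟩ r hr
  obtain ⟨μ, hμ, h⟩ := hEUF A hppt
  refine ⟨μ, hμ, fun n => le_trans ?_ (h n)⟩
  rw [Experiment.winProb_eq]
  refine ENNReal.toReal_mono (PMF.toOuterMeasure_ne_top _ _) ?_
  have e1 : ((U.G.forgeExp A n).map Outcome.win) = (U.G.keyGen n).bind fun p =>
      ((A.run (U.G.signOracle p.2) n (code (Unary.mk n, p.1)) .nil []).map fun o => (o.1, o.2.1)).map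
        fun r => (U.G.verify p.1 r.1.fst r.1.snd = true ∧ r.1.fst ∉ r.2) := by
    simp only [Sig.forgeExp, PMF.bind_eq, PMF.pure_eq, PMF.map_bind, PMF.pure_map, PMF.map_comp]
    rfl
  rw [e1, Γ.final_eq i]
  refine PMF.toOuterMeasure_bind_mono fun p hp => ?_
  rw [hA n (⟨n⟩, p.1) p _ ⟨rfl, hp, rfl⟩, Γ.forgeStart_eq hi n p]
  simp only [PMF.bind_bind, PMF.bind_map, PMF.map_bind, Function.comp_def, PMF.pure_map]
  refine PMF.toOuterMeasure_bind_mono fun s hs => PMF.toOuterMeasure_bind_mono fun keys hkeys =>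
    PMF.toOuterMeasure_bind_mono fun y hy => ?_
  have hx := Γ.reach_init (update_mem_accounts i hkeys hp) hy hs
  set x := chainInit n (Function.update keys i p) y s with hxdef
  -- A forgery in some round shows itself when that round ends, so the chain stopped at visible
  -- forgeries has stopped by then. At the start the log is empty and the only round is the current
  -- one, so both properties agree.
  have hmono := iterK_stop (s := U.chainStep P Γ.A) (E := U.Forged i) (S := U.Forging i) (Γ.Reach n)
    (fun k x hx y hy => hx.step hy) (fun k x hx hF y hy hF' =>
      Forged.step hy (hbound n _ x hx).log_round hF hF') (Γ.T.eval n) x hx (by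
        rintro ⟨r, t, p', hr, tx, h1, h2, h3, -⟩
        obtain rfl : s = t := by
          rcases r with _ | r
          · simpa [hxdef, chainInit] using hr
          · simp [hxdef, chainInit] at hr
        exact ⟨p', tx, h1, h2, h3, by simp [hxdef, chainInit]⟩)
  refine hmono.trans ?_
  have hmap := iterK_map (s := fun x => if U.Forging i x then PMF.pure x else U.chainStep P Γ.A x)
    (t := redStep (U.forgePre P Γ.A i) (U.forgePost i) (U.G.signOracle p.2))
    (fun y => forgeState (simState (some i) y, partyWorld (some i) y.w))
    (fun _ y => y.keys i = p) (fun _ x hx y hy => by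
      by_cases hF : U.Forging i x
      · rw [if_pos hF, PMF.mem_support_pure] at hy; rw [hy]; exact hx
      · rw [if_neg hF] at hy; rw [(U.step_const P Γ.A hy).2.1]; exact hx)
    (fun _ x hx => by
      have := forge_chainStep (Γ := Γ) i x
      rw [hx] at this; exact this) (Γ.T.eval n) x (by simp [hxdef, chainInit])
  have hkeys' : ∀ y ∈ (DelegatedTLP.iterK (fun x => if U.Forging i x then PMF.pure x
      else U.chainStep P Γ.A x) (Γ.T.eval n) x).support, y.keys i = p :=
    iterK_inv (fun _ y => y.keys i = p) (fun _ x hx y hy => by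
      by_cases hF : U.Forging i x
      · rw [if_pos hF, PMF.mem_support_pure] at hy; rw [hy]; exact hx
      · rw [if_neg hF] at hy; rw [(U.step_const P Γ.A hy).2.1]; exact hx)
      (Γ.T.eval n) 0 x (by simp [hxdef, chainInit])
  -- In a final state with a visible forgery, the first entry of the list passes the challenger's
  -- test: it verifies under the drawn key, and its content is not among the signed messages.
  refine (PMF.toOuterMeasure_mono _ (t := (fun y : ChainState z =>
    (U.G.verify p.1 (code (U.found i (forger i y))).fst.snd.fst (code (U.found i (forger i y))).fst.snd.snd
      = true ∧ (code (U.found i (forger i y))).fst.snd.fst ∉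
        bodies (partyWorld (some i) y.w).log)) ⁻¹' {p | p}) ?_).trans (le_of_eq ?_)
  · rintro y ⟨hF, hy⟩
    have hne : U.found i (forger i y) ≠ [] := fun h =>
      (found_isEmpty.1 (by rw [List.isEmpty_iff]; exact h)) hF
    obtain ⟨tx, l, htx⟩ := List.exists_cons_of_ne_nil hne
    have h1 : tx ∈ U.found i (forger i y) := by rw [htx]; exact List.mem_cons_self ..
    have h2 : ((forger i y).1.1.2.1 i).1 = p.1 := by
      rw [← hkeys' y hy]
      simp [forger, forgeState, simState, hideKey]
    rw [found, h2, mem_forgeries] at h1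
    simp only [Set.mem_preimage, Set.mem_ofPred_eq, htx, code_list_cons, fst_cons]
    exact ⟨h1.2.2.1, h1.2.2.2⟩
  · rw [← PMF.toOuterMeasure_map_apply]
    refine congrArg (fun q : PMF Prop => q.toOuterMeasure {p | p}) ?_
    rw [show (forger i x, ([] : List Data)) =
      forgeState (simState (some i) x, partyWorld (some i) x.w) from rfl, hmap, PMF.bind_map]
    rfl

end ChainGame

end

section

/-! ## Running a game without interaction -/

variable {z : ℕ}

namespace Setting

variable (U : Setting z) (P : ℕ → DTLP.Params z) (A : Interactive)

/-- A step of the game with a local blockchain. -/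
def localStep : SimState z × Data → PMF (SimState z × Data) :=
  redStep (U.simPre P A none) purePost U.localOracle

/-- The adversary's view depends on the current state of the blockchain and on the replies, but not
on the history. The whole game can therefore be run inside one non-interactive stage, as the
validity experiment of the puzzles requires. -/
theorem localStep_eq (x : ChainState z) : U.localStep P A (simState none x, x.w.cur) =
    (U.chainStep P A x).map fun y => (simState none y, y.w.cur) := by
  have h := congrArg (PMF.map fun y : SimState z × Blockchain.World Unit => (y.1, y.2.cur))
    (U.sim_chainStep P A none (.nil, .nil) x (by simp))
  rw [PMF.map_comp] at h
  refine Eq.trans ?_ h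
  simp only [localStep, redStep, purePost, PMF.map_bind, PMF.pure_map]
  refine PMF.bind_congr fun mq hmq => ?_
  rcases U.simPre_none P A hmq with hq | ⟨a, b, d, hq⟩ <;> rw [hq]
  · simp [localOracle, Blockchain.liveOracle, PMF.pure_eq, partyWorld]
  · have := congrArg (PMF.map fun r : Data × Data × List (Unit × Data × ℕ) =>
      (simPost (mq.1, r.1), r.2.1)) (U.act_cur (partyWorld none x.w) (Action.ofData d))
    simp only [PMF.map_comp, Function.comp_def] at this
    simp only [localOracle, Blockchain.liveOracle, PMF.bind_map, Function.comp_def]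
    exact this.symm

theorem local_iterK (k : ℕ) (x : ChainState z) :
    iterK (U.localStep P A) k (simState none x, x.w.cur) =
      (iterK (U.chainStep P A) k x).map fun y => (simState none y, y.w.cur) :=
  iterK_map (fun y => (simState none y, y.w.cur)) (fun _ _ => True) (fun _ _ _ _ _ => trivial)
    (fun _ x _ => U.localStep_eq P A x) k x trivial

end Setting

namespace ChainGame

open Setting

variable {U : Setting z} {P : ℕ → DTLP.Params z} (Γ : ChainGame U P)

/-- What a game starts from: security parameter, account keys, and the output of the start. -/
abbrev StartInput (z : ℕ) : Type := Unary × Keys × Data × (Fin z → Data) × Data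

/-- The start of the local game. -/
def localInit (x : StartInput z × Data) : SimState z × Data :=
  (((x.1.1, x.1.2.1, x.1.2.2.1, x.1.2.2.2.1), none, x.1.2.2.2.2, .nil, 0), x.2)

/-- The local game from given initial states; the result is the final state of the adversary. -/
def localPlay (x : StartInput z × Data) : PMF Data :=
  (DelegatedTLP.iterK (U.localStep P Γ.A) (Γ.T.eval x.1.1.val) (localInit x)).map fun y => y.1.2.2.1

def localRun (x : StartInput z) : PMF Data := (U.B.start x.1.val).bind fun s => Γ.localPlay (x, s)

theorem localRun_eq (n : ℕ) (keys : Keys) (y : Data × (Fin z → Data) × Data) :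
    Γ.localRun (⟨n⟩, keys, y) = (U.B.start n).bind fun s =>
      (DelegatedTLP.iterK (U.chainStep P Γ.A) (Γ.T.eval n) (chainInit n keys y s)).map fun x => x.st := by
  refine congrArg _ (funext fun s => ?_)
  have h := U.local_iterK P Γ.A (Γ.T.eval n) (chainInit n keys y s)
  simp only [simState, chainInit, hideKey_none, List.length_nil] at h
  rw [localPlay, localInit]
  refine (congrArg (PMF.map fun y : SimState z × Data => y.1.2.2.1) h).trans ?_
  rw [PMF.map_comp]
  rfl

/-- States of the local game before the last step. -/
def localDom (hP : DTLP.EfficientParams P) : Dom (SimState z × Data) :=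
  ⟨fun n s => ∃ k x, Γ.Reach n (k + 1) x ∧ (simState none x, x.w.cur) = s, by
    obtain ⟨q, hq⟩ := Γ.exists_bound hP
    refine ⟨2 * q + 1, ?_⟩
    rintro n _ ⟨k, x, hx, rfl⟩
    have h1 := (hq n _ x hx).sim_size none
    have h2 := (hq n _ x hx).cur_size
    have h3 : (code (simState none x, x.w.cur)).size = (code (simState none x)).size + x.w.cur.size + 1 := rfl
    simp only [Polynomial.eval_add, Polynomial.eval_mul, Polynomial.eval_ofNat, Polynomial.eval_one]
    omega⟩

theorem localStep_poly (hP : DTLP.EfficientParams P) :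
    PolyOn (Γ.localDom hP) (U.localStep P Γ.A) := by
  have hpre : PolyOn (Γ.localDom hP) fun s => U.simPre P Γ.A none s.1 :=
    PolyFun.bind (E := Γ.simDom hP none) PolyFun.id.fst (Γ.pre_poly hP none) (by
      rintro n _ ⟨k, x, hx, rfl⟩
      exact ⟨k, x, hx, rfl⟩)
  have h : PolyOn (Dom.ext _ hpre) fun x => U.localOracle x.1.2 x.2.2 :=
    U.localOracle_poly PolyFun.id.fst.snd PolyFun.id.snd.snd
  have h' : PolyOn (Dom.ext _ hpre) fun x => (U.localOracle x.1.2 x.2.2).map fun r =>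
      (simPost (x.2.1, r.1), r.2) := by
    refine PolyOn.map (g := fun x r => (simPost (x.2.1, r.1), r.2)) h ?_
    exact (PolyFun.all_comp simPost_poly (PolyFun.id.fst.snd.fst.pair PolyFun.id.snd.fst)).pair
      PolyFun.id.snd.snd
  refine (PolyOn.bind₂ (g := fun x m => (U.localOracle x.2 m.2).map fun r =>
    (simPost (m.1, r.1), r.2)) hpre h').congr fun n s _ => ?_
  simp only [localStep, redStep, purePost, PMF.pure_map]
  rfl

theorem localPlay_poly (hP : DTLP.EfficientParams P) {D : Dom (StartInput z × Data)}
    (hD : ∀ n x, D.mem n x → x.1.1 = ⟨n⟩ ∧ x.1.2.1 ∈ (DTLP.accounts U.G n).support ∧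
      x.1.2.2 ∈ (Γ.start (⟨n⟩, x.1.2.1)).support ∧ x.2 ∈ (U.B.start n).support) :
    PolyOn D Γ.localPlay := by
  have hx₀ : PolyFun D localInit := by
    have h : PolyFun D fun x => x.1 := PolyFun.id.fst
    exact ((h.fst.pair (h.snd.fst.pair (h.snd.snd.fst.pair h.snd.snd.snd.fst))).pair
      ((PolyFun.const _).pair (h.snd.snd.snd.snd.pair ((PolyFun.const _).pair (PolyFun.const _))))).pair
      PolyFun.id.snd
  have hlen : ∀ m : ℕ, (code (Unary.mk m)).len = m := by
    intro m; rw [code_unary, Data.len, Data.toList_ofList, List.length_replicate]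
  have hiter := PolyOn.iterate (Γ.localStep_poly hP) (D := D)
    (PolyFun.unaryPoly (PolyFun.id.fst.fst : PolyFun D fun x => x.1.1) Γ.T).coded hx₀
    (fun n k s => ∃ x, Γ.Reach n k x ∧ (simState none x, x.w.cur) = s)
    (by
      rintro n k _ ⟨x, hx, rfl⟩
      refine ⟨⟨k, x, hx, rfl⟩, fun b hb => ?_⟩
      rw [U.localStep_eq, PMF.mem_support_map] at hb
      obtain ⟨y, hy, rfl⟩ := hb
      exact ⟨y, hx.step hy, rfl⟩)
    (by
      rintro n ⟨⟨n', keys, y⟩, s⟩ hx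
      obtain ⟨h1, h2, h3, h4⟩ := hD n _ hx
      simp only at h1 h2 h3 h4
      subst h1
      rw [hlen]
      refine ⟨chainInit n keys y s, Γ.reach_init h2 h3 h4, ?_⟩
      simp [simState, chainInit, hideKey_none, localInit])
  have hiter' : PolyOn D fun x => DelegatedTLP.iterK (U.localStep P Γ.A) (Γ.T.eval x.1.1.val)
      (localInit x) := hiter.congr fun n x _ => by rw [hlen]
  exact PolyOn.map (g := fun _ y => y.1.2.2.1) hiter' PolyFun.id.snd.fst.snd.snd.fst

theorem localRun_poly (hP : DTLP.EfficientParams P) {D : Dom (StartInput z)}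
    (hD : ∀ n x, D.mem n x → x.1 = ⟨n⟩ ∧ x.2.1 ∈ (DTLP.accounts U.G n).support ∧
      x.2.2 ∈ (Γ.start (⟨n⟩, x.2.1)).support) : PolyOn D Γ.localRun := by
  have hstart : PolyOn D fun x => U.B.start x.1.val :=
    PolyFun.polyTime_comp (g := fun n : Unary => U.B.start n.val) U.hB.1 PolyFun.id.fst
  exact PolyOn.bind₂ (g := fun x s => Γ.localPlay (x, s)) hstart (Γ.localPlay_poly hP (by
    rintro n ⟨x, s⟩ ⟨hx, hs⟩
    obtain ⟨h1, h2, h3⟩ := hD n x hx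
    exact ⟨h1, h2, h3, by simpa [h1] using hs⟩))

end ChainGame

end

section

/-! ## The game for solution validity -/

variable {z : ℕ}

namespace Setting

variable (U : Setting z) (P : ℕ → DTLP.Params z)

theorem hideKey_party {i₀ : Option Party} {i : Party} (h : i₀ ≠ some i) (keys : Keys) :
    hideKey i₀ keys i = keys i := by
  rw [hideKey, if_neg fun e => h e.symm]

/-- The input of the second stage of an adversary against validity. -/
def validInput (n : ℕ) (keys : Keys) (k : Bits) (st : Data) (pk : Data)
    (p : (Fin z → Data) × (Fin z → Data)) : Data :=
  code (Unary.mk n, pk, code (P n).Δ, U.sol n (P n) pk p.1, p, st, code k, U.Ψ n (P n), (P n).Δ,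
    (P n).aux, (P n).coins, (U.contract n (P n) keys).adr, keys .HS, (P n).toc, (P n).t₀)

theorem validInput_hide {i₀ : Option Party} (h : i₀ ≠ some .HS) (n : ℕ) (keys : Keys) (k : Bits)
    (st pk : Data) (p : (Fin z → Data) × (Fin z → Data)) :
    U.validInput P n (hideKey i₀ keys) k st pk p = U.validInput P n keys k st pk p := by
  rw [validInput, validInput, U.contract_hideKey, hideKey_party h]

theorem validInput_poly {P : ℕ → DTLP.Params z} (hP : DTLP.EfficientParams P) {γ : Type} [Coded γ]
    {D : Dom γ} {n : γ → Unary} {keys : γ → Keys} {k : γ → Bits} {st pk : γ → Data}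
    {p : γ → (Fin z → Data) × (Fin z → Data)} (hn : PolyFun D n) (hkeys : PolyFun D keys)
    (hk : PolyFun D k) (hst : PolyFun D st) (hpk : PolyFun D pk) (hp : PolyFun D p) :
    PolyFun D fun g => U.validInput P (n g).val (keys g) (k g) (st g) (pk g) (p g) := by
  have h := params_poly hP hn
  have hΔ := Δ_poly hP hn
  exact (hn.pair (hpk.pair (hΔ.coded.pair ((U.sol_poly hP hn hpk hp.fst).pair (hp.pair (hst.pair
    (hk.coded.pair ((U.Ψ_poly hP hn).pair (hΔ.pair (h.snd.snd.fst.pair (h.snd.snd.snd.snd.fst.pair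
    ((U.adr_poly hP hn hkeys).pair ((hkeys.party .HS).pair (h.fst.pair
      h.snd.snd.snd.fst)))))))))))))).coded

/-- The input of the first stage. -/
def validFirstInput (n : ℕ) : Data := code (Unary.mk n, code (P n).Δ, (P n).Δ, Unary.mk z)

/-- The start of the game: the encoded messages, public key, statements, and the input of the second
stage of the adversary. -/
def validStart (p : Prog) (x : Unary × Keys) : PMF ((Fin z → Bits) × Data × (Fin z → Data) × Data) :=
  (U.E.keyGen x.1.val).bind fun k => (p.out (validFirstInput P x.1.val)).bind fun o =>
    (U.T.setup x.1.val (P x.1.val).Δ (U.τ.S x.1.val)).bind fun hk =>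
    (U.T.gen (toMsgs z o.fst) hk.1 hk.2).map fun q =>
      (toMsgs z o.fst, hk.1, q.2, U.validInput P x.1.val x.2 k o.snd hk.1 q)

theorem validStart_poly {P : ℕ → DTLP.Params z} (hP : DTLP.EfficientParams P) (p : Prog)
    (hp : ∃ q : Polynomial ℕ, ∀ n, p.WorkLe (validFirstInput P n) (q.eval n))
    {D : Dom (Unary × Keys)} (hD : ∀ n x, D.mem n x → x.1.val = n) : PolyOn D (U.validStart P p) := by
  have hn : PolyFun D fun x => x.1 := PolyFun.id.fst
  have hk : PolyOn D fun x => U.E.keyGen x.1.val :=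
    PolyFun.polyTime_comp (g := fun n : Unary => U.E.keyGen n.val) U.hE.1 hn
  refine PolyOn.bind₂ hk ?_
  have hn' := hn.up (hg := hk)
  have hin : PolyFun (Dom.ext _ hk) fun x => validFirstInput P x.1.1.val :=
    (hn'.pair ((Δ_poly hP hn').coded.pair ((Δ_poly hP hn').pair (PolyFun.const (Unary.mk z))))).coded
  have hout : PolyOn (Dom.ext _ hk) fun x => p.out (validFirstInput P x.1.1.val) := by
    obtain ⟨q, hq⟩ := hp
    refine PolyFun.bind (E := Dom.map _ hin) hin (PolyOn.of_workLe p q ?_) fun n a ha => ⟨a, ha, rfl⟩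
    rintro n _ ⟨x, ⟨hx, -⟩, rfl⟩
    have := hq n
    rw [← hD n _ hx] at this ⊢
    exact this
  refine PolyOn.bind₂ hout ?_
  have hset := U.setup_poly hP (hn'.up (hg := hout))
  refine PolyOn.bind₂ hset ?_
  have hn3 := (hn'.up (hg := hout)).up (hg := hset)
  have ho : PolyFun (Dom.ext _ hset) fun x => x.1.2 := PolyFun.id.fst.snd
  have hhk : PolyFun (Dom.ext _ hset) fun x => x.2 := PolyFun.id.snd
  have hm := PolyFun.toMsgs (z := z) ho.dfst
  have hgen := U.gen_poly hm hhk.fst hhk.snd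
  refine PolyOn.map hgen ?_
  exact hm.up.pair (hhk.fst.up.pair (PolyFun.id.snd.snd.pair (U.validInput_poly hP hn3.up
    PolyFun.id.fst.fst.fst.fst.snd PolyFun.id.fst.fst.fst.snd ho.dsnd.up hhk.fst.up PolyFun.id.snd)))

theorem validStart_hide {i₀ : Option Party} (h : i₀ ≠ some .HS) (p : Prog) (n : Unary) (keys : Keys) :
    U.validStart P p (n, hideKey i₀ keys) = U.validStart P p (n, keys) := by
  simp only [validStart, U.validInput_hide P h]

theorem mem_iterK_const {A : Interactive} {k : ℕ} {x y : ChainState z}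
    (hy : y ∈ (iterK (U.chainStep P A) k x).support) :
    y.n = x.n ∧ y.keys = x.keys ∧ y.pk = x.pk ∧ y.g = x.g :=
  iterK_inv (fun _ y => y.n = x.n ∧ y.keys = x.keys ∧ y.pk = x.pk ∧ y.g = x.g)
    (fun _ a ha b hb => by
      obtain ⟨h1, h2, h3, h4⟩ := U.step_const P A hb
      exact ⟨h1.trans ha.1, h2.trans ha.2.1, h3.trans ha.2.2.1, h4.trans ha.2.2.2⟩) k 0 x
    ⟨rfl, rfl, rfl, rfl⟩ y hy

/-- A solution other than the encoded one is accepted. -/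
def Cheats (e : Fin z → Bits) (pk : Data) (g : Fin z → Data) (r : Data) : Prop :=
  ∃ j : Fin z, (j : ℕ) = r.fst.toNat ∧ U.T.verify pk j r.snd.snd.toBits r.snd.fst (g j) = true ∧
    r.snd.snd.toBits ≠ e j

/-- A report has an accepted solution although no such solution has been delivered on time. -/
def Backdated (n : ℕ) (c : Contract z) (hist : List Data) : Prop :=
  ∃ (j : Fin z) (m : Bits) (π : Data), (¬ ∃ t, DTLP.OnTime U.G U.B n c hist j m π t) ∧
    ∃ (i : ℕ) (s : Data) (q : Fin U.B.N) (t : ℕ), hist[i]? = some s ∧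
      (U.B.report q s c).reg j = some (m, π, t) ∧ t ≤ deadline c.t₀ c.Δ c.Ψ c.Υ j

/-- The event that the adversary wins. -/
def ValidWins (n : ℕ) (keys : Keys) (y : (Fin z → Bits) × Data × (Fin z → Data) × Data) (st : Data)
    (hist : List Data) : Prop :=
  ∃ j : Fin z, (j : ℕ) = st.fst.toNat ∧
    ((∃ t, DTLP.OnTime U.G U.B n (U.contract n (P n) keys) hist j st.snd.snd.toBits st.snd.fst t ∧
      st.snd.snd.toBits ≠ y.1 j ∧ U.D.verify y.2.1 j st.snd.snd.toBits st.snd.fst (y.2.2.1 j)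
        (U.contract n (P n) keys).Ψ t (P n).t₀ (P n).Δ (U.B.delay n) = true) ∨
     ((¬ ∃ t, DTLP.OnTime U.G U.B n (U.contract n (P n) keys) hist j st.snd.snd.toBits st.snd.fst t) ∧
      st.snd.snd.toBits = y.1 j ∧ ∃ (i : ℕ) (s : Data) (q : Fin U.B.N) (t' : ℕ), hist[i]? = some s ∧
        (U.B.report q s (U.contract n (P n) keys)).reg j = some (st.snd.snd.toBits, st.snd.fst, t') ∧
        U.D.verify y.2.1 j st.snd.snd.toBits st.snd.fst (y.2.2.1 j) (U.contract n (P n) keys).Ψ t'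
          (P n).t₀ (P n).Δ (U.B.delay n) = true))

/-- In the first case of a win, the delivery time can be forgotten; what remains is an accepted
wrong message. In the second case, the correctness of the message can be forgotten; what remains is
a reported time within the deadline that contradicts the true one. -/
theorem ValidWins.cases {n : ℕ} {keys : Keys} {y : (Fin z → Bits) × Data × (Fin z → Data) × Data}
    {st : Data} {hist : List Data} (h : U.ValidWins P n keys y st hist) :
    U.Cheats y.1 y.2.1 y.2.2.1 st ∨ U.Backdated n (U.contract n (P n) keys) hist := by
  obtain ⟨j, hj, ⟨t, -, h1, h2⟩ | ⟨h1, -, i, s, q, t, h2, h3, h4⟩⟩ := h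
  · simp only [edTLP, Bool.and_eq_true] at h2
    exact Or.inl ⟨j, hj, h2.2, h1⟩
  · simp only [edTLP, Bool.and_eq_true, decide_eq_true_eq] at h4
    exact Or.inr ⟨j, _, _, h1, i, s, q, t, h2, h3, h4.1⟩

theorem validExp_eq (A : DTLP.ChainAdversary) (n : ℕ) : U.D.validityExp U.G U.B U.τ.S P A n =
    (DTLP.accounts U.G n).bind fun keys => (U.E.keyGen n).bind fun k =>
      (A.first.run (validFirstInput P n)).bind fun o =>
      (U.T.setup n (P n).Δ (U.τ.S n)).bind fun hk =>
      (U.T.gen (toMsgs z o.1.fst) hk.1 hk.2).bind fun p =>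
      (U.B.start n).bind fun s => (iterK (U.chainStep P A.second) ((A.second.acts + 2).eval n)
        (chainInit n keys (hk.1, p.2, U.validInput P n keys k o.1.snd hk.1 p) s)).map fun x =>
        -- The last component, the adversary's input, does not enter the winning condition; `nil`
        -- takes its place.
        ⟨U.ValidWins P n keys (toMsgs z o.1.fst, hk.1, p.2, .nil) x.st x.w.hist, o.2, x.cost⟩ := by
  simp only [DTLP.validityExp, PMF.bind_eq, PMF.pure_eq]
  refine congrArg _ (funext fun keys => ?_)
  simp only [edTLP, PMF.bind_eq, PMF.pure_eq, PMF.bind_bind, PMF.pure_bind]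
  refine congrArg _ (funext fun k => congrArg _ (funext fun o => congrArg _ (funext fun hk =>
    congrArg _ (funext fun p => ?_))))
  have h := U.runChain_eq P A.second n keys (hk.1, p.2, U.validInput P n keys k o.1.snd hk.1 p)
  refine (congrArg (fun q : PMF (Data × DTLP.CallWorld z × Cost) => PMF.bind q fun r => PMF.pure
    (Outcome.mk (U.ValidWins P n keys (toMsgs z o.1.fst, hk.1, p.2, .nil) r.1 r.2.1.hist) o.2 r.2.2)) h).trans ?_
  simp only [PMF.bind_bind, PMF.map, PMF.pure_bind, Function.comp_def]

end Setting

end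

/-! ### Reduction of accepted wrong messages to the validity of the puzzles. -/

section

variable {z : ℕ}

namespace Setting

variable (U : Setting z) {P : ℕ → DTLP.Params z}

/-- Partial runs of the experiment are completed to full ones, which yields separate bounds for the
two stages of the adversary. -/
theorem valid_work {A : DTLP.ChainAdversary} {q : Polynomial ℕ}
    (hA : ∀ n, ∀ o ∈ (U.D.validityExp U.G U.B U.τ.S P A n).support,
      o.cost₁.work + o.cost₂.work ≤ q.eval n) (n : ℕ) :
    A.first.WorkLe (validFirstInput P n) (q.eval n) ∧
    ∀ keys ∈ (DTLP.accounts U.G n).support,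
      ∀ y ∈ ((U.validStart P A.first (⟨n⟩, keys)).map Prod.snd).support,
      ∀ s ∈ (U.B.start n).support, ∀ x ∈ (iterK (U.chainStep P A.second)
        ((A.second.acts + 2).eval n) (chainInit n keys y s)).support, x.cost.work ≤ q.eval n := by
  have key : ∀ keys ∈ (DTLP.accounts U.G n).support, ∀ k ∈ (U.E.keyGen n).support,
      ∀ o ∈ (A.first.run (validFirstInput P n)).support,
      ∀ hk ∈ (U.T.setup n (P n).Δ (U.τ.S n)).support,
      ∀ p ∈ (U.T.gen (toMsgs z o.1.fst) hk.1 hk.2).support, ∀ s ∈ (U.B.start n).support,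
      ∀ x ∈ (iterK (U.chainStep P A.second) ((A.second.acts + 2).eval n)
        (chainInit n keys (hk.1, p.2, U.validInput P n keys k o.1.snd hk.1 p) s)).support,
      o.2.work + x.cost.work ≤ q.eval n := by
    intro keys hkeys k hk o ho hk' hhk p hp s hs x hx
    have hmem : ∃ w, (⟨w, o.2, x.cost⟩ : Outcome) ∈
        (U.D.validityExp U.G U.B U.τ.S P A n).support := by
      rw [validExp_eq]
      simp only [PMF.mem_support_bind, PMF.mem_support_map]
      exact ⟨_, keys, hkeys, k, hk, o, ho, hk', hhk, p, hp, s, hs, x, hx, rfl⟩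
    exact hA n _ hmem.choose_spec
  constructor
  · intro o ho
    obtain ⟨keys, hkeys⟩ := PMF.exists_mem_support (DTLP.accounts U.G n)
    obtain ⟨k, hk⟩ := PMF.exists_mem_support (U.E.keyGen n)
    obtain ⟨hk', hhk⟩ := PMF.exists_mem_support (U.T.setup n (P n).Δ (U.τ.S n))
    obtain ⟨p, hp⟩ := PMF.exists_mem_support (U.T.gen (toMsgs z o.1.fst) hk'.1 hk'.2)
    obtain ⟨s, hs⟩ := PMF.exists_mem_support (U.B.start n)
    obtain ⟨x, hx⟩ := PMF.exists_mem_support (iterK (U.chainStep P A.second)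
      ((A.second.acts + 2).eval n)
      (chainInit n keys (hk'.1, p.2, U.validInput P n keys k o.1.snd hk'.1 p) s))
    have := key keys hkeys k hk o ho hk' hhk p hp s hs x hx
    omega
  · intro keys hkeys y hy s hs x hx
    rw [PMF.mem_support_map] at hy
    obtain ⟨y, hy, rfl⟩ := hy
    simp only [validStart, PMF.mem_support_bind, PMF.mem_support_map] at hy
    obtain ⟨k, hk, o, ho, hk', hhk, p, hp, rfl⟩ := hy
    obtain ⟨o, ho', rfl⟩ := Prog.mem_out_iff.1 ho
    have := key keys hkeys k hk o ho' hk' hhk p hp s hs x hx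
    omega

/-- The game for solution validity. -/
def validGame (hP : DTLP.EfficientParams P) (A : DTLP.ChainAdversary) (q : Polynomial ℕ)
    (hA : ∀ n, ∀ o ∈ (U.D.validityExp U.G U.B U.τ.S P A n).support,
      o.cost₁.work + o.cost₂.work ≤ q.eval n) : ChainGame U P where
  A := A.second
  start x := (U.validStart P A.first x).map Prod.snd
  bound := q
  start_poly D hD := PolyOn.map (g := fun _ y => y.2)
    (U.validStart_poly hP A.first ⟨q, fun n => (U.valid_work hA n).1⟩ hD) PolyFun.id.snd.snd
  start_hide n keys i₀ h := by rw [U.validStart_hide P h]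
  ppt n := (U.valid_work hA n).2

/-- The game, with the encoded messages. -/
def validRun (P : ℕ → DTLP.Params z) (A : DTLP.ChainAdversary) (n : ℕ) :
    PMF (((Fin z → Bits) × Data × (Fin z → Data) × Data) × ChainState z) :=
  (DTLP.accounts U.G n).bind fun keys => (U.validStart P A.first (⟨n⟩, keys)).bind fun y =>
    (U.B.start n).bind fun s => (iterK (U.chainStep P A.second) ((A.second.acts + 2).eval n)
      (chainInit n keys y.2 s)).map fun x => (y, x)

/-- What the first stage of the reduction to the validity of the puzzles hands to the second. -/
abbrev CheatState : Type := Unary × Keys × Bits × Data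

/-- The encoded messages are chosen before the puzzle keys exist in the delegated scheme, so the
public key offered by the puzzle experiment is ignored. Accounts and client key are sampled here and
handed on. -/
def cheatFirst (P : ℕ → DTLP.Params z) (p : Prog) (x : Unary × Data × (Fin z → ℕ)) :
    PMF (Data × CheatState) :=
  (DTLP.accounts U.G x.1.val).bind fun keys => (U.E.keyGen x.1.val).bind fun k =>
    (p.out (validFirstInput P x.1.val)).map fun o => (o.fst, x.1, keys, k, o.snd)

/-- The input of the second stage of the reduction. -/
abbrev CheatInput (z : ℕ) : Type :=
  Data × (Fin z → Data) × ((Fin z → Data) × (Fin z → Data)) × CheatState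

/-- The joint distribution of what the second stage receives. As an efficient computation it has
bounded results, and these form the domain on which the second stage has to be efficient. -/
def cheatInput (P : ℕ → DTLP.Params z) (p : Prog) (x : Unary) : PMF (CheatInput z) :=
  (U.T.setup x.val (P x.val).Δ (U.τ.S x.val)).bind fun hk =>
    (U.cheatFirst P p (x, hk.1, (P x.val).Δ)).bind fun d =>
    (U.T.gen (toMsgs z d.1) hk.1 hk.2).map fun q => (hk.1, (U.T.solve hk.1 q.1).1, q, d.2)

/-- The second stage of the reduction simulates the whole game. -/
def cheatSecond {P : ℕ → DTLP.Params z} (Γ : ChainGame U P) (x : CheatInput z) : PMF Data :=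
  Γ.localRun (x.2.2.2.1, x.2.2.2.2.1, x.1, x.2.2.1.2,
    U.validInput P x.2.2.2.1.val x.2.2.2.2.1 x.2.2.2.2.2.1 x.2.2.2.2.2.2 x.1 x.2.2.1)

theorem cheatFirst_poly (hP : DTLP.EfficientParams P) (p : Prog)
    (hp : ∃ q : Polynomial ℕ, ∀ n, p.WorkLe (validFirstInput P n) (q.eval n))
    {D : Dom (Unary × Data × (Fin z → ℕ))} (hD : ∀ n x, D.mem n x → x.1.val = n) :
    PolyOn D (U.cheatFirst P p) := by
  have hn : PolyFun D fun x => x.1 := PolyFun.id.fst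
  refine PolyOn.bind₂ (U.accounts_poly hn) ?_
  have hn1 := hn.up (hg := U.accounts_poly hn)
  have hk : PolyOn (Dom.ext _ (U.accounts_poly hn)) fun x => U.E.keyGen x.1.1.val :=
    PolyFun.polyTime_comp (g := fun n : Unary => U.E.keyGen n.val) U.hE.1 hn1
  refine PolyOn.bind₂ hk ?_
  have hn' := hn1.up (hg := hk)
  have hin : PolyFun (Dom.ext _ hk) fun x => validFirstInput P x.1.1.1.val :=
    (hn'.pair ((Δ_poly hP hn').coded.pair ((Δ_poly hP hn').pair (PolyFun.const (Unary.mk z))))).coded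
  have hout : PolyOn (Dom.ext _ hk) fun x => p.out (validFirstInput P x.1.1.1.val) := by
    obtain ⟨q, hq⟩ := hp
    refine PolyFun.bind (E := Dom.map _ hin) hin (PolyOn.of_workLe p q ?_) fun n a ha => ⟨a, ha, rfl⟩
    rintro n _ ⟨x, ⟨⟨hx, -⟩, -⟩, rfl⟩
    have := hq n
    rw [← hD n _ hx] at this ⊢
    exact this
  refine PolyOn.map (g := fun x o => ((o.fst, x.1.1.1, x.1.2, x.2, o.snd) : Data × CheatState)) hout ?_
  exact PolyFun.id.snd.dfst.pair (hn'.up.pair (PolyFun.id.fst.fst.snd.pair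
    (PolyFun.id.fst.snd.pair PolyFun.id.snd.dsnd)))

theorem cheatInput_poly (hP : DTLP.EfficientParams P) (p : Prog)
    (hp : ∃ q : Polynomial ℕ, ∀ n, p.WorkLe (validFirstInput P n) (q.eval n))
    {D : Dom Unary} (hD : ∀ n x, D.mem n x → x.val = n) : PolyOn D (U.cheatInput P p) := by
  have hset := U.setup_poly hP (PolyFun.id : PolyFun D _)
  refine PolyOn.bind₂ hset ?_
  have hn : PolyFun (Dom.ext _ hset) fun x => x.1 := PolyFun.id.fst
  have hin := hn.pair ((PolyFun.id.snd.fst : PolyFun (Dom.ext _ hset) fun x => x.2.1).pair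
    (Δ_poly hP hn))
  have hfirst : PolyOn (Dom.ext _ hset) fun x => U.cheatFirst P p (x.1, x.2.1, (P x.1.val).Δ) :=
    PolyFun.bind (E := Dom.map _ hin) hin (U.cheatFirst_poly hP p hp (by
      rintro n _ ⟨x, hx, rfl⟩
      exact hD n _ hx.1)) fun n a ha => ⟨a, ha, rfl⟩
  refine PolyOn.bind₂ hfirst ?_
  have hhk : PolyFun (Dom.ext _ hfirst) fun x => x.1.2 := PolyFun.id.fst.snd
  have hd : PolyFun (Dom.ext _ hfirst) fun x => x.2 := PolyFun.id.snd
  have hgen := U.gen_poly (PolyFun.toMsgs (z := z) hd.fst) hhk.fst hhk.snd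
  refine PolyOn.map hgen ?_
  refine hhk.fst.up.pair (PolyFun.pair ?_ (PolyFun.id.snd.pair hd.snd.up))
  exact (PolyFun.polyTime_comp_pure (g := fun x : Data × (Fin z → Data) => U.T.solve x.1 x.2)
      U.hT.2.2.1 (hhk.fst.up.pair PolyFun.id.snd.fst)).fst

theorem cheatSecond_poly (hP : DTLP.EfficientParams P) {A : DTLP.ChainAdversary} {q : Polynomial ℕ}
    (hA : ∀ n, ∀ o ∈ (U.D.validityExp U.G U.B U.τ.S P A n).support,
      o.cost₁.work + o.cost₂.work ≤ q.eval n) {D : Dom (CheatInput z)}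
    (hD : ∀ n x, D.mem n x → x ∈ (U.cheatInput P A.first ⟨n⟩).support) :
    PolyOn D (U.cheatSecond (U.validGame hP A q hA)) := by
  have hn : PolyFun D fun x => x.2.2.2.1 := PolyFun.id.snd.snd.snd.fst
  have hkeys : PolyFun D fun x => x.2.2.2.2.1 := PolyFun.id.snd.snd.snd.snd.fst
  have hin := hn.pair (hkeys.pair ((PolyFun.id.fst : PolyFun D fun x => x.1).pair
    ((PolyFun.id.snd.snd.fst.snd : PolyFun D fun x => x.2.2.1.2).pair
    (U.validInput_poly hP hn hkeys PolyFun.id.snd.snd.snd.snd.snd.fst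
      PolyFun.id.snd.snd.snd.snd.snd.snd PolyFun.id.fst PolyFun.id.snd.snd.fst))))
  refine PolyFun.bind (E := Dom.map _ hin) hin ((U.validGame hP A q hA).localRun_poly hP ?_)
    fun n a ha => ⟨a, ha, rfl⟩
  rintro n _ ⟨x, hx, rfl⟩
  have h := hD n x hx
  simp only [cheatInput, cheatFirst, PMF.mem_support_bind, PMF.mem_support_map] at h
  obtain ⟨hk, hhk, _, ⟨keys, hkeys, k, hk', o, ho, rfl⟩, p, hp, rfl⟩ := h
  refine ⟨rfl, hkeys, PMF.mem_support_map.2 ⟨(toMsgs z o.fst, hk.1, p.2,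
    U.validInput P n keys k o.snd hk.1 p), ?_, rfl⟩⟩
  simp only [validStart, PMF.mem_support_bind, PMF.mem_support_map]
  exact ⟨k, hk', o, ho, hk, hhk, p, hp, rfl⟩

theorem gcExp_eq (Δ : ℕ → Fin z → ℕ) (A : TwoStage) (n : ℕ) : U.T.validityExp Δ U.τ.S A n =
    (U.T.setup n (Δ n) (U.τ.S n)).bind fun hk =>
      (A.first.run (code (Unary.mk n, hk.1, Δ n))).bind fun o =>
      (U.T.gen (toMsgs z o.1.fst) hk.1 hk.2).bind fun p =>
      (A.second.run (code (hk.1, (U.T.solve hk.1 p.1).1, p, o.1.snd))).map fun o' =>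
        ⟨∃ j : Fin z, (j : ℕ) = o'.1.fst.toNat ∧
          U.T.verify hk.1 j o'.1.snd.snd.toBits o'.1.snd.fst (p.2 j) = true ∧
          o'.1.snd.snd.toBits ≠ toMsgs z o.1.fst j, o.2, o'.2⟩ := rfl

/-- The second stage of the reduction recomputes the solutions from the puzzles and runs the
adversary together with the blockchain. Its output is the adversary's, and a wrong message with an
accepted proof is a win in both experiments. -/
theorem cheat_secure (hP : DTLP.EfficientParams P) (hV : U.T.Valid U.τ) {A : DTLP.ChainAdversary}
    {q : Polynomial ℕ} (hA : ∀ n, ∀ o ∈ (U.D.validityExp U.G U.B U.τ.S P A n).support,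
      o.cost₁.work + o.cost₂.work ≤ q.eval n) :
    ∃ μ, Negligible μ ∧ ∀ n, ((U.validRun P A n).toOuterMeasure
      {x | U.Cheats x.1.1 x.1.2.1 x.1.2.2.1 x.2.st}).toReal ≤ μ n := by
  let Dn : Dom Unary := ⟨fun n m => m = ⟨n⟩, 2 * .X + 1, by rintro n _ rfl; simp⟩
  have hp : ∃ q : Polynomial ℕ, ∀ n, A.first.WorkLe (validFirstInput P n) (q.eval n) :=
    ⟨q, fun n => (U.valid_work hA n).1⟩
  have hjoint := U.cheatInput_poly hP A.first hp (D := Dn) fun n x hx => by rw [hx]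
  have hset := U.setup_poly hP (PolyFun.id : PolyFun Dn _)
  have hin : PolyFun (Dom.ext _ hset) fun x => (x.1, x.2.1, (P x.1.val).Δ) :=
    PolyFun.id.fst.pair (PolyFun.id.snd.fst.pair (Δ_poly hP PolyFun.id.fst))
  obtain ⟨p₁, q₁, h₁⟩ := U.cheatFirst_poly hP A.first hp (D := Dom.map _ hin) (by
    rintro n _ ⟨x, hx, rfl⟩
    have := hx.1
    simp only [Dn] at this
    rw [this])
  obtain ⟨p₂, q₂, h₂⟩ := U.cheatSecond_poly hP hA (D := Dom.img Dn hjoint) (by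
    rintro n x ⟨_, rfl, hx⟩; exact hx)
  have hmem : ∀ n, ∀ hk ∈ (U.T.setup n (P n).Δ (U.τ.S n)).support,
      (Dom.map _ hin).mem n (⟨n⟩, hk.1, (P n).Δ) :=
    fun n hk hhk => ⟨(⟨n⟩, hk), ⟨rfl, hhk⟩, rfl⟩
  have hmem₂ : ∀ n, ∀ hk ∈ (U.T.setup n (P n).Δ (U.τ.S n)).support,
      ∀ d ∈ (U.cheatFirst P A.first (⟨n⟩, hk.1, (P n).Δ)).support,
      ∀ p ∈ (U.T.gen (toMsgs z d.1) hk.1 hk.2).support,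
      (Dom.img Dn hjoint).mem n (hk.1, (U.T.solve hk.1 p.1).1, p, d.2) := by
    intro n hk hhk d hd p hp
    refine ⟨⟨n⟩, rfl, ?_⟩
    simp only [cheatInput, PMF.mem_support_bind, PMF.mem_support_map]
    exact ⟨hk, hhk, d, hd, p, hp, rfl⟩
  let A' : TwoStage := ⟨p₁, p₂⟩
  have hppt : (U.T.validityExp (fun n => (P n).Δ) U.τ.S A').IsPPT := by
    refine ⟨q₁ + q₂, fun n o ho => ?_⟩
    rw [gcExp_eq] at ho
    simp only [PMF.mem_support_bind, PMF.mem_support_map] at ho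
    obtain ⟨hk, hhk, o₁, ho₁, p, hp, o₂, ho₂, rfl⟩ := ho
    have e₁ := (h₁ n _ (hmem n hk hhk)).2 o₁ ho₁
    have hd := Prog.mem_out ho₁
    rw [show A'.first = p₁ from rfl, (h₁ n _ (hmem n hk hhk)).1, PMF.mem_support_map] at hd
    obtain ⟨d, hd, hd'⟩ := hd
    rw [← hd'] at hp ho₂
    have e₂ := (h₂ n _ (hmem₂ n hk hhk d hd p hp)).2 o₂ ho₂
    simp only [Polynomial.eval_add]
    omega
  obtain ⟨μ, hμ, h⟩ := hV (fun n => (P n).Δ) (efficientTimes hP) A' hppt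
  refine ⟨μ, hμ, fun n => ?_⟩
  have h := h n
  rw [Experiment.winProb_eq] at h
  have e : ((U.T.validityExp (fun n => (P n).Δ) U.τ.S A' n).map Outcome.win) =
      (U.validRun P A n).map fun x => U.Cheats x.1.1 x.1.2.1 x.1.2.2.1 x.2.st := by
    rw [gcExp_eq]
    simp only [PMF.map_bind, PMF.map_comp, Function.comp_def]
    have e1 : ∀ hk ∈ (U.T.setup n (P n).Δ (U.τ.S n)).support, _ := fun hk hhk =>
      (Prog.run_bind (ε := Prop) p₁ (code (Unary.mk n, hk.1, (P n).Δ)) fun o =>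
        (U.T.gen (toMsgs z o.fst) hk.1 hk.2).bind fun p =>
        (p₂.run (code (hk.1, (U.T.solve hk.1 p.1).1, p, o.snd))).map fun o' =>
          ∃ j : Fin z, (j : ℕ) = o'.1.fst.toNat ∧
          U.T.verify hk.1 j o'.1.snd.snd.toBits o'.1.snd.fst (p.2 j) = true ∧
          o'.1.snd.snd.toBits ≠ toMsgs z o.fst j).trans
        (congrArg (fun r => PMF.bind r _) (h₁ n _ (hmem n hk hhk)).1)
    rw [PMF.bind_congr e1]
    simp only [PMF.bind_map, Function.comp_def]
    have e2 : ∀ hk ∈ (U.T.setup n (P n).Δ (U.τ.S n)).support,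
        ((U.cheatFirst P A.first (⟨n⟩, hk.1, (P n).Δ)).bind fun d =>
          (U.T.gen (toMsgs z d.1) hk.1 hk.2).bind fun p =>
          (p₂.run (code (hk.1, (U.T.solve hk.1 p.1).1, p, d.2))).map fun o' =>
            U.Cheats (toMsgs z d.1) hk.1 p.2 o'.1) =
        (U.cheatFirst P A.first (⟨n⟩, hk.1, (P n).Δ)).bind fun d =>
          (U.T.gen (toMsgs z d.1) hk.1 hk.2).bind fun p =>
          (U.cheatSecond (U.validGame hP A q hA) (hk.1, (U.T.solve hk.1 p.1).1, p, d.2)).map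
            fun r => U.Cheats (toMsgs z d.1) hk.1 p.2 r := by
      intro hk hhk
      refine PMF.bind_congr fun d hd => PMF.bind_congr fun p hp => ?_
      have e3 : ((p₂.run (code (hk.1, (U.T.solve hk.1 p.1).1, p, d.2))).map fun o' =>
            U.Cheats (toMsgs z d.1) hk.1 p.2 o'.1) =
          (p₂.out (code (hk.1, (U.T.solve hk.1 p.1).1, p, d.2))).map fun r =>
            U.Cheats (toMsgs z d.1) hk.1 p.2 r := by
        rw [Prog.out, PMF.map_comp]; rfl
      rw [e3, (h₂ n _ (hmem₂ n hk hhk d hd p hp)).1, PMF.map_comp]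
      rfl
    refine (PMF.bind_congr e2).trans ?_
    simp only [cheatFirst, PMF.bind_bind, PMF.bind_map, Function.comp_def]
    -- In the puzzle experiment the setup comes first. Accounts, client key and first stage are
    -- independent of it, and are moved in front of it one after the other.
    rw [PMF.bind_comm, validRun, PMF.map_bind]
    refine congrArg _ (funext fun keys => ?_)
    rw [PMF.bind_comm, validStart, PMF.bind_bind, PMF.map_bind]
    refine congrArg _ (funext fun k => ?_)
    rw [PMF.bind_comm, PMF.bind_bind, PMF.map_bind]
    refine congrArg _ (funext fun o => ?_)
    rw [PMF.bind_bind, PMF.map_bind]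
    refine congrArg _ (funext fun hk => ?_)
    rw [PMF.bind_map, PMF.map_bind]
    refine congrArg _ (funext fun p => ?_)
    have e4 := (U.validGame hP A q hA).localRun_eq n keys
      (hk.1, p.2, U.validInput P n keys k o.snd hk.1 p)
    refine (congrArg (PMF.map _) e4).trans ?_
    simp only [PMF.map_bind, PMF.map_comp, Function.comp_def]
    rfl
  rw [e, PMF.toOuterMeasure_map_apply] at h
  exact h

end Setting

end

section

/-! ## Ledgers and the execution of the contract -/

variable {z : ℕ}

namespace Blockchain

variable {B : Blockchain z} {n : ℕ} {hist : List Data}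

theorem ledger_prefix_view (p : Fin B.N) (s : Data) : B.ledger n p s <+: B.view p s :=
  List.take_prefix _ _

theorem persists (h : ¬ B.PersistenceFails n hist) {r r' : ℕ} {s s' : Data} {p p' : Fin B.N}
    (hr : r ≤ r') (hs : hist[r]? = some s) (hs' : hist[r']? = some s') :
    B.ledger n p s <+: B.view p' s' :=
  by_contra fun h' => h ⟨r, r', s, s', p, p', hr, hs, hs', h'⟩

theorem mem_stampedTxs {p : Fin B.N} {s : Data} {x : ℕ × Data} :
    x ∈ B.stampedTxs n p hist s ↔ ∃ (k : ℕ) (b : List Data), (B.ledger n p s)[k]? = some b ∧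
      x.2 ∈ b ∧ x.1 = hist.findIdx fun s' => decide (k < (B.ledger n p s').length) := by
  obtain ⟨t, tx⟩ := x
  simp only [stampedTxs, List.mem_flatMap, List.mem_map, Prod.exists, List.mk_mem_zipIdx_iff_getElem?,
    Prod.mk.injEq]
  constructor
  · rintro ⟨b, k, hb, tx', h, h1, rfl⟩
    exact ⟨k, b, hb, h, h1.symm⟩
  · rintro ⟨k, b, hb, h, h1⟩
    exact ⟨b, k, hb, tx, h, h1.symm, rfl⟩

theorem mem_ledger_of_stampedTxs {p : Fin B.N} {s : Data} {x : ℕ × Data}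
    (h : x ∈ B.stampedTxs n p hist s) : x.2 ∈ (B.ledger n p s).flatten := by
  obtain ⟨k, b, hb, hx, -⟩ := mem_stampedTxs.1 h
  exact List.mem_flatten.2 ⟨b, List.mem_of_getElem? hb, hx⟩

/-- At its registration time, a transaction is in the ledger. -/
theorem stamp_mem (h : ¬ B.PersistenceFails n hist) {p : Fin B.N} {i : ℕ} {s : Data}
    (hs : hist[i]? = some s) {x : ℕ × Data} (hx : x ∈ B.stampedTxs n p hist s) :
    ∃ s', hist[x.1]? = some s' ∧ x.2 ∈ (B.ledger n p s').flatten := by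
  obtain ⟨k, b, hb, hxb, ht⟩ := mem_stampedTxs.1 hx
  obtain ⟨hi, rfl⟩ := List.getElem?_eq_some_iff.1 hs
  have hk : k < (B.ledger n p hist[i]).length := (List.getElem?_eq_some_iff.1 hb).1
  have hle : x.1 ≤ i := by
    rw [ht]
    by_contra hlt
    have := List.not_of_lt_findIdx (not_le.1 hlt)
    simp [hk] at this
  have hlt : x.1 < hist.length := by omega
  have hpred : k < (B.ledger n p hist[x.1]).length := by
    have := List.findIdx_getElem (xs := hist)
      (p := fun s' => decide (k < (B.ledger n p s').length)) (w := ht ▸ hlt)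
    simp only [decide_eq_true_eq] at this
    simpa only [ht] using this
  refine ⟨hist[x.1], List.getElem?_eq_getElem hlt, List.mem_flatten.2 ⟨b, ?_, hxb⟩⟩
  -- The ledger at the registration time and the ledger in round `i` are prefixes of one chain, by
  -- persistence. They reach the position `k` both, so the block there is the same.
  have h1 := (persists h hle (List.getElem?_eq_getElem hlt) hs (p := p) (p' := p)).getElem hpred
  have h2 := (ledger_prefix_view (n := n) p hist[i]).getElem hk
  rw [← (List.getElem?_eq_some_iff.1 hb).2, h2, ← h1]
  exact List.getElem_mem hpred

/-- A stamp depends on the position and the fixed history, and not on the ledger in which the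
position is considered. A longer ledger thus has the same stamps at the old positions. -/
theorem stampedTxs_prefix {p : Fin B.N} {s s' : Data} (h : B.ledger n p s <+: B.ledger n p s') :
    ∃ l, B.stampedTxs n p hist s' = B.stampedTxs n p hist s ++ l ∧
      ∀ tx ∈ (B.ledger n p s').flatten, tx ∉ (B.ledger n p s).flatten → ∃ t, (t, tx) ∈ l := by
  obtain ⟨m, hm⟩ := h
  have key : B.stampedTxs n p hist s' = B.stampedTxs n p hist s ++
      (m.zipIdx (B.ledger n p s).length).flatMap fun x => x.1.map fun tx =>
        (hist.findIdx fun s' => decide (x.2 < (B.ledger n p s').length), tx) := by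
    rw [stampedTxs, ← hm, List.zipIdx_append, List.flatMap_append, Nat.zero_add]
    rfl
  refine ⟨_, key, fun tx h1 h2 => ?_⟩
  obtain ⟨b, hb, htx⟩ := List.mem_flatten.1 h1
  obtain ⟨k, hk⟩ := List.getElem?_of_mem hb
  have h3 := (mem_stampedTxs (hist := hist) (x := (_, tx))).2 ⟨k, b, hk, htx, rfl⟩
  rw [key, List.mem_append] at h3
  exact ⟨_, h3.resolve_left fun h => h2 (mem_ledger_of_stampedTxs h)⟩

/-- Persistence compares an earlier ledger with later chains and does not exclude that a ledger
shrinks. Both ledgers are prefixes of the later chain, hence comparable, and a transaction that is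
only in the later one decides which is longer. -/
theorem ledger_comparable (h : ¬ B.PersistenceFails n hist) {r r' : ℕ} {s s' : Data} {p : Fin B.N}
    (hr : r ≤ r') (hs : hist[r]? = some s) (hs' : hist[r']? = some s') {tx : Data}
    (h1 : tx ∈ (B.ledger n p s').flatten) (h2 : tx ∉ (B.ledger n p s).flatten) :
    B.ledger n p s <+: B.ledger n p s' := by
  refine (List.prefix_or_prefix_of_prefix (persists h hr hs hs') (ledger_prefix_view p s')).resolve_right
    fun h' => h2 ?_
  obtain ⟨b, hb, hx⟩ := List.mem_flatten.1 h1
  exact List.mem_flatten.2 ⟨b, h'.subset hb, hx⟩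

end Blockchain

namespace Call

theorem ofData_publish (pk : Data) (g : Fin z → Data) :
    ofData z (publish pk g).toData = some (publish pk g) := by
  have h : (publish pk g).toData = .cons (code 1) (.cons pk (code g)) := rfl
  rw [h]
  simp only [ofData, fst_cons, snd_cons, toNat_code]
  congr 2
  funext i
  exact nth_code g i

theorem ofData_pay (j : Fin z) : ofData z (pay j).toData = some (pay j) := by
  have h : (pay j : Call z).toData = .cons (code 3) (code (j : ℕ)) := rfl
  rw [h]
  simp [ofData, fst_cons, snd_cons, toNat_code]

end Call

namespace DTLP

variable {E : SKE} {G : Sig} {T : GMTLP z} {cedg : Data → ℕ → ℕ → Data → ℕ} {c : Contract z}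

theorem exec_cases (D : DTLP z) (st : SCState z) (x : ℕ × Data) : D.exec G c st x = st ∨
    ∃ f, IsCall G c x.2 x.2.fst f ∧ D.exec G c st x = D.call c x.1 x.2.fst st f := by
  unfold exec
  split_ifs with h
  · rcases hf : Call.ofData z x.2.snd.fst.snd.snd with _ | f
    · exact Or.inl rfl
    · exact Or.inr ⟨f, ⟨rfl, h.1, h.2, hf⟩, rfl⟩
  · exact Or.inl rfl

theorem exec_call (D : DTLP z) (st : SCState z) {x : ℕ × Data} {vk : Data} {f : Call z}
    (h : IsCall G c x.2 vk f) : D.exec G c st x = D.call c x.1 vk st f := by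
  obtain ⟨rfl, h1, h2, h3⟩ := h
  rw [exec, if_pos ⟨h1, h2⟩, h3]

/-- What is settled once and for all. -/
structure Extends (st st' : SCState z) : Prop where
  deployed : st.deployed = true → st'.deployed = true
  published : ∀ v, st.published = some v → st'.published = some v
  reg : ∀ j v, st.reg j = some v → st'.reg j = some v

theorem Extends.refl (st : SCState z) : Extends st st := ⟨id, fun _ => id, fun _ _ => id⟩

theorem Extends.trans {st st' st'' : SCState z} (h : Extends st st') (h' : Extends st' st'') :
    Extends st st'' :=
  ⟨h'.deployed ∘ h.deployed, fun v => h'.published v ∘ h.published v,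
    fun j v => h'.reg j v ∘ h.reg j v⟩

theorem pay_fields (v : Bool) (j : Fin z) (st : SCState z) :
    ((edTLP E T cedg).pay v c j st).deployed = st.deployed ∧
    ((edTLP E T cedg).pay v c j st).published = st.published ∧
    ((edTLP E T cedg).pay v c j st).reg = st.reg := by
  simp only [edTLP]
  split_ifs <;> exact ⟨rfl, rfl, rfl⟩

theorem pay_paid (v : Bool) (j : Fin z) (st : SCState z) (i : Fin z) :
    ((edTLP E T cedg).pay v c j st).paid i = st.paid i ∨
      i = j ∧ ((edTLP E T cedg).pay v c j st).paid i = some v := by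
  by_cases h : i = j
  · subst h
    cases v <;> simp only [edTLP] <;> split_ifs <;> first | contradiction | simp
  · left
    cases v <;> simp only [edTLP] <;> split_ifs <;> simp [h]

/-- A negative result has no effect once the bit is set, so consistency with the previous value is
needed; it holds because the registered solution does not change. -/
theorem pay_paid_self (v : Bool) (j : Fin z) (st : SCState z)
    (h : ∀ u, st.paid j = some u → u = v) : ((edTLP E T cedg).pay v c j st).paid j = some v := by
  cases v <;> simp only [edTLP]
  · rcases hp : st.paid j with _ | u
    · simp
    · rw [h u hp] at hp; simp [hp]
  · simp only [if_true]
    split_ifs with hp <;> simp [hp]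

theorem call_pay (t : ℕ) (vk : Data) (st : SCState z) (j : Fin z) :
    (edTLP E T cedg).call c t vk st (.pay j) = st ∨
    ∃ pk g m π t' r, st.published = some (pk, g) ∧ st.reg j = some (m, π, t') ∧
      (edTLP E T cedg).call c t vk st (.pay j) =
        (edTLP E T cedg).pay ((edTLP E T cedg).verify pk j m π (g j) c.Ψ t' c.t₀ c.Δ c.Υ) c j
          ⟨st.deployed, st.published, st.reg, r, st.paid, st.transfers⟩ := by
  simp only [call]
  split_ifs
  · rcases hp : st.published with _ | ⟨pk, g⟩
    · exact Or.inl rfl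
    rcases hr : st.reg j with _ | ⟨m, π, t'⟩
    · exact Or.inl rfl
    exact Or.inr ⟨pk, g, m, π, t', _, rfl, rfl, rfl⟩
  · exact Or.inl rfl

/-- The effects of a call. -/
theorem call_extends (t : ℕ) (vk : Data) (st : SCState z) (f : Call z) :
    Extends st ((edTLP E T cedg).call c t vk st f) := by
  cases f with
  | deploy a => simp only [call]; split_ifs <;> exact ⟨by simp, by simp, by simp⟩
  | publish pk g =>
    simp only [call]
    split_ifs with h
    · refine ⟨id, fun v hv => ?_, fun _ _ => id⟩
      simp [hv] at h
    · exact .refl _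
  | register j m π =>
    simp only [call]
    split_ifs with h
    · refine ⟨id, fun _ => id, fun i v hv => ?_⟩
      by_cases hij : i = j
      · subst hij; simp [hv] at h
      · simpa [hij] using hv
    · exact .refl _
  | pay j =>
    rcases call_pay (E := E) (T := T) (cedg := cedg) (c := c) t vk st j with
      h | ⟨_, _, _, _, _, _, -, -, h⟩ <;> rw [h]
    · exact .refl _
    · obtain ⟨h1, h2, h3⟩ := pay_fields (E := E) (T := T) (cedg := cedg) (c := c) _ j _
      exact ⟨h1.trans, fun v => h2.trans, fun i v h => (congrFun h3 i).trans h⟩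

theorem exec_extends (st : SCState z) (x : ℕ × Data) :
    Extends st ((edTLP E T cedg).exec G c st x) := by
  rcases (edTLP E T cedg).exec_cases (G := G) (c := c) st x with h | ⟨f, -, h⟩ <;> rw [h]
  · exact .refl _
  · exact call_extends _ _ _ _

theorem foldl_extends (st : SCState z) (l : List (ℕ × Data)) :
    Extends st (l.foldl ((edTLP E T cedg).exec G c) st) := by
  induction l generalizing st with
  | nil => exact .refl _
  | cons x l ih => exact (exec_extends st x).trans (ih _)

theorem call_published (t : ℕ) (vk : Data) (st : SCState z) (f : Call z) :
    ((edTLP E T cedg).call c t vk st f).published = st.published ∨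
      vk = c.acct .HC ∧ ∃ pk g, f = .publish pk g ∧
        ((edTLP E T cedg).call c t vk st f).published = some (pk, g) := by
  cases f with
  | deploy a => simp only [call]; split_ifs <;> simp
  | publish pk g =>
    simp only [call]
    split_ifs with h
    · exact Or.inr ⟨h.1, pk, g, rfl, rfl⟩
    · exact Or.inl rfl
  | register j m π => simp only [call]; split_ifs <;> simp
  | pay j =>
    rcases call_pay (E := E) (T := T) (cedg := cedg) (c := c) t vk st j with
      h | ⟨_, _, _, _, _, _, -, -, h⟩ <;> rw [h]
    · exact Or.inl rfl
    · exact Or.inl (pay_fields _ _ _).2.1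

theorem call_reg (t : ℕ) (vk : Data) (st : SCState z) (f : Call z) (j : Fin z) :
    ((edTLP E T cedg).call c t vk st f).reg j = st.reg j ∨
      vk = c.acct .HS ∧ ∃ m π, f = .register j m π ∧
        ((edTLP E T cedg).call c t vk st f).reg j = some (m, π, t) := by
  cases f with
  | deploy a => simp only [call]; split_ifs <;> simp
  | publish pk g => simp only [call]; split_ifs <;> simp
  | register i m π =>
    simp only [call]
    split_ifs with h
    · by_cases hij : j = i
      · subst hij
        exact Or.inr ⟨h.1, m, π, rfl, by simp⟩
      · exact Or.inl (by simp [hij])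
    · exact Or.inl rfl
  | pay i =>
    rcases call_pay (E := E) (T := T) (cedg := cedg) (c := c) t vk st i with
      h | ⟨_, _, _, _, _, _, -, -, h⟩ <;> rw [h]
    · exact Or.inl rfl
    · exact Or.inl (congrFun (pay_fields _ _ _).2.2 j)

theorem call_paid (t : ℕ) (vk : Data) (st : SCState z) (f : Call z) (j : Fin z) :
    ((edTLP E T cedg).call c t vk st f).paid j = st.paid j ∨
      ∃ pk g m π t', st.published = some (pk, g) ∧ st.reg j = some (m, π, t') ∧
        ((edTLP E T cedg).call c t vk st f).paid j =
          some ((edTLP E T cedg).verify pk j m π (g j) c.Ψ t' c.t₀ c.Δ c.Υ) := by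
  cases f with
  | deploy a => simp only [call]; split_ifs <;> simp
  | publish pk g => simp only [call]; split_ifs <;> simp
  | register i m π => simp only [call]; split_ifs <;> simp
  | pay i =>
    rcases call_pay (E := E) (T := T) (cedg := cedg) (c := c) t vk st i with
      h | ⟨pk, g, m, π, t', r, hp, hr, h⟩ <;> rw [h]
    · exact Or.inl rfl
    · rcases pay_paid (E := E) (T := T) (cedg := cedg) (c := c) _ i
        ⟨st.deployed, st.published, st.reg, r, st.paid, st.transfers⟩ j with h | ⟨rfl, h⟩
      · exact Or.inl h
      · exact Or.inr ⟨pk, g, m, π, t', hp, hr, h⟩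

/-- Registered solutions come from registrations. -/
theorem foldl_reg {l : List (ℕ × Data)} {j : Fin z} {m : Bits} {π : Data} {t : ℕ}
    (h : (l.foldl ((edTLP E T cedg).exec G c) (SCState.empty z)).reg j = some (m, π, t)) :
    ∃ tx, (t, tx) ∈ l ∧ IsCall G c tx (c.acct .HS) (.register j m π) := by
  induction l using List.reverseRecOn with
  | nil => simp [SCState.empty] at h
  | append_singleton l x ih =>
    rw [List.foldl_append, List.foldl_cons, List.foldl_nil] at h
    have ih' := fun h => (ih h).imp fun tx htx => And.intro (List.mem_append_left [x] htx.1) htx.2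
    rcases (edTLP E T cedg).exec_cases (G := G) (c := c) _ x with e | ⟨f, hf, e⟩ <;> rw [e] at h
    · exact ih' h
    · rcases call_reg (E := E) (T := T) (cedg := cedg) (c := c) x.1 x.2.fst
        (l.foldl ((edTLP E T cedg).exec G c) (SCState.empty z)) f j with e' | ⟨hv, m', π', rfl, e'⟩ <;> rw [e'] at h
      · exact ih' h
      · simp only [Option.some.injEq, Prod.mk.injEq] at h
        obtain ⟨rfl, rfl, rfl⟩ := h
        exact ⟨x.2, by simp, hv ▸ hf⟩

/-- If only `(pk, g)` is published, then the payments agree with the verification. -/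
theorem foldl_paid {l : List (ℕ × Data)} {pk : Data} {g : Fin z → Data}
    (hl : ∀ x ∈ l, ∀ pk' g', IsCall G c x.2 (c.acct .HC) (.publish pk' g') → pk' = pk ∧ g' = g) :
    (∀ v, (l.foldl ((edTLP E T cedg).exec G c) (SCState.empty z)).published = some v → v = (pk, g)) ∧
    ∀ j u, (l.foldl ((edTLP E T cedg).exec G c) (SCState.empty z)).paid j = some u →
      ∃ m π t, (l.foldl ((edTLP E T cedg).exec G c) (SCState.empty z)).reg j = some (m, π, t) ∧
        (edTLP E T cedg).verify pk j m π (g j) c.Ψ t c.t₀ c.Δ c.Υ = u := by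
  induction l using List.reverseRecOn with
  | nil => simp [SCState.empty]
  | append_singleton l x ih =>
    obtain ⟨ih₁, ih₂⟩ := ih fun y hy => hl y (by simp [hy])
    rw [List.foldl_append, List.foldl_cons, List.foldl_nil]
    have hext := exec_extends (E := E) (T := T) (cedg := cedg) (G := G) (c := c)
      (l.foldl ((edTLP E T cedg).exec G c) (SCState.empty z)) x
    rcases (edTLP E T cedg).exec_cases (G := G) (c := c) (l.foldl ((edTLP E T cedg).exec G c)
      (SCState.empty z)) x with e | ⟨f, hf, e⟩
    · rw [e]; exact ⟨ih₁, ih₂⟩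
    · rw [e] at hext ⊢
      constructor
      · intro v hv
        rcases call_published (E := E) (T := T) (cedg := cedg) (c := c) x.1 x.2.fst
            (l.foldl ((edTLP E T cedg).exec G c) (SCState.empty z)) f with e' | ⟨hvk, pk', g', rfl, e'⟩ <;> rw [e'] at hv
        · exact ih₁ v hv
        · obtain ⟨rfl, rfl⟩ := hl x (by simp) pk' g' (hvk ▸ hf)
          exact (Option.some_inj.1 hv).symm
      -- A set bit is the result of a verification at the time of some payment. The registration
      -- used there is final, so it is still the registered solution now.
      · intro j u hu
        rcases call_paid (E := E) (T := T) (cedg := cedg) (c := c) x.1 x.2.fst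
            (l.foldl ((edTLP E T cedg).exec G c) (SCState.empty z)) f j with e' | ⟨pk', g', m, π, t', h1, h2, e'⟩ <;> rw [e'] at hu
        · obtain ⟨m, π, t, h1, h2⟩ := ih₂ j u hu
          exact ⟨m, π, t, hext.reg j _ h1, h2⟩
        · have h3 := ih₁ _ h1
          simp only [Prod.mk.injEq] at h3
          obtain ⟨rfl, rfl⟩ := h3
          exact ⟨m, π, t', hext.reg j _ h2, Option.some_inj.1 hu⟩

/-- A call for payment is effective. -/
theorem foldl_pay {l l' : List (ℕ × Data)} {pk : Data} {g : Fin z → Data}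
    (hl : ∀ x ∈ l ++ l', ∀ pk' g', IsCall G c x.2 (c.acct .HC) (.publish pk' g') → pk' = pk ∧ g' = g)
    {j : Fin z} {m : Bits} {π : Data} {t : ℕ}
    (hdep : (l.foldl ((edTLP E T cedg).exec G c) (SCState.empty z)).deployed = true)
    (hpub : (l.foldl ((edTLP E T cedg).exec G c) (SCState.empty z)).published.isSome = true)
    (hreg : (l.foldl ((edTLP E T cedg).exec G c) (SCState.empty z)).reg j = some (m, π, t))
    {x : ℕ × Data} (hx : x ∈ l') {vk : Data} (hcall : IsCall G c x.2 vk (.pay j))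
    (hvk : vk = c.acct .C ∨ vk = c.acct .S) :
    ((l ++ l').foldl ((edTLP E T cedg).exec G c) (SCState.empty z)).paid j =
      some ((edTLP E T cedg).verify pk j m π (g j) c.Ψ t c.t₀ c.Δ c.Υ) := by
  -- The solution is registered after `l` and remains the same, so any value of the bit after a
  -- longer prefix is the result of verifying this very solution.
  have settled : ∀ l₁ l₂ : List (ℕ × Data), l ++ l' = l ++ l₁ ++ l₂ → ∀ u,
      ((l ++ l₁).foldl ((edTLP E T cedg).exec G c) (SCState.empty z)).paid j = some u →
      u = (edTLP E T cedg).verify pk j m π (g j) c.Ψ t c.t₀ c.Δ c.Υ := by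
    intro l₁ l₂ e u hu
    obtain ⟨m', π', t', h1, h2⟩ := (foldl_paid fun y hy => hl y (by rw [e]; simp at hy ⊢; tauto)).2 j u hu
    have h3 := (foldl_extends (E := E) (T := T) (cedg := cedg) (G := G) (c := c)
      (l.foldl ((edTLP E T cedg).exec G c) (SCState.empty z)) l₁).reg j _ hreg
    rw [← List.foldl_append, h1] at h3
    simp only [Option.some.injEq, Prod.mk.injEq] at h3
    obtain ⟨rfl, rfl, rfl⟩ := h3
    exact h2.symm
  suffices h : ∃ u, ((l ++ l').foldl ((edTLP E T cedg).exec G c) (SCState.empty z)).paid j = some u by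
    obtain ⟨u, hu⟩ := h
    rw [hu, settled l' [] (by simp) u hu]
  obtain ⟨l₁, l₂, rfl⟩ := List.append_of_mem hx
  set st := (l ++ l₁).foldl ((edTLP E T cedg).exec G c) (SCState.empty z) with hst
  have hext : Extends (l.foldl ((edTLP E T cedg).exec G c) (SCState.empty z)) st := by
    rw [hst, List.foldl_append]; exact foldl_extends _ _
  obtain ⟨⟨pk', g'⟩, hpub⟩ := Option.isSome_iff_exists.1 hpub
  have h₀ : ∃ u, ((edTLP E T cedg).exec G c st x).paid j = some u := by
    rw [exec_call _ _ hcall]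
    simp only [call]
    rw [if_pos ⟨hvk, hext.deployed hdep⟩, hext.published _ hpub, hext.reg _ _ hreg]
    have hpk : (pk', g') = (pk, g) := (foldl_paid fun y hy => hl y (by simp [hy])).1 _ hpub
    simp only [Prod.mk.injEq] at hpk
    obtain ⟨rfl, rfl⟩ := hpk
    exact ⟨_, pay_paid_self _ _ _ fun u hu => settled l₁ (x :: l₂) (by simp) u hu⟩
  -- Once set, the bit may change its value but is never unset. Its value is determined by
  -- `settled`.
  have : ∀ (l₂ : List (ℕ × Data)) (st' : SCState z), (∃ u, st'.paid j = some u) →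
      ∃ u, (l₂.foldl ((edTLP E T cedg).exec G c) st').paid j = some u := by
    intro l₂
    induction l₂ with
    | nil => exact fun _ h => h
    | cons y l₂ ih =>
      rintro st' ⟨u, hu⟩
      refine ih _ ?_
      rcases (edTLP E T cedg).exec_cases (G := G) (c := c) st' y with e | ⟨f, -, e⟩ <;> rw [e]
      · exact ⟨u, hu⟩
      · rcases call_paid (E := E) (T := T) (cedg := cedg) (c := c) y.1 y.2.fst st' f j with e' | ⟨_, _, _, _, _, -, -, e'⟩ <;> rw [e']
        · exact ⟨u, hu⟩
        · exact ⟨_, rfl⟩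
  rw [show l ++ (l₁ ++ x :: l₂) = (l ++ l₁) ++ (x :: l₂) by simp, List.foldl_append, List.foldl_cons]
  exact this l₂ _ h₀

end DTLP

end

section

/-! ## Solution validity -/

variable {z : ℕ}

/-- An event of negligible probability. -/
def Unlikely {α : Type} (p : ℕ → PMF α) (s : ℕ → Set α) : Prop :=
  ∃ μ : ℕ → ℝ, Negligible μ ∧ ∀ n, ((p n).toOuterMeasure (s n)).toReal ≤ μ n

theorem Unlikely.mono {α : Type} {p : ℕ → PMF α} {s t : ℕ → Set α} (h : Unlikely p t)
    (hst : ∀ n, ∀ x ∈ (p n).support, x ∈ s n → x ∈ t n) : Unlikely p s := by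
  obtain ⟨μ, hμ, h⟩ := h
  refine ⟨μ, hμ, fun n => (ENNReal.toReal_mono (PMF.toOuterMeasure_ne_top _ _) ?_).trans (h n)⟩
  exact (p n).toOuterMeasure_mono fun x hx => hst n x hx.2 hx.1

theorem Unlikely.union {α : Type} {p : ℕ → PMF α} {s t : ℕ → Set α} (hs : Unlikely p s)
    (ht : Unlikely p t) : Unlikely p fun n => s n ∪ t n := by
  obtain ⟨μ, hμ, hs⟩ := hs
  obtain ⟨ν, hν, ht⟩ := ht
  refine ⟨_, Asymptotics.SuperpolynomialDecay.add hμ hν, fun n => ?_⟩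
  refine le_trans ?_ (add_le_add (hs n) (ht n))
  rw [← ENNReal.toReal_add (PMF.toOuterMeasure_ne_top _ _) (PMF.toOuterMeasure_ne_top _ _)]
  exact ENNReal.toReal_mono (ENNReal.add_ne_top.2 ⟨PMF.toOuterMeasure_ne_top _ _,
    PMF.toOuterMeasure_ne_top _ _⟩) (MeasureTheory.measure_union_le _ _)

theorem Unlikely.of_map {α β : Type} {p : ℕ → PMF α} {f : α → β} {s : ℕ → Set β}
    (h : Unlikely (fun n => (p n).map f) s) : Unlikely p fun n => f ⁻¹' s n := by
  simpa only [Unlikely, PMF.toOuterMeasure_map_apply] using h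

theorem Experiment.cannotWin_of_unlikely {α : Type} {X : Experiment} {p : ℕ → PMF α}
    {s : ℕ → Set α} (e : ∀ n, (X n).map Outcome.win = (p n).map fun x => x ∈ s n)
    (h : Unlikely p s) : X.CannotWin := by
  obtain ⟨μ, hμ, h⟩ := h
  refine ⟨μ, hμ, fun n => ?_⟩
  rw [Experiment.winProb_eq, e, PMF.toOuterMeasure_map_apply]
  exact h n

namespace Setting

variable (U : Setting z) {P : ℕ → DTLP.Params z}

/-- A reported registration time is the stamp of an actual registration, and at its stamp a
transaction is in an honest ledger (`stamp_mem`). The true delivery is therefore not later than the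
reported time, which is within the deadline. -/
theorem not_backdated {n : ℕ} {c : Contract z} {hist : List Data}
    (hp : ¬ U.B.PersistenceFails n hist) (hc : ¬ U.D.ContractFails U.G U.B n hist) :
    ¬ U.Backdated n c hist := by
  rintro ⟨j, m, π, hno, i, s, q, t, hs, hreg, ht⟩
  have hrep : U.B.report q s c = U.D.scState U.G U.B n q hist s c :=
    by_contra fun h => hc ⟨i, s, q, c, hs, h⟩
  rw [hrep, DTLP.scState] at hreg
  obtain ⟨tx, htx, hcall⟩ := DTLP.foldl_reg hreg
  obtain ⟨s', hs', hmem⟩ := Blockchain.stamp_mem hp hs htx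
  have hdel : DTLP.DeliveredAt U.G U.B n c hist j m π t := ⟨s', q, hs', tx, hmem, hcall⟩
  classical
  refine hno ⟨Nat.find ⟨t, hdel⟩, ⟨Nat.find_spec ⟨t, hdel⟩, fun r hr => Nat.find_min' _ hr⟩, ?_⟩
  exact (Nat.find_min' _ hdel).trans ht

theorem validExp_win (A : DTLP.ChainAdversary) (n : ℕ) :
    (U.D.validityExp U.G U.B U.τ.S P A n).map Outcome.win = (U.validRun P A n).map fun x =>
      U.ValidWins P n x.2.keys x.1 x.2.st x.2.w.hist := by
  rw [validExp_eq, validRun]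
  simp only [validStart, PMF.map_bind, PMF.map_comp, PMF.bind_bind, PMF.bind_map, Function.comp_def]
  refine congrArg _ (funext fun keys => congrArg _ (funext fun k => ?_))
  rw [← Prog.run_bind]
  refine congrArg _ (funext fun o => congrArg _ (funext fun hk => congrArg _ (funext fun p =>
    congrArg _ (funext fun s => PMF.map_congr fun x hx => ?_))))
  rw [(U.mem_iterK_const P hx).2.1]
  rfl

/-- Cheating refers to the encoded messages, which the game does not record, whereas failures of the
blockchain concern the history only. The bounds for the latter carry over from the game to
`validRun` through this marginal. -/
theorem validRun_snd (hP : DTLP.EfficientParams P) (A : DTLP.ChainAdversary) (q : Polynomial ℕ)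
    (hA : ∀ n, ∀ o ∈ (U.D.validityExp U.G U.B U.τ.S P A n).support,
      o.cost₁.work + o.cost₂.work ≤ q.eval n) (n : ℕ) :
    (U.validRun P A n).map Prod.snd = (U.validGame hP A q hA).final n := by
  simp only [validRun, ChainGame.final, validGame, ChainGame.T, PMF.map_bind, PMF.map_comp,
    PMF.bind_map, Function.comp_def]
  refine congrArg _ (funext fun keys => congrArg _ (funext fun y => congrArg _ (funext fun s => ?_)))
  exact PMF.map_id _

/-- Solution validity. -/
theorem valid (hV : U.T.Valid U.τ) (hPersistent : U.B.Persistent)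
    (hSC : U.D.ContractCorrect U.G U.B) : U.D.Valid U.G U.B U.τ := by
  rintro P hP A ⟨q, hA⟩
  refine Experiment.cannotWin_of_unlikely (p := U.validRun P A)
    (s := fun n => {x | U.ValidWins P n x.2.keys x.1 x.2.st x.2.w.hist}) (U.validExp_win A) ?_
  have h₁ : Unlikely (U.validRun P A) fun n =>
      {x | U.Cheats x.1.1 x.1.2.1 x.1.2.2.1 x.2.st} := U.cheat_secure hP hV hA
  have key : ∀ {bad : ℕ → List Data → Prop},
      (∀ A : Interactive, (U.B.traceExp bad A).IsPPT → (U.B.traceExp bad A).CannotWin) →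
      Unlikely (U.validRun P A) fun n => {x | bad n x.2.w.hist} := by
    intro bad hbad
    have h : Unlikely (U.validGame hP A q hA).final fun n => {x | bad n x.w.hist} :=
      (U.validGame hP A q hA).trace_secure hP hbad
    refine Unlikely.of_map (f := Prod.snd)
      (s := fun n => {x : ChainState z | bad n x.w.hist}) ?_
    simpa only [U.validRun_snd hP A q hA] using h
  refine (h₁.union ((key hPersistent).union (key hSC))).mono fun n x _ hx => ?_
  rcases hx.cases with h | h
  · exact Or.inl h
  · by_contra hno
    simp only [Set.mem_union, Set.mem_ofPred_eq, not_or] at hno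
    exact U.not_backdated hno.2.1 hno.2.2 h

end Setting

end

section

/-! ## The game for fair payment -/

variable {z : ℕ}

namespace Setting

variable (U : Setting z) {P : ℕ → DTLP.Params z}

variable (P) in
/-- The input of the second stage of an adversary against fair payment. -/
def payInput (n : ℕ) (keys : Keys) (o pk : Data) (p : (Fin z → Data) × (Fin z → Data)) : Data :=
  code (Unary.mk n, code (P n).Δ, toMsgs z o.fst, o.snd, (P n).t₀, (P n).toc, (P n).aux, U.Ψ n (P n),
    (P n).Δ, (P n).coins, (U.contract n (P n) keys).adr, keys .HS, pk, p)

theorem payInput_hide {i₀ : Option Party} (h : i₀ ≠ some .HS) (n : ℕ) (keys : Keys) (o pk : Data)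
    (p : (Fin z → Data) × (Fin z → Data)) :
    U.payInput P n (hideKey i₀ keys) o pk p = U.payInput P n keys o pk p := by
  rw [payInput, payInput, U.contract_hideKey, hideKey_party h]

theorem payInput_poly (hP : DTLP.EfficientParams P) {γ : Type} [Coded γ]
    {D : Dom γ} {n : γ → Unary} {keys : γ → Keys} {o pk : γ → Data}
    {p : γ → (Fin z → Data) × (Fin z → Data)} (hn : PolyFun D n) (hkeys : PolyFun D keys)
    (ho : PolyFun D o) (hpk : PolyFun D pk) (hp : PolyFun D p) :
    PolyFun D fun g => U.payInput P (n g).val (keys g) (o g) (pk g) (p g) := by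
  have h := params_poly hP hn
  have hΔ := Δ_poly hP hn
  exact (hn.pair (hΔ.coded.pair ((PolyFun.toMsgs (z := z) ho.dfst).pair (ho.dsnd.pair
    (h.snd.snd.snd.fst.pair (h.fst.pair (h.snd.snd.fst.pair ((U.Ψ_poly hP hn).pair (hΔ.pair
    (h.snd.snd.snd.snd.fst.pair ((U.adr_poly hP hn hkeys).pair ((hkeys.party .HS).pair
    (hpk.pair hp))))))))))))).coded

variable (P) in
/-- The input of the first stage. -/
def payFirstInput (n : ℕ) : Data := code (Unary.mk n, code (P n).Δ, Unary.mk z)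

variable (P) in
/-- The start of the game: public key, statements, and the input of the second stage. -/
def payStart (p : Prog) (x : Unary × Keys) : PMF (Data × (Fin z → Data) × Data) :=
  (U.E.keyGen x.1.val).bind fun k => (p.out (payFirstInput P x.1.val)).bind fun o =>
    (drawVec z fun i => U.E.enc k (toMsgs z o.fst i)).bind fun e =>
    (U.T.setup x.1.val (P x.1.val).Δ (U.τ.S x.1.val)).bind fun hk =>
    (U.T.gen e hk.1 hk.2).map fun q => (hk.1, q.2, U.payInput P x.1.val x.2 o hk.1 q)

theorem payStart_poly (hP : DTLP.EfficientParams P) (p : Prog)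
    (hp : ∃ q : Polynomial ℕ, ∀ n, p.WorkLe (payFirstInput P n) (q.eval n))
    {D : Dom (Unary × Keys)} (hD : ∀ n x, D.mem n x → x.1.val = n) : PolyOn D (U.payStart P p) := by
  have hn : PolyFun D fun x => x.1 := PolyFun.id.fst
  have hk : PolyOn D fun x => U.E.keyGen x.1.val :=
    PolyFun.polyTime_comp (g := fun n : Unary => U.E.keyGen n.val) U.hE.1 hn
  refine PolyOn.bind₂ hk ?_
  have hn' := hn.up (hg := hk)
  have hin : PolyFun (Dom.ext _ hk) fun x => payFirstInput P x.1.1.val :=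
    (hn'.pair ((Δ_poly hP hn').coded.pair (PolyFun.const (Unary.mk z)))).coded
  have hout : PolyOn (Dom.ext _ hk) fun x => p.out (payFirstInput P x.1.1.val) := by
    obtain ⟨q, hq⟩ := hp
    refine PolyFun.bind (E := Dom.map _ hin) hin (PolyOn.of_workLe p q ?_) fun n a ha => ⟨a, ha, rfl⟩
    rintro n _ ⟨x, ⟨hx, -⟩, rfl⟩
    have := hq n
    rw [← hD n _ hx] at this ⊢
    exact this
  refine PolyOn.bind₂ hout ?_
  have ho₀ : PolyFun (Dom.ext _ hout) fun x => x.2 := PolyFun.id.snd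
  have henc : PolyOn (Dom.ext _ hout) fun x => drawVec z fun i => U.E.enc x.1.2 (toMsgs z x.2.fst i) :=
    PolyOn.drawVec fun i => PolyFun.polyTime_comp (g := fun y : Bits × Bits => U.E.enc y.1 y.2) U.hE.2.1
      ((PolyFun.id.fst.snd : PolyFun (Dom.ext _ hout) fun x => x.1.2).pair
        ((PolyFun.toMsgs (z := z) ho₀.dfst).app i))
  refine PolyOn.bind₂ henc ?_
  have hn3 := (hn'.up (hg := hout)).up (hg := henc)
  have hset := U.setup_poly hP hn3
  refine PolyOn.bind₂ hset ?_
  have hhk : PolyFun (Dom.ext _ hset) fun x => x.2 := PolyFun.id.snd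
  have hgen := U.gen_poly (PolyFun.id.fst.snd : PolyFun (Dom.ext _ hset) fun x => x.1.2) hhk.fst hhk.snd
  refine PolyOn.map hgen ?_
  have ho : PolyFun (Dom.ext _ hset) fun x => x.1.1.2 := PolyFun.id.fst.fst.snd
  exact hhk.fst.up.pair (PolyFun.id.snd.snd.pair (U.payInput_poly hP (hn3.up (hg := hset)).up
    PolyFun.id.fst.fst.fst.fst.fst.snd ho.up hhk.fst.up PolyFun.id.snd))

theorem payStart_hide {i₀ : Option Party} (h : i₀ ≠ some .HS) (p : Prog) (n : Unary) (keys : Keys) :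
    U.payStart P p (n, hideKey i₀ keys) = U.payStart P p (n, keys) := by
  simp only [payStart, U.payInput_hide h]

variable (P) in
/-- Payment of the `j`-th solution is not fair. -/
def Unfair (n : ℕ) (j : Fin z) (keys : Keys) (pk : Data) (g : Fin z → Data) (w : DTLP.CallWorld z) :
    Prop :=
  DTLP.PaymentFails U.B n (U.contract n (P n) keys) w j fun m π t =>
    U.D.verify pk j m π (g j) (U.contract n (P n) keys).Ψ t (U.contract n (P n) keys).t₀
      (U.contract n (P n) keys).Δ (U.contract n (P n) keys).Υ

theorem paymentExp_eq (j : Fin z) (A : DTLP.ChainAdversary) (n : ℕ) :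
    U.D.paymentExp U.G U.B U.τ.S P j A n =
    (DTLP.accounts U.G n).bind fun keys => (U.E.keyGen n).bind fun k =>
      (A.first.run (payFirstInput P n)).bind fun o =>
      (drawVec z fun i => U.E.enc k (toMsgs z o.1.fst i)).bind fun e =>
      (U.T.setup n (P n).Δ (U.τ.S n)).bind fun hk => (U.T.gen e hk.1 hk.2).bind fun p =>
      (U.B.start n).bind fun s => (iterK (U.chainStep P A.second) ((A.second.acts + 2).eval n)
        (chainInit n keys (hk.1, p.2, U.payInput P n keys o.1 hk.1 p) s)).map fun x =>
        ⟨U.Unfair P n j keys hk.1 p.2 x.w, o.2, x.cost⟩ := by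
  simp only [DTLP.paymentExp, PMF.bind_eq, PMF.pure_eq]
  refine congrArg _ (funext fun keys => ?_)
  simp only [edTLP, PMF.bind_eq, PMF.pure_eq, PMF.bind_bind, PMF.pure_bind, toBits_code]
  refine congrArg _ (funext fun k => congrArg _ (funext fun o => congrArg _ (funext fun e =>
    congrArg _ (funext fun hk => congrArg _ (funext fun p => ?_)))))
  have h := U.runChain_eq P A.second n keys (hk.1, p.2, U.payInput P n keys o.1 hk.1 p)
  refine (congrArg (fun q : PMF (Data × DTLP.CallWorld z × Cost) => PMF.bind q fun r => PMF.pure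
    (Outcome.mk (U.Unfair P n j keys hk.1 p.2 r.2.1) o.2 r.2.2)) h).trans ?_
  simp only [PMF.bind_bind, PMF.map, PMF.pure_bind, Function.comp_def]

theorem pay_work {j : Fin z} {A : DTLP.ChainAdversary} {q : Polynomial ℕ}
    (hA : ∀ n, ∀ o ∈ (U.D.paymentExp U.G U.B U.τ.S P j A n).support,
      o.cost₁.work + o.cost₂.work ≤ q.eval n) (n : ℕ) :
    A.first.WorkLe (payFirstInput P n) (q.eval n) ∧
    ∀ keys ∈ (DTLP.accounts U.G n).support, ∀ y ∈ (U.payStart P A.first (⟨n⟩, keys)).support,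
      ∀ s ∈ (U.B.start n).support, ∀ x ∈ (iterK (U.chainStep P A.second)
        ((A.second.acts + 2).eval n) (chainInit n keys y s)).support, x.cost.work ≤ q.eval n := by
  have key : ∀ keys ∈ (DTLP.accounts U.G n).support, ∀ k ∈ (U.E.keyGen n).support,
      ∀ o ∈ (A.first.run (payFirstInput P n)).support,
      ∀ e ∈ (drawVec z fun i => U.E.enc k (toMsgs z o.1.fst i)).support,
      ∀ hk ∈ (U.T.setup n (P n).Δ (U.τ.S n)).support,
      ∀ p ∈ (U.T.gen e hk.1 hk.2).support, ∀ s ∈ (U.B.start n).support,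
      ∀ x ∈ (iterK (U.chainStep P A.second) ((A.second.acts + 2).eval n)
        (chainInit n keys (hk.1, p.2, U.payInput P n keys o.1 hk.1 p) s)).support,
      o.2.work + x.cost.work ≤ q.eval n := by
    intro keys hkeys k hk o ho e he hk' hhk p hp s hs x hx
    have hmem : ∃ w, (⟨w, o.2, x.cost⟩ : Outcome) ∈
        (U.D.paymentExp U.G U.B U.τ.S P j A n).support := by
      rw [paymentExp_eq]
      simp only [PMF.mem_support_bind, PMF.mem_support_map]
      exact ⟨_, keys, hkeys, k, hk, o, ho, e, he, hk', hhk, p, hp, s, hs, x, hx, rfl⟩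
    exact hA n _ hmem.choose_spec
  constructor
  · intro o ho
    obtain ⟨keys, hkeys⟩ := PMF.exists_mem_support (DTLP.accounts U.G n)
    obtain ⟨k, hk⟩ := PMF.exists_mem_support (U.E.keyGen n)
    obtain ⟨e, he⟩ := PMF.exists_mem_support (drawVec z fun i => U.E.enc k (toMsgs z o.1.fst i))
    obtain ⟨hk', hhk⟩ := PMF.exists_mem_support (U.T.setup n (P n).Δ (U.τ.S n))
    obtain ⟨p, hp⟩ := PMF.exists_mem_support (U.T.gen e hk'.1 hk'.2)
    obtain ⟨s, hs⟩ := PMF.exists_mem_support (U.B.start n)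
    obtain ⟨x, hx⟩ := PMF.exists_mem_support (iterK (U.chainStep P A.second)
      ((A.second.acts + 2).eval n)
      (chainInit n keys (hk'.1, p.2, U.payInput P n keys o.1 hk'.1 p) s))
    have := key keys hkeys k hk o ho e he hk' hhk p hp s hs x hx
    omega
  · intro keys hkeys y hy s hs x hx
    simp only [payStart, PMF.mem_support_bind, PMF.mem_support_map] at hy
    obtain ⟨k, hk, o, ho, e, he, hk', hhk, p, hp, rfl⟩ := hy
    obtain ⟨o, ho', rfl⟩ := Prog.mem_out_iff.1 ho
    have := key keys hkeys k hk o ho' e he hk' hhk p hp s hs x hx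
    omega

/-- The game for fair payment. -/
def payGame (hP : DTLP.EfficientParams P) {j : Fin z} (A : DTLP.ChainAdversary) (q : Polynomial ℕ)
    (hA : ∀ n, ∀ o ∈ (U.D.paymentExp U.G U.B U.τ.S P j A n).support,
      o.cost₁.work + o.cost₂.work ≤ q.eval n) : ChainGame U P where
  A := A.second
  start := U.payStart P A.first
  bound := q
  start_poly _ hD := U.payStart_poly hP A.first ⟨q, fun n => (U.pay_work hA n).1⟩ hD
  start_hide n keys _ h := U.payStart_hide h A.first n keys
  ppt n := (U.pay_work hA n).2

theorem paymentExp_win (hP : DTLP.EfficientParams P) {j : Fin z} (A : DTLP.ChainAdversary)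
    (q : Polynomial ℕ) (hA : ∀ n, ∀ o ∈ (U.D.paymentExp U.G U.B U.τ.S P j A n).support,
      o.cost₁.work + o.cost₂.work ≤ q.eval n) (n : ℕ) :
    (U.D.paymentExp U.G U.B U.τ.S P j A n).map Outcome.win =
      ((U.payGame hP A q hA).final n).map fun x => U.Unfair P n j x.keys x.pk x.g x.w := by
  rw [paymentExp_eq]
  simp only [ChainGame.final, payGame, ChainGame.T, payStart, PMF.map_bind, PMF.map_comp,
    PMF.bind_bind, PMF.bind_map, Function.comp_def]
  refine congrArg _ (funext fun keys => congrArg _ (funext fun k => ?_))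
  rw [← Prog.run_bind]
  refine congrArg _ (funext fun o => congrArg _ (funext fun e => congrArg _ (funext fun hk =>
    congrArg _ (funext fun p => congrArg _ (funext fun s => PMF.map_congr fun x hx => ?_)))))
  obtain ⟨-, h1, h2, h3⟩ := U.mem_iterK_const P hx
  rw [h1, h2, h3]
  rfl

end Setting

end

section

/-! ## Fair payment -/

variable {z : ℕ}

/-- The nonce is the number of transactions issued before. Different entries of the log thus have
different contents, even if the same call is made twice. -/
theorem payload_inj {c c' : Contract z} {k k' : ℕ} {f f' : Call z}
    (h : payload c k f = payload c' k' f') : k = k' ∧ f.toData = f'.toData := by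
  have h1 := congrArg (fun d => d.snd.fst.toNat) h
  have h2 := congrArg (fun d => d.snd.snd) h
  simp only [payload, code_prod, fst_cons, snd_cons, toNat_code] at h1 h2
  exact ⟨h1, h2⟩

namespace Setting

variable (U : Setting z) (P : ℕ → DTLP.Params z)

/-- The logged transactions are the calls that are made in the game, properly signed and numbered. -/
structure Honest (n : ℕ) (x : ChainState z) : Prop where
  n_eq : x.n = n
  keys : x.keys ∈ (DTLP.accounts U.G n).support
  log : ∀ k e, x.w.log[k]? = some e → Issues x e.1.1 e.1.2 ∧
    ∃ σ ∈ (U.G.sign (x.keys e.1.1).2 (payload (U.contract n (P n) x.keys) k e.1.2)).support,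
      e.2.1 = mkTx (x.keys e.1.1).1 (payload (U.contract n (P n) x.keys) k e.1.2) σ

variable {U P}

theorem Honest.step {A : Interactive} {n : ℕ} {x y : ChainState z} (h : U.Honest P n x)
    (hy : y ∈ (U.chainStep P A x).support) : U.Honest P n y := by
  obtain ⟨h1, h2, h3, h4⟩ := U.step_const P A hy
  obtain ⟨rfl, hk, hl⟩ := h
  refine ⟨h1, h2 ▸ hk, ?_⟩
  have hI : ∀ i f, Issues x i f → Issues y i f := by
    intro i f
    simp only [Issues, h3, h4]
    exact _root_.id
  rw [h2]
  have hlog : ∀ k e, x.w.log[k]? = some e → Issues y e.1.1 e.1.2 ∧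
      ∃ σ ∈ (U.G.sign (x.keys e.1.1).2 (payload (U.contract x.n (P x.n) x.keys) k e.1.2)).support,
        e.2.1 = mkTx (x.keys e.1.1).1 (payload (U.contract x.n (P x.n) x.keys) k e.1.2) σ :=
    fun k e he => ⟨hI _ _ (hl k e he).1, (hl k e he).2⟩
  rcases step_world hy with ⟨e, -⟩ | ⟨-, i, f, hif, σ, hσ, e⟩ <;> rw [e]
  · exact hlog
  · intro k e he
    rcases lt_trichotomy k x.w.log.length with hlt | rfl | hlt
    · rw [List.getElem?_append_left hlt] at he
      exact hlog k e he
    · simp only [List.getElem?_concat_length, Option.some.injEq] at he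
      subst he
      exact ⟨hI _ _ hif, σ, hσ, rfl⟩
    · rw [List.getElem?_eq_none (by simp; omega)] at he
      exact absurd he (by simp)

theorem honest_final {Γ : ChainGame U P} {n : ℕ} {x : ChainState z}
    (hx : x ∈ (Γ.final n).support) : U.Honest P n x := by
  simp only [ChainGame.final, PMF.mem_support_bind] at hx
  obtain ⟨keys, hkeys, y, -, s, -, hx⟩ := hx
  refine iterK_inv (fun _ x => U.Honest P n x) (fun _ a ha b hb => ha.step hb) _ 0 _ ?_ x hx
  exact ⟨rfl, hkeys, by simp [chainInit]⟩

/-- The events that make payment unfair. -/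
theorem Honest.fair {n : ℕ} {x : ChainState z} (h : U.Honest P n x)
    (hpers : ¬ U.B.PersistenceFails n x.w.hist) (hsc : ¬ U.D.ContractFails U.G U.B n x.w.hist)
    (hforge : ∀ i, i ≠ .HS → ¬ U.Forged i x)
    (hlive : ∀ i, i ≠ .HS → ¬ U.B.LivenessFails n (partyWorld (some i) x.w)) (j : Fin z) :
    ¬ U.Unfair P n j x.keys x.pk x.g x.w := by
  set c := U.contract n (P n) x.keys with hc
  have hrep : ∀ (r : ℕ) (s : Data) (p : Fin U.B.N), x.w.hist[r]? = some s → U.B.report p s c =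
      (U.B.stampedTxs n p x.w.hist s).foldl (U.D.exec U.G c) (SCState.empty z) :=
    fun r s p hs => by_contra fun h => hsc ⟨r, s, p, c, hs, h⟩
  -- No forgeries: a valid signature of an honest party, seen at the end of round `r`, is on content
  -- that the party issued before. The inequality is strict because an entry carries the number of
  -- the last round that was complete when it was issued.
  have issued : ∀ i, i ≠ Party.HS → ∀ (r : ℕ) (s : Data) (p : Fin U.B.N), x.w.hist[r]? = some s → ∀ tx ∈ (U.B.view p s).flatten,
      tx.fst = (x.keys i).1 → U.G.verify (x.keys i).1 tx.snd.fst tx.snd.snd = true →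
      ∃ e ∈ x.w.log, e.1.1 = i ∧ e.2.2 < r ∧ tx.snd.fst = e.2.1.snd.fst := by
    intro i hi r s p hs tx htx h1 h2
    by_contra hno
    push Not at hno
    exact hforge i hi ⟨r, s, p, hs, tx, htx, h1, h2, fun e he h1 h2 => hno e he h1 h2⟩
  -- The client's helper publishes only the true key and statements, so no ledger contains a
  -- publication of its account with other ones.
  have hpub : ∀ (r : ℕ) (s : Data) (p : Fin U.B.N), x.w.hist[r]? = some s → ∀ y ∈ U.B.stampedTxs n p x.w.hist s, ∀ pk' g',
      IsCall U.G c y.2 (c.acct .HC) (.publish pk' g') → pk' = x.pk ∧ g' = x.g := by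
    rintro r s p hs y hy pk' g' ⟨h1, h2, -, h4⟩
    have hmem : y.2 ∈ (U.B.view p s).flatten := by
      obtain ⟨b, hb, hyb⟩ := List.mem_flatten.1 (Blockchain.mem_ledger_of_stampedTxs hy)
      exact List.mem_flatten.2 ⟨b, (Blockchain.ledger_prefix_view p s).subset hb, hyb⟩
    obtain ⟨e, he, hi, -, hbody⟩ := issued .HC (by simp) r s p hs y.2 hmem h1 h2
    obtain ⟨k, hk⟩ := List.getElem?_of_mem he
    obtain ⟨hI, σ, -, he'⟩ := h.log k e hk
    have hf : e.1.2 = .publish x.pk x.g := by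
      rcases hI with ⟨hI, -⟩ | ⟨-, hI⟩ | ⟨hI, -⟩
      · rw [hi] at hI; simp at hI
      · exact hI
      · rw [hi] at hI; simp at hI
    have e1 : y.2.snd.fst.snd.snd = (Call.publish x.pk x.g).toData := by
      rw [hbody, he', hf]; rfl
    rw [e1, Call.ofData_publish] at h4
    simp only [Option.some.injEq, Call.publish.injEq] at h4
    exact ⟨h4.1.symm, h4.2.symm⟩
  rintro ⟨r, s, p, hs, ⟨u, hu, hno⟩ | ⟨e, he, hpay, hr, s₀, m, π, t, hs₀, hdep, hpub₀, hreg, hno⟩⟩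
  · rw [← hc, hrep r s p hs] at hu hno
    exact hno ((DTLP.foldl_paid (hpub r s p hs)).2 j u hu)
  · obtain ⟨⟨i, f⟩, tx, r₀⟩ := e
    simp only at hpay hr hs₀
    subst hpay
    obtain ⟨k, hk⟩ := List.getElem?_of_mem he
    obtain ⟨hI, σ, hσ, htx⟩ := h.log k _ hk
    simp only at hI hσ htx
    have hi : i = .C ∨ i = .S := by
      rcases hI with ⟨-, a, hI⟩ | ⟨-, hI⟩ | ⟨hI, -⟩
      · simp at hI
      · simp at hI
      · exact hI
    have hHS : i ≠ .HS := by rcases hi with rfl | rfl <;> simp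
    have hver : U.G.verify (x.keys i).1 (payload c k (.pay j)) σ = true :=
      U.G.verify_sign n _ (DTLP.mem_accounts h.keys i) _ σ hσ
    have hcall : IsCall U.G c tx (c.acct i) (.pay j) := by
      subst htx
      exact ⟨rfl, hver, rfl, Call.ofData_pay j⟩
    -- Liveness for the caller: the delay has passed.
    have h1 : tx ∈ (U.B.ledger n p s).flatten := by
      by_contra hmem
      refine hlive i hHS ⟨((), tx, r₀), ?_, r, s, p, hr, hs, hmem⟩
      simp only [partyWorld, List.mem_map, List.mem_filter, decide_eq_true_eq]
      exact ⟨_, ⟨he, rfl⟩, rfl⟩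
    -- If the call were already in this ledger, its content would have been issued in an earlier
    -- round. By the nonce, that entry of the log is the call itself, which carries the number `r₀`.
    -- Consequently the call is executed only after the state reported in round `r₀`.
    have h2 : tx ∉ (U.B.ledger n p s₀).flatten := by
      intro hmem
      have hmem' : tx ∈ (U.B.view p s₀).flatten := by
        obtain ⟨b, hb, hyb⟩ := List.mem_flatten.1 hmem
        exact List.mem_flatten.2 ⟨b, (Blockchain.ledger_prefix_view p s₀).subset hb, hyb⟩
      obtain ⟨e, he', hei, hlt, hbody⟩ := issued i hHS r₀ s₀ p hs₀ tx hmem' hcall.1 hcall.2.1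
      obtain ⟨k', hk'⟩ := List.getElem?_of_mem he'
      obtain ⟨-, σ', -, he''⟩ := h.log k' e hk'
      rw [he'', htx] at hbody
      obtain ⟨rfl, -⟩ := payload_inj (c := c) (c' := c) hbody
      rw [hk] at hk'
      rw [← Option.some_inj.1 hk'] at hlt
      exact lt_irrefl _ hlt
    have hle : r₀ ≤ r := by omega
    -- The later ledger extends the earlier one, and the call lies in the extension. Contract and
    -- registration were in place before it, so `DTLP.foldl_pay` applies.
    obtain ⟨l, hl, hl'⟩ := Blockchain.stampedTxs_prefix (hist := x.w.hist)
      (Blockchain.ledger_comparable hpers hle hs₀ hs h1 h2)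
    obtain ⟨t', ht'⟩ := hl' tx h1 h2
    rw [← hc, hrep r₀ s₀ p hs₀] at hdep hpub₀ hreg
    rw [← hc, hrep r s p hs, hl] at hno
    refine hno (DTLP.foldl_pay (pk := x.pk) (g := x.g) ?_ hdep hpub₀ hreg ht' hcall ?_)
    · rw [← hl]; exact hpub r s p hs
    · rcases hi with rfl | rfl
      · exact Or.inl rfl
      · exact Or.inr rfl

variable (U)

/-- Fair payment. -/
theorem fairPayment (hPersistent : U.B.Persistent) (hLive : U.B.Live U.G) (hEUF : U.G.EUFCMA)
    (hSC : U.D.ContractCorrect U.G U.B) : U.D.FairPayment U.G U.B U.τ := by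
  rintro P hP j A ⟨q, hA⟩
  let Γ := U.payGame hP A q hA
  refine Experiment.cannotWin_of_unlikely (p := Γ.final)
    (s := fun n => {x | U.Unfair P n j x.keys x.pk x.g x.w}) (U.paymentExp_win hP A q hA) ?_
  have h₁ : Unlikely Γ.final fun n => {x | U.B.PersistenceFails n x.w.hist} :=
    Γ.trace_secure hP hPersistent
  have h₂ : Unlikely Γ.final fun n => {x | U.D.ContractFails U.G U.B n x.w.hist} :=
    Γ.trace_secure hP hSC
  have h₃ : ∀ i, i ≠ .HS → Unlikely Γ.final fun _ => {x | U.Forged i x} :=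
    fun i hi => Γ.forge_secure hP hEUF hi
  have h₄ : ∀ i, i ≠ .HS → Unlikely Γ.final fun n =>
      {x | U.B.LivenessFails n (partyWorld (some i) x.w)} := fun i hi => Γ.live_secure hP hLive hi
  have h := fun i hi => (h₃ i hi).union (h₄ i hi)
  refine ((h₁.union h₂).union ((h .C (by simp)).union ((h .S (by simp)).union
    (h .HC (by simp))))).mono fun n x hx hbad => ?_
  by_contra hno
  simp only [Set.mem_union, Set.mem_ofPred_eq, not_or] at hno
  obtain ⟨⟨hp, hc⟩, hC, hS, hHC⟩ := hno
  refine (honest_final hx).fair hp hc (fun i hi => ?_) (fun i hi => ?_) j hbad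
  · cases i
    exacts [hC.1, hS.1, hHC.1, absurd rfl hi]
  · cases i
    exacts [hC.2, hS.2, hHC.2, absurd rfl hi]

end Setting

end

end DelegatedTLP

end

open DelegatedTLP in
theorem mainTheorem2
    (K : ChainedParams) (G : Sig) (cedg : Data → ℕ → ℕ → Data → ℕ) (τ : Timing)
    (z : ℕ) (hz : 1 ≤ z) (B : Blockchain z)
    (hE : K.ske.Efficient) (hG : G.Efficient) (hB : B.Efficient)
    (hT : (chainedTLP K z).Efficient)
    (hS : PolyTime fun n : Unary => (pure ⟨τ.S n.val⟩ : PMF Unary))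
    (hcedg : PolyTime fun x : Data × Unary × Unary × Data =>
      (pure (cedg x.1 x.2.1.val x.2.2.1.val x.2.2.2) : PMF ℕ))
    (hCPA : K.ske.INDCPA)
    (hGC : (chainedTLP K z).Secure τ)
    (hPersistent : B.Persistent) (hLive : B.Live G) (hEUF : G.EUFCMA)
    (hSC : (edTLP K.ske (chainedTLP K z) cedg).ContractCorrect G B) :
    (edTLP K.ske (chainedTLP K z) cedg).Secure G B τ := by
  let U : Setting z := ⟨K.ske, G, chainedTLP K z, cedg, τ, B, hE, hG, hT, hB, hS, hcedg⟩
  exact ⟨fun P hP => ⟨fun A hA => U.helper_private P hCPA hP A hA,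
    fun j A hA hB => U.solver_private P hGC.1 hP j A hA hB⟩,
    U.valid hGC.2 hPersistent hSC, U.fairPayment hPersistent hLive hEUF hSC⟩
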